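/- Let $(M,g)$ be a smooth four-dimensional space-time (signature $(-+++)$), with Levi-Civita connection $\nabla$, Weyl tensor $W$ and metric volume element $\eta$ (for a local orientation; the conditions below do not depend on it). On 2-forms (bivectors) let $(*F)_{ab}=\frac12\eta_{abcd}F^{cd}$, $\delta=*d*$, that is $(\delta F)_b=-\nabla^aF_{ab}$, $(i(\xi)F)_b=\xi^aF_{ab}$, $(F^2)_{ab}=F_{ac}F^{c}{}_{b}$; a complex bivector is self-dual if $*F=\mathrm iF$. A double 2-form $A$ acts on bivectors by $A(F)_{ab}=\frac12A_{ab}{}^{cd}F_{cd}$, with $A(F,F)=\frac14A_{abcd}F^{ab}F^{cd}$, and products and traces of double 2-forms are those of these endomorphisms: $(AB)_{abcd}=\frac12A_{ab}{}^{ef}B_{efcd}$, $\operatorname{Tr}A=\frac12A_{ab}{}^{ab}$. Put $$\mathcal W=\tfrac12(W-\mathrm i*W),\qquad \mathcal G=\tfrac12(G-\mathrm i\,\eta),\quad G_{abcd}=g_{ac}g_{bd}-g_{ad}g_{bc},$$ $$\rho=-\frac{\operatorname{Tr}\mathcal W^3}{\operatorname{Tr}\mathcal W^2},\qquad \mathcal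 S=\frac1{3\rho}(\mathcal W-\rho\,\mathcal G),\qquad \mathcal U=\frac{\mathcal S(\mathcal X)}{\sqrt{\mathcal S(\mathcal X,\mathcal X)}},$$ $$\Sigma=\nabla\mathcal U-i(\delta\mathcal U)\mathcal U\otimes\mathcal U-i(\delta\mathcal U)\mathcal G,\qquad U=\sqrt2\,\mathrm{Re}\,\mathcal U,\qquad \mathbf a=-i(\delta{*U}){*U},\qquad \mathbf b=i(\delta U)U,$$ where $\mathcal X$ is an arbitrary smooth local field of self-dual bivectors with $\mathcal S(\mathcal X,\mathcal X)\neq0$, and the square root is a smooth local branch. ($\rho\ne0$ includes $\operatorname{Tr}\mathcal W^2\neq0$.) The metric is of Petrov–Bel type D at a point if $\mathcal W$, acting on the three-dimensional complex space of self-dual bivectors, is diagonalizable with exactly two different eigenvalues. A symmetric 2-tensor is of type $2+2$ if at each point it is $\alpha v+\beta h$ with $\alpha\neq\beta$, $v$ and $h=g-v$ being the orthogonal projectors on two complementary orthogonal (non-degenerate) planes. A conformal tensor is a smooth traceless symmetric tensor $P$ with $\nabla_aP_{bc}+\nabla_bP_{ca}+\nabla_cP_{ab}=g_{ab}t_c+g_{bc}t_a+g_{ca}t_b$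 for some covector field $t$; a Killing tensor is a smooth symmetric tensor $K$ with $\nabla_aK_{bc}+\nabla_bK_{ca}+\nabla_cK_{ab}=0$. "Admitting" such a tensor is meant locally: every point has a neighbourhood carrying one. The following holds on every open subset of the domain of any chart of $M$ (hence on $M$). **(Conformal tensors.)** $g$ is of type D at every point and admits a $2+2$ conformal tensor if and only if $$\rho\neq0,\qquad \mathcal S^2+\mathcal S=0,\qquad \Sigma=0,\qquad d(\mathbf a+\mathbf b)=0, \tag{1}$$ where it is equivalent to require the last two conditions for all local choices of $\mathcal X$ and of the root, or for one choice around each point. When (1) holds, there exists, around each point of the domain of $\mathcal U$, a smooth function $\alpha\ne0$ with $-d\ln|\alpha|=\mathbf a+\mathbf b$. For every such $\alpha$ on an open set $N$, $P=C\,\alpha\,[U^2+(*U)^2]$ is a conformal tensor on $N$ for each constant $C$, of type $2+2$ if $C\neq0$; and if $N$ is connected, every $2+2$ conformal tensor on $N$ is of this form with a constant $C\neq0$. **(Killing tensors.)** $g$ is of type D at every point and admits a $2+2$ Killing tensor if and only if (1) and $$d\mathbf b+\mathbf b\wedge\mathbf a=0 \tag{2}$$ hold (again for all local choices of $\mathcal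 X$ and of the root, or equivalently for one around each point). When (1) and (2) hold, there exist, around each point of the domain of $\mathcal U$, smooth functions $\alpha\neq\beta$ with $-d\ln|\alpha-\beta|=\mathbf a+\mathbf b$ and $d(\alpha+\beta)=(\alpha-\beta)(\mathbf b-\mathbf a)$. For all such $\alpha,\beta$ on an open set $N$, $K=C[\alpha\,U^2-\beta\,(*U)^2]+D\,g$ is a Killing tensor on $N$ for all constants $C,D$, of type $2+2$ if $C\neq0$; and if $N$ is connected, every $2+2$ Killing tensor on $N$ is of this form with constants $C\neq0$ and $D$. -/

import Mathlib

open scoped Manifold ContDiff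

namespace Spacetime

noncomputable section

/-- The model space `ℝ⁴`. -/
abbrev E4 : Type := EuclideanSpace ℝ (Fin 4)

/-- Components of a covariant 2-tensor at a point. -/
abbrev Tensor2 (𝕜 : Type) : Type := Matrix (Fin 4) (Fin 4) 𝕜

/-- Components of a covariant 4-tensor at a point. -/
abbrev Tensor4 (𝕜 : Type) : Type := Fin 4 → Fin 4 → Fin 4 → Fin 4 → 𝕜

/-! ### Lorentzian metrics on four-dimensional manifolds and their components in a chart -/

/-- The coordinate vector `∂ᵢ` of the chart `e`, at the point with coordinates `y`. -/
def coordVec {M : Type*} [TopologicalSpace M] [ChartedSpace E4 M]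
    (e : OpenPartialHomeomorph M E4) (y : E4) (i : Fin 4) :
    TangentSpace 𝓘(ℝ, E4) (e.symm y) :=
  mfderiv 𝓘(ℝ, E4) 𝓘(ℝ, E4) e.symm y (EuclideanSpace.single i (1 : ℝ) : E4)

/-- A smooth metric of signature `(-+++)` on a smooth 4-manifold. -/
structure LorentzMetric (M : Type*) [TopologicalSpace M] [ChartedSpace E4 M] where
  /-- the scalar product of the tangent space at `p` -/
  val : ∀ p : M, LinearMap.BilinForm ℝ (TangentSpace 𝓘(ℝ, E4) p)
  symm : ∀ (p : M) (u w : TangentSpace 𝓘(ℝ, E4) p), val p u w = val p w u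
  /-- there is an orthonormal basis, whose first vector is the time-like one -/
  signature : ∀ p : M, ∃ b : Module.Basis (Fin 4) ℝ (TangentSpace 𝓘(ℝ, E4) p),
    ∀ i j : Fin 4, val p (b i) (b j) = if i = j then (if i = 0 then -1 else 1) else 0
  smooth : ∀ e ∈ IsManifold.maximalAtlas 𝓘(ℝ, E4) ∞ M, ∀ i j : Fin 4,
    ContDiffOn ℝ ∞ (fun y => val (e.symm y) (coordVec e y i) (coordVec e y j)) e.target

/-- The components `g_{ij}` of the metric in the chart `e`, as functions on `e.target ⊆ ℝ⁴`. -/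
def LorentzMetric.components {M : Type*} [TopologicalSpace M] [ChartedSpace E4 M]
    (g : LorentzMetric M) (e : OpenPartialHomeomorph M E4) (y : E4) : Tensor2 ℝ :=
  Matrix.of fun i j => g.val (e.symm y) (coordVec e y i) (coordVec e y j)

/-! ### Algebra of 2-forms and double 2-forms at a point

Here `γ` is the matrix of the metric at the point. Operations on bivectors sum over unordered pairs
of indices, whence the factors `1/2`. -/

/-- The permutation symbol `ε_{abcd}`. -/
def permSymbol (a b c d : Fin 4) : ℝ :=
  Matrix.det (Matrix.of fun i j : Fin 4 => if ![a, b, c, d] i = j then (1 : ℝ) else 0)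

/-- The metric volume element `η_{abcd}`, for the orientation of the coordinate system. -/
def volForm (γ : Tensor2 ℝ) : Tensor4 ℝ := fun a b c d =>
  Real.sqrt |γ.det| * permSymbol a b c d

/-- `F^{ab}`. -/
def raise {𝕜 : Type} [RCLike 𝕜] (γ : Tensor2 ℝ) (F : Tensor2 𝕜) : Tensor2 𝕜 :=
  Matrix.of fun a b => ∑ c, ∑ d, (γ⁻¹ a c * γ⁻¹ b d) • F c d

/-- The Hodge dual `(*F)_{ab} = ½ η_{abcd} F^{cd}` of a 2-form. -/
def hodge {𝕜 : Type} [RCLike 𝕜] (γ : Tensor2 ℝ) (F : Tensor2 𝕜) : Tensor2 𝕜 :=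
  Matrix.of fun a b => (1 / 2 : ℝ) • ∑ c, ∑ d, volForm γ a b c d • raise γ F c d

/-- A bivector `F` (a complex 2-form) is self-dual if `*F = i F`. -/
def IsSelfDual (γ : Tensor2 ℝ) (F : Tensor2 ℂ) : Prop :=
  F.transpose = -F ∧ hodge γ F = Complex.I • F

/-- The interior product `(i(ξ)F)_b = ξ^a F_{ab}`. -/
def interior {𝕜 : Type} [RCLike 𝕜] (γ : Tensor2 ℝ) (ξ : Fin 4 → 𝕜) (F : Tensor2 𝕜) :
    Fin 4 → 𝕜 :=
  fun b => ∑ a, ∑ c, γ⁻¹ a c • (ξ c * F a b)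

/-- The product `F² = F × F`, that is `(F²)_{ab} = F_{ac} g^{cd} F_{db}`. -/
def sq (γ F : Tensor2 ℝ) : Tensor2 ℝ := F * γ⁻¹ * F

/-- The action `A(F)_{ab} = ½ A_{ab}{}^{cd} F_{cd}` of a double 2-form on bivectors. -/
def act (γ : Tensor2 ℝ) (A : Tensor4 ℂ) (F : Tensor2 ℂ) : Tensor2 ℂ :=
  Matrix.of fun a b => (1 / 2) * ∑ c, ∑ d, A a b c d * raise γ F c d

/-- The quadratic form `A(F, F) = ¼ A_{abcd} F^{ab} F^{cd}`. -/
def quad (γ : Tensor2 ℝ) (A : Tensor4 ℂ) (F : Tensor2 ℂ) : ℂ :=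
  (1 / 2) * ∑ a, ∑ b, raise γ F a b * act γ A F a b

/-- The composition `(A ∘ B)_{abcd} = ½ A_{ab}{}^{ef} B_{efcd}` of double 2-forms. -/
def comp (γ : Tensor2 ℝ) (A B : Tensor4 ℂ) : Tensor4 ℂ := fun a b c d =>
  act γ A (Matrix.of fun e f => B e f c d) a b

/-- The trace `Tr A = ½ A_{ab}{}^{ab}` of a double 2-form. -/
def tr (γ : Tensor2 ℝ) (A : Tensor4 ℂ) : ℂ :=
  (1 / 2) * ∑ a, ∑ b, raise γ (Matrix.of fun c d => A a b c d) a b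

/-- The self-dual metric `𝒢 = ½ (G - i η)`, where `G = ½ g ∧ g`. -/
def sdMetric (γ : Tensor2 ℝ) : Tensor4 ℂ := fun a b c d =>
  (1 / 2) * (((γ a c * γ b d - γ a d * γ b c : ℝ) : ℂ) - Complex.I * (volForm γ a b c d : ℂ))

/-! ### Differential calculus in a coordinate system

Here `g` is the matrix of components of the metric, as a function of the coordinates. -/

/-- The partial derivative `∂ᵢ f`. -/
def pd {V : Type} [NormedAddCommGroup V] [NormedSpace ℝ V] (i : Fin 4) (f : E4 → V) (x : E4) : V :=
  fderiv ℝ f x (EuclideanSpace.single i (1 : ℝ))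

/-- Smoothness of a tensor field, by components. -/
def SmoothOn {𝕜 : Type} [RCLike 𝕜] (F : E4 → Tensor2 𝕜) (O : Set E4) : Prop :=
  ∀ a b : Fin 4, ContDiffOn ℝ ∞ (fun y => F y a b) O

/-- The Christoffel symbols `Γ^k_{ij}` of the Levi-Civita connection. -/
def christoffel (g : E4 → Tensor2 ℝ) (x : E4) (k i j : Fin 4) : ℝ :=
  (1 / 2) * ∑ l, (g x)⁻¹ k l *
    (pd i (fun y => g y j l) x + pd j (fun y => g y i l) x - pd l (fun y => g y i j) x)

/-- The curvature `R^a{}_{bcd} = ∂_c Γ^a_{db} - ∂_d Γ^a_{cb} + Γ^a_{ce} Γ^e_{db} - Γ^a_{de} Γ^e_{cb}`. -/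
def curvature (g : E4 → Tensor2 ℝ) (x : E4) (a b c d : Fin 4) : ℝ :=
  pd c (fun y => christoffel g y a d b) x - pd d (fun y => christoffel g y a c b) x
    + ∑ e, (christoffel g x a c e * christoffel g x e d b
      - christoffel g x a d e * christoffel g x e c b)

/-- The Riemann tensor `R_{abcd}`. -/
def riemann (g : E4 → Tensor2 ℝ) (x : E4) : Tensor4 ℝ := fun a b c d =>
  ∑ e, g x a e * curvature g x e b c d

/-- The Ricci tensor `R_{bd} = R^a{}_{bad}`. -/
def ricci (g : E4 → Tensor2 ℝ) (x : E4) : Tensor2 ℝ :=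
  Matrix.of fun b d => ∑ a, curvature g x a b a d

/-- The scalar curvature. -/
def scalarCurv (g : E4 → Tensor2 ℝ) (x : E4) : ℝ :=
  ∑ b, ∑ d, (g x)⁻¹ b d * ricci g x b d

/-- The Weyl tensor `W_{abcd}` in dimension four. -/
def weyl (g : E4 → Tensor2 ℝ) (x : E4) : Tensor4 ℝ := fun a b c d =>
  riemann g x a b c d
    - (1 / 2) * (g x a c * ricci g x b d - g x a d * ricci g x b c
      - g x b c * ricci g x a d + g x b d * ricci g x a c)
    + (scalarCurv g x / 6) * (g x a c * g x b d - g x a d * g x b c)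

/-- The covariant derivative `∇_c F_{ab}`, with indices in the order `c a b`. -/
def covDeriv {𝕜 : Type} [RCLike 𝕜] (g : E4 → Tensor2 ℝ) (F : E4 → Tensor2 𝕜) (x : E4)
    (c a b : Fin 4) : 𝕜 :=
  pd c (fun y => F y a b) x
    - ∑ d, (christoffel g x d c a • F x d b + christoffel g x d c b • F x a d)

/-- The codifferential of a 2-form, `δF = *d*F`, that is `(δF)_b = -∇^a F_{ab}`. -/
def codiff {𝕜 : Type} [RCLike 𝕜] (g : E4 → Tensor2 ℝ) (F : E4 → Tensor2 𝕜) (x : E4) :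
    Fin 4 → 𝕜 :=
  fun b => -∑ a, ∑ c, (g x)⁻¹ a c • covDeriv g F x c a b

/-- The exterior derivative `(dξ)_{ij} = ∂_i ξ_j - ∂_j ξ_i` of a 1-form. -/
def extDeriv1 (ξ : E4 → Fin 4 → ℝ) (x : E4) : Tensor2 ℝ :=
  Matrix.of fun i j => pd i (fun y => ξ y j) x - pd j (fun y => ξ y i) x

/-- The exterior product `(ξ ∧ ζ)_{ij} = ξ_i ζ_j - ξ_j ζ_i` of two 1-forms. -/
def wedge1 (ξ ζ : Fin 4 → ℝ) : Tensor2 ℝ :=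
  Matrix.of fun i j => ξ i * ζ j - ξ j * ζ i

/-! ### Weyl concomitants -/

/-- The self-dual Weyl tensor `𝒲 = ½ (W - i *W)`. -/
def sdWeyl (g : E4 → Tensor2 ℝ) (x : E4) : Tensor4 ℂ := fun a b c d =>
  (1 / 2) * ((weyl g x a b c d : ℂ)
    - Complex.I * ((hodge (g x) (Matrix.of fun e f => weyl g x e f c d) a b : ℝ) : ℂ))

/-- Petrov-Bel type D at the point `x`: the endomorphism `𝒲` of the three-dimensional complex space
of self-dual bivectors is diagonalizable with exactly two different eigenvalues. -/
def IsTypeD (g : E4 → Tensor2 ℝ) (x : E4) : Prop :=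
  ∃ (F : Fin 3 → Tensor2 ℂ) (r t : ℂ), r ≠ t ∧ LinearIndependent ℂ F ∧
    (∀ k, IsSelfDual (g x) (F k)) ∧
    act (g x) (sdWeyl g x) (F 0) = r • F 0 ∧
    act (g x) (sdWeyl g x) (F 1) = r • F 1 ∧
    act (g x) (sdWeyl g x) (F 2) = t • F 2

/-- `ρ = - Tr 𝒲³ / Tr 𝒲²`. The quotient is `0` when `Tr 𝒲² = 0`, so `ρ ≠ 0` includes the condition
that it makes sense. -/
def rho (g : E4 → Tensor2 ℝ) (x : E4) : ℂ :=
  -(tr (g x) (comp (g x) (sdWeyl g x) (comp (g x) (sdWeyl g x) (sdWeyl g x))))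
    / tr (g x) (comp (g x) (sdWeyl g x) (sdWeyl g x))

/-- `𝒮 = (𝒲 - ρ 𝒢) / (3ρ)`. -/
def tensorS (g : E4 → Tensor2 ℝ) (x : E4) : Tensor4 ℂ :=
  (1 / (3 * rho g x)) • (sdWeyl g x - rho g x • sdMetric (g x))

/-- `𝒳` is a smooth field of self-dual bivectors on the open set `O`, with `𝒮(𝒳,𝒳) ≠ 0`, and `s` is
a smooth branch on `O` of the square root `√(𝒮(𝒳,𝒳))`. -/
structure IsSeed (g : E4 → Tensor2 ℝ) (O : Set E4) (X : E4 → Tensor2 ℂ) (s : E4 → ℂ) : Prop where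
  isOpen : IsOpen O
  smooth : SmoothOn X O
  selfDual : ∀ x ∈ O, IsSelfDual (g x) (X x)
  smooth_root : ContDiffOn ℝ ∞ s O
  root : ∀ x ∈ O, s x ^ 2 = quad (g x) (tensorS g x) (X x)
  ne_zero : ∀ x ∈ O, s x ≠ 0

/-- `𝒰 = 𝒮(𝒳) / √(𝒮(𝒳,𝒳))`. -/
def canonicalSD (g : E4 → Tensor2 ℝ) (X : E4 → Tensor2 ℂ) (s : E4 → ℂ) (x : E4) : Tensor2 ℂ :=
  (s x)⁻¹ • act (g x) (tensorS g x) (X x)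

/-- `Σ = ∇𝒰 - i(δ𝒰)𝒰 ⊗ 𝒰 - i(δ𝒰)𝒢`, with indices in the order `c a b` of `∇_c 𝒰_{ab}`. -/
def sigma (g : E4 → Tensor2 ℝ) (SU : E4 → Tensor2 ℂ) (x : E4) (c a b : Fin 4) : ℂ :=
  covDeriv g SU x c a b
    - interior (g x) (codiff g SU x) (SU x) c * SU x a b
    - interior (g x) (codiff g SU x) (Matrix.of fun d e => sdMetric (g x) d e a b) c

/-- `U = √2 Re 𝒰`. -/
def realU (SU : E4 → Tensor2 ℂ) (x : E4) : Tensor2 ℝ :=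
  Matrix.of fun a b => Real.sqrt 2 * (SU x a b).re

/-- The field `*U`. -/
def starU (g : E4 → Tensor2 ℝ) (SU : E4 → Tensor2 ℂ) (x : E4) : Tensor2 ℝ :=
  hodge (g x) (realU SU x)

/-- `a = - i(δ*U)*U`. -/
def formA (g : E4 → Tensor2 ℝ) (SU : E4 → Tensor2 ℂ) (x : E4) : Fin 4 → ℝ :=
  -interior (g x) (codiff g (starU g SU) x) (starU g SU x)

/-- `b = i(δU)U`. -/
def formB (g : E4 → Tensor2 ℝ) (SU : E4 → Tensor2 ℂ) (x : E4) : Fin 4 → ℝ :=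
  interior (g x) (codiff g (realU SU) x) (realU SU x)

/-! ### Killing and conformal tensors -/

/-- `∇_a T_{bc} + ∇_b T_{ca} + ∇_c T_{ab}`. -/
def killingOp (g : E4 → Tensor2 ℝ) (T : E4 → Tensor2 ℝ) (x : E4) (a b c : Fin 4) : ℝ :=
  covDeriv g T x a b c + covDeriv g T x b c a + covDeriv g T x c a b

/-- A symmetric tensor is of type 2+2 if `T = α v + β h` with `α ≠ β`, where `v` and `h = g - v` are
the orthogonal projectors on two complementary orthogonal planes. -/
def IsTwoPlusTwo (γ T : Tensor2 ℝ) : Prop :=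
  ∃ (v : Tensor2 ℝ) (α β : ℝ), α ≠ β ∧ v.IsSymm ∧ v * γ⁻¹ * v = v ∧ (γ⁻¹ * v).trace = 2 ∧
    T = α • v + β • (γ - v)

/-- `P` is a (traceless) conformal tensor on `N`. -/
structure IsConformalOn (g : E4 → Tensor2 ℝ) (N : Set E4) (P : E4 → Tensor2 ℝ) : Prop where
  smooth : SmoothOn P N
  symm : ∀ x ∈ N, (P x).IsSymm
  traceless : ∀ x ∈ N, ((g x)⁻¹ * P x).trace = 0
  conformal : ∀ x ∈ N, ∃ t : Fin 4 → ℝ, ∀ a b c,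
    killingOp g P x a b c = g x a b * t c + g x b c * t a + g x c a * t b

/-- `K` is a Killing tensor on `N`. -/
structure IsKillingOn (g : E4 → Tensor2 ℝ) (N : Set E4) (K : E4 → Tensor2 ℝ) : Prop where
  smooth : SmoothOn K N
  symm : ∀ x ∈ N, (K x).IsSymm
  killing : ∀ x ∈ N, ∀ a b c, killingOp g K x a b c = 0

/-- Every point of `Ω` has a neighbourhood with a conformal tensor of type 2+2. -/
def AdmitsConformal (g : E4 → Tensor2 ℝ) (Ω : Set E4) : Prop :=
  ∀ x ∈ Ω, ∃ N ⊆ Ω, IsOpen N ∧ x ∈ N ∧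
    ∃ P, IsConformalOn g N P ∧ ∀ y ∈ N, IsTwoPlusTwo (g y) (P y)

/-- Every point of `Ω` has a neighbourhood with a Killing tensor of type 2+2. -/
def AdmitsKilling (g : E4 → Tensor2 ℝ) (Ω : Set E4) : Prop :=
  ∀ x ∈ Ω, ∃ N ⊆ Ω, IsOpen N ∧ x ∈ N ∧
    ∃ K, IsKillingOn g N K ∧ ∀ y ∈ N, IsTwoPlusTwo (g y) (K y)

/-! ### The conditions on the concomitants -/

/-- `ρ ≠ 0` and `𝒮² + 𝒮 = 0`. -/
def AlgebraicConditions (g : E4 → Tensor2 ℝ) (Ω : Set E4) : Prop :=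
  ∀ x ∈ Ω, rho g x ≠ 0 ∧ comp (g x) (tensorS g x) (tensorS g x) + tensorS g x = 0

/-- `Σ = 0` and `d(a + b) = 0`, at the point `x`. -/
def ConformalEqs (g : E4 → Tensor2 ℝ) (SU : E4 → Tensor2 ℂ) (x : E4) : Prop :=
  (∀ c a b, sigma g SU x c a b = 0) ∧
    extDeriv1 (fun y => formA g SU y + formB g SU y) x = 0

/-- `Σ = 0`, `d(a + b) = 0` and `db + b ∧ a = 0`, at the point `x`. -/
def KillingEqs (g : E4 → Tensor2 ℝ) (SU : E4 → Tensor2 ℂ) (x : E4) : Prop :=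
  ConformalEqs g SU x ∧
    extDeriv1 (formB g SU) x + wedge1 (formB g SU x) (formA g SU x) = 0

/-- The condition `Q` holds on `Ω` for every local choice of `𝒳` and of the square root. -/
def ForEverySeed (g : E4 → Tensor2 ℝ) (Ω : Set E4)
    (Q : (E4 → Tensor2 ℂ) → E4 → Prop) : Prop :=
  ∀ O ⊆ Ω, ∀ X s, IsSeed g O X s → ∀ x ∈ O, Q (canonicalSD g X s) x

/-- Around each point of `Ω` there is a local choice of `𝒳` and of the square root for which the
condition `Q` holds. -/
def ForSomeSeed (g : E4 → Tensor2 ℝ) (Ω : Set E4)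
    (Q : (E4 → Tensor2 ℂ) → E4 → Prop) : Prop :=
  ∀ x ∈ Ω, ∃ O ⊆ Ω, x ∈ O ∧ ∃ X s, IsSeed g O X s ∧ ∀ y ∈ O, Q (canonicalSD g X s) y

/-! ### The algorithm -/

/-- `α` is a nonvanishing smooth function on `N` and `-d ln|α| = a + b`. -/
def IsConformalFactor (g : E4 → Tensor2 ℝ) (SU : E4 → Tensor2 ℂ) (N : Set E4) (α : E4 → ℝ) :
    Prop :=
  ContDiffOn ℝ ∞ α N ∧ ∀ x ∈ N, α x ≠ 0 ∧
    ∀ i, -pd i (fun y => Real.log |α y|) x = formA g SU x i + formB g SU x i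

/-- `α ≠ β` are smooth functions on `N`, `-d ln|α - β| = a + b` and
`d(α + β) = (α - β)(b - a)`. -/
def IsKillingPair (g : E4 → Tensor2 ℝ) (SU : E4 → Tensor2 ℂ) (N : Set E4) (α β : E4 → ℝ) :
    Prop :=
  ContDiffOn ℝ ∞ α N ∧ ContDiffOn ℝ ∞ β N ∧ ∀ x ∈ N, α x ≠ β x ∧
    (∀ i, -pd i (fun y => Real.log |α y - β y|) x = formA g SU x i + formB g SU x i) ∧
    ∀ i, pd i (fun y => α y + β y) x = (α x - β x) * (formB g SU x i - formA g SU x i)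

/-- `C α [U² + (*U)²]`. -/
def conformalTensor (g : E4 → Tensor2 ℝ) (SU : E4 → Tensor2 ℂ) (α : E4 → ℝ) (C : ℝ) (x : E4) :
    Tensor2 ℝ :=
  (C * α x) • (sq (g x) (realU SU x) + sq (g x) (starU g SU x))

/-- `C [α U² - β (*U)²] + D g`. -/
def killingTensor (g : E4 → Tensor2 ℝ) (SU : E4 → Tensor2 ℂ) (α β : E4 → ℝ) (C D : ℝ) (x : E4) :
    Tensor2 ℝ :=
  C • (α x • sq (g x) (realU SU x) - β x • sq (g x) (starU g SU x)) + D • g x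

end

end Spacetime

/-! The proof is first-order algebra at a point, one second-order integrability argument, and two
applications of the Poincaré lemma.

Algebra. In a null tetrad the self-dual bivectors form a three-dimensional complex space with an
orthonormal basis, and `𝒲` becomes a symmetric traceless 3×3 matrix. Type D means that its
eigenvalues are r, r, -2r with r ≠ 0. Then ρ = r and `-𝒮` is a symmetric projector of trace one, so
that `𝒮 = F ⊗ F` for a self-dual F of square -1, unique up to sign (`isTypeD_iff`,
`exists_tensorS_eq`). The bivector `𝒰` of any choice of `𝒳` and of the root is therefore F or -F.
The conditions and the tensors of the theorem depend on `𝒰` evenly, apart from `Σ`, which only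
changes sign.

First order. A traceless 2+2 tensor is P = αS, where S squares to g and has no trace. Up to sign,
such an S is `𝒰𝒰̄ + 𝒰̄𝒰 = U² + (*U)²` for a unitary self-dual `𝒰` (`IsLorentz.exists_unitSD`), and
`𝒰` can be chosen smooth (`IsMetricOn.exists_unitField`). Differentiating `𝒰² = g/2` leaves two
components p, q of `∇𝒰` in each direction of a tetrad adapted to `𝒰`. Of these eight numbers, four
are the components of `δ𝒰` and the other four are those of `Σ`. In this tetrad the conformal
equation for αS splits into `Σ = 0`, dα = -α(a + b), and a formula t = -α(b - a) for its right-hand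
side (`IsUnitFieldAt.conformal_forward`, `IsUnitFieldAt.conformal_backward`).

Alignment. The `𝒰` of a conformal tensor must still be compared with the canonical one. If `Σ = 0`
near a point, `∇𝒰` is algebraic in `δ𝒰`. The Ricci identity on the totally null planes spanned by k,
m and by l, n then gives R(k,m,k,m) = R(l,n,l,n) = 0, and on these components the Weyl and Riemann
tensors agree (`IsJetFrame.riemann_eq_zero`, `IsJetFrame.sdWeyl_eq_zero`). From `𝒮 = F ⊗ F` the
components of F along these two planes vanish, so F = ±`𝒰` (`IsUnitFieldAt.eq_or_eq_neg`).

Integration. The equation dα = -α(a + b) has nonvanishing local solutions exactly when a + b is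
closed, and on a connected set two solutions are proportional. This settles the conformal case. A
2+2 Killing tensor is K = φS + ψg, whose traceless part φS is conformal; the Killing equation adds
dψ = φ(b - a). Given the equation for φ and d(a + b) = 0, the identity d(φ(b - a)) = 2φ(db + b ∧ a)
(`extDeriv1_factor_mul`) turns integrability into condition (2). The functions of the theorem are α
= ψ + φ and β = ψ - φ, and the constants of integration of φ and ψ are C and D. -/

namespace Spacetime

noncomputable section

open Matrix Complex

/-! ### Null tetrads -/

/-- The complexification of a real matrix. -/
abbrev toComplex (γ : Tensor2 ℝ) : Tensor2 ℂ := γ.map Complex.ofReal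

/-- The Gram matrix of a null tetrad `k, l, m, n` with `n` the conjugate of `m`. -/
def nullGram : Tensor2 ℂ := !![0, -1, 0, 0; -1, 0, 0, 0; 0, 0, 0, 1; 0, 0, 1, 0]

/-- The matrix that exchanges the vectors `m` and `n` of a null tetrad. -/
def tetradSwap : Tensor2 ℂ := !![1, 0, 0, 0; 0, 1, 0, 0; 0, 0, 0, 1; 0, 0, 1, 0]

/-- The columns of `E` are an oriented null tetrad for the metric `γ`. -/
structure IsNullTetrad (γ : Tensor2 ℝ) (E : Tensor2 ℂ) : Prop where
  gram : Eᵀ * toComplex γ * E = nullGram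
  conj : E.map (starRingEnd ℂ) = E * tetradSwap
  orient : (Real.sqrt |γ.det| : ℂ) * E.det = I

/-- The matrix of a Lorentzian scalar product. -/
def IsLorentz (γ : Tensor2 ℝ) : Prop :=
  ∃ B : Tensor2 ℝ, IsUnit B.det ∧ Bᵀ * Matrix.diagonal ![-1, 1, 1, 1] * B = γ

/-- Components of a 2-tensor in the frame `E`. -/
def inFrame (E F : Tensor2 ℂ) : Tensor2 ℂ := Eᵀ * F * E

theorem nullGram_mul_self : nullGram * nullGram = 1 := by
  ext i j
  fin_cases i <;> fin_cases j <;> simp [nullGram, Matrix.mul_apply, Fin.sum_univ_four]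

theorem nullGram_transpose : nullGramᵀ = nullGram := by
  ext i j
  fin_cases i <;> fin_cases j <;> simp [nullGram]

theorem IsLorentz.transpose {γ : Tensor2 ℝ} (h : IsLorentz γ) : γᵀ = γ := by
  obtain ⟨B, -, rfl⟩ := h
  simp [Matrix.transpose_mul, Matrix.mul_assoc]

theorem IsLorentz.det_neg {γ : Tensor2 ℝ} (h : IsLorentz γ) : γ.det < 0 := by
  obtain ⟨B, hB, rfl⟩ := h
  have : B.det ≠ 0 := hB.ne_zero
  simp [Matrix.det_mul, Fin.prod_univ_four]
  positivity

theorem IsLorentz.isUnit_det {γ : Tensor2 ℝ} (h : IsLorentz γ) : IsUnit γ.det :=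
  h.det_neg.ne.isUnit

theorem IsLorentz.inv_transpose {γ : Tensor2 ℝ} (h : IsLorentz γ) : γ⁻¹ᵀ = γ⁻¹ := by
  rw [Matrix.transpose_nonsing_inv, h.transpose]

theorem toComplex_mul (A B : Tensor2 ℝ) : toComplex (A * B) = toComplex A * toComplex B := by
  ext i j
  simp [Matrix.mul_apply]

theorem toComplex_inv {γ : Tensor2 ℝ} (h : IsUnit γ.det) : (toComplex γ)⁻¹ = toComplex γ⁻¹ := by
  apply Matrix.inv_eq_right_inv
  rw [← toComplex_mul, Matrix.mul_nonsing_inv _ h]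
  ext i j
  by_cases hij : i = j <;> simp [Matrix.one_apply, hij]

theorem IsNullTetrad.isUnit_det {γ : Tensor2 ℝ} {E : Tensor2 ℂ} (h : IsNullTetrad γ E) :
    IsUnit E.det := by
  rw [isUnit_iff_ne_zero]
  intro h0
  have := h.orient
  simp [h0] at this
  exact I_ne_zero this.symm

theorem IsNullTetrad.metric_isUnit_det {γ : Tensor2 ℝ} {E : Tensor2 ℂ} (h : IsNullTetrad γ E) :
    IsUnit γ.det := by
  rw [isUnit_iff_ne_zero]
  intro h0
  have := h.orient
  simp [h0] at this
  exact I_ne_zero this.symm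

/-- The contravariant metric in terms of a null tetrad. -/
theorem IsNullTetrad.inv_eq {γ : Tensor2 ℝ} {E : Tensor2 ℂ} (h : IsNullTetrad γ E) :
    toComplex γ⁻¹ = E * nullGram * Eᵀ := by
  rw [← toComplex_inv h.metric_isUnit_det]
  have h1 := h.gram
  have hE := h.isUnit_det
  have hEt : IsUnit Eᵀ.det := by rwa [Matrix.det_transpose]
  apply Matrix.inv_eq_left_inv
  have h2 : Eᵀ * toComplex γ = nullGram * E⁻¹ := by
    rw [← h1, Matrix.mul_nonsing_inv_cancel_right _ _ hE]
  calc E * nullGram * Eᵀ * toComplex γ = E * nullGram * (Eᵀ * toComplex γ) := by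
        simp only [Matrix.mul_assoc]
    _ = E * (nullGram * nullGram) * E⁻¹ := by rw [h2]; simp only [Matrix.mul_assoc]
    _ = 1 := by rw [nullGram_mul_self, Matrix.mul_one, Matrix.mul_nonsing_inv _ hE]

theorem inFrame_injective {E : Tensor2 ℂ} (hE : IsUnit E.det) {F H : Tensor2 ℂ}
    (h : inFrame E F = inFrame E H) : F = H := by
  have hEt : IsUnit Eᵀ.det := by rwa [Matrix.det_transpose]
  unfold inFrame at h
  have h1 := congrArg (fun T => Eᵀ⁻¹ * T * E⁻¹) h
  simpa [Matrix.mul_assoc, Matrix.mul_nonsing_inv _ hE, Matrix.nonsing_inv_mul_cancel_left _ _ hEt]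
    using h1

theorem inFrame_apply (E F : Tensor2 ℂ) (i j : Fin 4) :
    inFrame E F i j = ∑ a, ∑ b, E a i * E b j * F a b := by
  simp only [inFrame, Matrix.mul_apply, Matrix.transpose_apply, Finset.sum_mul]
  rw [Finset.sum_comm]
  refine Finset.sum_congr rfl fun a _ => Finset.sum_congr rfl fun b _ => by ring

/-- The product of covariant 2-tensors in a null tetrad. -/
theorem IsNullTetrad.inFrame_mul {γ : Tensor2 ℝ} {E : Tensor2 ℂ} (h : IsNullTetrad γ E)
    (F H : Tensor2 ℂ) : inFrame E (F * toComplex γ⁻¹ * H) =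
      inFrame E F * nullGram * inFrame E H := by
  rw [h.inv_eq]
  simp only [inFrame, Matrix.mul_assoc]

/-- The selection matrix times the Vandermonde matrix of 0, 1, 2, 3 is the Vandermonde matrix of a,
b, c, d, and the former Vandermonde determinant is 1!·2!·3! = 12. A polynomial formula lets `ring`
see the antisymmetry and `simp` evaluate the symbol. -/
theorem permSymbol_eq (a b c d : Fin 4) : permSymbol a b c d =
    (((b : ℝ) - a) * (c - a) * (d - a) * (c - b) * (d - b) * (d - c)) / 12 := by
  have h1 : (Matrix.of fun i j : Fin 4 => if ![a, b, c, d] i = j then (1 : ℝ) else 0) *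
      Matrix.vandermonde (fun i : Fin 4 => (i : ℝ)) =
      Matrix.vandermonde (fun i : Fin 4 => ((![a, b, c, d] i : Fin 4) : ℝ)) := by
    ext i j
    simp [Matrix.mul_apply, Matrix.vandermonde]
  have h2 := congrArg Matrix.det h1
  rw [Matrix.det_mul, Matrix.det_vandermonde, Matrix.det_vandermonde] at h2
  have e1 : ∏ i : Fin 4, ∏ j ∈ Finset.Ioi i, (((j : Fin 4) : ℝ) - ((i : Fin 4) : ℝ)) = 12 := by
    rw [Fin.prod_univ_four]
    have i0 : Finset.Ioi (0 : Fin 4) = {1, 2, 3} := by decide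
    have i1 : Finset.Ioi (1 : Fin 4) = {2, 3} := by decide
    have i2 : Finset.Ioi (2 : Fin 4) = {3} := by decide
    have i3 : Finset.Ioi (3 : Fin 4) = ∅ := by decide
    simp [i0, i1, i2, i3]
    norm_num
  have e2 : ∏ i : Fin 4, ∏ j ∈ Finset.Ioi i,
      (((![a, b, c, d] j : Fin 4) : ℝ) - ((![a, b, c, d] i : Fin 4) : ℝ)) =
      ((b : ℝ) - a) * (c - a) * (d - a) * (c - b) * (d - b) * (d - c) := by
    rw [Fin.prod_univ_four]
    have i0 : Finset.Ioi (0 : Fin 4) = {1, 2, 3} := by decide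
    have i1 : Finset.Ioi (1 : Fin 4) = {2, 3} := by decide
    have i2 : Finset.Ioi (2 : Fin 4) = {3} := by decide
    have i3 : Finset.Ioi (3 : Fin 4) = ∅ := by decide
    rw [i0, i1, i2, i3]
    simp only [Matrix.cons_val_zero, Matrix.cons_val_one, Matrix.cons_val, Finset.prod_empty,
      Finset.prod_singleton, mul_one]
    rw [Finset.prod_insert (by decide), Finset.prod_insert (by decide),
      Finset.prod_insert (by decide)]
    simp only [Matrix.cons_val_one, Matrix.cons_val, Finset.prod_singleton]
    ring
  rw [e1, e2] at h2
  unfold permSymbol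
  linarith

theorem det_rows_eq_sum (v : Fin 4 → Fin 4 → ℂ) :
    (Matrix.of v).det = ∑ a, ∑ b, ∑ c, ∑ d,
      v 0 a * v 1 b * v 2 c * v 3 d * (permSymbol a b c d : ℂ) := by
  have hp : ∀ a b c d : Fin 4, (permSymbol a b c d : ℂ) =
      (((b : ℂ) - a) * (c - a) * (d - a) * (c - b) * (d - b) * (d - c)) / 12 := by
    intro a b c d; rw [permSymbol_eq]; push_cast; rfl
  simp only [hp, Fin.sum_univ_four]
  simp [Matrix.det_succ_row_zero, Fin.sum_univ_succ, Fin.succAbove]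
  ring

/-- Both sides are the determinant of the matrix whose rows are the columns i, j, k, l of E; it
factors as a selection matrix times the transpose of E. -/
theorem sum_permSymbol_frame (E : Tensor2 ℂ) (i j k l : Fin 4) :
    ∑ a, ∑ b, ∑ c, ∑ d, E a i * E b j * E c k * E d l * (permSymbol a b c d : ℂ) =
      E.det * permSymbol i j k l := by
  have h := det_rows_eq_sum (fun r a => E a (![i, j, k, l] r))
  have h2 : (Matrix.of fun r a => E a (![i, j, k, l] r)) =
      (Matrix.of fun r s : Fin 4 => if ![i, j, k, l] r = s then (1 : ℝ) else 0).map Complex.ofReal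
        * Eᵀ := by
    ext r a
    rw [Matrix.mul_apply, Finset.sum_eq_single (![i, j, k, l] r)]
    · simp
    · intro b _ hb
      simp [hb.symm]
    · simp
  rw [h2, Matrix.det_mul, Matrix.det_transpose] at h
  have h3 : ((Matrix.of fun r s : Fin 4 => if ![i, j, k, l] r = s then (1 : ℝ) else 0).map
      Complex.ofReal).det = (permSymbol i j k l : ℂ) := by
    unfold permSymbol
    exact (RingHom.map_det Complex.ofRealHom _).symm
  rw [h3] at h
  simp at h
  rw [mul_comm, h]

/-! ### Self-dual bivectors in a null tetrad -/

theorem sum_comm_one_two {A : Type*} [AddCommMonoid A] (f : Fin 4 → Fin 4 → Fin 4 → A) :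
    ∑ a, ∑ k, ∑ l, f a k l = ∑ k, ∑ l, ∑ a, f a k l := by
  rw [Finset.sum_comm]
  exact Finset.sum_congr rfl fun k _ => Finset.sum_comm

theorem sum_comm_four_two {A : Type*} [AddCommMonoid A]
    (f : Fin 4 → Fin 4 → Fin 4 → Fin 4 → Fin 4 → Fin 4 → A) :
    ∑ a, ∑ b, ∑ c, ∑ d, ∑ k, ∑ l, f a b c d k l = ∑ k, ∑ l, ∑ a, ∑ b, ∑ c, ∑ d, f a b c d k l := by
  calc _ = ∑ a, ∑ b, ∑ c, ∑ k, ∑ l, ∑ d, f a b c d k l :=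
        Finset.sum_congr rfl fun a _ => Finset.sum_congr rfl fun b _ =>
          Finset.sum_congr rfl fun c _ => sum_comm_one_two _
    _ = ∑ a, ∑ b, ∑ k, ∑ l, ∑ c, ∑ d, f a b c d k l :=
        Finset.sum_congr rfl fun a _ => Finset.sum_congr rfl fun b _ => sum_comm_one_two _
    _ = ∑ a, ∑ k, ∑ l, ∑ b, ∑ c, ∑ d, f a b c d k l :=
        Finset.sum_congr rfl fun a _ => sum_comm_one_two _
    _ = _ := sum_comm_one_two _

theorem mul_mul_transpose_apply (E G : Tensor2 ℂ) (c d : Fin 4) :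
    (E * G * Eᵀ) c d = ∑ k, ∑ l, E c k * E d l * G k l := by
  simp only [Matrix.mul_apply, Matrix.transpose_apply, Finset.sum_mul]
  rw [Finset.sum_comm]
  exact Finset.sum_congr rfl fun k _ => Finset.sum_congr rfl fun l _ => by ring

theorem raise_eq (γ : Tensor2 ℝ) (F : Tensor2 ℂ) :
    raise γ F = toComplex γ⁻¹ * F * (toComplex γ⁻¹)ᵀ := by
  ext a b
  rw [mul_mul_transpose_apply]
  simp [raise]

/-- Components of a 4-tensor in the frame `E`. -/
def inFrame4 (E : Tensor2 ℂ) (A : Tensor4 ℂ) : Tensor4 ℂ := fun i j k l =>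
  ∑ a, ∑ b, ∑ c, ∑ d, E a i * E b j * E c k * E d l * A a b c d

theorem IsNullTetrad.raise_eq {γ : Tensor2 ℝ} {E : Tensor2 ℂ} (h : IsNullTetrad γ E)
    (F : Tensor2 ℂ) : raise γ F = E * (nullGram * inFrame E F * nullGram) * Eᵀ := by
  rw [Spacetime.raise_eq, h.inv_eq]
  simp only [Matrix.transpose_mul, Matrix.transpose_transpose, nullGram_transpose, inFrame,
    Matrix.mul_assoc]

/-- The condition `orient` is chosen for this: the density √|det γ| and the determinant of the
tetrad combine to the constant i, and no trace of the coordinates remains. -/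
theorem IsNullTetrad.volForm_frame {γ : Tensor2 ℝ} {E : Tensor2 ℂ} (h : IsNullTetrad γ E)
    (i j k l : Fin 4) :
    inFrame4 E (fun a b c d => (volForm γ a b c d : ℂ)) i j k l = I * permSymbol i j k l := by
  rw [← h.orient, mul_assoc, ← sum_permSymbol_frame]
  simp only [inFrame4, volForm, Finset.mul_sum]
  refine Finset.sum_congr rfl fun a _ => Finset.sum_congr rfl fun b _ =>
    Finset.sum_congr rfl fun c _ => Finset.sum_congr rfl fun d _ => ?_
  push_cast
  ring

theorem IsNullTetrad.hodge_frame {γ : Tensor2 ℝ} {E : Tensor2 ℂ} (h : IsNullTetrad γ E)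
    (F : Tensor2 ℂ) (i j : Fin 4) : inFrame E (hodge γ F) i j =
      I / 2 * ∑ k, ∑ l, permSymbol i j k l * (nullGram * inFrame E F * nullGram) k l := by
  have h1 : ∀ a b, E a i * E b j * hodge γ F a b = ∑ c, ∑ d, ∑ k, ∑ l,
      1 / 2 * (E a i * E b j * E c k * E d l * (volForm γ a b c d : ℂ)) *
        (nullGram * inFrame E F * nullGram) k l := by
    intro a b
    simp only [hodge, Matrix.of_apply, Complex.real_smul, h.raise_eq, mul_mul_transpose_apply,
      Finset.mul_sum]
    refine Finset.sum_congr rfl fun c _ => Finset.sum_congr rfl fun d _ =>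
      Finset.sum_congr rfl fun k _ => Finset.sum_congr rfl fun l _ => ?_
    push_cast
    ring
  rw [inFrame_apply]
  simp only [h1]
  rw [sum_comm_four_two]
  simp only [Finset.mul_sum]
  refine Finset.sum_congr rfl fun k _ => Finset.sum_congr rfl fun l _ => ?_
  have h2 := h.volForm_frame i j k l
  unfold inFrame4 at h2
  simp only [← Finset.sum_mul, ← Finset.mul_sum]
  rw [h2]
  ring

/-- The Hodge dual of a 2-form in terms of its components in a null tetrad. -/
def frameHodge (F : Tensor2 ℂ) : Tensor2 ℂ :=
  I • !![0, -F 2 3, F 0 2, -F 0 3;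
    F 2 3, 0, -F 1 2, F 1 3;
    -F 0 2, F 1 2, 0, -F 0 1;
    F 0 3, -F 1 3, F 0 1, 0]

theorem nullGram_mul_mul (F : Tensor2 ℂ) : nullGram * F * nullGram =
    !![F 1 1, F 1 0, -F 1 3, -F 1 2; F 0 1, F 0 0, -F 0 3, -F 0 2;
      -F 3 1, -F 3 0, F 3 3, F 3 2; -F 2 1, -F 2 0, F 2 3, F 2 2] := by
  ext i j
  fin_cases i <;> fin_cases j <;>
    simp [nullGram, Matrix.mul_apply, Fin.sum_univ_four, Matrix.vecMul, dotProduct]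

theorem IsNullTetrad.inFrame_hodge {γ : Tensor2 ℝ} {E : Tensor2 ℂ} (h : IsNullTetrad γ E)
    (F : Tensor2 ℂ) (hF : Fᵀ = -F) : inFrame E (hodge γ F) = frameHodge (inFrame E F) := by
  have hF' : (inFrame E F)ᵀ = -inFrame E F := by
    simp [inFrame, Matrix.transpose_mul, hF, Matrix.mul_assoc]
  have ha : ∀ i j, inFrame E F j i = -inFrame E F i j := fun i j => congrFun (congrFun hF' i) j
  have hp : ∀ a b c d : Fin 4, (permSymbol a b c d : ℂ) =
      (((b : ℂ) - a) * (c - a) * (d - a) * (c - b) * (d - b) * (d - c)) / 12 := by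
    intro a b c d; rw [permSymbol_eq]; push_cast; rfl
  ext i j
  rw [h.hodge_frame, nullGram_mul_mul]
  generalize inFrame E F = T at ha
  fin_cases i <;> fin_cases j <;>
    simp [frameHodge, Fin.sum_univ_four, hp, ha 0 1, ha 0 2, ha 0 3, ha 1 2, ha 1 3, ha 2 3] <;>
    ring

/-- An orthonormal basis of the space of self-dual bivectors, in a null tetrad. -/
def frameBasis : Fin 3 → Tensor2 ℂ :=
  ![(1 / Real.sqrt 2 : ℂ) • !![0, 0, 1, 0; 0, 0, 0, -1; -1, 0, 0, 0; 0, 1, 0, 0],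
    (I / Real.sqrt 2) • !![0, 1, 0, 0; -1, 0, 0, 0; 0, 0, 0, -1; 0, 0, 1, 0],
    (I / Real.sqrt 2) • !![0, 0, 1, 0; 0, 0, 0, 1; -1, 0, 0, 0; 0, -1, 0, 0]]

theorem sqrt_two_mul_self : (Real.sqrt 2 : ℂ) * Real.sqrt 2 = 2 := by
  rw [← Complex.ofReal_mul, Real.mul_self_sqrt (by norm_num)]; simp

theorem sqrt_two_ne_zero : (Real.sqrt 2 : ℂ) ≠ 0 := by
  simp

/-- An orthonormal basis of the space of self-dual bivectors. -/
def sdBasis (E : Tensor2 ℂ) (p : Fin 3) : Tensor2 ℂ := E⁻¹ᵀ * frameBasis p * E⁻¹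

theorem inFrame_of_coframe {E : Tensor2 ℂ} (hE : IsUnit E.det) (T : Tensor2 ℂ) :
    inFrame E (E⁻¹ᵀ * T * E⁻¹) = T := by
  have h1 : Eᵀ * E⁻¹ᵀ = 1 := by
    rw [← Matrix.transpose_mul, Matrix.nonsing_inv_mul _ hE, Matrix.transpose_one]
  calc _ = (Eᵀ * E⁻¹ᵀ) * T * (E⁻¹ * E) := by simp only [inFrame, Matrix.mul_assoc]
    _ = T := by rw [h1, Matrix.nonsing_inv_mul _ hE]; simp

theorem inFrame_sdBasis {E : Tensor2 ℂ} (hE : IsUnit E.det) (p : Fin 3) :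
    inFrame E (sdBasis E p) = frameBasis p := inFrame_of_coframe hE _

theorem inFrame_smul (E F : Tensor2 ℂ) (c : ℂ) : inFrame E (c • F) = c • inFrame E F := by
  simp [inFrame]

theorem inFrame_add (E F H : Tensor2 ℂ) : inFrame E (F + H) = inFrame E F + inFrame E H := by
  simp [inFrame, Matrix.mul_add, Matrix.add_mul]

theorem inFrame_sub (E F H : Tensor2 ℂ) : inFrame E (F - H) = inFrame E F - inFrame E H := by
  simp [inFrame, Matrix.mul_sub, Matrix.sub_mul]

theorem inFrame_sum {ι : Type*} (s : Finset ι) (E : Tensor2 ℂ) (F : ι → Tensor2 ℂ) :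
    inFrame E (∑ p ∈ s, F p) = ∑ p ∈ s, inFrame E (F p) := by
  simp [inFrame, Matrix.mul_sum, Matrix.sum_mul]

theorem inFrame_transpose (E F : Tensor2 ℂ) : (inFrame E F)ᵀ = inFrame E Fᵀ := by
  simp [inFrame, Matrix.transpose_mul, Matrix.mul_assoc]

/-- The components in a null tetrad of a self-dual bivector. -/
def IsFrameSelfDual (T : Tensor2 ℂ) : Prop :=
  Tᵀ = -T ∧ T 0 3 = 0 ∧ T 1 2 = 0 ∧ T 2 3 = -T 0 1

/-- The Hodge dual multiplies the components 02 and 13 by i and the components 03 and 12 by -i, and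
exchanges 01 with 23 up to the factor -i. Three free components 01, 02, 13 are left. -/
theorem IsNullTetrad.isSelfDual_iff {γ : Tensor2 ℝ} {E : Tensor2 ℂ} (h : IsNullTetrad γ E)
    (F : Tensor2 ℂ) : IsSelfDual γ F ↔ IsFrameSelfDual (inFrame E F) := by
  have ht : Fᵀ = -F ↔ (inFrame E F)ᵀ = -inFrame E F := by
    rw [inFrame_transpose]
    have : -inFrame E F = inFrame E (-F) := by simp [inFrame]
    rw [this]
    exact ⟨fun h => by rw [h], fun h' => inFrame_injective h.isUnit_det h'⟩
  constructor
  · rintro ⟨hF, hd⟩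
    have ha := ht.1 hF
    refine ⟨ha, ?_⟩
    have h1 : frameHodge (inFrame E F) = I • inFrame E F := by
      rw [← h.inFrame_hodge F hF, hd, inFrame_smul]
    have e := fun i j => congrFun (congrFun h1 i) j
    have e03 := e 0 3
    have e12 := e 1 2
    have e23 := e 2 3
    simp [frameHodge, neg_eq_self] at e03 e12 e23
    refine ⟨?_, ?_, ?_⟩
    · simpa using e03
    · simpa using e12
    · exact mul_left_cancel₀ I_ne_zero (by rw [mul_neg, e23])
  · rintro ⟨ha, h03, h12, h23⟩
    have hF := ht.2 ha
    refine ⟨hF, inFrame_injective h.isUnit_det ?_⟩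
    rw [h.inFrame_hodge F hF, inFrame_smul]
    have ha' : ∀ i j, inFrame E F j i = -inFrame E F i j := fun i j => congrFun (congrFun ha i) j
    have hd : ∀ i, inFrame E F i i = 0 := fun i => by
      have := ha' i i
      rwa [eq_neg_iff_add_eq_zero, ← two_mul, mul_eq_zero, or_iff_right two_ne_zero] at this
    ext i j
    generalize inFrame E F = T at *
    fin_cases i <;> fin_cases j <;>
      simp [frameHodge, h03, h12, h23, hd, ha' 0 1, ha' 0 2, ha' 0 3, ha' 1 2, ha' 1 3, ha' 2 3]

theorem isFrameSelfDual_iff_exists (T : Tensor2 ℂ) :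
    IsFrameSelfDual T ↔ ∃ z : Fin 3 → ℂ, T = ∑ p, z p • frameBasis p := by
  have hs := sqrt_two_mul_self
  have hs0 := sqrt_two_ne_zero
  constructor
  · rintro ⟨ha, h03, h12, h23⟩
    have ha' : ∀ i j, T j i = -T i j := fun i j => congrFun (congrFun ha i) j
    have hd : ∀ i, T i i = 0 := fun i => by
      have := ha' i i
      rwa [eq_neg_iff_add_eq_zero, ← two_mul, mul_eq_zero, or_iff_right two_ne_zero] at this
    refine ⟨![Real.sqrt 2 * (T 0 2 - T 1 3) / 2, -I * Real.sqrt 2 * T 0 1,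
      -I * Real.sqrt 2 * (T 0 2 + T 1 3) / 2], ?_⟩
    ext i j
    fin_cases i <;> fin_cases j <;>
      simp [Fin.sum_univ_three, frameBasis, h03, h12, h23, hd, ha' 0 1, ha' 0 2, ha' 0 3, ha' 1 2,
        ha' 1 3, ha' 2 3] <;> field_simp <;> simp <;> ring
  · rintro ⟨z, rfl⟩
    refine ⟨?_, ?_, ?_, ?_⟩
    · ext i j
      fin_cases i <;> fin_cases j <;> simp [Fin.sum_univ_three, frameBasis] <;> ring
    all_goals simp [Fin.sum_univ_three, frameBasis]

section

/-! ### Double 2-forms on the space of self-dual bivectors -/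

/-- The scalar product `½ F^{ab} H_{ab}` of bivectors. -/
def pairing (γ : Tensor2 ℝ) (F H : Tensor2 ℂ) : ℂ := (1 / 2) * ∑ a, ∑ b, raise γ F a b * H a b

/-- The scalar product of bivectors in a null tetrad. -/
def framePairing (F H : Tensor2 ℂ) : ℂ :=
  (1 / 2) * ∑ i, ∑ j, (nullGram * F * nullGram) i j * H i j

theorem IsNullTetrad.pairing_eq {γ : Tensor2 ℝ} {E : Tensor2 ℂ} (h : IsNullTetrad γ E)
    (F H : Tensor2 ℂ) : pairing γ F H = framePairing (inFrame E F) (inFrame E H) := by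
  unfold pairing framePairing
  congr 1
  simp only [h.raise_eq, mul_mul_transpose_apply, inFrame_apply E H, Finset.sum_mul, Finset.mul_sum]
  rw [show ∀ f : Fin 4 → Fin 4 → Fin 4 → Fin 4 → ℂ, ∑ a, ∑ b, ∑ k, ∑ l, f a b k l =
      ∑ k, ∑ l, ∑ a, ∑ b, f a b k l from fun f =>
    (Finset.sum_congr rfl fun a _ => sum_comm_one_two _).trans (sum_comm_one_two _)]
  refine Finset.sum_congr rfl fun k _ => Finset.sum_congr rfl fun l _ =>
      Finset.sum_congr rfl fun c _ => Finset.sum_congr rfl fun d _ => ?_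
  ring

theorem framePairing_frameBasis (p q : Fin 3) :
    framePairing (frameBasis p) (frameBasis q) = if p = q then 1 else 0 := by
  have hs := sqrt_two_mul_self
  have hs0 := sqrt_two_ne_zero
  have hi : (Real.sqrt 2 : ℂ) ^ 2 = 2 := by rw [pow_two, hs]
  unfold framePairing
  rw [nullGram_mul_mul]
  fin_cases p <;> fin_cases q <;> simp [frameBasis, Fin.sum_univ_four] <;> field_simp <;>
    simp [hi] <;> norm_num

theorem IsNullTetrad.pairing_sdBasis {γ : Tensor2 ℝ} {E : Tensor2 ℂ} (h : IsNullTetrad γ E)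
    (p q : Fin 3) : pairing γ (sdBasis E p) (sdBasis E q) = if p = q then 1 else 0 := by
  rw [h.pairing_eq, inFrame_sdBasis h.isUnit_det, inFrame_sdBasis h.isUnit_det,
    framePairing_frameBasis]

theorem raise_smul (γ : Tensor2 ℝ) (c : ℂ) (F : Tensor2 ℂ) : raise γ (c • F) = c • raise γ F := by
  simp [raise_eq]

theorem raise_sum {ι : Type*} (s : Finset ι) (γ : Tensor2 ℝ) (F : ι → Tensor2 ℂ) :
    raise γ (∑ p ∈ s, F p) = ∑ p ∈ s, raise γ (F p) := by
  simp [raise_eq, Matrix.mul_sum, Matrix.sum_mul]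

theorem pairing_smul_left (γ : Tensor2 ℝ) (c : ℂ) (F H : Tensor2 ℂ) :
    pairing γ (c • F) H = c * pairing γ F H := by
  simp only [pairing, raise_smul, Matrix.smul_apply, smul_eq_mul, Finset.mul_sum]
  exact Finset.sum_congr rfl fun a _ => Finset.sum_congr rfl fun b _ => by ring

theorem sum_sum_finset_comm {ι : Type*} (s : Finset ι) (f : Fin 4 → Fin 4 → ι → ℂ) :
    ∑ a, ∑ b, ∑ p ∈ s, f a b p = ∑ p ∈ s, ∑ a, ∑ b, f a b p := by
  rw [Finset.sum_comm (s := s)]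
  exact Finset.sum_congr rfl fun a _ => Finset.sum_comm

theorem pairing_sum_left {ι : Type*} (s : Finset ι) (γ : Tensor2 ℝ) (F : ι → Tensor2 ℂ)
    (H : Tensor2 ℂ) : pairing γ (∑ p ∈ s, F p) H = ∑ p ∈ s, pairing γ (F p) H := by
  simp only [pairing, raise_sum, Matrix.sum_apply, Finset.sum_mul]
  rw [← Finset.mul_sum]
  exact congrArg _ (sum_sum_finset_comm s fun a b p => raise γ (F p) a b * H a b)

theorem pairing_smul_right (γ : Tensor2 ℝ) (c : ℂ) (F H : Tensor2 ℂ) :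
    pairing γ F (c • H) = c * pairing γ F H := by
  simp only [pairing, Matrix.smul_apply, smul_eq_mul, Finset.mul_sum]
  exact Finset.sum_congr rfl fun a _ => Finset.sum_congr rfl fun b _ => by ring

theorem pairing_sum_right {ι : Type*} (s : Finset ι) (γ : Tensor2 ℝ) (F : Tensor2 ℂ)
    (H : ι → Tensor2 ℂ) : pairing γ F (∑ p ∈ s, H p) = ∑ p ∈ s, pairing γ F (H p) := by
  simp only [pairing, Matrix.sum_apply, Finset.mul_sum]
  exact sum_sum_finset_comm s fun a b p => 1 / 2 * (raise γ F a b * H p a b)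

/-- The double 2-form with components `M` in the basis `s` of bivectors. -/
def doubleForm (s : Fin 3 → Tensor2 ℂ) (M : Matrix (Fin 3) (Fin 3) ℂ) : Tensor4 ℂ :=
  fun a b c d => ∑ p, ∑ q, M p q * s p a b * s q c d

theorem act_doubleForm (γ : Tensor2 ℝ) (s : Fin 3 → Tensor2 ℂ) (M : Matrix (Fin 3) (Fin 3) ℂ)
    (F : Tensor2 ℂ) : act γ (doubleForm s M) F = ∑ p, (∑ q, M p q * pairing γ F (s q)) • s p := by
  ext a b
  simp only [act, doubleForm, Matrix.of_apply, pairing, Matrix.sum_apply, Matrix.smul_apply,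
    smul_eq_mul, Fin.sum_univ_three, Finset.mul_sum, Finset.sum_mul, Finset.sum_add_distrib,
    add_mul, mul_add]
  refine congrArg₂ _ (congrArg₂ _ ?_ ?_) ?_ <;> refine congrArg₂ _ (congrArg₂ _ ?_ ?_) ?_ <;>
  exact Finset.sum_congr rfl fun a _ => Finset.sum_congr rfl fun b _ => by ring

variable {γ : Tensor2 ℝ} {s : Fin 3 → Tensor2 ℂ}

theorem pairing_sum_basis (hs : ∀ p q, pairing γ (s p) (s q) = if p = q then 1 else 0)
    (z : Fin 3 → ℂ) (q : Fin 3) : pairing γ (∑ p, z p • s p) (s q) = z q := by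
  simp [pairing_sum_left, pairing_smul_left, hs]

theorem act_doubleForm_sum (hs : ∀ p q, pairing γ (s p) (s q) = if p = q then 1 else 0)
    (M : Matrix (Fin 3) (Fin 3) ℂ) (z : Fin 3 → ℂ) :
    act γ (doubleForm s M) (∑ p, z p • s p) = ∑ p, (M *ᵥ z) p • s p := by
  simp only [act_doubleForm, pairing_sum_basis hs]
  rfl

/-- Orthonormality replaces the inner contraction by the identity matrix. With the same statement
for the trace, every algebraic condition on double 2-forms becomes one on 3×3 matrices. -/
theorem comp_doubleForm (hs : ∀ p q, pairing γ (s p) (s q) = if p = q then 1 else 0)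
    (M N : Matrix (Fin 3) (Fin 3) ℂ) :
    comp γ (doubleForm s M) (doubleForm s N) = doubleForm s (M * N) := by
  funext a b c d
  have h1 : (Matrix.of fun e f => doubleForm s N e f c d) =
      ∑ p, (∑ q, N p q * s q c d) • s p := by
    ext e f
    simp only [Matrix.of_apply, doubleForm, Matrix.sum_apply, Matrix.smul_apply, smul_eq_mul,
      Finset.sum_mul]
    exact Finset.sum_congr rfl fun a _ => Finset.sum_congr rfl fun b _ => by ring
  rw [comp, h1, act_doubleForm_sum hs]
  simp only [Matrix.sum_apply, Matrix.smul_apply, smul_eq_mul, doubleForm, Matrix.mulVec, dotProduct,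
    Matrix.mul_apply, Fin.sum_univ_three]
  ring

theorem tr_doubleForm (hs : ∀ p q, pairing γ (s p) (s q) = if p = q then 1 else 0)
    (M : Matrix (Fin 3) (Fin 3) ℂ) : tr γ (doubleForm s M) = M.trace := by
  have h1 : ∀ a b, (Matrix.of fun c d => doubleForm s M a b c d) =
      ∑ q, (∑ p, M p q * s p a b) • s q := by
    intro a b
    ext e f
    simp only [Matrix.of_apply, doubleForm, Matrix.sum_apply, Matrix.smul_apply, smul_eq_mul,
      Finset.sum_mul]
    rw [Finset.sum_comm]
  have h2 : tr γ (doubleForm s M) = ∑ p, ∑ q, M p q * pairing γ (s q) (s p) := by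
    unfold tr
    simp only [h1, raise_sum, raise_smul, pairing, Matrix.sum_apply, Matrix.smul_apply,
      smul_eq_mul]
    simp only [Fin.sum_univ_three, Finset.mul_sum, Finset.sum_add_distrib,
      add_mul, mul_add]
    have h3 : ∀ p q, ∑ a, ∑ b, 1 / 2 * (M p q * s p a b * raise γ (s q) a b) =
      ∑ a, ∑ b, M p q * (1 / 2 * (raise γ (s q) a b * s p a b)) := fun p q =>
      Finset.sum_congr rfl fun a _ => Finset.sum_congr rfl fun b _ => by ring
    simp only [h3]
    ring
  rw [h2]
  simp [hs, Matrix.trace]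

theorem doubleForm_injective (hs : ∀ p q, pairing γ (s p) (s q) = if p = q then 1 else 0)
    {M N : Matrix (Fin 3) (Fin 3) ℂ} (h : doubleForm s M = doubleForm s N) : M = N := by
  ext p q
  have h1 : ∀ M : Matrix (Fin 3) (Fin 3) ℂ,
      pairing γ (act γ (doubleForm s M) (s q)) (s p) = M p q := by
    intro M
    rw [act_doubleForm, pairing_sum_basis hs]
    simp [hs]
  rw [← h1 M, h, h1 N]

theorem doubleForm_smul (c : ℂ) (M : Matrix (Fin 3) (Fin 3) ℂ) :
    doubleForm s (c • M) = c • doubleForm s M := by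
  funext a b c d
  simp only [doubleForm, Pi.smul_apply, Matrix.smul_apply, smul_eq_mul, Finset.mul_sum]
  exact Finset.sum_congr rfl fun a _ => Finset.sum_congr rfl fun b _ => by ring

theorem doubleForm_add (M N : Matrix (Fin 3) (Fin 3) ℂ) :
    doubleForm s (M + N) = doubleForm s M + doubleForm s N := by
  funext a b c d
  simp only [doubleForm, Pi.add_apply, Matrix.add_apply, add_mul, Finset.sum_add_distrib]

theorem doubleForm_sub (M N : Matrix (Fin 3) (Fin 3) ℂ) :
    doubleForm s (M - N) = doubleForm s M - doubleForm s N := by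
  funext a b c d
  simp only [doubleForm, Pi.sub_apply, Matrix.sub_apply, sub_mul, Finset.sum_sub_distrib]

theorem doubleForm_zero : doubleForm s 0 = 0 := by
  funext a b c d
  simp [doubleForm]

theorem inFrame4_eq (E : Tensor2 ℂ) (A : Tensor4 ℂ) (i j k l : Fin 4) : inFrame4 E A i j k l =
    inFrame E (Matrix.of fun a b => inFrame E (Matrix.of fun c d => A a b c d) k l) i j := by
  simp only [inFrame4, inFrame_apply, Matrix.of_apply, Finset.mul_sum]
  refine Finset.sum_congr rfl fun a _ => Finset.sum_congr rfl fun b _ =>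
    Finset.sum_congr rfl fun c _ => Finset.sum_congr rfl fun d _ => ?_
  ring

theorem inFrame4_injective {E : Tensor2 ℂ} (hE : IsUnit E.det) {A B : Tensor4 ℂ}
    (h : inFrame4 E A = inFrame4 E B) : A = B := by
  have h1 : ∀ k l, (Matrix.of fun a b => inFrame E (Matrix.of fun c d => A a b c d) k l) =
      (Matrix.of fun a b => inFrame E (Matrix.of fun c d => B a b c d) k l) := by
    intro k l
    apply inFrame_injective hE
    ext i j
    rw [← inFrame4_eq, ← inFrame4_eq, h]
  funext a b c d
  have h2 : (Matrix.of fun c d => A a b c d) = Matrix.of fun c d => B a b c d := by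
    apply inFrame_injective hE
    ext k l
    exact congrFun (congrFun (h1 k l) a) b
  exact congrFun (congrFun h2 c) d

theorem inFrame4_doubleForm (E : Tensor2 ℂ) (M : Matrix (Fin 3) (Fin 3) ℂ) :
    inFrame4 E (doubleForm s M) = doubleForm (fun p => inFrame E (s p)) M := by
  funext i j k l
  have h1 : ∀ a b, (Matrix.of fun c d => doubleForm s M a b c d) =
      ∑ q, (∑ p, M p q * s p a b) • s q := by
    intro a b
    ext e f
    simp only [Matrix.of_apply, doubleForm, Matrix.sum_apply, Matrix.smul_apply, smul_eq_mul,
      Finset.sum_mul]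
    rw [Finset.sum_comm]
  rw [inFrame4_eq]
  simp only [h1, inFrame_sum, inFrame_smul, Matrix.sum_apply, Matrix.smul_apply, smul_eq_mul]
  have h2 : (Matrix.of fun a b => ∑ q, (∑ p, M p q * s p a b) * inFrame E (s q) k l) =
      ∑ p, (∑ q, M p q * inFrame E (s q) k l) • s p := by
    ext a b
    simp only [Matrix.of_apply, Matrix.sum_apply, Matrix.smul_apply, smul_eq_mul, Finset.sum_mul]
    rw [Finset.sum_comm]
    exact Finset.sum_congr rfl fun a _ => Finset.sum_congr rfl fun b _ => by ring
  rw [h2]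
  simp only [inFrame_sum, inFrame_smul, Matrix.sum_apply, Matrix.smul_apply, smul_eq_mul,
    doubleForm, Finset.sum_mul]
  exact Finset.sum_congr rfl fun a _ => Finset.sum_congr rfl fun b _ => by ring

/-- Antisymmetry of a 4-tensor in its two pairs of indices. -/
def IsDoubleForm {𝕜 : Type} [Neg 𝕜] (A : Tensor4 𝕜) : Prop :=
  (∀ i j k l, A j i k l = -A i j k l) ∧ ∀ i j k l, A i j l k = -A i j k l

theorem forall_fin_four_antisymm {f : Fin 4 → Fin 4 → ℂ} (hf : ∀ i j, f j i = -f i j)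
    (h01 : f 0 1 = 0) (h02 : f 0 2 = 0) (h03 : f 0 3 = 0) (h12 : f 1 2 = 0) (h13 : f 1 3 = 0)
    (h23 : f 2 3 = 0) (i j : Fin 4) : f i j = 0 := by
  have hd : ∀ i, f i i = 0 := fun i => by
    have := hf i i
    rwa [eq_neg_iff_add_eq_zero, ← two_mul, mul_eq_zero, or_iff_right two_ne_zero] at this
  fin_cases i <;> fin_cases j <;>
    simp [hd, hf 0 1, hf 0 2, hf 0 3, hf 1 2, hf 1 3, hf 2 3, h01, h02, h03, h12, h13, h23]

theorem IsDoubleForm.inFrame4 {A : Tensor4 ℂ} (hA : IsDoubleForm A) (E : Tensor2 ℂ) :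
    IsDoubleForm (inFrame4 E A) := by
  constructor
  · intro i j k l
    simp only [Spacetime.inFrame4]
    rw [Finset.sum_comm]
    simp only [← Finset.sum_neg_distrib]
    refine Finset.sum_congr rfl fun a _ => Finset.sum_congr rfl fun b _ =>
      Finset.sum_congr rfl fun c _ => Finset.sum_congr rfl fun d _ => ?_
    rw [hA.1 a b]
    ring
  · intro i j k l
    simp only [Spacetime.inFrame4]
    simp only [← Finset.sum_neg_distrib]
    refine Finset.sum_congr rfl fun a _ => Finset.sum_congr rfl fun b _ => ?_
    rw [Finset.sum_comm]
    refine Finset.sum_congr rfl fun c _ => Finset.sum_congr rfl fun d _ => ?_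
    rw [hA.2 a b c d]
    ring

/-- Together with `IsDoubleForm.ext_row` this reduces the 256 components of an identity to the 6 × 6
components on ordered pairs. -/
theorem IsDoubleForm.ext {A B : Tensor4 ℂ} (hA : IsDoubleForm A) (hB : IsDoubleForm B)
    (h : ∀ k l, A 0 1 k l = B 0 1 k l ∧ A 0 2 k l = B 0 2 k l ∧ A 0 3 k l = B 0 3 k l ∧
      A 1 2 k l = B 1 2 k l ∧ A 1 3 k l = B 1 3 k l ∧ A 2 3 k l = B 2 3 k l) : A = B := by
  funext i j k l
  rw [← sub_eq_zero]
  obtain ⟨h01, h02, h03, h12, h13, h23⟩ := h k l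
  refine forall_fin_four_antisymm (f := fun i j => A i j k l - B i j k l) ?_ ?_ ?_ ?_ ?_ ?_ ?_ i j
  · intro i j
    rw [hA.1 i j, hB.1 i j]
    ring
  all_goals rw [sub_eq_zero]; assumption

theorem IsDoubleForm.ext_row {A B : Tensor4 ℂ} (hA : IsDoubleForm A) (hB : IsDoubleForm B)
    {i j : Fin 4} (h01 : A i j 0 1 = B i j 0 1) (h02 : A i j 0 2 = B i j 0 2)
    (h03 : A i j 0 3 = B i j 0 3) (h12 : A i j 1 2 = B i j 1 2) (h13 : A i j 1 3 = B i j 1 3)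
    (h23 : A i j 2 3 = B i j 2 3) (k l : Fin 4) : A i j k l = B i j k l := by
  rw [← sub_eq_zero]
  refine forall_fin_four_antisymm (f := fun k l => A i j k l - B i j k l) ?_ ?_ ?_ ?_ ?_ ?_ ?_ k l
  · intro k l
    rw [hA.2 i j k l, hB.2 i j k l]
    ring
  all_goals rw [sub_eq_zero]; assumption

end

theorem isDoubleForm_doubleForm {s : Fin 3 → Tensor2 ℂ} (hs : ∀ p i j, s p j i = -s p i j)
    (M : Matrix (Fin 3) (Fin 3) ℂ) : IsDoubleForm (doubleForm s M) := by
  constructor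
  · intro i j k l
    simp only [doubleForm, ← Finset.sum_neg_distrib, hs _ i j]
    exact Finset.sum_congr rfl fun a _ => Finset.sum_congr rfl fun b _ => by ring
  · intro i j k l
    simp only [doubleForm, ← Finset.sum_neg_distrib, hs _ k l]
    exact Finset.sum_congr rfl fun a _ => Finset.sum_congr rfl fun b _ => by ring

theorem frameBasis_antisymm (p : Fin 3) (i j : Fin 4) : frameBasis p j i = -frameBasis p i j := by
  have h := ((isFrameSelfDual_iff_exists (frameBasis p)).2
    ⟨Pi.single p 1, by simp [Pi.single_apply]⟩).1
  exact congrFun (congrFun h i) j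

theorem volForm_eq (γ : Tensor2 ℝ) (a b c d : Fin 4) : volForm γ a b c d = Real.sqrt |γ.det| *
    ((((b : ℝ) - a) * (c - a) * (d - a) * (c - b) * (d - b) * (d - c)) / 12) := by
  rw [volForm, permSymbol_eq]

theorem isDoubleForm_sdMetric (γ : Tensor2 ℝ) : IsDoubleForm (sdMetric γ) := by
  constructor <;> intro i j k l <;> simp only [sdMetric, volForm_eq] <;> push_cast <;> ring

theorem IsNullTetrad.gram_apply {γ : Tensor2 ℝ} {E : Tensor2 ℂ} (h : IsNullTetrad γ E)
    (i j : Fin 4) : ∑ a, ∑ b, E a i * E b j * (γ a b : ℂ) = nullGram i j := by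
  rw [← h.gram, ← inFrame, inFrame_apply]
  rfl

theorem IsNullTetrad.inFrame4_sdMetric {γ : Tensor2 ℝ} {E : Tensor2 ℂ} (h : IsNullTetrad γ E)
    (i j k l : Fin 4) : inFrame4 E (sdMetric γ) i j k l = (1 / 2) *
      (nullGram i k * nullGram j l - nullGram i l * nullGram j k + permSymbol i j k l) := by
  have h1 : inFrame4 E (sdMetric γ) i j k l = (1 / 2) *
      (∑ a, ∑ b, ∑ c, ∑ d, (E a i * E c k * γ a c) * (E b j * E d l * γ b d)
        - ∑ a, ∑ b, ∑ c, ∑ d, (E a i * E d l * γ a d) * (E b j * E c k * γ b c)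
        - I * inFrame4 E (fun a b c d => (volForm γ a b c d : ℂ)) i j k l) := by
    simp only [inFrame4, sdMetric, Finset.mul_sum, ← Finset.sum_sub_distrib]
    refine Finset.sum_congr rfl fun a _ => Finset.sum_congr rfl fun b _ =>
      Finset.sum_congr rfl fun c _ => Finset.sum_congr rfl fun d _ => ?_
    push_cast
    ring
  have h2 : ∑ a, ∑ b, ∑ c, ∑ d, (E a i * E c k * γ a c) * (E b j * E d l * γ b d) =
      nullGram i k * nullGram j l := by
    rw [← h.gram_apply i k, ← h.gram_apply j l, Finset.sum_mul]
    refine Finset.sum_congr rfl fun a _ => ?_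
    rw [Finset.mul_sum]
    refine Finset.sum_congr rfl fun b _ => ?_
    rw [Finset.sum_mul]
    exact Finset.sum_congr rfl fun c _ => by rw [Finset.mul_sum]
  have h3 : ∑ a, ∑ b, ∑ c, ∑ d, (E a i * E d l * γ a d) * (E b j * E c k * γ b c) =
      nullGram i l * nullGram j k := by
    rw [← h.gram_apply i l, ← h.gram_apply j k, Finset.sum_mul]
    refine Finset.sum_congr rfl fun a _ => ?_
    rw [Finset.mul_sum]
    refine Finset.sum_congr rfl fun b _ => ?_
    rw [Finset.sum_mul, Finset.sum_comm]
    exact Finset.sum_congr rfl fun c _ => by rw [Finset.mul_sum]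
  rw [h1, h2, h3, h.volForm_frame, ← mul_assoc, I_mul_I]
  ring

/-- The self-dual metric is the identity of the space of self-dual bivectors. -/
theorem IsNullTetrad.sdMetric_eq {γ : Tensor2 ℝ} {E : Tensor2 ℂ} (h : IsNullTetrad γ E) :
    sdMetric γ = doubleForm (sdBasis E) 1 := by
  have hp : ∀ a b c d : Fin 4, (permSymbol a b c d : ℂ) =
      (((b : ℂ) - a) * (c - a) * (d - a) * (c - b) * (d - b) * (d - c)) / 12 := by
    intro a b c d; rw [permSymbol_eq]; push_cast; rfl
  have hi : (Real.sqrt 2 : ℂ) ^ 2 = 2 := by rw [pow_two, sqrt_two_mul_self]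
  have hs0 := sqrt_two_ne_zero
  apply inFrame4_injective h.isUnit_det
  rw [inFrame4_doubleForm]
  simp only [inFrame_sdBasis h.isUnit_det]
  have hA := (isDoubleForm_sdMetric γ).inFrame4 E
  have hB := isDoubleForm_doubleForm frameBasis_antisymm 1
  refine hA.ext hB ?_
  have key : ∀ i j, (i, j) ∈ [((0 : Fin 4), (1 : Fin 4)), (0, 2), (0, 3), (1, 2), (1, 3), (2, 3)] →
      ∀ k l, inFrame4 E (sdMetric γ) i j k l = doubleForm frameBasis 1 i j k l := by
    intro i j hij
    simp only [List.mem_cons, Prod.mk.injEq, List.not_mem_nil, or_false] at hij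
    apply hA.ext_row hB <;> rw [h.inFrame4_sdMetric, hp] <;>
      rcases hij with ⟨rfl, rfl⟩ | ⟨rfl, rfl⟩ | ⟨rfl, rfl⟩ | ⟨rfl, rfl⟩ | ⟨rfl, rfl⟩ | ⟨rfl, rfl⟩ <;>
      simp [nullGram, doubleForm, frameBasis, Fin.sum_univ_three, Matrix.one_apply] <;>
      field_simp <;> simp [hi] <;> norm_num
  intro k l
  exact ⟨key 0 1 (by simp) k l, key 0 2 (by simp) k l, key 0 3 (by simp) k l,
    key 1 2 (by simp) k l, key 1 3 (by simp) k l, key 2 3 (by simp) k l⟩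

/-! ### The algebra of the Weyl tensor -/

/-- The algebraic symmetries of a curvature tensor. -/
structure HasRiemannSymmetries {𝕜 : Type} [AddCommGroup 𝕜] (R : Tensor4 𝕜) : Prop where
  doubleForm : IsDoubleForm R
  pair : ∀ a b c d, R c d a b = R a b c d
  cyclic : ∀ a b c d, R a b c d + R a c d b + R a d b c = 0

theorem HasRiemannSymmetries.inFrame4 {R : Tensor4 ℂ} (hR : HasRiemannSymmetries R)
    (E : Tensor2 ℂ) : HasRiemannSymmetries (inFrame4 E R) := by
  refine ⟨hR.doubleForm.inFrame4 E, ?_, ?_⟩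
  · intro i j k l
    simp only [Spacetime.inFrame4]
    rw [show ∀ f : Fin 4 → Fin 4 → Fin 4 → Fin 4 → ℂ, ∑ a, ∑ b, ∑ c, ∑ d, f a b c d =
      ∑ c, ∑ d, ∑ a, ∑ b, f a b c d from fun f =>
      (Finset.sum_congr rfl fun a _ => sum_comm_one_two _).trans (sum_comm_one_two _)]
    refine Finset.sum_congr rfl fun a _ => Finset.sum_congr rfl fun b _ =>
      Finset.sum_congr rfl fun c _ => Finset.sum_congr rfl fun d _ => ?_
    rw [hR.pair a b c d]
    ring
  · intro i j k l
    have e1 : Spacetime.inFrame4 E R i k l j =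
        ∑ a, ∑ b, ∑ c, ∑ d, E a i * E b j * E c k * E d l * R a c d b := by
      simp only [Spacetime.inFrame4]
      refine Finset.sum_congr rfl fun a _ => ?_
      rw [sum_comm_one_two fun b c d => E a i * E b j * E c k * E d l * R a c d b]
      refine Finset.sum_congr rfl fun b _ =>
        Finset.sum_congr rfl fun c _ => Finset.sum_congr rfl fun d _ => by ring
    have e2 : Spacetime.inFrame4 E R i l j k =
        ∑ a, ∑ b, ∑ c, ∑ d, E a i * E b j * E c k * E d l * R a d b c := by
      simp only [Spacetime.inFrame4]
      refine Finset.sum_congr rfl fun a _ => ?_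
      rw [sum_comm_one_two fun d b c => E a i * E d l * E b j * E c k * R a d b c]
      refine Finset.sum_congr rfl fun b _ =>
        Finset.sum_congr rfl fun c _ => Finset.sum_congr rfl fun d _ => by ring
    rw [e1, e2]
    simp only [Spacetime.inFrame4, ← Finset.sum_add_distrib, ← mul_add, hR.cyclic]
    simp

/-- The trace of a double 2-form in a null tetrad. -/
theorem IsNullTetrad.trace_inFrame4 {γ : Tensor2 ℝ} {E : Tensor2 ℂ} (h : IsNullTetrad γ E)
    (R : Tensor4 ℂ) (j l : Fin 4) :
    ∑ i, ∑ k, nullGram i k * inFrame4 E R i j k l =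
      ∑ b, ∑ d, E b j * E d l * ∑ a, ∑ c, (γ⁻¹ a c : ℂ) * R a b c d := by
  have hg : ∀ a c, (γ⁻¹ a c : ℂ) = ∑ i, ∑ k, E a i * E c k * nullGram i k := by
    intro a c
    rw [← mul_mul_transpose_apply, ← h.inv_eq]
    rfl
  simp only [hg, inFrame4, Finset.mul_sum, Finset.sum_mul]
  rw [show ∀ f : Fin 4 → Fin 4 → Fin 4 → Fin 4 → Fin 4 → Fin 4 → ℂ,
      ∑ i, ∑ k, ∑ a, ∑ b, ∑ c, ∑ d, f i k a b c d = ∑ b, ∑ d, ∑ a, ∑ c, ∑ i, ∑ k, f i k a b c d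
      from fun f => by
    rw [← sum_comm_four_two fun a b c d i k => f i k a b c d]
    rw [Finset.sum_comm]
    refine Finset.sum_congr rfl fun b _ => ?_
    exact (sum_comm_one_two fun d a c => ∑ i, ∑ k, f i k a b c d).symm]
  refine Finset.sum_congr rfl fun a _ => Finset.sum_congr rfl fun b _ =>
      Finset.sum_congr rfl fun c _ => Finset.sum_congr rfl fun d _ =>
      Finset.sum_congr rfl fun _ _ => Finset.sum_congr rfl fun _ _ => ?_
  ring

/-- The self-dual part `½ (W - i *W)` of a double 2-form. -/
def sdPart (γ : Tensor2 ℝ) (W : Tensor4 ℝ) : Tensor4 ℂ := fun a b c d =>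
  (1 / 2) * ((W a b c d : ℂ)
    - Complex.I * ((hodge γ (Matrix.of fun e f => W e f c d) a b : ℝ) : ℂ))

theorem ofReal_hodge (γ : Tensor2 ℝ) (F : Tensor2 ℝ) (a b : Fin 4) :
    ((hodge γ F a b : ℝ) : ℂ) = hodge γ (toComplex F) a b := by
  simp [hodge, raise]

/-- The matrix of the self-dual part of a Weyl tensor, from its components in a null tetrad. -/
def weylMatrix (W : Tensor4 ℂ) : Matrix (Fin 3) (Fin 3) ℂ :=
  !![(W 0 2 0 2 - 2 * W 0 2 1 3 + W 1 3 1 3) / 2, -I * (W 0 1 0 2 - W 0 1 1 3),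
      -I * (W 0 2 0 2 - W 1 3 1 3) / 2;
    -I * (W 0 1 0 2 - W 0 1 1 3), -(W 0 1 0 1 - W 0 1 2 3), -(W 0 1 0 2 + W 0 1 1 3);
    -I * (W 0 2 0 2 - W 1 3 1 3) / 2, -(W 0 1 0 2 + W 0 1 1 3),
      -(W 0 2 0 2 + 2 * W 0 2 1 3 + W 1 3 1 3) / 2]

theorem weylMatrix_transpose (W : Tensor4 ℂ) : (weylMatrix W)ᵀ = weylMatrix W := by
  ext i j
  fin_cases i <;> fin_cases j <;> simp [weylMatrix]

theorem inFrame4_eq_right (E : Tensor2 ℂ) (A : Tensor4 ℂ) (i j k l : Fin 4) :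
    inFrame4 E A i j k l =
    inFrame E (Matrix.of fun c d => inFrame E (Matrix.of fun a b => A a b c d) i j) k l := by
  simp only [inFrame4, inFrame_apply, Matrix.of_apply, Finset.mul_sum]
  rw [show ∀ f : Fin 4 → Fin 4 → Fin 4 → Fin 4 → ℂ, ∑ a, ∑ b, ∑ c, ∑ d, f a b c d =
      ∑ c, ∑ d, ∑ a, ∑ b, f a b c d from fun f =>
      (Finset.sum_congr rfl fun a _ => sum_comm_one_two _).trans (sum_comm_one_two _)]
  refine Finset.sum_congr rfl fun a _ => Finset.sum_congr rfl fun b _ =>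
    Finset.sum_congr rfl fun c _ => Finset.sum_congr rfl fun d _ => ?_
  ring

/-- The dual acts on one pair of indices and the change of frame on the other, so that they commute.
-/
theorem frameHodge_linear (E : Tensor2 ℂ) (T : Fin 4 → Fin 4 → Tensor2 ℂ) (i j k l : Fin 4) :
    inFrame E (Matrix.of fun c d => frameHodge (T c d) i j) k l =
      frameHodge (Matrix.of fun i j => inFrame E (Matrix.of fun c d => T c d i j) k l) i j := by
  have h1 : ∀ (z : ℂ) (i j : Fin 4), inFrame E (Matrix.of fun c d => z * T c d i j) k l =
      z * inFrame E (Matrix.of fun c d => T c d i j) k l := by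
    intro z i j
    have : (Matrix.of fun c d => z * T c d i j) = z • Matrix.of fun c d => T c d i j := rfl
    rw [this, inFrame_smul]
    rfl
  have h2 : inFrame E (Matrix.of fun _ _ => (0 : ℂ)) k l = 0 := by
    simp [inFrame_apply]
  have h3 : ∀ (i j : Fin 4), inFrame E (Matrix.of fun c d => -(I * T c d i j)) k l =
      -(I * inFrame E (Matrix.of fun c d => T c d i j) k l) := by
    intro i j
    rw [← neg_mul, ← h1]
    simp only [neg_mul]
  fin_cases i <;> fin_cases j <;> simp [frameHodge, h1, h2, h3]

theorem IsNullTetrad.inFrame4_sdPart {γ : Tensor2 ℝ} {E : Tensor2 ℂ} (h : IsNullTetrad γ E)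
    {W : Tensor4 ℝ} (hW : IsDoubleForm W) (i j k l : Fin 4) :
    inFrame4 E (sdPart γ W) i j k l = (1 / 2) *
      (inFrame4 E (fun a b c d => (W a b c d : ℂ)) i j k l - I * frameHodge
        (Matrix.of fun i j => inFrame4 E (fun a b c d => (W a b c d : ℂ)) i j k l) i j) := by
  set Wc : Tensor4 ℂ := fun a b c d => (W a b c d : ℂ) with hWc
  have h1 : ∀ c d, (Matrix.of fun a b => sdPart γ W a b c d) = (1 / 2 : ℂ) •
      ((Matrix.of fun a b => Wc a b c d) - I • hodge γ (Matrix.of fun a b => Wc a b c d)) := by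
    intro c d
    ext a b
    have : toComplex (Matrix.of fun e f => W e f c d) = Matrix.of fun a b => Wc a b c d := by
      ext; simp [hWc]
    simp only [sdPart, Matrix.of_apply, ofReal_hodge, this, Matrix.smul_apply, Matrix.sub_apply,
      smul_eq_mul]
    rfl
  have h2 : ∀ c d, (Matrix.of fun a b => Wc a b c d)ᵀ = -Matrix.of fun a b => Wc a b c d := by
    intro c d
    ext a b
    simp [hWc, hW.1 a b]
  simp only [inFrame4_eq_right, h1, inFrame_smul, inFrame_sub, h.inFrame_hodge _ (h2 _ _)]
  rw [show (Matrix.of fun c d => ((1 / 2 : ℂ) • (inFrame E (Matrix.of fun a b => Wc a b c d) -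
    I • frameHodge (inFrame E (Matrix.of fun a b => Wc a b c d)))) i j) = (1 / 2 : ℂ) •
    ((Matrix.of fun c d => inFrame E (Matrix.of fun a b => Wc a b c d) i j) -
    I • Matrix.of fun c d => frameHodge (inFrame E (Matrix.of fun a b => Wc a b c d)) i j) from rfl,
    inFrame_smul, inFrame_sub, inFrame_smul]
  simp only [Matrix.smul_apply, Matrix.sub_apply, smul_eq_mul]
  rw [frameHodge_linear E (fun c d => inFrame E (Matrix.of fun a b => Wc a b c d))]

/-- The components in a null tetrad of a traceless curvature tensor. -/
structure IsFrameWeyl (W : Tensor4 ℂ) : Prop where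
  symm : HasRiemannSymmetries W
  traceless : ∀ j l, ∑ i, ∑ k, nullGram i k * W i j k l = 0

theorem IsDoubleForm.self_left {W : Tensor4 ℂ} (h : IsDoubleForm W) (i k l : Fin 4) :
    W i i k l = 0 := by
  have := h.1 i i k l
  rwa [eq_neg_iff_add_eq_zero, ← two_mul, mul_eq_zero, or_iff_right two_ne_zero] at this

theorem IsDoubleForm.self_right {W : Tensor4 ℂ} (h : IsDoubleForm W) (i j k : Fin 4) :
    W i j k k = 0 := by
  have := h.2 i j k k
  rwa [eq_neg_iff_add_eq_zero, ← two_mul, mul_eq_zero, or_iff_right two_ne_zero] at this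

theorem IsFrameWeyl.trace_eq {W : Tensor4 ℂ} (h : IsFrameWeyl W) (j l : Fin 4) :
    -W 0 j 1 l - W 1 j 0 l + W 2 j 3 l + W 3 j 2 l = 0 := by
  have := h.traceless j l
  simp [Fin.sum_univ_four, nullGram] at this
  linear_combination this

/-- The first eight relations are one trace component each; `W 2 3 2 3 = W 0 1 0 1` uses two traces,
and the last one a trace and the cyclic identity. All but the last say that W does not couple
self-dual with anti-self-dual bivectors; the last makes its self-dual block traceless. -/
theorem IsFrameWeyl.relations {W : Tensor4 ℂ} (h : IsFrameWeyl W) :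
    (W 0 2 0 3 = 0 ∧ W 0 2 1 2 = 0 ∧ W 1 3 1 2 = 0 ∧ W 1 3 0 3 = 0) ∧
    (W 0 2 2 3 = -W 0 1 0 2 ∧ W 1 3 2 3 = -W 0 1 1 3 ∧ W 0 3 2 3 = W 0 1 0 3 ∧
      W 1 2 2 3 = W 0 1 1 2) ∧
    W 2 3 2 3 = W 0 1 0 1 ∧ 2 * W 0 2 1 3 + W 0 1 0 1 - W 0 1 2 3 = 0 := by
  have h1 := h.symm.doubleForm.1
  have h2 := h.symm.doubleForm.2
  have hp := h.symm.pair
  have hl := h.symm.doubleForm.self_left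
  have hr := h.symm.doubleForm.self_right
  have t := h.trace_eq
  refine ⟨⟨?_, ?_, ?_, ?_⟩, ⟨?_, ?_, ?_, ?_⟩, ?_, ?_⟩
  · have := t 0 0
    rw [hl, hr, h1 0 2, h1 0 3, h2 0 2 0 3, h2 0 3 0 2, hp 0 2 0 3] at this
    linear_combination this / 2
  · have := t 2 2
    rw [hl, hr, hp 0 2 1 2] at this
    linear_combination -this / 2
  · have := t 1 1
    rw [hl, hr, h1 1 2, h1 1 3, h2 1 2 1 3, h2 1 3 1 2, hp 1 3 1 2] at this
    linear_combination this / 2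
  · have := t 3 3
    rw [hl, hr, hp 1 3 0 3] at this
    linear_combination -this / 2
  · have := t 0 2
    rw [hl, hr, h1 0 1, h1 0 2, h2 0 2 2 3] at this
    linear_combination this
  · have := t 1 3
    rw [hl, hr, h1 1 3] at this
    linear_combination -this
  · have := t 0 3
    rw [hl, hr, h1 0 1, h1 0 3] at this
    linear_combination -this
  · have := t 1 2
    rw [hl, hr, h1 1 2, h2 1 2 2 3] at this
    linear_combination this
  · have e1 := t 0 1
    have e2 := t 2 3
    rw [hl, h1 0 1, h1 0 2, h1 0 3, h2 0 2 1 3, h2 0 3 1 2] at e1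
    rw [hl, h1 2 3, hp 0 3 1 2] at e2
    linear_combination -e1 - e2
  · have e1 := t 0 1
    have c := h.symm.cyclic 0 1 2 3
    rw [hl, h1 0 1, h1 0 2, h1 0 3, h2 0 2 1 3, h2 0 3 1 2] at e1
    rw [h2 0 2 1 3] at c
    linear_combination e1 - c

theorem IsFrameWeyl.trace_weylMatrix {W : Tensor4 ℂ} (h : IsFrameWeyl W) :
    (weylMatrix W).trace = 0 := by
  have := h.relations.2.2.2
  simp [Matrix.trace, Fin.sum_univ_three, weylMatrix]
  linear_combination -this

/-- A traceless tensor with the symmetries of a curvature tensor. -/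
structure IsWeyl (γ : Tensor2 ℝ) (W : Tensor4 ℝ) : Prop where
  symm : HasRiemannSymmetries W
  traceless : ∀ b d, ∑ a, ∑ c, γ⁻¹ a c * W a b c d = 0

theorem IsWeyl.isFrameWeyl {γ : Tensor2 ℝ} {E : Tensor2 ℂ} (h : IsNullTetrad γ E)
    {W : Tensor4 ℝ} (hW : IsWeyl γ W) :
    IsFrameWeyl (inFrame4 E (fun a b c d => (W a b c d : ℂ))) := by
  refine ⟨HasRiemannSymmetries.inFrame4 ⟨⟨?_, ?_⟩, ?_, ?_⟩ E, ?_⟩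
  · intro a b c d; rw [hW.symm.doubleForm.1]; simp
  · intro a b c d; rw [hW.symm.doubleForm.2]; simp
  · intro a b c d; rw [hW.symm.pair]
  · intro a b c d; exact_mod_cast hW.symm.cyclic a b c d
  · intro j l
    rw [h.trace_inFrame4]
    have : ∀ b d, ∑ a, ∑ c, (γ⁻¹ a c : ℂ) * (W a b c d : ℂ) = 0 := by
      intro b d; exact_mod_cast hW.traceless b d
    simp [this]

theorem isDoubleForm_sdPart (γ : Tensor2 ℝ) {W : Tensor4 ℝ} (hW : IsDoubleForm W) :
    IsDoubleForm (sdPart γ W) := by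
  constructor
  · intro a b c d
    have : ∀ F : Tensor2 ℝ, hodge γ F b a = -hodge γ F a b := by
      intro F
      simp only [hodge, Matrix.of_apply, ← smul_neg, ← Finset.sum_neg_distrib, volForm_eq]
      congr 1
      refine Finset.sum_congr rfl fun c _ => Finset.sum_congr rfl fun d _ => ?_
      simp only [smul_eq_mul]
      ring
    simp only [sdPart]
    rw [this, hW.1]
    push_cast
    ring
  · intro a b c d
    have : (Matrix.of fun e f => W e f d c) = -Matrix.of fun e f => W e f c d := by
      ext e f
      simp [hW.2 e f c d]
    have h2 : ∀ F : Tensor2 ℝ, hodge γ (-F) a b = -hodge γ F a b := by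
      intro F
      simp [hodge, raise]
    simp only [sdPart]
    rw [this, h2, hW.2]
    push_cast
    ring

/-- Taking the self-dual part in the first pair suffices: by the vanishing of the mixed components
the second pair is then self-dual too, and the result lies in the tensor square of the
three-dimensional space. -/
theorem IsNullTetrad.sdPart_eq {γ : Tensor2 ℝ} {E : Tensor2 ℂ} (h : IsNullTetrad γ E)
    {W : Tensor4 ℝ} (hW : IsWeyl γ W) : sdPart γ W =
      doubleForm (sdBasis E) (weylMatrix (inFrame4 E (fun a b c d => (W a b c d : ℂ)))) := by
  have hi : (Real.sqrt 2 : ℂ) ^ 2 = 2 := by rw [pow_two, sqrt_two_mul_self]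
  have hs0 := sqrt_two_ne_zero
  apply inFrame4_injective h.isUnit_det
  rw [inFrame4_doubleForm]
  simp only [inFrame_sdBasis h.isUnit_det]
  have hA := (isDoubleForm_sdPart γ hW.symm.doubleForm).inFrame4 E
  have hF := hW.isFrameWeyl h
  have hf := h.inFrame4_sdPart hW.symm.doubleForm
  generalize inFrame4 E (fun a b c d => (W a b c d : ℂ)) = V at *
  have hB := isDoubleForm_doubleForm frameBasis_antisymm (weylMatrix V)
  refine hA.ext hB ?_
  obtain ⟨⟨r1, r2, r3, r4⟩, ⟨r5, r6, r7, r8⟩, r9, r10⟩ := hF.relations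
  have hp := hF.symm.pair
  have p1 := hp 0 1 0 2
  have p2 := hp 0 1 0 3
  have p3 := hp 0 1 1 2
  have p4 := hp 0 1 1 3
  have p5 := hp 0 1 2 3
  have p6 := hp 0 2 2 3
  have p7 := hp 0 3 2 3
  have p8 := hp 1 2 2 3
  have p9 := hp 1 3 2 3
  have p10 := hp 0 2 1 3
  have key : ∀ i j, (i, j) ∈ [((0 : Fin 4), (1 : Fin 4)), (0, 2), (0, 3), (1, 2), (1, 3), (2, 3)] →
      ∀ k l, inFrame4 E (sdPart γ W) i j k l = doubleForm frameBasis (weylMatrix V) i j k l := by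
    intro i j hij
    simp only [List.mem_cons, Prod.mk.injEq, List.not_mem_nil, or_false] at hij
    apply hA.ext_row hB <;> rw [hf] <;>
      rcases hij with ⟨rfl, rfl⟩ | ⟨rfl, rfl⟩ | ⟨rfl, rfl⟩ | ⟨rfl, rfl⟩ | ⟨rfl, rfl⟩ | ⟨rfl, rfl⟩ <;>
      simp [doubleForm, frameBasis, Fin.sum_univ_three, frameHodge, weylMatrix, ← mul_assoc,
        p1, p2, p3, p4, p5, p6, p7, p8, p9, p10, r1, r2, r3, r4, r5, r6, r7, r8, r9] <;>
      field_simp <;> simp only [hi, I_sq] <;> ring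
  intro k l
  exact ⟨key 0 1 (by simp) k l, key 0 2 (by simp) k l, key 0 3 (by simp) k l,
    key 1 2 (by simp) k l, key 1 3 (by simp) k l, key 2 3 (by simp) k l⟩

/-! ### Existence of null tetrads -/

/-- Changes of oriented null tetrad. -/
structure IsTetradChange (N : Tensor2 ℂ) : Prop where
  gram : Nᵀ * nullGram * N = nullGram
  conj : tetradSwap * N.map (starRingEnd ℂ) = N * tetradSwap
  det : N.det = 1

theorem IsNullTetrad.mul {γ : Tensor2 ℝ} {E N : Tensor2 ℂ} (h : IsNullTetrad γ E)
    (hN : IsTetradChange N) : IsNullTetrad γ (E * N) := by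
  refine ⟨?_, ?_, ?_⟩
  · calc _ = Nᵀ * (Eᵀ * toComplex γ * E) * N := by
          simp only [Matrix.transpose_mul, Matrix.mul_assoc]
      _ = _ := by rw [h.gram, hN.gram]
  · rw [Matrix.map_mul, h.conj, Matrix.mul_assoc, hN.conj, Matrix.mul_assoc]
  · rw [Matrix.det_mul, hN.det, mul_one, h.orient]

theorem inFrame_mul_right (E N F : Tensor2 ℂ) : inFrame (E * N) F = inFrame N (inFrame E F) := by
  simp only [inFrame, Matrix.transpose_mul, Matrix.mul_assoc]

/-- The null rotation that fixes the vector `l`. -/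
def rotationL (a : ℂ) : Tensor2 ℂ :=
  !![1, 0, 0, 0; a * starRingEnd ℂ a, 1, a, starRingEnd ℂ a; starRingEnd ℂ a, 0, 1, 0; a, 0, 0, 1]

/-- The null rotation that fixes the vector `k`. -/
def rotationK (a : ℂ) : Tensor2 ℂ :=
  !![1, a * starRingEnd ℂ a, a, starRingEnd ℂ a; 0, 1, 0, 0; 0, starRingEnd ℂ a, 1, 0; 0, a, 0, 1]

/-- The exchange of `k` with `l` and of `m` with `n`. -/
def tetradFlip : Tensor2 ℂ := !![0, 1, 0, 0; 1, 0, 0, 0; 0, 0, 0, 1; 0, 0, 1, 0]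

theorem isTetradChange_rotationL (a : ℂ) : IsTetradChange (rotationL a) := by
  refine ⟨?_, ?_, ?_⟩
  · ext i j
    fin_cases i <;> fin_cases j <;>
      simp [nullGram, rotationL, Matrix.mul_apply, Fin.sum_univ_four]
    all_goals ring
  · ext i j
    fin_cases i <;> fin_cases j <;>
      simp [tetradSwap, rotationL, Matrix.mul_apply, Fin.sum_univ_four]
    all_goals ring
  · simp [rotationL, Matrix.det_succ_row_zero, Fin.sum_univ_succ, Fin.succAbove]

theorem isTetradChange_rotationK (a : ℂ) : IsTetradChange (rotationK a) := by
  refine ⟨?_, ?_, ?_⟩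
  · ext i j
    fin_cases i <;> fin_cases j <;>
      simp [nullGram, rotationK, Matrix.mul_apply, Fin.sum_univ_four]
    all_goals ring
  · ext i j
    fin_cases i <;> fin_cases j <;>
      simp [tetradSwap, rotationK, Matrix.mul_apply, Fin.sum_univ_four]
    all_goals ring
  · simp [rotationK, Matrix.det_succ_row_zero, Fin.sum_univ_succ, Fin.succAbove]

theorem isTetradChange_flip : IsTetradChange tetradFlip := by
  refine ⟨?_, ?_, ?_⟩
  · ext i j
    fin_cases i <;> fin_cases j <;>
      simp [nullGram, tetradFlip, Matrix.mul_apply, Fin.sum_univ_four]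
  · ext i j
    fin_cases i <;> fin_cases j <;>
      simp [tetradSwap, tetradFlip, Matrix.mul_apply, Fin.sum_univ_four]
  · simp [tetradFlip, Matrix.det_succ_row_zero, Fin.sum_univ_succ, Fin.succAbove]

/-- A null tetrad of the Minkowski space. -/
def minkowskiTetrad : Tensor2 ℂ := (1 / Real.sqrt 2 : ℂ) •
  !![1, 1, 0, 0; 1, -1, 0, 0; 0, 0, 1, 1; 0, 0, I, -I]

theorem minkowskiTetrad_gram : minkowskiTetradᵀ * Matrix.diagonal ![-1, 1, 1, 1] * minkowskiTetrad =
    nullGram := by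
  have hi : (Real.sqrt 2 : ℂ) ^ 2 = 2 := by rw [pow_two, sqrt_two_mul_self]
  have hs0 := sqrt_two_ne_zero
  rw [minkowskiTetrad, Matrix.transpose_smul, Matrix.smul_mul, Matrix.smul_mul, Matrix.mul_smul,
    smul_smul, show (1 / Real.sqrt 2 : ℂ) * (1 / Real.sqrt 2) = 1 / 2 by field_simp; simp [hi]]
  ext i j
  fin_cases i <;> fin_cases j <;>
    simp [nullGram, Matrix.mul_apply, Fin.sum_univ_four, Matrix.diagonal] <;> norm_num

theorem minkowskiTetrad_conj : minkowskiTetrad.map (starRingEnd ℂ) =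
    minkowskiTetrad * tetradSwap := by
  ext i j
  fin_cases i <;> fin_cases j <;>
    simp [tetradSwap, minkowskiTetrad, Matrix.mul_apply, Fin.sum_univ_four]

theorem minkowskiTetrad_det : minkowskiTetrad.det = I := by
  have hi : (Real.sqrt 2 : ℂ) ^ 4 = 4 := by
    rw [show (Real.sqrt 2 : ℂ) ^ 4 = (Real.sqrt 2 * Real.sqrt 2) * (Real.sqrt 2 * Real.sqrt 2) by
      ring, sqrt_two_mul_self]
    norm_num
  have hs0 := sqrt_two_ne_zero
  simp only [minkowskiTetrad, Matrix.det_smul, Fintype.card_fin]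
  simp [Matrix.det_succ_row_zero, Fin.sum_univ_succ, Fin.succAbove, hi]
  ring

theorem tetradSwap_gram : tetradSwapᵀ * nullGram * tetradSwap = nullGram := by
  ext i j
  fin_cases i <;> fin_cases j <;> simp [tetradSwap, nullGram, Matrix.mul_apply, Fin.sum_univ_four]

theorem tetradSwap_conj : tetradSwap.map (starRingEnd ℂ) = tetradSwap := by
  ext i j
  fin_cases i <;> fin_cases j <;> simp [tetradSwap]

theorem tetradSwap_det : tetradSwap.det = -1 := by
  simp [tetradSwap, Matrix.det_succ_row_zero, Fin.sum_univ_succ, Fin.succAbove]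

/-- The tetrad of Minkowski space is carried over by the inverse of B, which is real and so respects
conjugation. -/
theorem IsLorentz.exists_nullTetrad {γ : Tensor2 ℝ} (h : IsLorentz γ) :
    ∃ E, IsNullTetrad γ E := by
  obtain ⟨B, hB, rfl⟩ := h
  set C := toComplex B⁻¹ with hC
  have hBC : toComplex B * C = 1 := by
    rw [hC, ← toComplex_mul, Matrix.mul_nonsing_inv _ hB]
    ext i j
    by_cases hij : i = j <;> simp [Matrix.one_apply, hij]
  have hgram : ∀ N : Tensor2 ℂ, (C * N)ᵀ * toComplex (Bᵀ * Matrix.diagonal ![-1, 1, 1, 1] * B) *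
      (C * N) = Nᵀ * Matrix.diagonal ![-1, 1, 1, 1] * N := by
    intro N
    have e1 : toComplex (Matrix.diagonal ![-1, 1, 1, 1]) = Matrix.diagonal ![-1, 1, 1, 1] := by
      ext i j
      fin_cases i <;> fin_cases j <;> simp [Matrix.diagonal]
    have e2 : Cᵀ * toComplex Bᵀ = 1 := by
      rw [show toComplex Bᵀ = (toComplex B)ᵀ from rfl, ← Matrix.transpose_mul, hBC,
        Matrix.transpose_one]
    rw [toComplex_mul, toComplex_mul, e1, Matrix.transpose_mul]
    calc _ = Nᵀ * (Cᵀ * toComplex Bᵀ) * Matrix.diagonal ![-1, 1, 1, 1] * (toComplex B * C) * N := by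
          simp only [Matrix.mul_assoc]
      _ = _ := by rw [e2, hBC, Matrix.mul_one, Matrix.mul_one]
  have hconj : C.map (starRingEnd ℂ) = C := by
    ext i j
    simp [hC]
  have hdet : (Real.sqrt |(Bᵀ * Matrix.diagonal ![-1, 1, 1, 1] * B).det| : ℂ) * C.det =
      (|B.det| / B.det : ℝ) := by
    have e1 : |(Bᵀ * Matrix.diagonal ![-1, 1, 1, 1] * B).det| = B.det ^ 2 := by
      simp [Matrix.det_mul, Fin.prod_univ_four, abs_mul]
      exact (pow_two _).symm
    have e2 : C.det = ((B.det)⁻¹ : ℝ) := by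
      have := (RingHom.map_det Complex.ofRealHom B⁻¹).symm
      rw [Matrix.det_nonsing_inv, Ring.inverse_eq_inv'] at this
      exact this
    rw [e1, e2, Real.sqrt_sq_eq_abs]
    push_cast
    rw [div_eq_mul_inv]
  -- The orientation comes out as the sign of det B. When it is wrong, exchanging m and n, a change
  -- of determinant -1, repairs it.
  rcases lt_or_gt_of_ne hB.ne_zero with hneg | hpos
  · refine ⟨C * (minkowskiTetrad * tetradSwap), ?_, ?_, ?_⟩
    · rw [hgram, Matrix.transpose_mul]
      calc _ = tetradSwapᵀ * (minkowskiTetradᵀ * Matrix.diagonal ![-1, 1, 1, 1] * minkowskiTetrad)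
            * tetradSwap := by simp only [Matrix.mul_assoc]
        _ = _ := by rw [minkowskiTetrad_gram, tetradSwap_gram]
    · rw [Matrix.map_mul, Matrix.map_mul, hconj, minkowskiTetrad_conj, tetradSwap_conj]
      simp only [Matrix.mul_assoc]
    · rw [Matrix.det_mul C, ← mul_assoc, hdet, Matrix.det_mul, minkowskiTetrad_det, tetradSwap_det,
        abs_of_neg hneg, neg_div, div_self hneg.ne]
      simp
  · refine ⟨C * minkowskiTetrad, ?_, ?_, ?_⟩
    · rw [hgram, minkowskiTetrad_gram]
    · rw [Matrix.map_mul, hconj, minkowskiTetrad_conj, Matrix.mul_assoc]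
    · rw [Matrix.det_mul C, ← mul_assoc, hdet, minkowskiTetrad_det,
        abs_of_pos hpos, div_self hpos.ne']
      simp

/-- The unitary self-dual bivector of a null tetrad. -/
def frameUnit : Tensor2 ℂ := (1 / Real.sqrt 2 : ℂ) •
  !![0, 1, 0, 0; -1, 0, 0, 0; 0, 0, 0, -1; 0, 0, 1, 0]

theorem IsFrameSelfDual.self {T : Tensor2 ℂ} (h : IsFrameSelfDual T) (i : Fin 4) : T i i = 0 := by
  have := congrFun (congrFun h.1 i) i
  simp only [Matrix.transpose_apply, Matrix.neg_apply] at this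
  rwa [eq_neg_iff_add_eq_zero, ← two_mul, mul_eq_zero, or_iff_right two_ne_zero] at this

theorem IsFrameSelfDual.antisymm {T : Tensor2 ℂ} (h : IsFrameSelfDual T) (i j : Fin 4) :
    T j i = -T i j := congrFun (congrFun h.1 i) j

theorem IsFrameSelfDual.eq {T : Tensor2 ℂ} (h : IsFrameSelfDual T) :
    T = !![0, T 0 1, T 0 2, 0; -T 0 1, 0, 0, T 1 3; -T 0 2, 0, 0, -T 0 1; 0, -T 1 3, T 0 1, 0] := by
  have ha := h.antisymm
  ext i j
  fin_cases i <;> fin_cases j <;>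
    simp [h.self, h.2.1, h.2.2.1, h.2.2.2, ha 0 1, ha 0 2, ha 0 3, ha 1 2, ha 1 3, ha 2 3]

theorem IsFrameSelfDual.framePairing {T : Tensor2 ℂ} (h : IsFrameSelfDual T) :
    framePairing T T = -2 * (T 0 1 ^ 2 + T 0 2 * T 1 3) := by
  have ha := h.antisymm
  rw [Spacetime.framePairing, nullGram_mul_mul]
  simp [Fin.sum_univ_four, h.self, h.2.1, h.2.2.1, h.2.2.2, ha 0 1, ha 0 2, ha 0 3, ha 1 2, ha 1 3,
    ha 2 3]
  ring

/-- A null tetrad adapted to a unitary self-dual bivector. -/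
theorem IsLorentz.exists_adapted {γ : Tensor2 ℝ} (hγ : IsLorentz γ) {F : Tensor2 ℂ}
    (hF : IsSelfDual γ F) (hn : pairing γ F F = -1) :
    ∃ E, IsNullTetrad γ E ∧ inFrame E F = frameUnit := by
  have hs : (Real.sqrt 2 : ℂ) ^ 2 = 2 := by rw [pow_two, sqrt_two_mul_self]
  have hs0 := sqrt_two_ne_zero
  have norm : ∀ E, IsNullTetrad γ E → IsFrameSelfDual (inFrame E F) ∧
      inFrame E F 0 1 ^ 2 + inFrame E F 0 2 * inFrame E F 1 3 = 1 / 2 := by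
    intro E hE
    have h1 := (hE.isSelfDual_iff F).1 hF
    refine ⟨h1, ?_⟩
    have h2 := h1.framePairing
    rw [← hE.pairing_eq, hn] at h2
    linear_combination h2 / 2
  -- A null rotation about l with parameter a turns the component 02 into the quadratic polynomial
  -- F₀₂ + 2aF₀₁ - a²F₁₃, and a is taken to be a root. If F₁₃ = 0 the polynomial has degree one,
  -- because the norm gives F₀₁ ≠ 0.
  have exists_zero : ∃ E, IsNullTetrad γ E ∧ inFrame E F 0 2 = 0 := by
    obtain ⟨E, hE⟩ := hγ.exists_nullTetrad
    obtain ⟨h1, h2⟩ := norm E hE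
    suffices ∃ a, inFrame E F 0 2 + 2 * a * inFrame E F 0 1 - a ^ 2 * inFrame E F 1 3 = 0 by
      obtain ⟨a, ha⟩ := this
      refine ⟨_, hE.mul (isTetradChange_rotationL a), ?_⟩
      rw [inFrame_mul_right, h1.eq, inFrame_apply]
      simp [Fin.sum_univ_four, rotationL]
      linear_combination ha
    by_cases h13 : inFrame E F 1 3 = 0
    · have h01 : inFrame E F 0 1 ≠ 0 := by
        intro h0
        rw [h13, h0] at h2
        norm_num at h2
      refine ⟨-inFrame E F 0 2 / (2 * inFrame E F 0 1), ?_⟩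
      rw [h13]
      field_simp
      ring
    -- The reduced discriminant F₀₁² + F₀₂F₁₃ equals 1/2 by the normalization, so its root is 1/√2.
    · refine ⟨(inFrame E F 0 1 + 1 / Real.sqrt 2) / inFrame E F 1 3, ?_⟩
      field_simp
      rw [hs]
      linear_combination 2 * h2 + (inFrame E F 0 2 * inFrame E F 1 3 + inFrame E F 0 1 ^ 2) * hs
  have exists_two_zeros : ∃ E, IsNullTetrad γ E ∧ inFrame E F 0 2 = 0 ∧ inFrame E F 1 3 = 0 := by
    obtain ⟨E, hE, h02⟩ := exists_zero
    obtain ⟨h1, h2⟩ := norm E hE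
    have h01 : inFrame E F 0 1 ≠ 0 := by
      intro h0
      rw [h02, h0] at h2
      norm_num at h2
    -- With F₀₂ = 0 a null rotation about k keeps this zero and changes F₁₃ by a multiple of F₀₁,
    -- which is not zero. The parameter is conjugated because its conjugate enters this component.
    refine ⟨_, hE.mul (isTetradChange_rotationK
      (starRingEnd ℂ (inFrame E F 1 3 / (2 * inFrame E F 0 1)))), ?_, ?_⟩
    · rw [inFrame_mul_right, h1.eq, inFrame_apply]
      simp [Fin.sum_univ_four, rotationK, h02]
    · rw [inFrame_mul_right, h1.eq, inFrame_apply]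
      simp [Fin.sum_univ_four, rotationK, h02]
      field_simp
      ring
  obtain ⟨E, hE, h02, h13⟩ := exists_two_zeros
  obtain ⟨h1, h2⟩ := norm E hE
  have h3 : (inFrame E F 0 1 - 1 / Real.sqrt 2) * (inFrame E F 0 1 + 1 / Real.sqrt 2) = 0 := by
    have : (1 / Real.sqrt 2 : ℂ) ^ 2 = 1 / 2 := by rw [div_pow, hs, one_pow]
    rw [h02] at h2
    linear_combination h2 - this
  rcases mul_eq_zero.1 h3 with h4 | h4
  · refine ⟨E, hE, ?_⟩
    have h5 : inFrame E F 0 1 = 1 / Real.sqrt 2 := by linear_combination h4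
    rw [h1.eq, h02, h13, h5]
    ext i j
    fin_cases i <;> fin_cases j <;> simp [frameUnit]
  -- Only the sign of F₀₁ = ±1/√2 is left; exchanging k with l and m with n reverses it and
  -- preserves the orientation.
  · refine ⟨_, hE.mul isTetradChange_flip, ?_⟩
    have h5 : inFrame E F 0 1 = -(1 / Real.sqrt 2) := by linear_combination h4
    rw [inFrame_mul_right, h1.eq, h02, h13, h5]
    ext i j
    rw [inFrame_apply]
    fin_cases i <;> fin_cases j <;> simp [frameUnit, Fin.sum_univ_four, tetradFlip]

/-! ### Petrov-Bel type D -/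

/-- The Cayley–Hamilton form of the adjugate. For an idempotent of trace one it shows at once that
all 2×2 minors vanish. -/
theorem adjugate_fin_three_eq (T : Matrix (Fin 3) (Fin 3) ℂ) : T.adjugate =
    T * T - T.trace • T + ((T.trace ^ 2 - (T * T).trace) / 2) • (1 : Matrix (Fin 3) (Fin 3) ℂ) := by
  rw [Matrix.adjugate_fin_three]
  ext i j
  fin_cases i <;> fin_cases j <;>
    simp [Matrix.mul_apply, Matrix.trace, Fin.sum_univ_three] <;> ring

/-- A symmetric projector of trace one is the square of a vector. -/
theorem exists_vec_of_idempotent {T : Matrix (Fin 3) (Fin 3) ℂ} (hT : Tᵀ = T) (h2 : T * T = T)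
    (h1 : T.trace = 1) : ∃ v : Fin 3 → ℂ, ∀ p q, T p q = v p * v q := by
  -- The entries of the adjugate are the 2×2 minors up to sign, so T has rank at most one.
  have hadj : T.adjugate = 0 := by
    rw [adjugate_fin_three_eq, h2, h1]
    simp
  rw [Matrix.adjugate_fin_three] at hadj
  have e := fun i j => congrFun (congrFun hadj i) j
  have hs : ∀ i j, T j i = T i j := fun i j => congrFun (congrFun hT i) j
  have s10 := hs 0 1
  have s20 := hs 0 2
  have s21 := hs 1 2
  have e00 := e 0 0
  have e01 := e 0 1
  have e02 := e 0 2
  have e11 := e 1 1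
  have e12 := e 1 2
  have e22 := e 2 2
  simp [s10, s20, s21] at e00 e01 e02 e11 e12 e22
  have key : ∃ i, T i i ≠ 0 := by
    by_contra! h
    simp [Matrix.trace, h] at h1
  obtain ⟨i, hi⟩ := key
  have hm : ∀ p q, T p i * T q i = T p q * T i i := by
    intro p q
    fin_cases i <;> fin_cases p <;> fin_cases q <;> simp [s10, s20, s21] <;> first
      | ring1
      | linear_combination e00
      | linear_combination e01
      | linear_combination e02
      | linear_combination e11
      | linear_combination e12
      | linear_combination e22
      | linear_combination -e00
      | linear_combination -e01
      | linear_combination -e02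
      | linear_combination -e11
      | linear_combination -e12
      | linear_combination -e22
  -- For a symmetric matrix with vanishing minors, T p q = T p i · T q i / T i i; the vector is the
  -- i-th column divided by a root of the pivot.
  obtain ⟨c, hc⟩ := IsAlgClosed.exists_eq_mul_self (T i i)
  have hc0 : c ≠ 0 := by
    rintro rfl
    simp at hc
    exact hi hc
  refine ⟨fun p => T p i / c, fun p q => ?_⟩
  have := hm p q
  rw [hc] at this
  field_simp
  linear_combination -this

/-- The type D condition for the matrix of `𝒲`. -/
def IsTypeDMatrix (M : Matrix (Fin 3) (Fin 3) ℂ) : Prop :=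
  ∃ (z : Fin 3 → Fin 3 → ℂ) (r t : ℂ), r ≠ t ∧ LinearIndependent ℂ z ∧
    M *ᵥ z 0 = r • z 0 ∧ M *ᵥ z 1 = r • z 1 ∧ M *ᵥ z 2 = t • z 2

/-- The scalar `ρ` for the matrix of `𝒲`. -/
def rhoMatrix (M : Matrix (Fin 3) (Fin 3) ℂ) : ℂ := -(M * (M * M)).trace / (M * M).trace

/-- The matrix of `𝒮`. -/
def matrixS (M : Matrix (Fin 3) (Fin 3) ℂ) : Matrix (Fin 3) (Fin 3) ℂ :=
  (1 / (3 * rhoMatrix M)) • (M - rhoMatrix M • (1 : Matrix (Fin 3) (Fin 3) ℂ))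

theorem matrixS_trace {M : Matrix (Fin 3) (Fin 3) ℂ} (h0 : M.trace = 0) (hr : rhoMatrix M ≠ 0) :
    (matrixS M).trace = -1 := by
  simp [matrixS, Matrix.trace_smul, Matrix.trace_sub, h0]
  field_simp

theorem matrixS_transpose {M : Matrix (Fin 3) (Fin 3) ℂ} (h : Mᵀ = M) :
    (matrixS M)ᵀ = matrixS M := by
  simp [matrixS, h]

/-- The eigenvalues are r, r, -2r, and r ≠ 0 because they are not all equal. Hence Tr M² = 6r², Tr
M³ = -6r³ and ρ = r, while `𝒮` has eigenvalues 0, 0, -1. -/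
theorem IsTypeDMatrix.algebraic {M : Matrix (Fin 3) (Fin 3) ℂ} (h0 : M.trace = 0)
    (h : IsTypeDMatrix M) : rhoMatrix M ≠ 0 ∧ matrixS M * matrixS M + matrixS M = 0 := by
  obtain ⟨z, r, t, hrt, hz, h1, h2, h3⟩ := h
  set P : Matrix (Fin 3) (Fin 3) ℂ := (Matrix.of z)ᵀ with hP
  have hdet : IsUnit P.det := by
    rw [hP, Matrix.det_transpose]
    exact (Matrix.isUnit_iff_isUnit_det _).1 (Matrix.linearIndependent_rows_iff_isUnit.1 hz)
  set D : Matrix (Fin 3) (Fin 3) ℂ := Matrix.diagonal ![r, r, t] with hD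
  have hMP : M * P = P * D := by
    ext i j
    have e1 := congrFun h1 i
    have e2 := congrFun h2 i
    have e3 := congrFun h3 i
    simp only [Matrix.mulVec, dotProduct, Pi.smul_apply, smul_eq_mul] at e1 e2 e3
    rw [hD, Matrix.mul_diagonal, Matrix.mul_apply]
    fin_cases j <;> simp [hP, e1, e2, e3, mul_comm]
  have hM : M = P * D * P⁻¹ := by
    rw [← hMP, Matrix.mul_nonsing_inv_cancel_right _ _ hdet]
  have conjm : ∀ A B : Matrix (Fin 3) (Fin 3) ℂ, (P * A * P⁻¹) * (P * B * P⁻¹) =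
      P * (A * B) * P⁻¹ := by
    intro A B
    calc _ = P * A * (P⁻¹ * P) * B * P⁻¹ := by simp only [Matrix.mul_assoc]
      _ = _ := by rw [Matrix.nonsing_inv_mul _ hdet]; simp only [Matrix.mul_assoc, Matrix.one_mul]
  have tr : ∀ A : Matrix (Fin 3) (Fin 3) ℂ, (P * A * P⁻¹).trace = A.trace := by
    intro A
    rw [Matrix.trace_mul_cycle, Matrix.nonsing_inv_mul _ hdet, Matrix.one_mul]
  have ht : t = -2 * r := by
    rw [hM, tr, hD] at h0
    simp [Matrix.trace, Fin.sum_univ_three] at h0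
    linear_combination h0
  have hr : r ≠ 0 := by
    rintro rfl
    apply hrt
    rw [ht]
    simp
  have hrho : rhoMatrix M = r := by
    rw [rhoMatrix, hM, conjm, conjm, tr, tr, hD]
    simp only [Matrix.diagonal_mul_diagonal, Matrix.trace_diagonal, Fin.sum_univ_three]
    simp
    rw [ht]
    have : r * r + r * r + -2 * r * (-2 * r) ≠ 0 := by
      rw [show r * r + r * r + -2 * r * (-2 * r) = 6 * r ^ 2 by ring]
      simpa using hr
    rw [div_eq_iff this]
    ring
  refine ⟨hrho ▸ hr, ?_⟩
  have h1' : (1 : Matrix (Fin 3) (Fin 3) ℂ) = P * 1 * P⁻¹ := by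
    rw [Matrix.mul_one, Matrix.mul_nonsing_inv _ hdet]
  have hS : matrixS M = P * ((1 / (3 * r)) • (D - r • (1 : Matrix (Fin 3) (Fin 3) ℂ))) * P⁻¹ := by
    rw [matrixS, hrho]
    conv_lhs => rw [hM, h1']
    simp only [Matrix.mul_smul, Matrix.smul_mul, Matrix.mul_sub, Matrix.sub_mul]
  rw [hS, conjm, ← Matrix.add_mul, ← Matrix.mul_add]
  have : ((1 / (3 * r)) • (D - r • (1 : Matrix (Fin 3) (Fin 3) ℂ))) *
      ((1 / (3 * r)) • (D - r • (1 : Matrix (Fin 3) (Fin 3) ℂ))) +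
      (1 / (3 * r)) • (D - r • (1 : Matrix (Fin 3) (Fin 3) ℂ)) = 0 := by
    rw [hD, ht]
    ext i j
    fin_cases i <;> fin_cases j <;>
      simp [Matrix.mul_apply, Fin.sum_univ_three, Matrix.diagonal] <;> field_simp <;> ring
  rw [this]
  simp

/-- T = -`𝒮` is a projector of trace one, hence of rank one, and M = r - 3rT. Its kernel, of
dimension two, is an eigenspace for r and its range one for -2r. -/
theorem isTypeDMatrix_of_algebraic {M : Matrix (Fin 3) (Fin 3) ℂ} (h0 : M.trace = 0)
    (hr : rhoMatrix M ≠ 0) (hS : matrixS M * matrixS M + matrixS M = 0) : IsTypeDMatrix M := by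
  set r := rhoMatrix M with hrdef
  set T : Matrix (Fin 3) (Fin 3) ℂ := -matrixS M with hT
  have hTT : T * T = T := by
    rw [hT, neg_mul_neg]
    exact eq_neg_of_add_eq_zero_left hS
  have htr : T.trace = 1 := by
    rw [hT, Matrix.trace_neg, matrixS_trace h0 hr]
    simp
  have hM : M = r • (1 : Matrix (Fin 3) (Fin 3) ℂ) - (3 * r) • T := by
    rw [hT, matrixS, ← hrdef, smul_neg, smul_smul, mul_one_div_cancel (by simp [hr])]
    simp
  set f := Matrix.toLin' T with hf
  have hff : ∀ v, f (f v) = f v := by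
    intro v
    rw [hf, Matrix.toLin'_apply, Matrix.toLin'_apply, Matrix.mulVec_mulVec, hTT]
  have hproj : LinearMap.IsProj (LinearMap.range f) f := by
    refine ⟨fun v => LinearMap.mem_range_self f v, ?_⟩
    rintro _ ⟨v, rfl⟩
    exact hff v
  have hrank : Module.finrank ℂ (LinearMap.range f) = 1 := by
    have := hproj.trace
    rw [hf, Matrix.trace_toLin'_eq, htr] at this
    exact_mod_cast this.symm
  have hker : Module.finrank ℂ (LinearMap.ker f) = 2 := by
    have := LinearMap.finrank_range_add_finrank_ker f
    rw [hrank] at this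
    simp at this
    omega
  let b := Module.finBasisOfFinrankEq ℂ (LinearMap.ker f) hker
  obtain ⟨w, hw⟩ := (Module.finrank_pos_iff_exists_ne_zero (R := ℂ) (M := LinearMap.range f)).1
    (by rw [hrank]; norm_num)
  have hfw : f (w : Fin 3 → ℂ) = w := hproj.2 _ w.2
  have hfb : ∀ i, f (b i : Fin 3 → ℂ) = 0 := fun i => (b i).2
  have hw0 : (w : Fin 3 → ℂ) ≠ 0 := fun h => hw (Subtype.ext h)
  have hMv : ∀ v, M *ᵥ v = r • v - (3 * r) • f v := by
    intro v
    rw [hM, Matrix.sub_mulVec, Matrix.smul_mulVec, Matrix.smul_mulVec, Matrix.one_mulVec, hf,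
      Matrix.toLin'_apply]
  refine ⟨![b 0, b 1, w], r, -2 * r, ?_, ?_, ?_, ?_, ?_⟩
  · intro h
    apply hr
    linear_combination h / 3
  · rw [Fintype.linearIndependent_iff]
    intro c hc
    simp only [Fin.sum_univ_three, Matrix.cons_val_zero, Matrix.cons_val_one, Matrix.cons_val] at hc
    have hc2 : c 2 = 0 := by
      have := congrArg f hc
      simp only [map_add, map_smul, hfb, hfw, smul_zero, zero_add, map_zero] at this
      exact (smul_eq_zero.1 this).resolve_right hw0
    rw [hc2, zero_smul, add_zero] at hc
    have hb := Fintype.linearIndependent_iff.1 b.linearIndependent ![c 0, c 1] (by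
      apply Subtype.ext
      simpa [Fin.sum_univ_two] using hc)
    intro i
    fin_cases i
    · simpa using hb 0
    · simpa using hb 1
    · exact hc2
  · simp [hMv, hfb]
  · simp [hMv, hfb]
  · simp [hMv, hfw]
    module

/-! ### Type D and the canonical bivector at a point -/

section

theorem sdBasis_combination_injective {γ : Tensor2 ℝ} {s : Fin 3 → Tensor2 ℂ}
    (hs : ∀ p q, pairing γ (s p) (s q) = if p = q then 1 else 0) {z w : Fin 3 → ℂ}
    (h : ∑ p, z p • s p = ∑ p, w p • s p) : z = w := by
  funext q
  rw [← pairing_sum_basis hs z q, h, pairing_sum_basis hs]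

theorem IsNullTetrad.isSelfDual_iff_exists {γ : Tensor2 ℝ} {E : Tensor2 ℂ} (h : IsNullTetrad γ E)
    (F : Tensor2 ℂ) : IsSelfDual γ F ↔ ∃ z : Fin 3 → ℂ, F = ∑ p, z p • sdBasis E p := by
  rw [h.isSelfDual_iff, isFrameSelfDual_iff_exists]
  refine exists_congr fun z => ?_
  constructor
  · intro hz
    apply inFrame_injective h.isUnit_det
    simp only [hz, inFrame_sum, inFrame_smul, inFrame_sdBasis h.isUnit_det]
  · rintro rfl
    simp only [inFrame_sum, inFrame_smul, inFrame_sdBasis h.isUnit_det]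

variable {g : E4 → Tensor2 ℝ} {x : E4}

/-- The self-dual Weyl tensor as a traceless symmetric endomorphism. -/
theorem exists_sdWeyl_eq (hW : IsWeyl (g x) (weyl g x)) {E : Tensor2 ℂ}
    (hE : IsNullTetrad (g x) E) : ∃ M : Matrix (Fin 3) (Fin 3) ℂ, Mᵀ = M ∧ M.trace = 0 ∧
      sdWeyl g x = doubleForm (sdBasis E) M ∧ rho g x = rhoMatrix M ∧
      tensorS g x = doubleForm (sdBasis E) (matrixS M) := by
  set M := weylMatrix (inFrame4 E (fun a b c d => (weyl g x a b c d : ℂ)))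
  have h1 : sdWeyl g x = doubleForm (sdBasis E) M := hE.sdPart_eq hW
  have hs := hE.pairing_sdBasis
  have h2 : rho g x = rhoMatrix M := by
    rw [rho, h1, comp_doubleForm hs, comp_doubleForm hs, tr_doubleForm hs, tr_doubleForm hs]
    rfl
  refine ⟨M, weylMatrix_transpose _, (hW.isFrameWeyl hE).trace_weylMatrix, h1, h2, ?_⟩
  rw [tensorS, h1, h2, hE.sdMetric_eq, matrixS, doubleForm_smul, doubleForm_sub, doubleForm_smul]

theorem isTypeD_iff (hg : IsLorentz (g x)) (hW : IsWeyl (g x) (weyl g x)) : IsTypeD g x ↔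
    rho g x ≠ 0 ∧ comp (g x) (tensorS g x) (tensorS g x) + tensorS g x = 0 := by
  obtain ⟨E, hE⟩ := hg.exists_nullTetrad
  obtain ⟨M, -, h0, h1, h2, h3⟩ := exists_sdWeyl_eq hW hE
  have hs := hE.pairing_sdBasis
  have e1 : (comp (g x) (tensorS g x) (tensorS g x) + tensorS g x = 0) ↔
      matrixS M * matrixS M + matrixS M = 0 := by
    rw [h3, comp_doubleForm hs, ← doubleForm_add, ← doubleForm_zero (s := sdBasis E)]
    exact ⟨fun h => doubleForm_injective hs h, fun h => by rw [h]⟩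
  rw [e1, h2]
  constructor
  · rintro ⟨F, r, t, hrt, hF, hsd, f0, f1, f2⟩
    choose z hz using fun k => (hE.isSelfDual_iff_exists (F k)).1 (hsd k)
    refine IsTypeDMatrix.algebraic h0 ⟨z, r, t, hrt, ?_, ?_, ?_, ?_⟩
    · rw [Fintype.linearIndependent_iff] at hF ⊢
      intro c hc
      apply hF
      have : ∀ k, c k • F k = ∑ p, (c k * z k p) • sdBasis E p := by
        intro k
        rw [hz k, Finset.smul_sum]
        exact Finset.sum_congr rfl fun p _ => by rw [smul_smul]
      simp only [this]
      rw [Finset.sum_comm]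
      simp only [← Finset.sum_smul]
      have h4 : ∀ p, ∑ k, c k * z k p = 0 := by
        intro p
        have := congrFun hc p
        simpa [Finset.sum_apply] using this
      simp [h4]
    all_goals
      apply sdBasis_combination_injective hs
      rw [← act_doubleForm_sum hs, ← hz, ← h1]
      simp only [Pi.smul_apply, smul_eq_mul, ← smul_smul, ← Finset.smul_sum, ← hz]
      assumption
  · rintro ⟨hr, hS⟩
    obtain ⟨z, r, t, hrt, hz, z0, z1, z2⟩ := isTypeDMatrix_of_algebraic h0 hr hS
    refine ⟨fun k => ∑ p, z k p • sdBasis E p, r, t, hrt, ?_,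
      fun k => (hE.isSelfDual_iff_exists _).2 ⟨z k, rfl⟩, ?_, ?_, ?_⟩
    · rw [Fintype.linearIndependent_iff] at hz ⊢
      intro c hc
      apply hz
      apply sdBasis_combination_injective hs
      rw [show ∑ p, (0 : Fin 3 → ℂ) p • sdBasis E p = 0 by simp, ← hc]
      simp only [Finset.sum_apply, Pi.smul_apply, smul_eq_mul, Finset.sum_smul, Finset.smul_sum,
        smul_smul]
      rw [Finset.sum_comm]
    all_goals
      rw [h1, act_doubleForm_sum hs]
      simp only [z0, z1, z2, Pi.smul_apply, smul_eq_mul, ← smul_smul, ← Finset.smul_sum]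

/-- A unitary self-dual bivector. -/
structure IsUnitSD (γ : Tensor2 ℝ) (F : Tensor2 ℂ) : Prop where
  selfDual : IsSelfDual γ F
  norm : pairing γ F F = -1

/-- The tensor `𝒮` of a type D metric is the square of the canonical bivector. -/
theorem exists_tensorS_eq (hg : IsLorentz (g x)) (hW : IsWeyl (g x) (weyl g x))
    (hr : rho g x ≠ 0) (hS : comp (g x) (tensorS g x) (tensorS g x) + tensorS g x = 0) :
    ∃ F, IsUnitSD (g x) F ∧ (∀ a b c d, tensorS g x a b c d = F a b * F c d) ∧
      ∀ X, act (g x) (tensorS g x) X = pairing (g x) X F • F ∧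
        quad (g x) (tensorS g x) X = pairing (g x) X F ^ 2 := by
  obtain ⟨E, hE⟩ := hg.exists_nullTetrad
  obtain ⟨M, ht, h0, h1, h2, h3⟩ := exists_sdWeyl_eq hW hE
  have hs := hE.pairing_sdBasis
  rw [h3, comp_doubleForm hs, ← doubleForm_add, ← doubleForm_zero (s := sdBasis E)] at hS
  replace hS := doubleForm_injective hs hS
  rw [h2] at hr
  obtain ⟨v, hv⟩ := exists_vec_of_idempotent (T := -matrixS M)
    (by rw [Matrix.transpose_neg, matrixS_transpose ht])
    (by rw [neg_mul_neg]; exact eq_neg_of_add_eq_zero_left hS)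
    (by rw [Matrix.trace_neg, matrixS_trace h0 hr, neg_neg])
  -- The projector `-𝒮` is the square of v, so `𝒮` is the square of iv; this factor i is the reason
  -- why the bivector has norm -1.
  have hv' : ∀ p q, matrixS M p q = (I * v p) * (I * v q) := by
    intro p q
    have := hv p q
    rw [Matrix.neg_apply] at this
    linear_combination -this - v p * v q * I_mul_I
  have hvv : ∑ p, v p * v p = 1 := by
    have := matrixS_trace h0 hr
    rw [Matrix.trace] at this
    have h4 : ∀ p, (matrixS M).diag p = -(v p * v p) := by
      intro p
      rw [Matrix.diag_apply, ← hv, Matrix.neg_apply, neg_neg]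
    simp only [h4, Finset.sum_neg_distrib] at this
    exact neg_injective this
  set F := ∑ p, (I * v p) • sdBasis E p with hF
  have hten : ∀ a b c d, tensorS g x a b c d = F a b * F c d := by
    intro a b c d
    rw [h3, doubleForm, hF]
    simp only [hv', Matrix.sum_apply, Matrix.smul_apply, smul_eq_mul, Finset.sum_mul_sum]
    exact Finset.sum_congr rfl fun a _ => Finset.sum_congr rfl fun b _ => by ring
  have hact : ∀ X, act (g x) (tensorS g x) X = pairing (g x) X F • F := by
    intro X
    ext a b
    simp only [act, Matrix.of_apply, hten, pairing, Matrix.smul_apply, smul_eq_mul, Finset.mul_sum,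
      Finset.sum_mul]
    exact Finset.sum_congr rfl fun a _ => Finset.sum_congr rfl fun b _ => by ring
  refine ⟨F, ⟨(hE.isSelfDual_iff_exists _).2 ⟨_, rfl⟩, ?_⟩, hten, fun X => ⟨hact X, ?_⟩⟩
  · conv_lhs => rw [hF]
    simp only [pairing_sum_left, pairing_sum_right, pairing_smul_left, pairing_smul_right, hs]
    simp only [mul_ite, mul_one, mul_zero, Finset.sum_ite_eq', Finset.mem_univ, if_true]
    rw [← neg_inj.2 hvv, ← Finset.sum_neg_distrib]
    exact Finset.sum_congr rfl fun p _ => by linear_combination v p * v p * I_mul_I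
  · have : quad (g x) (tensorS g x) X = pairing (g x) X (act (g x) (tensorS g x) X) := rfl
    rw [this, hact, pairing_smul_right, pow_two]

theorem IsUnitSD.smul_of_sq {γ : Tensor2 ℝ} {F : Tensor2 ℂ} (h : IsUnitSD γ F) {c : ℂ}
    (hc : c ^ 2 = 1) : IsUnitSD γ (c • F) := by
  refine ⟨⟨?_, ?_⟩, ?_⟩
  · rw [Matrix.transpose_smul, h.selfDual.1, smul_neg]
  · have : hodge γ (c • F) = c • hodge γ F := by
      ext a b
      simp only [hodge, raise_smul, Matrix.of_apply, Matrix.smul_apply, Complex.real_smul,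
        smul_eq_mul, Finset.mul_sum]
      exact Finset.sum_congr rfl fun a _ => Finset.sum_congr rfl fun b _ => by ring
    rw [this, h.selfDual.2, smul_comm]
  · rw [pairing_smul_left, pairing_smul_right, h.norm]
    linear_combination -hc

/-- The canonical bivector of a seed is unitary, and `𝒮 = 𝒰 ⊗ 𝒰`. -/
theorem canonicalSD_spec (hg : IsLorentz (g x)) (hW : IsWeyl (g x) (weyl g x))
    (hr : rho g x ≠ 0) (hS : comp (g x) (tensorS g x) (tensorS g x) + tensorS g x = 0)
    {X : E4 → Tensor2 ℂ} {s : E4 → ℂ} (hroot : s x ^ 2 = quad (g x) (tensorS g x) (X x))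
    (hs : s x ≠ 0) : IsUnitSD (g x) (canonicalSD g X s x) ∧ ∀ a b c d, tensorS g x a b c d =
      canonicalSD g X s x a b * canonicalSD g X s x c d := by
  obtain ⟨F, hF, h1, h2⟩ := exists_tensorS_eq hg hW hr hS
  have h3 : canonicalSD g X s x = ((s x)⁻¹ * pairing (g x) (X x) F) • F := by
    rw [canonicalSD, (h2 _).1, smul_smul]
  -- Since `𝒮(𝒳, 𝒳)` is the square of the product of `𝒳` and F, different choices of `𝒳` and of the
  -- root only produce ±F.
  have h4 : ((s x)⁻¹ * pairing (g x) (X x) F) ^ 2 = 1 := by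
    rw [mul_pow, ← (h2 _).2, ← hroot, inv_pow, inv_mul_cancel₀ (pow_ne_zero 2 hs)]
  rw [h3]
  refine ⟨hF.smul_of_sq h4, fun a b c d => ?_⟩
  rw [h1, Matrix.smul_apply, Matrix.smul_apply, smul_eq_mul, smul_eq_mul]
  linear_combination -(F a b * F c d) * h4

theorem exists_quad_ne_zero (hg : IsLorentz (g x)) (hW : IsWeyl (g x) (weyl g x))
    (hr : rho g x ≠ 0) (hS : comp (g x) (tensorS g x) (tensorS g x) + tensorS g x = 0) :
    ∃ F, IsSelfDual (g x) F ∧ quad (g x) (tensorS g x) F ≠ 0 := by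
  obtain ⟨F, hF, h1, h2⟩ := exists_tensorS_eq hg hW hr hS
  refine ⟨F, hF.selfDual, ?_⟩
  rw [(h2 F).2, hF.norm]
  norm_num

end

/-! ### Partial derivatives -/

section PartialDerivatives

variable {V : Type} [NormedAddCommGroup V] [NormedSpace ℝ V] {x : E4} {i j : Fin 4}

theorem pd_congr {f h : E4 → V} (hfh : f =ᶠ[nhds x] h) : pd i f x = pd i h x := by
  unfold pd
  rw [hfh.fderiv_eq]

theorem pd_const (c : V) : pd i (fun _ => c) x = 0 := by
  simp [pd]

theorem pd_add {f h : E4 → V} (hf : DifferentiableAt ℝ f x) (hh : DifferentiableAt ℝ h x) :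
    pd i (fun y => f y + h y) x = pd i f x + pd i h x := by
  unfold pd
  rw [fderiv_fun_add hf hh]
  rfl

theorem pd_sub {f h : E4 → V} (hf : DifferentiableAt ℝ f x) (hh : DifferentiableAt ℝ h x) :
    pd i (fun y => f y - h y) x = pd i f x - pd i h x := by
  unfold pd
  rw [fderiv_fun_sub hf hh]
  rfl

theorem pd_neg (f : E4 → V) : pd i (fun y => -f y) x = -pd i f x := by
  unfold pd
  rw [fderiv_fun_neg]
  rfl

theorem pd_sum {ι : Type*} (s : Finset ι) {f : ι → E4 → V}
    (hf : ∀ k ∈ s, DifferentiableAt ℝ (f k) x) :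
    pd i (fun y => ∑ k ∈ s, f k y) x = ∑ k ∈ s, pd i (f k) x := by
  unfold pd
  rw [fderiv_fun_sum hf]
  simp

theorem pd_clm {W : Type} [NormedAddCommGroup W] [NormedSpace ℝ W] (L : V →L[ℝ] W) {f : E4 → V}
    (hf : DifferentiableAt ℝ f x) : pd i (fun y => L (f y)) x = L (pd i f x) := by
  unfold pd
  rw [show (fun y => L (f y)) = L ∘ f from rfl, fderiv_comp x L.differentiableAt hf, L.fderiv]
  rfl

theorem pd_mul {𝕜 : Type} [RCLike 𝕜] {f h : E4 → 𝕜} (hf : DifferentiableAt ℝ f x)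
    (hh : DifferentiableAt ℝ h x) :
    pd i (fun y => f y * h y) x = pd i f x * h x + f x * pd i h x := by
  unfold pd
  rw [fderiv_fun_mul hf hh]
  simp
  ring

theorem pd_ofReal {f : E4 → ℝ} (hf : DifferentiableAt ℝ f x) :
    pd i (fun y => (f y : ℂ)) x = ((pd i f x : ℝ) : ℂ) := pd_clm Complex.ofRealCLM hf

theorem pd_conj {f : E4 → ℂ} (hf : DifferentiableAt ℝ f x) :
    pd i (fun y => starRingEnd ℂ (f y)) x = starRingEnd ℂ (pd i f x) :=
  pd_clm (Complex.conjCLE : ℂ →L[ℝ] ℂ) hf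

theorem contDiffAt_pd {f : E4 → V} (hf : ContDiffAt ℝ ∞ f x) :
    ContDiffAt ℝ ∞ (fun y => pd i f y) x :=
  (hf.fderiv_right (m := ∞) (by simp)).clm_apply contDiffAt_const

theorem pd_comm {f : E4 → V} (hf : ContDiffAt ℝ ∞ f x) :
    pd i (fun y => pd j f y) x = pd j (fun y => pd i f y) x := by
  have hs : IsSymmSndFDerivAt ℝ f x := hf.isSymmSndFDerivAt (by
    rw [minSmoothness_of_isRCLikeNormedField]; exact WithTop.coe_le_coe.2 le_top)
  have hd : DifferentiableAt ℝ (fderiv ℝ f) x :=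
    (hf.fderiv_right (m := ∞) (by simp)).differentiableAt (by simp)
  have key : ∀ u v : E4, fderiv ℝ (fun y => fderiv ℝ f y u) x v = fderiv ℝ (fderiv ℝ f) x v u := by
    intro u v
    rw [fderiv_clm_apply hd (differentiableAt_const u)]
    simp
  unfold pd
  rw [key, key, hs]

end PartialDerivatives

/-! ### Smooth matrix fields -/

/-- Smoothness of a tensor field at a point, by components. -/
def SmoothAt {𝕜 : Type} [RCLike 𝕜] (F : E4 → Tensor2 𝕜) (x : E4) : Prop :=
  ∀ a b : Fin 4, ContDiffAt ℝ ∞ (fun y => F y a b) x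

/-- The partial derivatives of the components of a tensor field. -/
def mpd {𝕜 : Type} [RCLike 𝕜] (i : Fin 4) (F : E4 → Tensor2 𝕜) (x : E4) : Tensor2 𝕜 :=
  Matrix.of fun a b => pd i (fun y => F y a b) x

section MatrixFields

variable {𝕜 : Type} [RCLike 𝕜] {x : E4} {F H : E4 → Tensor2 𝕜} {i j : Fin 4}

theorem SmoothOn.smoothAt {O : Set E4} (hF : SmoothOn F O) (hO : IsOpen O) (hx : x ∈ O) :
    SmoothAt F x := fun a b => (hF a b).contDiffAt (hO.mem_nhds hx)

theorem smoothOn_of_smoothAt {O : Set E4} (h : ∀ x ∈ O, SmoothAt F x) : SmoothOn F O :=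
  fun a b x hx => (h x hx a b).contDiffWithinAt

theorem SmoothAt.diff (hF : SmoothAt F x) (a b : Fin 4) :
    DifferentiableAt ℝ (fun y => F y a b) x := (hF a b).differentiableAt (by simp)

theorem SmoothAt.congr (hF : SmoothAt F x) (h : H =ᶠ[nhds x] F) : SmoothAt H x := fun a b =>
  (hF a b).congr_of_eventuallyEq (h.mono fun _ hy => congrFun (congrFun hy a) b)

theorem SmoothAt.mul (hF : SmoothAt F x) (hH : SmoothAt H x) :
    SmoothAt (fun y => F y * H y) x := by
  intro a b
  simp only [Matrix.mul_apply]
  exact ContDiffAt.sum fun k _ => (hF a k).mul (hH k b)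

theorem SmoothAt.add (hF : SmoothAt F x) (hH : SmoothAt H x) :
    SmoothAt (fun y => F y + H y) x := fun a b => (hF a b).add (hH a b)

theorem SmoothAt.sub (hF : SmoothAt F x) (hH : SmoothAt H x) :
    SmoothAt (fun y => F y - H y) x := fun a b => (hF a b).sub (hH a b)

theorem SmoothAt.transpose (hF : SmoothAt F x) : SmoothAt (fun y => (F y)ᵀ) x :=
  fun a b => hF b a

theorem SmoothAt.smul {f : E4 → 𝕜} (hf : ContDiffAt ℝ ∞ f x) (hF : SmoothAt F x) :
    SmoothAt (fun y => f y • F y) x := fun a b => hf.mul (hF a b)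

theorem smoothAt_const (T : Tensor2 𝕜) : SmoothAt (fun _ => T) x := fun _ _ => contDiffAt_const

theorem SmoothAt.mpd (hF : SmoothAt F x) : SmoothAt (fun y => mpd i F y) x :=
  fun a b => contDiffAt_pd (hF a b)

theorem SmoothAt.trace (hF : SmoothAt F x) : ContDiffAt ℝ ∞ (fun y => (F y).trace) x :=
  ContDiffAt.sum fun k _ => hF k k

theorem SmoothAt.det (hF : SmoothAt F x) : ContDiffAt ℝ ∞ (fun y => (F y).det) x := by
  simp only [Matrix.det_apply]
  refine ContDiffAt.sum fun σ _ => ?_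
  simp only [Units.smul_def, zsmul_eq_mul]
  exact contDiffAt_const.mul (contDiffAt_prod fun k _ => hF _ _)

theorem SmoothAt.inv (hF : SmoothAt F x) (h0 : (F x).det ≠ 0) : SmoothAt (fun y => (F y)⁻¹) x := by
  intro a b
  simp only [Matrix.inv_def, Ring.inverse_eq_inv', Matrix.smul_apply, smul_eq_mul]
  refine (hF.det.inv h0).mul ?_
  simp only [Matrix.adjugate_apply]
  refine SmoothAt.det (F := fun y => (F y).updateRow b (Pi.single a 1)) ?_
  intro c d
  by_cases hc : c = b
  · subst hc
    simp only [Matrix.updateRow_self]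
    exact contDiffAt_const
  · simp only [Matrix.updateRow_ne hc]
    exact hF c d

theorem mpd_congr (h : F =ᶠ[nhds x] H) : mpd i F x = mpd i H x := by
  ext a b
  exact pd_congr (h.mono fun y hy => by simp only [hy])

theorem mpd_const (T : Tensor2 𝕜) : mpd i (fun _ => T) x = 0 := by
  ext a b
  exact pd_const _

theorem mpd_add (hF : SmoothAt F x) (hH : SmoothAt H x) :
    mpd i (fun y => F y + H y) x = mpd i F x + mpd i H x := by
  ext a b
  exact pd_add (hF.diff a b) (hH.diff a b)

theorem mpd_sub (hF : SmoothAt F x) (hH : SmoothAt H x) :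
    mpd i (fun y => F y - H y) x = mpd i F x - mpd i H x := by
  ext a b
  exact pd_sub (hF.diff a b) (hH.diff a b)

theorem mpd_mul (hF : SmoothAt F x) (hH : SmoothAt H x) :
    mpd i (fun y => F y * H y) x = mpd i F x * H x + F x * mpd i H x := by
  ext a b
  simp only [mpd, Matrix.of_apply, Matrix.mul_apply, Matrix.add_apply]
  rw [pd_sum (f := fun k y => F y a k * H y k b) _ fun k _ => (hF.diff a k).mul (hH.diff k b), ← Finset.sum_add_distrib]
  exact Finset.sum_congr rfl fun k _ => pd_mul (hF.diff a k) (hH.diff k b)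

theorem mpd_smul {f : E4 → 𝕜} (hf : DifferentiableAt ℝ f x) (hF : SmoothAt F x) :
    mpd i (fun y => f y • F y) x = pd i f x • F x + f x • mpd i F x := by
  ext a b
  exact pd_mul hf (hF.diff a b)

theorem mpd_transpose : mpd i (fun y => (F y)ᵀ) x = (mpd i F x)ᵀ := rfl

theorem mpd_comm (hF : SmoothAt F x) :
    mpd i (fun y => mpd j F y) x = mpd j (fun y => mpd i F y) x := by
  ext a b
  exact pd_comm (hF a b)

end MatrixFields

theorem SmoothAt.toComplex {F : E4 → Tensor2 ℝ} {x : E4} (hF : SmoothAt F x) :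
    SmoothAt (fun y => toComplex (F y)) x :=
  fun a b => Complex.ofRealCLM.contDiff.contDiffAt.comp x (hF a b)

theorem SmoothAt.conj {F : E4 → Tensor2 ℂ} {x : E4} (hF : SmoothAt F x) :
    SmoothAt (fun y => (F y).map (starRingEnd ℂ)) x :=
  fun a b => (Complex.conjCLE : ℂ →L[ℝ] ℂ).contDiff.contDiffAt.comp x (hF a b)

theorem mpd_toComplex {F : E4 → Tensor2 ℝ} {x : E4} (hF : SmoothAt F x) (i : Fin 4) :
    mpd i (fun y => toComplex (F y)) x = toComplex (mpd i F x) := by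
  ext a b
  exact pd_ofReal (hF.diff a b)

theorem mpd_conj {F : E4 → Tensor2 ℂ} {x : E4} (hF : SmoothAt F x) (i : Fin 4) :
    mpd i (fun y => (F y).map (starRingEnd ℂ)) x = (mpd i F x).map (starRingEnd ℂ) := by
  ext a b
  exact pd_conj (hF.diff a b)

/-! ### The Levi-Civita connection -/

/-- `g` is a Lorentzian metric on the open set `Ω`. -/
structure IsMetricOn (g : E4 → Tensor2 ℝ) (Ω : Set E4) : Prop where
  isOpen : IsOpen Ω
  lorentz : ∀ x ∈ Ω, IsLorentz (g x)
  smooth : SmoothOn g Ω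

/-- The matrix `Γ^d_{ca}` of the connection in the direction `c`. -/
def connection (g : E4 → Tensor2 ℝ) (x : E4) (c : Fin 4) : Tensor2 ℝ :=
  Matrix.of fun d a => christoffel g x d c a

/-- The covariant derivative in the direction `c`. -/
def cov (g : E4 → Tensor2 ℝ) (F : E4 → Tensor2 ℂ) (x : E4) (c : Fin 4) : Tensor2 ℂ :=
  Matrix.of (covDeriv g F x c)

section LeviCivita

variable {g : E4 → Tensor2 ℝ} {Ω : Set E4} {x : E4}

theorem cov_eq (g : E4 → Tensor2 ℝ) (F : E4 → Tensor2 ℂ) (x : E4) (c : Fin 4) :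
    cov g F x c = mpd c F x - (toComplex (connection g x c))ᵀ * F x
      - F x * toComplex (connection g x c) := by
  ext a b
  simp only [cov, covDeriv, mpd, connection, Matrix.of_apply, Matrix.sub_apply, Matrix.mul_apply,
    Matrix.transpose_apply, Matrix.map_apply, Finset.sum_add_distrib, Complex.real_smul]
  rw [sub_sub]
  congr 2
  exact Finset.sum_congr rfl fun d _ => mul_comm _ _

theorem ofReal_covDeriv {F : E4 → Tensor2 ℝ} (hF : SmoothAt F x) (c a b : Fin 4) :
    ((covDeriv g F x c a b : ℝ) : ℂ) = cov g (fun y => toComplex (F y)) x c a b := by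
  simp only [cov, covDeriv, Matrix.of_apply, Matrix.map_apply]
  rw [pd_ofReal (hF.diff a b)]
  simp

theorem IsMetricOn.smoothAt (hg : IsMetricOn g Ω) (hx : x ∈ Ω) : SmoothAt g x :=
  hg.smooth.smoothAt hg.isOpen hx

theorem IsMetricOn.det_ne_zero (hg : IsMetricOn g Ω) (hx : x ∈ Ω) : (g x).det ≠ 0 :=
  (hg.lorentz x hx).det_neg.ne

theorem IsMetricOn.smoothAt_inv (hg : IsMetricOn g Ω) (hx : x ∈ Ω) :
    SmoothAt (fun y => (g y)⁻¹) x := (hg.smoothAt hx).inv (hg.det_ne_zero hx)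

theorem IsMetricOn.symm (hg : IsMetricOn g Ω) (hx : x ∈ Ω) (a b : Fin 4) : g x b a = g x a b :=
  congrFun (congrFun (hg.lorentz x hx).transpose a) b

theorem IsMetricOn.pd_symm (hg : IsMetricOn g Ω) (hx : x ∈ Ω) (i a b : Fin 4) :
    pd i (fun y => g y b a) x = pd i (fun y => g y a b) x :=
  pd_congr (Filter.eventually_of_mem (hg.isOpen.mem_nhds hx) fun _ hy => hg.symm hy a b)

theorem IsMetricOn.smoothAt_connection (hg : IsMetricOn g Ω) (hx : x ∈ Ω) (c : Fin 4) :
    SmoothAt (fun y => connection g y c) x := by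
  intro d a
  have h1 := hg.smoothAt hx
  have h2 := hg.smoothAt_inv hx
  simp only [connection, Matrix.of_apply, christoffel]
  refine contDiffAt_const.mul (ContDiffAt.sum fun l _ => (h2 d l).mul ?_)
  exact ((contDiffAt_pd (h1 _ _)).add (contDiffAt_pd (h1 _ _))).sub (contDiffAt_pd (h1 _ _))

theorem IsMetricOn.christoffel_symm (hg : IsMetricOn g Ω) (hx : x ∈ Ω) (k i j : Fin 4) :
    christoffel g x k j i = christoffel g x k i j := by
  unfold christoffel
  congr 1
  refine Finset.sum_congr rfl fun l _ => ?_
  rw [hg.pd_symm hx l j i]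
  ring

theorem IsMetricOn.christoffel_lower (hg : IsMetricOn g Ω) (hx : x ∈ Ω) (b i j : Fin 4) :
    ∑ d, g x b d * christoffel g x d i j = (1 / 2) *
      (pd i (fun y => g y j b) x + pd j (fun y => g y i b) x - pd b (fun y => g y i j) x) := by
  have h1 : ∀ l, ∑ d, g x b d * (g x)⁻¹ d l = if b = l then 1 else 0 := by
    intro l
    have := Matrix.mul_nonsing_inv (g x) (hg.lorentz x hx).isUnit_det
    rw [← Matrix.mul_apply, this, Matrix.one_apply]
  unfold christoffel
  simp only [Finset.mul_sum]
  rw [Finset.sum_comm]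
  have h2 : ∀ l, ∑ d, g x b d * (1 / 2 * ((g x)⁻¹ d l * (pd i (fun y => g y j l) x +
      pd j (fun y => g y i l) x - pd l (fun y => g y i j) x))) =
      (if b = l then 1 else 0) * (1 / 2 * (pd i (fun y => g y j l) x +
      pd j (fun y => g y i l) x - pd l (fun y => g y i j) x)) := by
    intro l
    rw [← h1, Finset.sum_mul]
    exact Finset.sum_congr rfl fun d _ => by ring
  simp only [h2]
  simp

/-- The metric is parallel. -/
theorem IsMetricOn.mpd_metric (hg : IsMetricOn g Ω) (hx : x ∈ Ω) (c : Fin 4) :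
    mpd c g x = (connection g x c)ᵀ * g x + g x * connection g x c := by
  ext a b
  simp only [mpd, connection, Matrix.of_apply, Matrix.add_apply, Matrix.mul_apply,
    Matrix.transpose_apply]
  have h1 : ∑ d, christoffel g x d c a * g x d b = ∑ d, g x b d * christoffel g x d c a :=
    Finset.sum_congr rfl fun d _ => by rw [hg.symm hx b d, mul_comm]
  rw [h1, hg.christoffel_lower hx, hg.christoffel_lower hx, hg.pd_symm hx c b a]
  ring

theorem IsMetricOn.cov_metric (hg : IsMetricOn g Ω) (hx : x ∈ Ω) (c : Fin 4) :
    cov g (fun y => toComplex (g y)) x c = 0 := by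
  rw [cov_eq, mpd_toComplex (hg.smoothAt hx), hg.mpd_metric hx]
  have : toComplex ((connection g x c)ᵀ * g x + g x * connection g x c) =
      (toComplex (connection g x c))ᵀ * toComplex (g x) +
        toComplex (g x) * toComplex (connection g x c) := by
    rw [← toComplex_mul, show (toComplex (connection g x c))ᵀ = toComplex (connection g x c)ᵀ
      from rfl, ← toComplex_mul]
    ext a b
    simp
  rw [this]
  abel

theorem IsMetricOn.mpd_inv (hg : IsMetricOn g Ω) (hx : x ∈ Ω) (c : Fin 4) :
    mpd c (fun y => (g y)⁻¹) x =
      -(connection g x c * (g x)⁻¹) - (g x)⁻¹ * (connection g x c)ᵀ := by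
  have hu := (hg.lorentz x hx).isUnit_det
  have h1 : mpd c (fun y => (g y)⁻¹ * g y) x = 0 := by
    rw [mpd_congr (H := fun _ => 1) (Filter.eventually_of_mem (hg.isOpen.mem_nhds hx) fun y hy =>
      Matrix.nonsing_inv_mul _ (hg.lorentz y hy).isUnit_det), mpd_const]
  rw [mpd_mul (hg.smoothAt_inv hx) (hg.smoothAt hx), hg.mpd_metric hx] at h1
  have h2 := congrArg (fun T => T * (g x)⁻¹) h1
  simp only [Matrix.add_mul, Matrix.zero_mul, Matrix.mul_add, Matrix.mul_assoc,
    Matrix.mul_nonsing_inv _ hu, Matrix.mul_one] at h2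
  rw [Matrix.nonsing_inv_mul_cancel_left _ _ hu] at h2
  rw [eq_neg_of_add_eq_zero_left h2]
  abel

end LeviCivita

/-! ### Curvature -/

/-- The matrix `R^a{}_{bcd}` of the curvature in the directions `c`, `d`. -/
def curvatureMatrix (g : E4 → Tensor2 ℝ) (x : E4) (c d : Fin 4) : Tensor2 ℝ :=
  Matrix.of fun a b => curvature g x a b c d

section Curvature

variable {g : E4 → Tensor2 ℝ} {Ω : Set E4} {x : E4}

theorem curvatureMatrix_eq (g : E4 → Tensor2 ℝ) (x : E4) (c d : Fin 4) :
    curvatureMatrix g x c d = mpd c (fun y => connection g y d) x - mpd d (fun y => connection g y c) x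
      + (connection g x c * connection g x d - connection g x d * connection g x c) := by
  ext a b
  simp [curvatureMatrix, curvature, mpd, connection, Matrix.mul_apply, Finset.sum_sub_distrib]

theorem toComplex_transpose (A : Tensor2 ℝ) : (toComplex A)ᵀ = toComplex Aᵀ := rfl

theorem toComplex_add (A B : Tensor2 ℝ) : toComplex (A + B) = toComplex A + toComplex B := by
  ext; simp

theorem toComplex_sub (A B : Tensor2 ℝ) : toComplex (A - B) = toComplex A - toComplex B := by
  ext; simp

theorem IsMetricOn.smoothAt_cov (hg : IsMetricOn g Ω) (hx : x ∈ Ω) {F : E4 → Tensor2 ℂ}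
    (hF : SmoothAt F x) (c : Fin 4) : SmoothAt (fun y => cov g F y c) x := by
  simp only [cov_eq]
  have h := (hg.smoothAt_connection hx c).toComplex
  exact (hF.mpd.sub (h.transpose.mul hF)).sub (hF.mul h)

/-- The Ricci identity for 2-tensors. -/
theorem IsMetricOn.ricci_identity (hg : IsMetricOn g Ω) (hx : x ∈ Ω) {F : E4 → Tensor2 ℂ}
    (hF : SmoothAt F x) (e c : Fin 4) :
    cov g (fun y => cov g F y c) x e - cov g (fun y => cov g F y e) x c =
      -((toComplex (curvatureMatrix g x e c))ᵀ * F x +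
        F x * toComplex (curvatureMatrix g x e c)) := by
  have hm : ∀ e c, mpd e (fun y => cov g F y c) x =
      mpd e (fun y => mpd c F y) x -
        ((mpd e (fun y => toComplex (connection g y c)) x)ᵀ * F x
          + (toComplex (connection g x c))ᵀ * mpd e F x) -
        (mpd e F x * toComplex (connection g x c)
          + F x * mpd e (fun y => toComplex (connection g y c)) x) := by
    intro e c
    have h := (hg.smoothAt_connection hx c).toComplex
    simp only [cov_eq]
    rw [mpd_sub (hF.mpd.sub (h.transpose.mul hF)) (hF.mul h), mpd_sub hF.mpd (h.transpose.mul hF),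
      mpd_mul h.transpose hF, mpd_mul hF h, mpd_transpose]
  rw [cov_eq g (fun y => cov g F y c), cov_eq g (fun y => cov g F y e), hm, hm, mpd_comm hF,
    cov_eq, cov_eq, curvatureMatrix_eq, toComplex_add, toComplex_sub, toComplex_sub,
    toComplex_mul, toComplex_mul, mpd_toComplex (hg.smoothAt_connection hx c),
    mpd_toComplex (hg.smoothAt_connection hx e)]
  simp only [Matrix.transpose_add, Matrix.transpose_sub, Matrix.transpose_mul]
  noncomm_ring

theorem riemann_eq (g : E4 → Tensor2 ℝ) (x : E4) (a b c d : Fin 4) :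
    riemann g x a b c d = (g x * curvatureMatrix g x c d) a b := by
  simp [riemann, curvatureMatrix, Matrix.mul_apply]

theorem curvature_antisymm (g : E4 → Tensor2 ℝ) (x : E4) (a b c d : Fin 4) :
    curvature g x a b d c = -curvature g x a b c d := by
  simp only [curvature, Finset.sum_sub_distrib]
  ring

theorem IsMetricOn.curvature_cyclic (hg : IsMetricOn g Ω) (hx : x ∈ Ω) (a b c d : Fin 4) :
    curvature g x a b c d + curvature g x a c d b + curvature g x a d b c = 0 := by
  have h1 : ∀ i k j l, pd i (fun y => christoffel g y k j l) x =
      pd i (fun y => christoffel g y k l j) x := fun i k j l =>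
    pd_congr (Filter.eventually_of_mem (hg.isOpen.mem_nhds hx) fun _ hy =>
      hg.christoffel_symm hy k l j)
  simp only [curvature, Finset.sum_sub_distrib]
  rw [h1 c a b d, h1 d a c b, h1 b a d c]
  have h2 : ∀ e, christoffel g x e b d = christoffel g x e d b := fun e =>
    hg.christoffel_symm hx e d b
  have h3 : ∀ e, christoffel g x e c b = christoffel g x e b c := fun e =>
    hg.christoffel_symm hx e b c
  have h4 : ∀ e, christoffel g x e d c = christoffel g x e c d := fun e =>
    hg.christoffel_symm hx e c d
  simp only [h2, h3, h4]
  ring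

/-- This is the Ricci identity for the metric itself, whose covariant derivative vanishes in a whole
neighbourhood. -/
theorem IsMetricOn.riemann_antisymm (hg : IsMetricOn g Ω) (hx : x ∈ Ω) (a b c d : Fin 4) :
    riemann g x b a c d = -riemann g x a b c d := by
  have h := hg.ricci_identity hx (hg.smoothAt hx).toComplex c d
  have h0 : ∀ c e, cov g (fun y => cov g (fun z => toComplex (g z)) y c) x e = 0 := by
    intro c e
    have : (fun y => cov g (fun z => toComplex (g z)) y c) =ᶠ[nhds x] fun _ => 0 :=
      Filter.eventually_of_mem (hg.isOpen.mem_nhds hx) fun _ hy => hg.cov_metric hy c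
    rw [cov_eq, mpd_congr this, mpd_const, hg.cov_metric hx]
    simp
  rw [h0, h0, sub_zero, eq_comm, neg_eq_zero, toComplex_transpose, ← toComplex_mul,
    ← toComplex_mul, ← toComplex_add] at h
  have h1 := congrFun (congrFun h a) b
  have h2 : ((curvatureMatrix g x c d)ᵀ * g x + g x * curvatureMatrix g x c d) a b = 0 := by
    exact Complex.ofReal_eq_zero.1 h1
  have h3 : (curvatureMatrix g x c d)ᵀ * g x = (g x * curvatureMatrix g x c d)ᵀ := by
    rw [Matrix.transpose_mul, (hg.lorentz x hx).transpose]
  rw [h3, Matrix.add_apply, Matrix.transpose_apply, ← riemann_eq, ← riemann_eq] at h2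
  linarith

theorem IsMetricOn.riemann_symmetries (hg : IsMetricOn g Ω) (hx : x ∈ Ω) :
    HasRiemannSymmetries (riemann g x) := by
  have h1 := hg.riemann_antisymm hx
  have h2 : ∀ a b c d, riemann g x a b d c = -riemann g x a b c d := by
    intro a b c d
    simp only [riemann, ← Finset.sum_neg_distrib]
    exact Finset.sum_congr rfl fun e _ => by rw [curvature_antisymm]; ring
  have h3 : ∀ a b c d, riemann g x a b c d + riemann g x a c d b + riemann g x a d b c = 0 := by
    intro a b c d
    simp only [riemann, ← Finset.sum_add_distrib, ← mul_add, hg.curvature_cyclic hx]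
    simp
  refine ⟨⟨fun a b c d => h1 a b c d, h2⟩, fun a b c d => ?_, h3⟩
  -- The classical octahedron argument: four cyclic identities and the two antisymmetries imply the
  -- symmetry by pairs.
  have c1 := h3 a b c d
  have c2 := h3 b c d a
  have c3 := h3 c d a b
  have c4 := h3 d a b c
  rw [h1 a c] at *
  linarith [h1 a b c d, h1 a c d b, h1 a d b c, h1 b c d a, h1 b d a c, h1 c d a b,
    h2 a b c d, h2 b c a d, h2 c d a b, h2 a c b d, h2 a d b c, h2 b d a c,
    h1 a b d c, h1 a c b d, h1 a d c b, h1 b c a d, h1 b d c a, h1 c d b a]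

theorem IsMetricOn.inv_mul_apply (hg : IsMetricOn g Ω) (hx : x ∈ Ω) (a b : Fin 4) :
    ∑ e, (g x)⁻¹ a e * g x e b = if a = b then 1 else 0 := by
  rw [← Matrix.mul_apply, Matrix.nonsing_inv_mul _ (hg.lorentz x hx).isUnit_det, Matrix.one_apply]

theorem IsMetricOn.inv_symm (hg : IsMetricOn g Ω) (hx : x ∈ Ω) (a b : Fin 4) :
    (g x)⁻¹ b a = (g x)⁻¹ a b :=
  congrFun (congrFun (hg.lorentz x hx).inv_transpose a) b

theorem IsMetricOn.ricci_eq (hg : IsMetricOn g Ω) (hx : x ∈ Ω) (b d : Fin 4) :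
    ricci g x b d = ∑ a, ∑ c, (g x)⁻¹ a c * riemann g x a b c d := by
  have h1 : ∀ c, ∑ a, (g x)⁻¹ a c * riemann g x a b c d = curvature g x c b c d := by
    intro c
    simp only [riemann, Finset.mul_sum]
    rw [Finset.sum_comm]
    have : ∀ e, ∑ a, (g x)⁻¹ a c * (g x a e * curvature g x e b c d) =
        (if c = e then 1 else 0) * curvature g x e b c d := by
      intro e
      rw [← hg.inv_mul_apply hx, Finset.sum_mul]
      exact Finset.sum_congr rfl fun a _ => by rw [hg.inv_symm hx a c]; ring
    simp only [this]
    simp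
  rw [Finset.sum_comm]
  simp only [h1]
  rfl

theorem IsMetricOn.ricci_symm (hg : IsMetricOn g Ω) (hx : x ∈ Ω) (b d : Fin 4) :
    ricci g x d b = ricci g x b d := by
  rw [hg.ricci_eq hx, hg.ricci_eq hx, Finset.sum_comm]
  refine Finset.sum_congr rfl fun a _ => Finset.sum_congr rfl fun c _ => ?_
  rw [hg.inv_symm hx a c, (hg.riemann_symmetries hx).pair a b c d]

theorem IsMetricOn.isWeyl (hg : IsMetricOn g Ω) (hx : x ∈ Ω) : IsWeyl (g x) (weyl g x) := by
  have hR := hg.riemann_symmetries hx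
  have hs := hg.symm hx
  have hr := hg.ricci_symm hx
  refine ⟨⟨⟨?_, ?_⟩, ?_, ?_⟩, ?_⟩
  · intro a b c d
    simp only [weyl]
    rw [hR.doubleForm.1 a b]
    ring
  · intro a b c d
    simp only [weyl]
    rw [hR.doubleForm.2 a b c d]
    ring
  · intro a b c d
    simp only [weyl]
    rw [hR.pair a b c d, hs a c, hs a d, hs b c, hs b d, hr a c, hr a d, hr b c, hr b d]
    ring
  · intro a b c d
    have := hR.cyclic a b c d
    simp only [weyl]
    rw [hs b c, hs b d, hs c d, hr b c, hr b d, hr c d]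
    linear_combination this
  · intro b d
    -- The dimension enters here. With Ricci tensor Ric and scalar curvature R, the trace of the
    -- Weyl tensor is Ric - ½(4Ric - Ric - Ric + R g) + (R/6)(4 - 1)g = 0.
    have t1 : ∑ a, ∑ c, (g x)⁻¹ a c * g x a c = 4 := by
      have : ∀ a, ∑ c, (g x)⁻¹ a c * g x a c = 1 := by
        intro a
        have := hg.inv_mul_apply hx a a
        rw [if_pos rfl] at this
        rw [← this]
        exact Finset.sum_congr rfl fun c _ => by rw [hs c a]
      simp [this]
    have t2 : ∀ (T : Fin 4 → ℝ) (d : Fin 4), ∑ a, ∑ c, (g x)⁻¹ a c * (g x a d * T c) = T d := by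
      intro T d
      rw [Finset.sum_comm]
      have : ∀ c, ∑ a, (g x)⁻¹ a c * (g x a d * T c) = (if c = d then 1 else 0) * T c := by
        intro c
        rw [← hg.inv_mul_apply hx, Finset.sum_mul]
        exact Finset.sum_congr rfl fun a _ => by rw [hg.inv_symm hx c a]; ring
      simp only [this]
      simp
    have t3 : ∀ (T : Fin 4 → ℝ) (b : Fin 4), ∑ a, ∑ c, (g x)⁻¹ a c * (g x b c * T a) = T b := by
      intro T b
      have : ∀ a, ∑ c, (g x)⁻¹ a c * (g x b c * T a) = (if a = b then 1 else 0) * T a := by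
        intro a
        rw [← hg.inv_mul_apply hx, Finset.sum_mul]
        exact Finset.sum_congr rfl fun c _ => by rw [hs c b]; ring
      simp only [this]
      simp
    have t4 : ∑ a, ∑ c, (g x)⁻¹ a c * ricci g x a c = scalarCurv g x := rfl
    have e : ∀ a c, (g x)⁻¹ a c * weyl g x a b c d = (g x)⁻¹ a c * riemann g x a b c d
        - (1 / 2) * ((g x)⁻¹ a c * g x a c * ricci g x b d
          - (g x)⁻¹ a c * (g x a d * ricci g x b c)
          - (g x)⁻¹ a c * (g x b c * ricci g x a d) + (g x)⁻¹ a c * ricci g x a c * g x b d)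
        + (scalarCurv g x / 6) * ((g x)⁻¹ a c * g x a c * g x b d
          - (g x)⁻¹ a c * (g x a d * g x b c)) := by
      intro a c
      simp only [weyl]
      ring
    simp only [e, Finset.sum_add_distrib, Finset.sum_sub_distrib, ← Finset.mul_sum,
      ← Finset.sum_mul, t1, t2 (fun c => ricci g x b c), t3 (fun a => ricci g x a d), t4,
      t2 (fun c => g x b c), ← hg.ricci_eq hx]
    ring

/-! ### Smoothness of the concomitants of the curvature -/

theorem IsMetricOn.contDiffAt_curvature (hg : IsMetricOn g Ω) (hx : x ∈ Ω) (a b c d : Fin 4) :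
    ContDiffAt ℝ ∞ (fun y => curvature g y a b c d) x := by
  have h := fun c => hg.smoothAt_connection hx c
  have h' : ∀ k i j, ContDiffAt ℝ ∞ (fun y => christoffel g y k i j) x := fun k i j => h i k j
  simp only [curvature]
  refine ((contDiffAt_pd (h' _ _ _)).sub (contDiffAt_pd (h' _ _ _))).add (ContDiffAt.sum fun e _ => ?_)
  exact ((h' _ _ _).mul (h' _ _ _)).sub ((h' _ _ _).mul (h' _ _ _))

theorem IsMetricOn.contDiffAt_weyl (hg : IsMetricOn g Ω) (hx : x ∈ Ω) (a b c d : Fin 4) :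
    ContDiffAt ℝ ∞ (fun y => weyl g y a b c d) x := by
  have hc := hg.contDiffAt_curvature hx
  have h1 := hg.smoothAt hx
  have h2 := hg.smoothAt_inv hx
  have hr : ∀ b d, ContDiffAt ℝ ∞ (fun y => ricci g y b d) x := fun b d => by
    simp only [ricci, Matrix.of_apply]
    exact ContDiffAt.sum fun a _ => hc a b a d
  have hs : ContDiffAt ℝ ∞ (fun y => scalarCurv g y) x :=
    ContDiffAt.sum fun b _ => ContDiffAt.sum fun d _ => (h2 b d).mul (hr b d)
  have hR : ContDiffAt ℝ ∞ (fun y => riemann g y a b c d) x :=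
    ContDiffAt.sum fun e _ => (h1 a e).mul (hc e b c d)
  simp only [weyl]
  refine (hR.sub (contDiffAt_const.mul ?_)).add ((hs.div_const 6).mul ?_)
  · exact ((((h1 _ _).mul (hr _ _)).sub ((h1 _ _).mul (hr _ _))).sub
      ((h1 _ _).mul (hr _ _))).add ((h1 _ _).mul (hr _ _))
  · exact ((h1 _ _).mul (h1 _ _)).sub ((h1 _ _).mul (h1 _ _))

theorem contDiffAt_ofReal {f : E4 → ℝ} (hf : ContDiffAt ℝ ∞ f x) :
    ContDiffAt ℝ ∞ (fun y => (f y : ℂ)) x :=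
  Complex.ofRealCLM.contDiff.contDiffAt.comp x hf

theorem IsMetricOn.contDiffAt_volForm (hg : IsMetricOn g Ω) (hx : x ∈ Ω) (a b c d : Fin 4) :
    ContDiffAt ℝ ∞ (fun y => volForm (g y) a b c d) x := by
  have h0 := hg.det_ne_zero hx
  have h1 : ContDiffAt ℝ ∞ (fun y => |(g y).det|) x :=
    (hg.smoothAt hx).det.abs h0
  exact (h1.sqrt (abs_ne_zero.2 h0)).mul contDiffAt_const

theorem IsMetricOn.smoothAt_raise {𝕜 : Type} [RCLike 𝕜] (hg : IsMetricOn g Ω) (hx : x ∈ Ω)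
    {F : E4 → Tensor2 𝕜} (hF : SmoothAt F x) : SmoothAt (fun y => raise (g y) (F y)) x := by
  intro a b
  have h2 := hg.smoothAt_inv hx
  simp only [raise, Matrix.of_apply]
  exact ContDiffAt.sum fun c _ => ContDiffAt.sum fun d _ => ((h2 _ _).mul (h2 _ _)).smul (hF c d)

theorem IsMetricOn.smoothAt_hodge {𝕜 : Type} [RCLike 𝕜] (hg : IsMetricOn g Ω) (hx : x ∈ Ω)
    {F : E4 → Tensor2 𝕜} (hF : SmoothAt F x) : SmoothAt (fun y => hodge (g y) (F y)) x := by
  intro a b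
  have h2 := hg.smoothAt_raise hx hF
  simp only [hodge, Matrix.of_apply]
  exact (contDiffAt_const (c := (1 / 2 : ℝ))).smul (ContDiffAt.sum fun c _ => ContDiffAt.sum fun d _ =>
    (hg.contDiffAt_volForm hx _ _ _ _).smul (h2 c d))

/-- Smoothness of a field of 4-tensors at a point, by components. -/
def Smooth4At (A : E4 → Tensor4 ℂ) (x : E4) : Prop :=
  ∀ a b c d : Fin 4, ContDiffAt ℝ ∞ (fun y => A y a b c d) x

theorem IsMetricOn.smoothAt_act (hg : IsMetricOn g Ω) (hx : x ∈ Ω) {A : E4 → Tensor4 ℂ}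
    {F : E4 → Tensor2 ℂ} (hA : Smooth4At A x) (hF : SmoothAt F x) :
    SmoothAt (fun y => act (g y) (A y) (F y)) x := by
  intro a b
  have h2 := hg.smoothAt_raise hx hF
  simp only [act, Matrix.of_apply]
  exact contDiffAt_const.mul (ContDiffAt.sum fun c _ => ContDiffAt.sum fun d _ =>
    (hA _ _ _ _).mul (h2 c d))

theorem IsMetricOn.contDiffAt_pairing (hg : IsMetricOn g Ω) (hx : x ∈ Ω)
    {F H : E4 → Tensor2 ℂ} (hF : SmoothAt F x) (hH : SmoothAt H x) :
    ContDiffAt ℝ ∞ (fun y => pairing (g y) (F y) (H y)) x := by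
  have h2 := hg.smoothAt_raise hx hF
  simp only [pairing]
  exact contDiffAt_const.mul (ContDiffAt.sum fun c _ => ContDiffAt.sum fun d _ =>
    (h2 c d).mul (hH c d))

theorem IsMetricOn.contDiffAt_quad (hg : IsMetricOn g Ω) (hx : x ∈ Ω) {A : E4 → Tensor4 ℂ}
    {F : E4 → Tensor2 ℂ} (hA : Smooth4At A x) (hF : SmoothAt F x) :
    ContDiffAt ℝ ∞ (fun y => quad (g y) (A y) (F y)) x :=
  hg.contDiffAt_pairing hx hF (hg.smoothAt_act hx hA hF)

theorem IsMetricOn.smooth4At_comp (hg : IsMetricOn g Ω) (hx : x ∈ Ω) {A B : E4 → Tensor4 ℂ}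
    (hA : Smooth4At A x) (hB : Smooth4At B x) : Smooth4At (fun y => comp (g y) (A y) (B y)) x :=
  fun a b c d => hg.smoothAt_act hx hA (F := fun y => Matrix.of fun e f => B y e f c d)
    (fun e f => hB e f c d) a b

theorem IsMetricOn.contDiffAt_tr (hg : IsMetricOn g Ω) (hx : x ∈ Ω) {A : E4 → Tensor4 ℂ}
    (hA : Smooth4At A x) : ContDiffAt ℝ ∞ (fun y => tr (g y) (A y)) x :=
  contDiffAt_const.mul (ContDiffAt.sum fun a _ => ContDiffAt.sum fun b _ =>
    hg.smoothAt_raise hx (F := fun y => Matrix.of fun c d => A y a b c d)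
      (fun c d => hA a b c d) a b)

theorem IsMetricOn.smooth4At_sdWeyl (hg : IsMetricOn g Ω) (hx : x ∈ Ω) :
    Smooth4At (sdWeyl g) x := by
  intro a b c d
  simp only [sdWeyl]
  refine contDiffAt_const.mul ((contDiffAt_ofReal (hg.contDiffAt_weyl hx _ _ _ _)).sub
    (contDiffAt_const.mul (contDiffAt_ofReal ?_)))
  exact hg.smoothAt_hodge hx (F := fun y => Matrix.of fun e f => weyl g y e f c d)
    (fun e f => hg.contDiffAt_weyl hx e f c d) a b

theorem IsMetricOn.smooth4At_tensorS (hg : IsMetricOn g Ω) (hx : x ∈ Ω) (hr : rho g x ≠ 0) :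
    Smooth4At (tensorS g) x := by
  have h1 := hg.smooth4At_sdWeyl hx
  have h2 := hg.smooth4At_comp hx h1 h1
  have h3 := hg.smooth4At_comp hx h1 h2
  -- As division by zero gives zero, ρ ≠ 0 contains the nonvanishing of the denominator, which is
  -- needed for smoothness.
  have h0 : tr (g x) (comp (g x) (sdWeyl g x) (sdWeyl g x)) ≠ 0 := by
    intro h
    apply hr
    rw [rho, h, div_zero]
  have hrho : ContDiffAt ℝ ∞ (fun y => rho g y) x := by
    simp only [rho, div_eq_mul_inv]
    exact (hg.contDiffAt_tr hx h3).neg.mul ((hg.contDiffAt_tr hx h2).inv h0)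
  have hsd : Smooth4At (fun y => sdMetric (g y)) x := by
    intro a b c d
    have h := hg.smoothAt hx
    simp only [sdMetric]
    refine contDiffAt_const.mul ((contDiffAt_ofReal ?_).sub (contDiffAt_const.mul
      (contDiffAt_ofReal (hg.contDiffAt_volForm hx _ _ _ _))))
    exact ((h _ _).mul (h _ _)).sub ((h _ _).mul (h _ _))
  intro a b c d
  have e : (fun y => tensorS g y a b c d) = fun y =>
      (3 * rho g y)⁻¹ * (sdWeyl g y a b c d - rho g y * sdMetric (g y) a b c d) := by
    funext y
    simp only [tensorS, Pi.smul_apply, Pi.sub_apply, smul_eq_mul, one_div]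
  rw [e]
  exact ((contDiffAt_const.mul hrho).inv (by simpa using hr)).mul
    ((h1 a b c d).sub (hrho.mul (hsd a b c d)))

end Curvature

section

/-! ### First-order jets of unitary self-dual bivectors -/

/-- Components of a covector in the frame `E`. -/
def inFrame1 (E : Tensor2 ℂ) (ξ : Fin 4 → ℂ) (i : Fin 4) : ℂ := ∑ a, E a i * ξ a

/-- Components of a 3-tensor in the frame `E`. -/
def inFrame3 (E : Tensor2 ℂ) (T : Fin 4 → Tensor2 ℂ) (i : Fin 4) : Tensor2 ℂ :=
  ∑ c, E c i • inFrame E (T c)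

theorem inFrame1_eq (E : Tensor2 ℂ) (ξ : Fin 4 → ℂ) : inFrame1 E ξ = Eᵀ *ᵥ ξ := by
  funext i
  simp [inFrame1, Matrix.mulVec, dotProduct]

theorem inFrame1_injective {E : Tensor2 ℂ} (hE : IsUnit E.det) {ξ ζ : Fin 4 → ℂ}
    (h : inFrame1 E ξ = inFrame1 E ζ) : ξ = ζ := by
  have hEt : IsUnit Eᵀ.det := by rwa [Matrix.det_transpose]
  rw [inFrame1_eq, inFrame1_eq] at h
  have := congrArg (fun v => Eᵀ⁻¹ *ᵥ v) h
  simpa [Matrix.mulVec_mulVec, Matrix.nonsing_inv_mul _ hEt] using this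

theorem inFrame3_injective {E : Tensor2 ℂ} (hE : IsUnit E.det) {T S : Fin 4 → Tensor2 ℂ}
    (h : inFrame3 E T = inFrame3 E S) : T = S := by
  have h1 : ∀ j k, inFrame1 E (fun c => inFrame E (T c) j k) =
      inFrame1 E (fun c => inFrame E (S c) j k) := by
    intro j k
    funext i
    have := congrFun (congrFun (congrFun h i) j) k
    simpa [inFrame3, inFrame1, Matrix.sum_apply] using this
  funext c
  apply inFrame_injective hE
  ext j k
  exact congrFun (inFrame1_injective hE (h1 j k)) c

theorem inFrame3_apply (E : Tensor2 ℂ) (T : Fin 4 → Tensor2 ℂ) (i j k : Fin 4) :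
    inFrame3 E T i j k = ∑ c, E c i * inFrame E (T c) j k := by
  simp [inFrame3, Matrix.sum_apply]

theorem IsNullTetrad.sum_inv {γ : Tensor2 ℝ} {E : Tensor2 ℂ} (h : IsNullTetrad γ E)
    (ξ ζ : Fin 4 → ℂ) : ∑ a, ∑ c, γ⁻¹ a c • (ξ c * ζ a) =
      ∑ i, ∑ k, nullGram i k * (inFrame1 E ξ k * inFrame1 E ζ i) := by
  have hg : ∀ a c, (γ⁻¹ a c : ℂ) = ∑ i, ∑ k, E a i * E c k * nullGram i k := by
    intro a c
    rw [← mul_mul_transpose_apply, ← h.inv_eq]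
    rfl
  simp only [Complex.real_smul, hg, inFrame1, Finset.sum_mul, Finset.mul_sum]
  rw [show ∀ f : Fin 4 → Fin 4 → Fin 4 → Fin 4 → ℂ, ∑ a, ∑ b, ∑ k, ∑ l, f a b k l =
      ∑ k, ∑ l, ∑ b, ∑ a, f a b k l from fun f =>
    ((Finset.sum_congr rfl fun a _ => sum_comm_one_two _).trans (sum_comm_one_two _)).trans
    (Finset.sum_congr rfl fun a _ => Finset.sum_congr rfl fun b _ => Finset.sum_comm)]
  refine Finset.sum_congr rfl fun a _ => Finset.sum_congr rfl fun b _ => ?_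
  rw [Finset.sum_comm]
  refine Finset.sum_congr rfl fun c _ => Finset.sum_congr rfl fun d _ => ?_
  ring

theorem IsNullTetrad.inFrame1_interior {γ : Tensor2 ℝ} {E : Tensor2 ℂ} (h : IsNullTetrad γ E)
    (ξ : Fin 4 → ℂ) (F : Tensor2 ℂ) (j : Fin 4) : inFrame1 E (interior γ ξ F) j =
      ∑ i, ∑ k, nullGram i k * (inFrame1 E ξ k * inFrame E F i j) := by
  have h1 : ∀ b, interior γ ξ F b =
      ∑ i, ∑ k, nullGram i k * (inFrame1 E ξ k * inFrame1 E (fun a => F a b) i) := by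
    intro b
    rw [← h.sum_inv]
    rfl
  have h2 : ∀ i, inFrame E F i j = ∑ b, E b j * inFrame1 E (fun a => F a b) i := by
    intro i
    rw [inFrame_apply, Finset.sum_comm]
    simp only [inFrame1, Finset.mul_sum]
    exact Finset.sum_congr rfl fun a _ => Finset.sum_congr rfl fun b _ => by ring
  have h3 : inFrame1 E (interior γ ξ F) j = ∑ b, E b j * interior γ ξ F b := rfl
  rw [h3]
  simp only [h1, h2, Finset.mul_sum]
  rw [sum_comm_one_two]
  refine Finset.sum_congr rfl fun a _ => Finset.sum_congr rfl fun b _ =>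
    Finset.sum_congr rfl fun c _ => ?_
  ring

/-- The components in an adapted null tetrad of the derivative of a unitary self-dual bivector. -/
def frameJet (p q : ℂ) : Tensor2 ℂ := !![0, 0, p, 0; 0, 0, 0, q; -p, 0, 0, 0; 0, -q, 0, 0]

theorem frameUnit_eq : frameUnit = !![0, (1 / Real.sqrt 2 : ℂ), 0, 0; -(1 / Real.sqrt 2 : ℂ), 0, 0, 0;
    0, 0, 0, -(1 / Real.sqrt 2 : ℂ); 0, 0, (1 / Real.sqrt 2 : ℂ), 0] := by
  ext i j
  fin_cases i <;> fin_cases j <;> simp [frameUnit]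

theorem inv_sqrt_two_sq : (1 / Real.sqrt 2 : ℂ) * (1 / Real.sqrt 2) = 1 / 2 := by
  have hs0 := sqrt_two_ne_zero
  have := sqrt_two_mul_self
  field_simp
  rw [pow_two, this]

theorem mul_nullGram (F : Tensor2 ℂ) : F * nullGram =
    !![-F 0 1, -F 0 0, F 0 3, F 0 2; -F 1 1, -F 1 0, F 1 3, F 1 2;
      -F 2 1, -F 2 0, F 2 3, F 2 2; -F 3 1, -F 3 0, F 3 3, F 3 2] := by
  ext i j
  fin_cases i <;> fin_cases j <;>
    simp [nullGram, Matrix.mul_apply, Fin.sum_univ_four]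

theorem frameUnit_sq : frameUnit * nullGram * frameUnit = (1 / 2 : ℂ) • nullGram := by
  have := inv_sqrt_two_sq
  rw [mul_nullGram, frameUnit_eq]
  generalize (1 / Real.sqrt 2 : ℂ) = r at this
  ext i j
  fin_cases i <;> fin_cases j <;>
    simp [nullGram, Matrix.mul_apply, Fin.sum_univ_four] <;> linear_combination this

/-- The hypothesis is the derivative of `𝒰² = g/2`. Anticommuting with the adapted bivector kills
the components 01, 23, 03, 12, which are those on which it acts by nonzero multiples. -/
theorem eq_frameJet {T : Tensor2 ℂ} (ha : Tᵀ = -T)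
    (h : T * nullGram * frameUnit + frameUnit * nullGram * T = 0) :
    T = frameJet (T 0 2) (T 1 3) := by
  have hs : (1 / Real.sqrt 2 : ℂ) ≠ 0 := by simp
  have ha' : ∀ i j, T j i = -T i j := fun i j => congrFun (congrFun ha i) j
  have hd : ∀ i, T i i = 0 := fun i => by
    have := ha' i i
    rwa [eq_neg_iff_add_eq_zero, ← two_mul, mul_eq_zero, or_iff_right two_ne_zero] at this
  rw [mul_nullGram, mul_nullGram, frameUnit_eq] at h
  generalize (1 / Real.sqrt 2 : ℂ) = r at h hs
  have e := fun i j => congrFun (congrFun h i) j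
  have e00 := e 0 1
  have e02 := e 0 3
  have e12 := e 2 1
  have e22 := e 2 3
  simp [Matrix.vecMul, dotProduct, Fin.sum_univ_four, ha' 0 1, ha' 0 2, ha' 0 3, ha' 1 2, ha' 1 3, ha' 2 3,
    hd] at e00 e02 e12 e22
  have h01 : T 0 1 = 0 := by
    have : r * T 0 1 = 0 := by linear_combination -e00 / 2
    exact (mul_eq_zero.1 this).resolve_left hs
  have h23 : T 2 3 = 0 := by
    have : r * T 2 3 = 0 := by linear_combination -e22 / 2
    exact (mul_eq_zero.1 this).resolve_left hs
  have h03 : T 0 3 = 0 := by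
    have : r * T 0 3 = 0 := by linear_combination -e02 / 2
    exact (mul_eq_zero.1 this).resolve_left hs
  have h12 : T 1 2 = 0 := by
    have : r * T 1 2 = 0 := by linear_combination e12 / 2
    exact (mul_eq_zero.1 this).resolve_left hs
  ext i j
  fin_cases i <;> fin_cases j <;>
    simp [frameJet, hd, ha' 0 1, ha' 0 2, ha' 0 3, ha' 1 2, ha' 1 3, ha' 2 3, h01, h23, h03, h12]

variable {g : E4 → Tensor2 ℝ} {Ω : Set E4} {x : E4}

/-- The product rule for the product of covariant 2-tensors. -/
theorem IsMetricOn.cov_mul (hg : IsMetricOn g Ω) (hx : x ∈ Ω) {F H : E4 → Tensor2 ℂ}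
    (hF : SmoothAt F x) (hH : SmoothAt H x) (c : Fin 4) :
    cov g (fun y => F y * toComplex (g y)⁻¹ * H y) x c =
      cov g F x c * toComplex (g x)⁻¹ * H x + F x * toComplex (g x)⁻¹ * cov g H x c := by
  have hi := (hg.smoothAt_inv hx).toComplex
  have e : toComplex (-(connection g x c * (g x)⁻¹) - (g x)⁻¹ * (connection g x c)ᵀ) =
      -(toComplex (connection g x c) * toComplex (g x)⁻¹) -
        toComplex (g x)⁻¹ * (toComplex (connection g x c))ᵀ := by
    rw [toComplex_transpose, ← toComplex_mul, ← toComplex_mul]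
    ext a b
    simp
  simp only [cov_eq]
  rw [mpd_mul (hF.mul hi) hH, mpd_mul hF hi, mpd_toComplex (hg.smoothAt_inv hx), hg.mpd_inv hx, e]
  noncomm_ring

theorem cov_add {F H : E4 → Tensor2 ℂ} (hF : SmoothAt F x) (hH : SmoothAt H x) (c : Fin 4) :
    cov g (fun y => F y + H y) x c = cov g F x c + cov g H x c := by
  simp only [cov_eq]
  rw [mpd_add hF hH]
  noncomm_ring

theorem cov_smul {f : E4 → ℂ} {F : E4 → Tensor2 ℂ} (hf : DifferentiableAt ℝ f x)
    (hF : SmoothAt F x) (c : Fin 4) :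
    cov g (fun y => f y • F y) x c = pd c f x • F x + f x • cov g F x c := by
  simp only [cov_eq]
  rw [mpd_smul hf hF]
  simp only [Matrix.mul_smul, Matrix.smul_mul, smul_sub]
  abel

theorem cov_congr {F H : E4 → Tensor2 ℂ} (h : F =ᶠ[nhds x] H) (c : Fin 4) :
    cov g F x c = cov g H x c := by
  simp only [cov_eq]
  rw [mpd_congr h, h.self_of_nhds]

theorem cov_conj {F : E4 → Tensor2 ℂ} (hF : SmoothAt F x) (c : Fin 4) :
    cov g (fun y => (F y).map (starRingEnd ℂ)) x c = (cov g F x c).map (starRingEnd ℂ) := by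
  have hG : ∀ A : Tensor2 ℝ, (toComplex A).map (starRingEnd ℂ) = toComplex A := by
    intro A
    ext; simp
  simp only [cov_eq]
  rw [mpd_conj hF, Matrix.map_sub _ (map_sub _), Matrix.map_sub _ (map_sub _), Matrix.map_mul,
    Matrix.map_mul, toComplex_transpose, hG, hG]

theorem cov_transpose {F : E4 → Tensor2 ℂ} (c : Fin 4) :
    cov g (fun y => (F y)ᵀ) x c = (cov g F x c)ᵀ := by
  simp only [cov_eq, mpd_transpose, Matrix.transpose_sub, Matrix.transpose_mul,
    Matrix.transpose_transpose]
  abel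

/-- A tensor identity, hence verified in one adapted tetrad. Its derivative is what restricts the
first-order jet of a unitary field. -/
theorem IsUnitSD.sq_eq {γ : Tensor2 ℝ} (hγ : IsLorentz γ) {F : Tensor2 ℂ} (hF : IsUnitSD γ F) :
    F * toComplex γ⁻¹ * F = (1 / 2 : ℂ) • toComplex γ := by
  obtain ⟨E, hE, h0⟩ := hγ.exists_adapted hF.selfDual hF.norm
  apply inFrame_injective hE.isUnit_det
  rw [hE.inFrame_mul, h0, frameUnit_sq, inFrame_smul, inFrame, hE.gram]

theorem inFrame3_mul_left {E : Tensor2 ℂ} {γ : Tensor2 ℝ} (hE : IsNullTetrad γ E)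
    (T : Fin 4 → Tensor2 ℂ) (F : Tensor2 ℂ) (i : Fin 4) :
    inFrame3 E (fun c => T c * toComplex γ⁻¹ * F) i = inFrame3 E T i * nullGram * inFrame E F := by
  simp only [inFrame3, hE.inFrame_mul, Matrix.sum_mul, Matrix.smul_mul]

theorem inFrame3_mul_right {E : Tensor2 ℂ} {γ : Tensor2 ℝ} (hE : IsNullTetrad γ E)
    (T : Fin 4 → Tensor2 ℂ) (F : Tensor2 ℂ) (i : Fin 4) :
    inFrame3 E (fun c => F * toComplex γ⁻¹ * T c) i = inFrame E F * nullGram * inFrame3 E T i := by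
  simp only [inFrame3, hE.inFrame_mul, Matrix.mul_sum, Matrix.mul_smul]

theorem inFrame3_add (E : Tensor2 ℂ) (T S : Fin 4 → Tensor2 ℂ) (i : Fin 4) :
    inFrame3 E (fun c => T c + S c) i = inFrame3 E T i + inFrame3 E S i := by
  simp only [inFrame3, inFrame_add, smul_add, Finset.sum_add_distrib]

theorem inFrame3_smul_const (E : Tensor2 ℂ) (T : Fin 4 → Tensor2 ℂ) (z : ℂ) (i : Fin 4) :
    inFrame3 E (fun c => z • T c) i = z • inFrame3 E T i := by
  simp only [inFrame3, inFrame_smul, Finset.smul_sum, smul_comm z]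

theorem inFrame3_smul (E : Tensor2 ℂ) (ξ : Fin 4 → ℂ) (F : Tensor2 ℂ) (i : Fin 4) :
    inFrame3 E (fun c => ξ c • F) i = inFrame1 E ξ i • inFrame E F := by
  simp only [inFrame3, inFrame_smul, inFrame1, Finset.sum_smul, smul_smul]

/-- A null tetrad adapted to a field `U` of unitary self-dual bivectors at `x`, and the components
`p`, `q` of the derivative of the field. -/
structure IsJetFrame (g : E4 → Tensor2 ℝ) (U : E4 → Tensor2 ℂ) (x : E4) (E : Tensor2 ℂ)
    (p q : Fin 4 → ℂ) : Prop where
  tetrad : IsNullTetrad (g x) E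
  unit : inFrame E (U x) = frameUnit
  jet : ∀ i, inFrame3 E (cov g U x) i = frameJet (p i) (q i)

/-- `U` is a smooth field of unitary self-dual bivectors around `x`. -/
structure IsUnitFieldAt (g : E4 → Tensor2 ℝ) (U : E4 → Tensor2 ℂ) (x : E4) : Prop where
  smooth_nhds : ∀ᶠ y in nhds x, SmoothAt U y
  unit : ∀ᶠ y in nhds x, IsUnitSD (g y) (U y)

theorem IsUnitFieldAt.smooth {U : E4 → Tensor2 ℂ} (hU : IsUnitFieldAt g U x) : SmoothAt U x :=
  hU.smooth_nhds.self_of_nhds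

theorem IsUnitFieldAt.eventually {U : E4 → Tensor2 ℂ} (hU : IsUnitFieldAt g U x) :
    ∀ᶠ y in nhds x, IsUnitFieldAt g U y := by
  filter_upwards [eventually_eventually_nhds.2 hU.smooth_nhds,
    eventually_eventually_nhds.2 hU.unit] with y h1 h2 using ⟨h1, h2⟩

/-- The tetrad is adapted at the single point x and is never differentiated: `∇𝒰` is computed in
coordinates and only then expressed in it. The antisymmetry of `𝒰` and `𝒰² = g/2` hold near x and
can be differentiated. -/
theorem IsMetricOn.exists_jetFrame (hg : IsMetricOn g Ω) (hx : x ∈ Ω) {U : E4 → Tensor2 ℂ}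
    (hU : IsUnitFieldAt g U x) : ∃ E p q, IsJetFrame g U x E p q := by
  have hu := hU.unit.self_of_nhds
  obtain ⟨E, hE, h0⟩ := (hg.lorentz x hx).exists_adapted hu.selfDual hu.norm
  refine ⟨E, _, _, hE, h0, fun i => eq_frameJet ?_ ?_⟩
  · have h1 : ∀ c, (cov g U x c)ᵀ = -cov g U x c := by
      intro c
      rw [← cov_transpose, cov_congr (H := fun y => (-1 : ℂ) • U y), cov_smul
        (differentiableAt_const _) hU.smooth, pd_const]
      · simp
      · filter_upwards [hU.unit] with y hy
        rw [hy.selfDual.1, neg_smul, one_smul]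
    rw [inFrame3, Matrix.transpose_sum, ← Finset.sum_neg_distrib]
    refine Finset.sum_congr rfl fun c _ => ?_
    rw [Matrix.transpose_smul, inFrame_transpose, h1, ← smul_neg]
    simp [inFrame]
  · rw [← h0, ← inFrame3_mul_left hE, ← inFrame3_mul_right hE, ← inFrame3_add]
    have h1 : ∀ c, cov g U x c * toComplex (g x)⁻¹ * U x + U x * toComplex (g x)⁻¹ * cov g U x c
        = 0 := by
      intro c
      rw [← hg.cov_mul hx hU.smooth hU.smooth, cov_congr (H := fun y => (1 / 2 : ℂ) •
        toComplex (g y)), cov_smul (differentiableAt_const _) (hg.smoothAt hx).toComplex,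
        pd_const, hg.cov_metric hx]
      · simp
      · filter_upwards [hU.unit, hg.isOpen.mem_nhds hx] with y hy hyO
        exact hy.sq_eq (hg.lorentz y hyO)
    simp only [h1]
    simp [inFrame3, inFrame]

end

/-! ### The first-order concomitants in an adapted null tetrad -/

theorem inFrame3_eq_sum (E : Tensor2 ℂ) (T : Fin 4 → Tensor2 ℂ) (i j k : Fin 4) :
    inFrame3 E T i j k = ∑ a, ∑ b, E a j * E b k * inFrame1 E (fun c => T c a b) i := by
  rw [inFrame3_apply]
  simp only [inFrame_apply, inFrame1, Finset.mul_sum]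
  rw [sum_comm_one_two]
  refine Finset.sum_congr rfl fun a _ => Finset.sum_congr rfl fun b _ =>
    Finset.sum_congr rfl fun c _ => ?_
  ring

theorem inFrame3_sub (E : Tensor2 ℂ) (T S : Fin 4 → Tensor2 ℂ) (i : Fin 4) :
    inFrame3 E (fun c => T c - S c) i = inFrame3 E T i - inFrame3 E S i := by
  simp only [inFrame3, inFrame_sub, smul_sub, Finset.sum_sub_distrib]

/-- The contraction with a covector of the self-dual metric, in a null tetrad. -/
theorem IsNullTetrad.inFrame3_sdMetric {γ : Tensor2 ℝ} {E : Tensor2 ℂ} (h : IsNullTetrad γ E)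
    (ξ : Fin 4 → ℂ) (i : Fin 4) :
    inFrame3 E (fun c => Matrix.of fun a b => interior γ ξ
      (Matrix.of fun d e => sdMetric γ d e a b) c) i =
      ∑ p, (∑ m, ∑ n, nullGram m n * (inFrame1 E ξ n * frameBasis p m i)) • frameBasis p := by
  have h1 : ∀ m j k, ∑ a, ∑ b, E a j * E b k * inFrame E (Matrix.of fun d e => sdMetric γ d e a b) m i
      = ∑ p, frameBasis p m i * frameBasis p j k := by
    intro m j k
    have h2 : inFrame4 E (sdMetric γ) m i j k = ∑ p, frameBasis p m i * frameBasis p j k := by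
      rw [h.sdMetric_eq, inFrame4_doubleForm]
      simp only [inFrame_sdBasis h.isUnit_det]
      simp [doubleForm, Matrix.one_apply]
    rw [← h2, inFrame4_eq_right, inFrame_apply]
    rfl
  ext j k
  rw [inFrame3_eq_sum]
  have h3 : ∀ a b, inFrame1 E (fun c => (Matrix.of fun a b => interior γ ξ
      (Matrix.of fun d e => sdMetric γ d e a b) c) a b) i = ∑ m, ∑ n, nullGram m n *
        (inFrame1 E ξ n * inFrame E (Matrix.of fun d e => sdMetric γ d e a b) m i) :=
    fun a b => h.inFrame1_interior ξ _ i
  simp only [h3]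
  calc _ = ∑ m, ∑ n, nullGram m n * (inFrame1 E ξ n * ∑ a, ∑ b, E a j * E b k *
        inFrame E (Matrix.of fun d e => sdMetric γ d e a b) m i) := by
        simp only [Finset.mul_sum]
        rw [Finset.sum_congr rfl fun a _ => sum_comm_one_two _, sum_comm_one_two]
        refine Finset.sum_congr rfl fun m _ => Finset.sum_congr rfl fun n _ =>
          Finset.sum_congr rfl fun a _ => Finset.sum_congr rfl fun b _ => ?_
        ring
    _ = _ := by
        simp only [h1, Finset.mul_sum, Matrix.sum_apply, Matrix.smul_apply, smul_eq_mul,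
          Finset.sum_mul]
        rw [Finset.sum_congr rfl fun m _ => Finset.sum_comm, Finset.sum_comm]
        refine Finset.sum_congr rfl fun p _ => Finset.sum_congr rfl fun m _ =>
          Finset.sum_congr rfl fun n _ => ?_
        ring

section JetFrame

variable {g : E4 → Tensor2 ℝ} {Ω : Set E4} {x : E4} {U : E4 → Tensor2 ℂ} {E : Tensor2 ℂ}
  {p q : Fin 4 → ℂ}

/-- The contraction pairs k with l and m with n, so it sees only four of the eight components of the
jet. -/
theorem IsJetFrame.codiff (h : IsJetFrame g U x E p q) :
    inFrame1 E (codiff g U x) = ![p 3, q 2, p 1, q 0] := by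
  have h1 : ∀ b, Spacetime.codiff g U x b =
      -∑ i, ∑ k, nullGram i k * ∑ a, E a i * inFrame1 E (fun c => cov g U x c a b) k := by
    intro b
    have h2 : ∀ a, ∑ c, ((g x)⁻¹ a c : ℂ) * cov g U x c a b = ∑ i, ∑ k, nullGram i k *
        (E a i * inFrame1 E (fun c => cov g U x c a b) k) := by
      intro a
      have hg : ∀ c, ((g x)⁻¹ a c : ℂ) = ∑ i, ∑ k, E a i * E c k * nullGram i k := by
        intro c
        rw [← mul_mul_transpose_apply, ← h.tetrad.inv_eq]
        rfl
      simp only [hg, inFrame1, Finset.sum_mul, Finset.mul_sum]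
      rw [sum_comm_one_two]
      refine Finset.sum_congr rfl fun a _ => Finset.sum_congr rfl fun b _ =>
        Finset.sum_congr rfl fun c _ => ?_
      ring
    have h3 : Spacetime.codiff g U x b = -∑ a, ∑ c, ((g x)⁻¹ a c : ℂ) * cov g U x c a b := by
      simp [Spacetime.codiff, cov]
    rw [h3]
    simp only [h2, Finset.mul_sum]
    rw [sum_comm_one_two]
  have h2 : ∀ j, inFrame1 E (Spacetime.codiff g U x) j =
      -∑ i, ∑ k, nullGram i k * inFrame3 E (cov g U x) k i j := by
    intro j
    have h3 : inFrame1 E (Spacetime.codiff g U x) j = ∑ b, E b j * Spacetime.codiff g U x b := rfl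
    rw [h3]
    simp only [h1, inFrame3_eq_sum, Finset.mul_sum, mul_neg, Finset.sum_neg_distrib]
    rw [sum_comm_one_two]
    refine congrArg Neg.neg ?_
    refine Finset.sum_congr rfl fun i _ => Finset.sum_congr rfl fun k _ => ?_
    rw [Finset.sum_comm]
    refine Finset.sum_congr rfl fun a _ => Finset.sum_congr rfl fun b _ => ?_
    ring
  funext j
  rw [h2]
  simp only [h.jet]
  fin_cases j <;> simp [Fin.sum_univ_four, nullGram, frameJet]

/-- The two subtracted terms rebuild exactly the part of `∇𝒰` that `δ𝒰` determines. What survives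
are, up to constant factors, the Newman–Penrose coefficients κ, σ, ν, λ: the null directions k and l
are geodesic and shear-free when they vanish. -/
theorem IsJetFrame.sigma (h : IsJetFrame g U x E p q) (i : Fin 4) :
    inFrame3 E (fun c => Matrix.of (sigma g U x c)) i =
      frameJet (![p 0, 0, p 2, 0] i) (![0, q 1, 0, q 3] i) := by
  have h2 : (fun c => Matrix.of (Spacetime.sigma g U x c)) = fun c => cov g U x c -
      interior (g x) (Spacetime.codiff g U x) (U x) c • U x -
      Matrix.of fun a b => interior (g x) (Spacetime.codiff g U x)
        (Matrix.of fun d e => sdMetric (g x) d e a b) c := by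
    funext c
    ext a b
    simp [Spacetime.sigma, cov]
  rw [h2, inFrame3_sub, inFrame3_sub, h.jet, inFrame3_smul, h.tetrad.inFrame1_interior,
    h.tetrad.inFrame3_sdMetric, h.codiff, h.unit, frameUnit_eq]
  have hr := inv_sqrt_two_sq
  have h3 : frameBasis = ![(1 / Real.sqrt 2 : ℂ) • !![0, 0, 1, 0; 0, 0, 0, -1; -1, 0, 0, 0; 0, 1, 0, 0],
    (I * (1 / Real.sqrt 2)) • !![0, 1, 0, 0; -1, 0, 0, 0; 0, 0, 0, -1; 0, 0, 1, 0],
    (I * (1 / Real.sqrt 2)) • !![0, 0, 1, 0; 0, 0, 0, 1; -1, 0, 0, 0; 0, -1, 0, 0]] := by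
    simp only [frameBasis, mul_one_div]
  rw [h3]
  generalize (1 / Real.sqrt 2 : ℂ) = r at hr
  have hi : (I * r) * (I * r) = -(1 / 2) := by rw [mul_mul_mul_comm, I_mul_I, hr]; ring
  generalize I * r = s at hi
  ext j k
  fin_cases i <;> simp [Fin.sum_univ_four, Fin.sum_univ_three, nullGram, frameJet] <;>
   fin_cases j <;> fin_cases k <;> simp [mul_assoc, hr, hi] <;> ring

end JetFrame

/-! ### The covectors `a` and `b` -/

/-- Complex conjugation of the vectors of a null tetrad. -/
def tetradPerm : Fin 4 → Fin 4 := ![0, 1, 3, 2]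

section Conj

variable {γ : Tensor2 ℝ} {E : Tensor2 ℂ}

theorem IsNullTetrad.conj_apply (h : IsNullTetrad γ E) (a i : Fin 4) :
    starRingEnd ℂ (E a i) = E a (tetradPerm i) := by
  have := congrFun (congrFun h.conj a) i
  rw [Matrix.map_apply] at this
  rw [this]
  fin_cases i <;> simp [Matrix.mul_apply, tetradSwap, tetradPerm, Fin.sum_univ_four]

theorem tetradPerm_tetradPerm (i : Fin 4) : tetradPerm (tetradPerm i) = i := by
  fin_cases i <;> rfl

theorem IsNullTetrad.conj_apply' (h : IsNullTetrad γ E) (a i : Fin 4) :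
    starRingEnd ℂ (E a (tetradPerm i)) = E a i := by
  rw [h.conj_apply, tetradPerm_tetradPerm]

theorem IsNullTetrad.inFrame1_conj (h : IsNullTetrad γ E) (ξ : Fin 4 → ℂ) (i : Fin 4) :
    inFrame1 E (fun a => starRingEnd ℂ (ξ a)) i =
      starRingEnd ℂ (inFrame1 E ξ (tetradPerm i)) := by
  simp [inFrame1, h.conj_apply']

theorem IsNullTetrad.inFrame_conj (h : IsNullTetrad γ E) (F : Tensor2 ℂ) (i j : Fin 4) :
    inFrame E (F.map (starRingEnd ℂ)) i j =
      starRingEnd ℂ (inFrame E F (tetradPerm i) (tetradPerm j)) := by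
  simp [inFrame_apply, h.conj_apply']

theorem IsNullTetrad.inFrame3_conj (h : IsNullTetrad γ E) (T : Fin 4 → Tensor2 ℂ) (i j k : Fin 4) :
    inFrame3 E (fun c => (T c).map (starRingEnd ℂ)) i j k =
      starRingEnd ℂ (inFrame3 E T (tetradPerm i) (tetradPerm j) (tetradPerm k)) := by
  simp [inFrame3_apply, h.inFrame_conj, h.conj_apply']

theorem hodge_re (F : Tensor2 ℂ) (a b : Fin 4) (t : ℝ) :
    hodge γ (Matrix.of fun a b => t * (F a b).re) a b = t * (hodge γ F a b).re := by
  simp only [hodge, raise, Matrix.of_apply, smul_eq_mul, Complex.smul_re, Complex.re_sum,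
    Finset.mul_sum]
  refine Finset.sum_congr rfl fun a _ => Finset.sum_congr rfl fun b _ =>
    Finset.sum_congr rfl fun c _ => Finset.sum_congr rfl fun d _ => ?_
  ring

end Conj

section Forms

variable {g : E4 → Tensor2 ℝ} {Ω : Set E4} {x : E4} {U : E4 → Tensor2 ℂ} {E : Tensor2 ℂ}
  {p q : Fin 4 → ℂ}

/-- The dual is a real operator, so *U = √2 Re(`*𝒰`) = √2 Re(i`𝒰`). -/
theorem starU_eq (h : IsSelfDual (g x) (U x)) :
    starU g U x = Matrix.of fun a b => -Real.sqrt 2 * (U x a b).im := by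
  ext a b
  rw [starU, realU, hodge_re, h.2]
  simp

/-- The connection has real coefficients and so commutes with real and imaginary parts; δU and δ*U
can thus be read from `δ𝒰`. -/
theorem covDeriv_clm (L : ℂ →L[ℝ] ℝ) {F : E4 → Tensor2 ℂ} (hF : SmoothAt F x) (c a b : Fin 4) :
    covDeriv g (fun y => Matrix.of fun a b => L (F y a b)) x c a b = L (covDeriv g F x c a b) := by
  simp only [covDeriv, Matrix.of_apply, pd_clm L (hF.diff a b), map_sub, map_sum, map_add, map_smul]

theorem codiff_clm (L : ℂ →L[ℝ] ℝ) {F : E4 → Tensor2 ℂ} (hF : SmoothAt F x) (b : Fin 4) :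
    codiff g (fun y => Matrix.of fun a b => L (F y a b)) x b = L (codiff g F x b) := by
  simp only [codiff, covDeriv_clm L hF, map_neg, map_sum, map_smul]

theorem covDeriv_congr {𝕜 : Type} [RCLike 𝕜] {F H : E4 → Tensor2 𝕜} (h : F =ᶠ[nhds x] H)
    (c a b : Fin 4) : covDeriv g F x c a b = covDeriv g H x c a b := by
  simp only [covDeriv, h.self_of_nhds]
  rw [pd_congr (f := fun y => F y a b) (h := fun y => H y a b) (h.mono fun y hy => by simp only [hy])]

theorem codiff_congr {𝕜 : Type} [RCLike 𝕜] {F H : E4 → Tensor2 𝕜} (h : F =ᶠ[nhds x] H) :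
    codiff g F x = codiff g H x := by
  funext b
  simp only [codiff, covDeriv_congr h]

theorem codiff_realU (hU : IsUnitFieldAt g U x) (b : Fin 4) :
    codiff g (realU U) x b = Real.sqrt 2 * (codiff g U x b).re := 
  codiff_clm (Real.sqrt 2 • Complex.reCLM) hU.smooth b

theorem codiff_starU (hU : IsUnitFieldAt g U x) (b : Fin 4) :
    codiff g (starU g U) x b = -Real.sqrt 2 * (codiff g U x b).im := by
  rw [codiff_congr (hU.unit.mono fun y hy => starU_eq hy.selfDual)]
  exact codiff_clm ((-Real.sqrt 2) • Complex.imCLM) hU.smooth b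

/-- Here b is twice the product of real parts and a is minus twice the product of imaginary parts.
Their sum is the real part of a complex product; the difference b - a needs the conjugate of `𝒰` in
one factor. -/
theorem formA_add_formB (hU : IsUnitFieldAt g U x) (i : Fin 4) :
    formA g U x i + formB g U x i = 2 * (interior (g x) (codiff g U x) (U x) i).re := by
  have h2 : Real.sqrt 2 * Real.sqrt 2 = 2 := Real.mul_self_sqrt (by norm_num)
  simp only [formA, formB, Pi.neg_apply, interior, codiff_realU hU, codiff_starU hU,
    starU_eq hU.unit.self_of_nhds.selfDual, realU, Matrix.of_apply, Complex.re_sum, Complex.smul_re,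
    smul_eq_mul, Complex.mul_re, Finset.mul_sum, ← Finset.sum_neg_distrib, ← Finset.sum_add_distrib]
  refine Finset.sum_congr rfl fun a _ => Finset.sum_congr rfl fun c _ => ?_
  linear_combination (g x)⁻¹ a c * ((codiff g U x c).re * (U x a i).re -
    (codiff g U x c).im * (U x a i).im) * h2

theorem formB_sub_formA (hU : IsUnitFieldAt g U x) (i : Fin 4) :
    formB g U x i - formA g U x i =
      2 * (interior (g x) (codiff g U x) ((U x).map (starRingEnd ℂ)) i).re := by
  have h2 : Real.sqrt 2 * Real.sqrt 2 = 2 := Real.mul_self_sqrt (by norm_num)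
  simp only [formA, formB, Pi.neg_apply, interior, codiff_realU hU, codiff_starU hU,
    starU_eq hU.unit.self_of_nhds.selfDual, realU, Matrix.of_apply, Complex.re_sum, Complex.smul_re,
    smul_eq_mul, Complex.mul_re, Finset.mul_sum, ← Finset.sum_neg_distrib, ← Finset.sum_sub_distrib,
    Matrix.map_apply, Complex.conj_re, Complex.conj_im]
  refine Finset.sum_congr rfl fun a _ => Finset.sum_congr rfl fun c _ => ?_
  linear_combination (g x)⁻¹ a c * ((codiff g U x c).re * (U x a i).re +
    (codiff g U x c).im * (U x a i).im) * h2

/-- The components in a frame of a real covector. -/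
def realInFrame (E : Tensor2 ℂ) (ξ : Fin 4 → ℝ) : Fin 4 → ℂ := inFrame1 E fun a => (ξ a : ℂ)

theorem realInFrame_injective (hE : IsUnit E.det) {ξ ζ : Fin 4 → ℝ}
    (h : realInFrame E ξ = realInFrame E ζ) : ξ = ζ := by
  have := inFrame1_injective hE h
  funext a
  exact Complex.ofReal_injective (congrFun this a)

theorem IsNullTetrad.realInFrame_two_re (h : IsNullTetrad (g x) E) (ξ : Fin 4 → ℂ) (i : Fin 4) :
    realInFrame E (fun a => 2 * (ξ a).re) i =
      inFrame1 E ξ i + starRingEnd ℂ (inFrame1 E ξ (tetradPerm i)) := by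
  rw [← h.inFrame1_conj, realInFrame]
  simp only [inFrame1, ← Finset.sum_add_distrib, ← mul_add, Complex.add_conj]

theorem IsNullTetrad.inFrame_conj_unit {γ : Tensor2 ℝ} (h : IsNullTetrad γ E) {F : Tensor2 ℂ}
    (hu : inFrame E F = frameUnit) :
    inFrame E (F.map (starRingEnd ℂ)) = !![0, (1 / Real.sqrt 2 : ℂ), 0, 0;
      -(1 / Real.sqrt 2 : ℂ), 0, 0, 0; 0, 0, 0, (1 / Real.sqrt 2 : ℂ);
      0, 0, -(1 / Real.sqrt 2 : ℂ), 0] := by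
  ext i j
  rw [h.inFrame_conj, hu, frameUnit_eq]
  fin_cases i <;> fin_cases j <;> simp [tetradPerm]

theorem IsJetFrame.conjUnit (h : IsJetFrame g U x E p q) :
    inFrame E ((U x).map (starRingEnd ℂ)) = !![0, (1 / Real.sqrt 2 : ℂ), 0, 0;
      -(1 / Real.sqrt 2 : ℂ), 0, 0, 0; 0, 0, 0, (1 / Real.sqrt 2 : ℂ);
      0, 0, -(1 / Real.sqrt 2 : ℂ), 0] := h.tetrad.inFrame_conj_unit h.unit

theorem IsJetFrame.formA_add_formB (h : IsJetFrame g U x E p q) (hU : IsUnitFieldAt g U x) :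
    realInFrame E (formA g U x + formB g U x) = (1 / Real.sqrt 2 : ℂ) •
      ![p 3 + starRingEnd ℂ (p 3), -(q 2 + starRingEnd ℂ (q 2)), p 1 - starRingEnd ℂ (q 0),
        starRingEnd ℂ (p 1) - q 0] := by
  rw [show formA g U x + formB g U x = _ from funext fun i => Spacetime.formA_add_formB hU i]
  funext i
  rw [h.tetrad.realInFrame_two_re]
  simp only [h.tetrad.inFrame1_interior, h.codiff, h.unit, frameUnit_eq]
  fin_cases i <;> simp [Fin.sum_univ_four, nullGram, tetradPerm] <;> ring

theorem IsJetFrame.formB_sub_formA (h : IsJetFrame g U x E p q) (hU : IsUnitFieldAt g U x) :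
    realInFrame E (formB g U x - formA g U x) = (1 / Real.sqrt 2 : ℂ) •
      ![p 3 + starRingEnd ℂ (p 3), -(q 2 + starRingEnd ℂ (q 2)), starRingEnd ℂ (q 0) - p 1,
        q 0 - starRingEnd ℂ (p 1)] := by
  rw [show formB g U x - formA g U x = _ from funext fun i => Spacetime.formB_sub_formA hU i]
  funext i
  rw [h.tetrad.realInFrame_two_re]
  simp only [h.tetrad.inFrame1_interior, h.codiff, h.conjUnit]
  fin_cases i <;> simp [Fin.sum_univ_four, nullGram, tetradPerm] <;> ring

end Forms

/-! ### Conformal tensors at a point -/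

/-- The traceless tensor `U² + (*U)²` of the almost-product structure defined by `U`. -/
def structureTensor (g : E4 → Tensor2 ℝ) (U : E4 → Tensor2 ℂ) (x : E4) : Tensor2 ℝ :=
  sq (g x) (realU U x) + sq (g x) (starU g U x)

/-- The complex form of the structure tensor. -/
def hermitianSq (γ : Tensor2 ℝ) (F : Tensor2 ℂ) : Tensor2 ℂ :=
  F * toComplex γ⁻¹ * F.map (starRingEnd ℂ) + F.map (starRingEnd ℂ) * toComplex γ⁻¹ * F

section Structure

variable {g : E4 → Tensor2 ℝ} {Ω : Set E4} {x : E4} {U : E4 → Tensor2 ℂ} {E : Tensor2 ℂ}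
  {p q : Fin 4 → ℂ}

theorem toComplex_realU : toComplex (realU U x) =
    (1 / Real.sqrt 2 : ℂ) • (U x + (U x).map (starRingEnd ℂ)) := by
  have h := sqrt_two_mul_self
  have h0 := sqrt_two_ne_zero
  ext a b
  simp only [toComplex, realU, Matrix.map_apply, Matrix.of_apply, Matrix.smul_apply,
    Matrix.add_apply, Complex.add_conj, smul_eq_mul]
  push_cast
  field_simp
  linear_combination (U x a b).re * h

theorem toComplex_starU (hU : IsSelfDual (g x) (U x)) : toComplex (starU g U x) =
    (I / Real.sqrt 2 : ℂ) • (U x - (U x).map (starRingEnd ℂ)) := by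
  have h := sqrt_two_mul_self
  have h0 := sqrt_two_ne_zero
  rw [starU_eq hU]
  ext a b
  simp only [toComplex, Matrix.map_apply, Matrix.of_apply, Matrix.smul_apply,
    Matrix.sub_apply, Complex.sub_conj, smul_eq_mul]
  push_cast
  field_simp
  rw [I_sq]
  linear_combination -(U x a b).im * h

/-- With U = (`𝒰` + `𝒰̄`)/√2 and *U = i(`𝒰` - `𝒰̄`)/√2 the pure squares cancel in the sum and the
mixed products remain. -/
theorem toComplex_structureTensor (hU : IsSelfDual (g x) (U x)) :
    toComplex (structureTensor g U x) = hermitianSq (g x) (U x) := by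
  have h := inv_sqrt_two_sq
  have hi : (I / Real.sqrt 2 : ℂ) * (I / Real.sqrt 2) = -(1 / 2) := by
    rw [div_mul_div_comm, I_mul_I, sqrt_two_mul_self]; norm_num
  rw [structureTensor, toComplex_add, sq, sq, toComplex_mul, toComplex_mul, toComplex_mul,
    toComplex_mul, toComplex_realU, toComplex_starU hU]
  simp only [Matrix.smul_mul, Matrix.mul_smul, smul_smul, h, hi, hermitianSq]
  simp only [Matrix.add_mul, Matrix.mul_add, Matrix.sub_mul, Matrix.mul_sub]
  module

/-- In the difference the mixed products cancel instead, and `𝒰²` and its conjugate contribute g/2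
each. -/
theorem sq_realU_sub_sq_starU (hg : IsLorentz (g x)) (hU : IsUnitSD (g x) (U x)) :
    sq (g x) (realU U x) - sq (g x) (starU g U x) = g x := by
  have h := inv_sqrt_two_sq
  have hi : (I / Real.sqrt 2 : ℂ) * (I / Real.sqrt 2) = -(1 / 2) := by
    rw [div_mul_div_comm, I_mul_I, sqrt_two_mul_self]; norm_num
  have hinj : Function.Injective (toComplex) := fun A B h => by
    ext a b
    exact Complex.ofReal_injective (congrFun (congrFun h a) b)
  have hc : (U x).map (starRingEnd ℂ) * toComplex (g x)⁻¹ * (U x).map (starRingEnd ℂ) =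
      (1 / 2 : ℂ) • toComplex (g x) := by
    have := congrArg (fun A : Tensor2 ℂ => A.map (starRingEnd ℂ)) (hU.sq_eq hg)
    have hG : ∀ A : Tensor2 ℝ, (toComplex A).map (starRingEnd ℂ) = toComplex A := by
      intro A
      ext; simp
    simp only [Matrix.map_mul, hG] at this
    rw [this]
    ext
    simp [map_ofNat (starRingEnd ℂ) 2]
  apply hinj
  rw [toComplex_sub, sq, sq, toComplex_mul, toComplex_mul, toComplex_mul,
    toComplex_mul, toComplex_realU, toComplex_starU hU.selfDual]
  simp only [Matrix.smul_mul, Matrix.mul_smul, smul_smul, h, hi]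
  have h1 := hU.sq_eq hg
  simp only [Matrix.add_mul, Matrix.mul_add, Matrix.sub_mul, Matrix.mul_sub, h1, hc]
  module

/-- The components of the covariant derivative of `α (U² + (*U)²)`. -/
def frameConformal (n p q p' q' : ℂ) : Tensor2 ℂ :=
  !![0, -n, -p, -p'; -n, 0, q', q; -p, q', 0, -n; -p', q, -n, 0]

theorem IsUnitFieldAt.smoothAt_hermitianSq (hg : IsMetricOn g Ω) (hx : x ∈ Ω)
    (hU : IsUnitFieldAt g U x) : SmoothAt (fun y => hermitianSq (g y) (U y)) x :=
  ((hU.smooth.mul (hg.smoothAt_inv hx).toComplex).mul hU.smooth.conj).add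
    ((hU.smooth.conj.mul (hg.smoothAt_inv hx).toComplex).mul hU.smooth)

theorem IsNullTetrad.inFrame_hermitianSq {γ : Tensor2 ℝ} (h : IsNullTetrad γ E) {F : Tensor2 ℂ}
    (hu : inFrame E F = frameUnit) : inFrame E (hermitianSq γ F) =
      !![0, -1, 0, 0; -1, 0, 0, 0; 0, 0, 0, -1; 0, 0, -1, 0] := by
  rw [hermitianSq, inFrame_add, h.inFrame_mul, h.inFrame_mul, hu, h.inFrame_conj_unit hu,
    mul_nullGram, mul_nullGram, frameUnit_eq]
  have := inv_sqrt_two_sq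
  generalize (1 / Real.sqrt 2 : ℂ) = r at this
  simp
  linear_combination (-2) * this

theorem frameConformal_eq (n p q p' q' α r : ℂ) :
    n • !![0, -1, 0, 0; -1, 0, 0, 0; 0, 0, 0, -1; 0, 0, -1, 0] + α •
      (frameJet p q * nullGram * !![0, r, 0, 0; -r, 0, 0, 0; 0, 0, 0, r; 0, 0, -r, 0] +
        !![0, r, 0, 0; -r, 0, 0, 0; 0, 0, 0, -r; 0, 0, r, 0] * nullGram *
          !![0, 0, 0, p'; 0, 0, q', 0; 0, -q', 0, 0; -p', 0, 0, 0] +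
      (!![0, 0, 0, p'; 0, 0, q', 0; 0, -q', 0, 0; -p', 0, 0, 0] * nullGram *
          !![0, r, 0, 0; -r, 0, 0, 0; 0, 0, 0, -r; 0, 0, r, 0] +
        !![0, r, 0, 0; -r, 0, 0, 0; 0, 0, 0, r; 0, 0, -r, 0] * nullGram * frameJet p q)) =
      frameConformal n (2 * r * α * p) (2 * r * α * q) (2 * r * α * p') (2 * r * α * q') := by
  simp only [mul_nullGram]
  simp [frameConformal, frameJet]
  and_intros <;> ring

/-- The product rule gives four terms in the jet and its conjugate. Conjugation exchanges the
directions m and n, whence `tetradPerm` in the conjugate coefficients; √2 is twice the entry 1/√2 of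
the adapted bivector. -/
theorem IsJetFrame.cov_hermitianSq (h : IsJetFrame g U x E p q) (hg : IsMetricOn g Ω) (hx : x ∈ Ω)
    (hU : IsUnitFieldAt g U x) {α : E4 → ℝ} (hα : ContDiffAt ℝ ∞ α x) (i : Fin 4) :
    inFrame3 E (cov g (fun y => (α y : ℂ) • hermitianSq (g y) (U y)) x) i =
      frameConformal (realInFrame E (fun a => pd a α x) i) (Real.sqrt 2 * α x * p i)
        (Real.sqrt 2 * α x * q i) (Real.sqrt 2 * α x * starRingEnd ℂ (p (tetradPerm i)))
        (Real.sqrt 2 * α x * starRingEnd ℂ (q (tetradPerm i))) := by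
  have hs := hU.smooth
  have hc := hs.conj
  have hi := (hg.smoothAt_inv hx).toComplex
  have hd : DifferentiableAt ℝ α x := hα.differentiableAt (by simp)
  have h1 : cov g (fun y => (α y : ℂ) • hermitianSq (g y) (U y)) x = fun c =>
      ((pd c α x : ℝ) : ℂ) • hermitianSq (g x) (U x) + (α x : ℂ) •
      ((cov g U x c * toComplex (g x)⁻¹ * (U x).map (starRingEnd ℂ) +
        U x * toComplex (g x)⁻¹ * (cov g U x c).map (starRingEnd ℂ)) +
      ((cov g U x c).map (starRingEnd ℂ) * toComplex (g x)⁻¹ * U x +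
        (U x).map (starRingEnd ℂ) * toComplex (g x)⁻¹ * cov g U x c)) := by
    funext c
    rw [cov_smul (contDiffAt_ofReal hα |>.differentiableAt (by simp))
      (hU.smoothAt_hermitianSq hg hx), pd_ofReal hd]
    congr 2
    simp only [hermitianSq]
    rw [cov_add ((hs.mul hi).mul hc) ((hc.mul hi).mul hs), hg.cov_mul hx hs hc, hg.cov_mul hx hc hs,
      cov_conj hs]
  have h2 : inFrame3 E (fun c => (cov g U x c).map (starRingEnd ℂ)) i =
      !![0, 0, 0, starRingEnd ℂ (p (tetradPerm i)); 0, 0, starRingEnd ℂ (q (tetradPerm i)), 0;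
        0, -starRingEnd ℂ (q (tetradPerm i)), 0, 0; -starRingEnd ℂ (p (tetradPerm i)), 0, 0, 0] := by
    ext j k
    rw [h.tetrad.inFrame3_conj, h.jet]
    generalize p (tetradPerm i) = p'
    generalize q (tetradPerm i) = q'
    fin_cases j <;> fin_cases k <;> simp [tetradPerm, frameJet]
  have hr : (Real.sqrt 2 : ℂ) = 2 * (1 / Real.sqrt 2) := by
    have := sqrt_two_mul_self
    have h0 := sqrt_two_ne_zero
    field_simp
    linear_combination this
  rw [h1, inFrame3_add, inFrame3_smul, inFrame3_smul_const, inFrame3_add, inFrame3_add,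
    inFrame3_add, inFrame3_mul_left h.tetrad, inFrame3_mul_left h.tetrad,
    inFrame3_mul_right h.tetrad, inFrame3_mul_right h.tetrad, h2, h.tetrad.inFrame_hermitianSq h.unit, h.jet,
    h.unit, h.conjUnit, frameUnit_eq, frameConformal_eq, ← hr, realInFrame]

end Structure

/-! ### The conformal equation of the structure tensor -/

/-- The cyclic sum of a 3-tensor. -/
def cyclicSum {𝕜 : Type} [Add 𝕜] (T : Fin 4 → Tensor2 𝕜) (a b c : Fin 4) : 𝕜 :=
  T a b c + T b c a + T c a b

theorem inFrame3_rotate (E : Tensor2 ℂ) (T : Fin 4 → Tensor2 ℂ) (i j k : Fin 4) :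
    inFrame3 E (fun a => Matrix.of fun b c => T b c a) i j k = inFrame3 E T j k i := by
  simp only [inFrame3_apply, inFrame_apply, Matrix.of_apply, Finset.mul_sum]
  rw [sum_comm_one_two]
  refine Finset.sum_congr rfl fun a _ => Finset.sum_congr rfl fun b _ =>
    Finset.sum_congr rfl fun c _ => ?_
  ring

theorem inFrame3_cyclicSum (E : Tensor2 ℂ) (T : Fin 4 → Tensor2 ℂ) (i j k : Fin 4) :
    inFrame3 E (fun a => Matrix.of fun b c => cyclicSum T a b c) i j k =
      cyclicSum (inFrame3 E T) i j k := by
  have h1 : (fun a => (Matrix.of fun b c => cyclicSum T a b c : Tensor2 ℂ)) = fun a =>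
      (T a + Matrix.of fun b c => T b c a) +
        Matrix.of fun b c => (fun a => (Matrix.of fun b c => T b c a : Tensor2 ℂ)) b c a := rfl
  rw [h1, inFrame3_add, inFrame3_add, Matrix.add_apply, Matrix.add_apply, inFrame3_rotate,
    inFrame3_rotate, inFrame3_rotate]
  rfl

theorem cyclicSum_eq_zero_iff {E : Tensor2 ℂ} (hE : IsUnit E.det) (T : Fin 4 → Tensor2 ℂ) :
    (∀ a b c, cyclicSum T a b c = 0) ↔ ∀ i j k, cyclicSum (inFrame3 E T) i j k = 0 := by
  constructor
  · intro h i j k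
    rw [← inFrame3_cyclicSum]
    simp [h, inFrame3_apply, inFrame_apply]
  · intro h a b c
    have h1 : (fun a => (Matrix.of fun b c => cyclicSum T a b c : Tensor2 ℂ)) = 0 := by
      apply inFrame3_injective hE
      funext i
      ext j k
      rw [inFrame3_cyclicSum, h]
      simp [inFrame3_apply, inFrame_apply]
    exact congrFun (congrFun (congrFun h1 a) b) c

/-- Twelve components of the equation are enough. Those of types 002, 220, 113, 331 contain a single
coefficient of the jet, which must vanish; the other eight determine dα and t. The primed variables
stand for the conjugate jet and are independent in this computation. -/
theorem conformal_frame_forward {n p q p' q' t : Fin 4 → ℂ} {s : ℂ} (hs : s ≠ 0)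
    (h : ∀ i j k, cyclicSum (fun i => frameConformal (n i) (s * p i) (s * q i) (s * p' i) (s * q' i)
      - t i • nullGram) i j k = 0) :
    p 0 = 0 ∧ p 2 = 0 ∧ q 1 = 0 ∧ q 3 = 0 ∧
      n = (-(s / 2)) • ![p 3 + p' 2, -(q 2 + q' 3), p 1 - q' 0, p' 1 - q 0] ∧
      t = (-(s / 2)) • ![p 3 + p' 2, -(q 2 + q' 3), q' 0 - p 1, q 0 - p' 1] := by
  have e := fun i j k => h i j k
  simp only [cyclicSum] at e
  have e002 := e 0 0 2
  have e220 := e 2 2 0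
  have e113 := e 1 1 3
  have e331 := e 3 3 1
  have e001 := e 0 0 1
  have e110 := e 1 1 0
  have e223 := e 2 2 3
  have e332 := e 3 3 2
  have e023 := e 0 2 3
  have e123 := e 1 2 3
  have e201 := e 2 0 1
  have e301 := e 3 0 1
  simp [frameConformal, nullGram] at e002 e220 e113 e331 e001 e110 e223 e332 e023 e123 e201 e301
  refine ⟨e002.resolve_left hs, e220.resolve_left hs, e113.resolve_left hs, e331.resolve_left hs,
    ?_, ?_⟩
  -- For each direction one component contains n - t or n + t up to sign, another the complementary
  -- combination; half sums isolate n and half differences isolate t.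
  · funext i
    fin_cases i <;> simp
    · linear_combination (-1 / 2 : ℂ) * e001 - (1 / 2 : ℂ) * e023
    · linear_combination (-1 / 2 : ℂ) * e110 - (1 / 2 : ℂ) * e123
    · linear_combination (-1 / 2 : ℂ) * e223 - (1 / 2 : ℂ) * e201
    · linear_combination (-1 / 2 : ℂ) * e332 - (1 / 2 : ℂ) * e301
  · funext i
    fin_cases i <;> simp
    · linear_combination (1 / 2 : ℂ) * e001 - (1 / 2 : ℂ) * e023
    · linear_combination (1 / 2 : ℂ) * e110 - (1 / 2 : ℂ) * e123
    · linear_combination (-1 / 2 : ℂ) * e223 + (1 / 2 : ℂ) * e201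
    · linear_combination (-1 / 2 : ℂ) * e332 + (1 / 2 : ℂ) * e301

/-- The converse needs all components, in particular those with the conjugate jet; hence the
vanishing of p' and q' in the conjugate directions is assumed as well. -/
theorem conformal_frame_backward {n p q p' q' t : Fin 4 → ℂ} {s : ℂ}
    (hp0 : p 0 = 0) (hp2 : p 2 = 0) (hq1 : q 1 = 0) (hq3 : q 3 = 0) (hp0' : p' 0 = 0)
    (hp3' : p' 3 = 0) (hq1' : q' 1 = 0) (hq2' : q' 2 = 0)
    (hn : n = (-(s / 2)) • ![p 3 + p' 2, -(q 2 + q' 3), p 1 - q' 0, p' 1 - q 0])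
    (ht : t = (-(s / 2)) • ![p 3 + p' 2, -(q 2 + q' 3), q' 0 - p 1, q 0 - p' 1]) (i j k : Fin 4) :
    cyclicSum (fun i => frameConformal (n i) (s * p i) (s * q i) (s * p' i) (s * q' i)
      - t i • nullGram) i j k = 0 := by
  subst hn ht
  fin_cases i <;> fin_cases j <;> fin_cases k <;>
    simp [cyclicSum, frameConformal, nullGram, hp0, hp2, hq1, hq3, hp0', hp3', hq1', hq2'] <;> ring

section Conformal

variable {g : E4 → Tensor2 ℝ} {Ω : Set E4} {x : E4} {U : E4 → Tensor2 ℂ} {E : Tensor2 ℂ}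
  {p q : Fin 4 → ℂ}

theorem IsJetFrame.sigma_eq_zero_iff (h : IsJetFrame g U x E p q) :
    (∀ c a b, Spacetime.sigma g U x c a b = 0) ↔ p 0 = 0 ∧ p 2 = 0 ∧ q 1 = 0 ∧ q 3 = 0 := by
  constructor
  · intro h0
    have h1 : ∀ i, frameJet (![p 0, 0, p 2, 0] i) (![0, q 1, 0, q 3] i) = 0 := by
      intro i
      rw [← h.sigma]
      ext j k
      simp [inFrame3_apply, inFrame_apply, h0]
    have h2 := fun i => congrFun (congrFun (h1 i) 0) 2
    have h3 := fun i => congrFun (congrFun (h1 i) 1) 3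
    have e0 := h2 0
    have e2 := h2 2
    have e1 := h3 1
    have e3 := h3 3
    simp [frameJet] at e0 e1 e2 e3
    exact ⟨e0, e2, e1, e3⟩
  · rintro ⟨h0, h2, h1, h3⟩ c a b
    have h4 : (fun c => (Matrix.of (Spacetime.sigma g U x c) : Tensor2 ℂ)) = 0 := by
      apply inFrame3_injective h.tetrad.isUnit_det
      funext i
      rw [h.sigma]
      ext j k
      simp only [inFrame3_apply, inFrame_apply]
      fin_cases i <;> fin_cases j <;> fin_cases k <;> simp [frameJet, h0, h1, h2, h3]
    exact congrFun (congrFun (congrFun h4 c) a) b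

theorem IsUnitFieldAt.smoothAt_realU (hU : IsUnitFieldAt g U x) : SmoothAt (realU U) x :=
  fun a b => contDiffAt_const.mul (Complex.reCLM.contDiff.contDiffAt.comp x (hU.smooth a b))

theorem IsUnitFieldAt.smoothAt_starU (hg : IsMetricOn g Ω) (hx : x ∈ Ω)
    (hU : IsUnitFieldAt g U x) : SmoothAt (starU g U) x := hg.smoothAt_hodge hx hU.smoothAt_realU

theorem IsUnitFieldAt.smoothAt_structureTensor (hg : IsMetricOn g Ω) (hx : x ∈ Ω)
    (hU : IsUnitFieldAt g U x) : SmoothAt (structureTensor g U) x := by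
  have h1 := hU.smoothAt_realU
  have h2 := hU.smoothAt_starU hg hx
  have h3 := hg.smoothAt_inv hx
  exact ((h1.mul h3).mul h1).add ((h2.mul h3).mul h2)

theorem conformal_eq_iff {T : E4 → Tensor2 ℝ} (hT : SmoothAt T x) (t : Fin 4 → ℝ) :
    (∀ a b c, killingOp g T x a b c = g x a b * t c + g x b c * t a + g x c a * t b) ↔
      ∀ a b c, cyclicSum (fun c => cov g (fun y => toComplex (T y)) x c -
        (t c : ℂ) • toComplex (g x)) a b c = 0 := by
  refine forall_congr' fun a => forall_congr' fun b => forall_congr' fun c => ?_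
  rw [← sub_eq_zero, ← Complex.ofReal_inj]
  have h1 : ((killingOp g T x a b c - (g x a b * t c + g x b c * t a + g x c a * t b) : ℝ) : ℂ) =
      cyclicSum (fun c => cov g (fun y => toComplex (T y)) x c - (t c : ℂ) • toComplex (g x)) a b c := by
    simp only [killingOp, cyclicSum, Matrix.sub_apply, ← ofReal_covDeriv hT, Matrix.smul_apply,
      Matrix.map_apply]
    push_cast
    simp
    ring
  rw [h1]
  rfl

theorem IsJetFrame.conformal_eq_iff (h : IsJetFrame g U x E p q) (hg : IsMetricOn g Ω)
    (hx : x ∈ Ω) (hU : IsUnitFieldAt g U x) {α : E4 → ℝ} (hα : ContDiffAt ℝ ∞ α x)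
    (t : Fin 4 → ℝ) :
    (∀ a b c, killingOp g (fun y => α y • structureTensor g U y) x a b c =
      g x a b * t c + g x b c * t a + g x c a * t b) ↔
      ∀ i j k, cyclicSum (fun i => frameConformal (realInFrame E (fun a => pd a α x) i)
        (Real.sqrt 2 * α x * p i) (Real.sqrt 2 * α x * q i)
        (Real.sqrt 2 * α x * starRingEnd ℂ (p (tetradPerm i)))
        (Real.sqrt 2 * α x * starRingEnd ℂ (q (tetradPerm i))) -
        realInFrame E t i • nullGram) i j k = 0 := by
  have hS := SmoothAt.smul hα (hU.smoothAt_structureTensor hg hx)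
  rw [Spacetime.conformal_eq_iff hS,
    cyclicSum_eq_zero_iff h.tetrad.isUnit_det]
  have h1 : cov g (fun y => toComplex (α y • structureTensor g U y)) x =
      cov g (fun y => (α y : ℂ) • hermitianSq (g y) (U y)) x := by
    funext c
    refine cov_congr ?_ c
    filter_upwards [hU.unit] with y hy
    rw [← toComplex_structureTensor hy.selfDual]
    ext a b
    simp
  have h2 : inFrame3 E (fun c => cov g (fun y => toComplex (α y • structureTensor g U y)) x c -
      (t c : ℂ) • toComplex (g x)) = fun i => frameConformal (realInFrame E (fun a => pd a α x) i)
        (Real.sqrt 2 * α x * p i) (Real.sqrt 2 * α x * q i)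
        (Real.sqrt 2 * α x * starRingEnd ℂ (p (tetradPerm i)))
        (Real.sqrt 2 * α x * starRingEnd ℂ (q (tetradPerm i))) -
        realInFrame E t i • nullGram := by
    funext i
    rw [inFrame3_sub, inFrame3_smul, h1, h.cov_hermitianSq hg hx hU hα, inFrame, h.tetrad.gram]
    rfl
  rw [h2]

theorem realInFrame_smul (ξ : Fin 4 → ℝ) (r : ℝ) : realInFrame E (r • ξ) = (r : ℂ) • realInFrame E ξ := by
  funext i
  simp only [realInFrame, inFrame1, Pi.smul_apply, smul_eq_mul, Finset.mul_sum]
  refine Finset.sum_congr rfl fun a _ => ?_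
  push_cast
  ring

theorem half_sqrt_two (α : ℝ) : (Real.sqrt 2 * α / 2 : ℂ) = α * (1 / Real.sqrt 2) := by
  have := sqrt_two_mul_self
  have h0 := sqrt_two_ne_zero
  field_simp
  linear_combination (α : ℂ) * this

/-- This is the origin of the covectors a and b: the values that the tetrad equations force on dα
and t are -α times the tetrad components of a + b and of b - a. -/
theorem IsUnitFieldAt.conformal_forward (hg : IsMetricOn g Ω) (hx : x ∈ Ω)
    (hU : IsUnitFieldAt g U x) {α : E4 → ℝ} (hα : ContDiffAt ℝ ∞ α x) (h0 : α x ≠ 0)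
    {t : Fin 4 → ℝ} (h : ∀ a b c, killingOp g (fun y => α y • structureTensor g U y) x a b c =
      g x a b * t c + g x b c * t a + g x c a * t b) :
    (∀ c a b, sigma g U x c a b = 0) ∧
      (fun i => pd i α x) = (-α x) • (formA g U x + formB g U x) ∧
      t = (-α x) • (formB g U x - formA g U x) := by
  obtain ⟨E, p, q, hE⟩ := hg.exists_jetFrame hx hU
  rw [hE.conformal_eq_iff hg hx hU hα] at h
  have hs : (Real.sqrt 2 * α x : ℂ) ≠ 0 := mul_ne_zero sqrt_two_ne_zero (by exact_mod_cast h0)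
  obtain ⟨h1, h2, h3, h4, hn, ht⟩ := conformal_frame_forward
    (p' := fun i => starRingEnd ℂ (p (tetradPerm i))) (q' := fun i => starRingEnd ℂ (q (tetradPerm i)))
    hs h
  refine ⟨hE.sigma_eq_zero_iff.2 ⟨h1, h2, h3, h4⟩, ?_, ?_⟩
  · apply realInFrame_injective hE.tetrad.isUnit_det
    rw [hn, realInFrame_smul, hE.formA_add_formB hU, half_sqrt_two, smul_smul]
    push_cast
    rw [neg_mul]
    rfl
  · apply realInFrame_injective hE.tetrad.isUnit_det
    rw [ht, realInFrame_smul, hE.formB_sub_formA hU, half_sqrt_two, smul_smul]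
    push_cast
    rw [neg_mul]
    rfl

/-- The covector of the conformal equation is given explicitly, since the Killing case has to cancel
it against the derivative of the trace. No condition α ≠ 0 is needed in this direction. -/
theorem IsUnitFieldAt.conformal_backward (hg : IsMetricOn g Ω) (hx : x ∈ Ω)
    (hU : IsUnitFieldAt g U x) {α : E4 → ℝ} (hα : ContDiffAt ℝ ∞ α x)
    (hs : ∀ c a b, sigma g U x c a b = 0)
    (hd : (fun i => pd i α x) = (-α x) • (formA g U x + formB g U x)) (a b c : Fin 4) :
    killingOp g (fun y => α y • structureTensor g U y) x a b c =
      g x a b * ((-α x) • (formB g U x - formA g U x)) c +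
      g x b c * ((-α x) • (formB g U x - formA g U x)) a +
      g x c a * ((-α x) • (formB g U x - formA g U x)) b := by
  obtain ⟨E, p, q, hE⟩ := hg.exists_jetFrame hx hU
  revert a b c
  rw [hE.conformal_eq_iff hg hx hU hα]
  obtain ⟨h1, h2, h3, h4⟩ := hE.sigma_eq_zero_iff.1 hs
  refine conformal_frame_backward
    (p' := fun i => starRingEnd ℂ (p (tetradPerm i))) (q' := fun i => starRingEnd ℂ (q (tetradPerm i)))
    h1 h2 h3 h4 ?_ ?_ ?_ ?_ ?_ ?_
  · simp [tetradPerm, h1]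
  · simp [tetradPerm, h2]
  · simp [tetradPerm, h3]
  · simp [tetradPerm, h4]
  · rw [hd, realInFrame_smul, hE.formA_add_formB hU, half_sqrt_two, smul_smul]
    push_cast
    rw [neg_mul]
    rfl
  · rw [realInFrame_smul, hE.formB_sub_formA hU, half_sqrt_two, smul_smul]
    push_cast
    rw [neg_mul]
    rfl

end Conformal

/-! ### Umbilical almost-product structures are aligned with the Weyl tensor -/

section Umbilical

variable {g : E4 → Tensor2 ℝ} {Ω : Set E4} {x : E4} {U : E4 → Tensor2 ℂ} {E : Tensor2 ℂ}
  {p q : Fin 4 → ℂ}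

theorem cov_sub {F H : E4 → Tensor2 ℂ} (hF : SmoothAt F x) (hH : SmoothAt H x) (c : Fin 4) :
    cov g (fun y => F y - H y) x c = cov g F x c - cov g H x c := by
  simp only [Spacetime.cov_eq]
  rw [mpd_sub hF hH]
  noncomm_ring

/-- The 2-forms `ξ ∧ g_c`. -/
def wedgeMetric (γ : Tensor2 ℝ) (ξ : Fin 4 → ℂ) (c : Fin 4) : Tensor2 ℂ :=
  Matrix.of fun b d => ξ b * γ c d - ξ d * γ c b

theorem IsNullTetrad.inFrame_wedgeMetric {γ : Tensor2 ℝ} (h : IsNullTetrad γ E) (ξ : Fin 4 → ℂ)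
    (i j k : Fin 4) : inFrame3 E (wedgeMetric γ ξ) i j k =
      inFrame1 E ξ j * nullGram i k - inFrame1 E ξ k * nullGram i j := by
  have h1 : ∀ j k, ∑ c, E c i * ∑ a, ∑ b, E a j * E b k * (ξ a * γ c b) =
      inFrame1 E ξ j * nullGram i k := by
    intro j k
    rw [← h.gram_apply, inFrame1, Finset.sum_mul]
    simp only [Finset.mul_sum]
    rw [Finset.sum_comm]
    refine Finset.sum_congr rfl fun a _ => Finset.sum_congr rfl fun b _ =>
      Finset.sum_congr rfl fun c _ => ?_
    ring
  rw [← h1, ← h1, ← Finset.sum_sub_distrib, inFrame3_apply]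
  refine Finset.sum_congr rfl fun c _ => ?_
  rw [← mul_sub, inFrame_apply]
  congr 1
  rw [Finset.sum_comm (f := fun a b => E a k * E b j * (ξ a * γ c b)), ← Finset.sum_sub_distrib]
  refine Finset.sum_congr rfl fun a _ => ?_
  rw [← Finset.sum_sub_distrib]
  refine Finset.sum_congr rfl fun b _ => ?_
  simp only [wedgeMetric, Matrix.of_apply]
  ring

/-- The map M ↦ M/2 - `𝒰`M`𝒰` is the projector of 2-forms onto those that anticommute with `𝒰`. It
is used to write `∇𝒰` without a tetrad when `Σ = 0`, so that the formula can be differentiated. -/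
theorem frameUnit_conj {M : Tensor2 ℂ} (hM : Mᵀ = -M) :
    (1 / 2 : ℂ) • M - frameUnit * nullGram * M * nullGram * frameUnit =
      frameJet (M 0 2) (M 1 3) := by
  have hr := inv_sqrt_two_sq
  have ha : ∀ i j, M j i = -M i j := fun i j => congrFun (congrFun hM i) j
  have hd : ∀ i, M i i = 0 := fun i => by
    have := ha i i
    rwa [eq_neg_iff_add_eq_zero, ← two_mul, mul_eq_zero, or_iff_right two_ne_zero] at this
  rw [frameUnit_eq, mul_nullGram, mul_nullGram]
  generalize (1 / Real.sqrt 2 : ℂ) = r at hr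
  ext j k
  fin_cases j <;> fin_cases k <;>
    simp [frameJet, Matrix.vecMul, dotProduct, Fin.sum_univ_four, ha 0 1, ha 0 2, ha 0 3, ha 1 2,
      ha 1 3, ha 2 3, hd] <;>
    first
    | linear_combination (M 0 1) * hr
    | linear_combination (M 0 2) * hr
    | linear_combination (M 0 3) * hr
    | linear_combination (M 1 2) * hr
    | linear_combination (M 1 3) * hr
    | linear_combination (M 2 3) * hr
    | linear_combination -(M 0 1) * hr
    | linear_combination -(M 0 2) * hr
    | linear_combination -(M 0 3) * hr
    | linear_combination -(M 1 2) * hr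
    | linear_combination -(M 1 3) * hr
    | linear_combination -(M 2 3) * hr

/-- The derivative of a unitary self-dual bivector with `Σ = 0`. -/
theorem IsJetFrame.cov_eq (h : IsJetFrame g U x E p q)
    (hs : ∀ c a b, Spacetime.sigma g U x c a b = 0) (c : Fin 4) :
    cov g U x c = (1 / 2 : ℂ) • wedgeMetric (g x) (Spacetime.codiff g U x) c -
      U x * toComplex (g x)⁻¹ * wedgeMetric (g x) (Spacetime.codiff g U x) c *
        toComplex (g x)⁻¹ * U x := by
  obtain ⟨h1, h2, h3, h4⟩ := h.sigma_eq_zero_iff.1 hs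
  revert c
  apply congrFun
  apply inFrame3_injective h.tetrad.isUnit_det
  funext i
  rw [inFrame3_sub, inFrame3_smul_const, inFrame3_mul_left h.tetrad, inFrame3_mul_right h.tetrad,
    h.jet, h.unit]
  have h5 : inFrame3 E (wedgeMetric (g x) (Spacetime.codiff g U x)) i = Matrix.of fun j k =>
      ![p 3, q 2, p 1, q 0] j * nullGram i k - ![p 3, q 2, p 1, q 0] k * nullGram i j := by
    ext j k
    rw [h.tetrad.inFrame_wedgeMetric, h.codiff]
    rfl
  rw [h5, frameUnit_conj]
  · fin_cases i <;> simp [nullGram, h1, h2, h3, h4]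
  · ext j k
    simp

/-- The index c is a mere label for `cov`, which is why a Christoffel term is left over. It is
symmetric in e and c and disappears on antisymmetrization. -/
theorem IsMetricOn.cov_wedgeMetric (hg : IsMetricOn g Ω) (hx : x ∈ Ω) {ξ : E4 → Fin 4 → ℂ}
    (hξ : ∀ a, ContDiffAt ℝ ∞ (fun y => ξ y a) x) (e c : Fin 4) :
    cov g (fun y => wedgeMetric (g y) (ξ y) c) x e =
      wedgeMetric (g x) (fun b => pd e (fun y => ξ y b) x -
        ∑ f, (christoffel g x f e b : ℂ) * ξ x f) c +
      ∑ f, (christoffel g x f e c : ℂ) • wedgeMetric (g x) (ξ x) f := by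
  have hd : ∀ a, DifferentiableAt ℝ (fun y => ξ y a) x := fun a => (hξ a).differentiableAt (by simp)
  have hgd : ∀ a b, DifferentiableAt ℝ (fun y => (g y a b : ℂ)) x :=
    fun a b => (hg.smoothAt hx).toComplex.diff a b
  have hgp : ∀ a b, pd e (fun y => (g y a b : ℂ)) x = ∑ f, ((christoffel g x f e a : ℂ) * g x f b +
      g x a f * christoffel g x f e b) := by
    intro a b
    rw [pd_ofReal ((hg.smoothAt hx).diff a b)]
    have := congrFun (congrFun (hg.mpd_metric hx e) a) b
    simp only [mpd, connection, Matrix.of_apply, Matrix.add_apply, Matrix.mul_apply,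
      Matrix.transpose_apply] at this
    rw [this, ← Finset.sum_add_distrib]
    push_cast
    rfl
  ext b d
  simp only [cov, covDeriv, wedgeMetric, Matrix.of_apply, Matrix.add_apply, Matrix.sum_apply,
    Matrix.smul_apply, smul_eq_mul, Complex.real_smul]
  rw [pd_sub (f := fun y => ξ y b * (g y c d : ℂ)) (h := fun y => ξ y d * (g y c b : ℂ))
    ((hd b).mul (hgd c d)) ((hd d).mul (hgd c b)), pd_mul (hd b) (hgd c d),
    pd_mul (hd d) (hgd c b), hgp, hgp]
  simp only [Fin.sum_univ_four]
  ring

/-- The equation `Σ = 0` makes the curvature of the null planes of the structure vanish. -/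
theorem IsJetFrame.riemann_eq_zero (h : IsJetFrame g U x E p q) (hg : IsMetricOn g Ω) (hx : x ∈ Ω)
    (hU : IsUnitFieldAt g U x) (hs : ∀ᶠ y in nhds x, ∀ c a b, Spacetime.sigma g U y c a b = 0)
    {j k : Fin 4} {τ : ℂ} (hτ : τ * τ = 1 / 2)
    (hR : ∀ M : Tensor2 ℂ, (M * nullGram * frameUnit) j k = τ * M j k)
    (hL : ∀ M : Tensor2 ℂ, (frameUnit * nullGram * M) j k = -τ * M j k)
    (hJR : ∀ M : Tensor2 ℂ, (M * nullGram * frameJet (p j) (q j)) j k = 0 ∧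
      (M * nullGram * frameJet (p k) (q k)) j k = 0)
    (hJL : ∀ M : Tensor2 ℂ, (frameJet (p j) (q j) * nullGram * M) j k = 0 ∧
      (frameJet (p k) (q k) * nullGram * M) j k = 0)
    (hjj : nullGram j j = 0) (hjk : nullGram j k = 0) (hkj : nullGram k j = 0)
    (hkk : nullGram k k = 0) :
    inFrame4 E (fun a b c d => (riemann g x a b c d : ℂ)) j k j k = 0 := by
  -- The directions j, k span a totally null plane on which `𝒰` acts as the scalar τ; the cases in
  -- use are k, m with τ = 1/√2 and l, n with τ = -1/√2. The hypotheses `hJR` and `hJL` express that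
  -- `Σ = 0` removes the jet along this plane from the component jk.
  set δ := Spacetime.codiff g U with hδ
  set A : Fin 4 → E4 → Tensor2 ℂ := fun c y => wedgeMetric (g y) (δ y) c with hA
  set C : Fin 4 → Fin 4 → Tensor2 ℂ := fun e c => cov g (A c) x e with hC
  have hi := (hg.smoothAt_inv hx).toComplex
  have hδs : ∀ a, ContDiffAt ℝ ∞ (fun y => δ y a) x := by
    intro a
    refine (ContDiffAt.sum fun b _ => ContDiffAt.sum fun c _ => ?_).neg
    exact (hg.smoothAt_inv hx b c).smul (hg.smoothAt_cov hx hU.smooth c b a)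
  have hAs : ∀ c, SmoothAt (A c) x := fun c a b =>
    ((hδs a).mul ((hg.smoothAt hx).toComplex c b)).sub
      ((hδs b).mul ((hg.smoothAt hx).toComplex c a))
  have hcov : ∀ c, (fun y => cov g U y c) =ᶠ[nhds x] fun y => (1 / 2 : ℂ) • A c y -
      U y * toComplex (g y)⁻¹ * A c y * toComplex (g y)⁻¹ * U y := by
    intro c
    filter_upwards [hs, hU.eventually, hg.isOpen.mem_nhds hx] with y hy hyU hyΩ
    obtain ⟨E', p', q', h'⟩ := hg.exists_jetFrame hyΩ hyU
    exact h'.cov_eq hy c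
  have hS : ∀ e c, cov g (fun y => cov g U y c) x e = (1 / 2 : ℂ) • C e c -
      (cov g U x e * toComplex (g x)⁻¹ * A c x * toComplex (g x)⁻¹ * U x +
        U x * toComplex (g x)⁻¹ * C e c * toComplex (g x)⁻¹ * U x +
        U x * toComplex (g x)⁻¹ * A c x * toComplex (g x)⁻¹ * cov g U x e) := by
    intro e c
    have hUA := (hU.smooth.mul hi).mul (hAs c)
    rw [cov_congr (hcov c), cov_sub (SmoothAt.smul contDiffAt_const (hAs c))
      ((hUA.mul hi).mul hU.smooth), cov_smul (differentiableAt_const _) (hAs c), pd_const,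
      hg.cov_mul hx hUA hU.smooth, hg.cov_mul hx hU.smooth (hAs c)]
    simp only [zero_smul, zero_add, Matrix.add_mul, hC]
  -- On the component jk, `𝒰` contributes τ from the right and -τ from the left, so -`𝒰`C`𝒰` is τ²C
  -- = C/2 and adds to C/2.
  have hframe : ∀ e c, inFrame E (cov g (fun y => cov g U y c) x e) j k = inFrame E (C e c) j k -
      τ * ((inFrame E (cov g U x e) * nullGram * inFrame E (A c x)) j k -
        (inFrame E (A c x) * nullGram * inFrame E (cov g U x e)) j k) := by
    intro e c
    rw [hS]
    simp only [inFrame_sub, inFrame_smul, inFrame_add, h.tetrad.inFrame_mul, h.unit]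
    rw [show frameUnit * nullGram * inFrame E (A c x) * nullGram * inFrame E (cov g U x e) =
      frameUnit * nullGram * (inFrame E (A c x) * nullGram * inFrame E (cov g U x e)) by
        simp only [Matrix.mul_assoc]]
    simp only [Matrix.sub_apply, Matrix.add_apply, Matrix.smul_apply, hR, hL, smul_eq_mul]
    linear_combination (inFrame E (C e c) j k) * hτ
  -- The Christoffel terms cancel by symmetry. Each remaining term has a factor g(e_j,e_j),
  -- g(e_j,e_k) or g(e_k,e_k), zero on a totally null plane; the derivatives of `δ𝒰` never have to
  -- be known.
  have hCanti : ∑ e, ∑ c, E e j * E c k * (inFrame E (C e c) j k - inFrame E (C c e) j k) = 0 := by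
    set N : Fin 4 → Fin 4 → ℂ := fun e b => pd e (fun y => δ y b) x -
        ∑ f, (christoffel g x f e b : ℂ) * δ x f with hN
    have h1 : ∀ e c, inFrame E (C e c) j k - inFrame E (C c e) j k =
        inFrame E (wedgeMetric (g x) (N e) c) j k - inFrame E (wedgeMetric (g x) (N c) e) j k := by
      intro e c
      simp only [hC, hA]
      rw [hg.cov_wedgeMetric hx hδs, hg.cov_wedgeMetric hx hδs]
      simp only [hg.christoffel_symm hx _ e c, inFrame_add, Matrix.add_apply, hN]
      ring
    have h2 : ∀ e, ∑ c, E e j * E c k * inFrame E (wedgeMetric (g x) (N e) c) j k = 0 := by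
      intro e
      simp only [@mul_assoc ℂ _]
      rw [← Finset.mul_sum, ← inFrame3_apply, h.tetrad.inFrame_wedgeMetric, hkk, hkj]
      ring
    have h3 : ∀ c, ∑ e, E e j * E c k * inFrame E (wedgeMetric (g x) (N c) e) j k = 0 := by
      intro c
      simp only [mul_comm _ (E c k), @mul_assoc ℂ _]
      rw [← Finset.mul_sum, ← inFrame3_apply, h.tetrad.inFrame_wedgeMetric, hjj, hjk]
      ring
    simp only [h1, mul_sub, Finset.sum_sub_distrib, h2]
    rw [Finset.sum_comm]
    simp only [h3]
    simp
  have hX : ∀ i (M : Tensor2 ℂ), ∑ e, E e i * (inFrame E (cov g U x e) * nullGram * M) j k =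
      (frameJet (p i) (q i) * nullGram * M) j k := by
    intro i M
    rw [← h.jet, inFrame3, Matrix.sum_mul, Matrix.sum_mul, Matrix.sum_apply]
    simp only [Matrix.smul_mul, Matrix.smul_apply, smul_eq_mul]
  have hX' : ∀ i (M : Tensor2 ℂ), ∑ e, E e i * (M * nullGram * inFrame E (cov g U x e)) j k =
      (M * nullGram * frameJet (p i) (q i)) j k := by
    intro i M
    rw [← h.jet, inFrame3, Matrix.mul_sum, Matrix.sum_apply]
    simp only [Matrix.mul_smul, Matrix.smul_apply, smul_eq_mul]
  -- The commutator of covariant derivatives is that of the curvature with `𝒰`. Its two terms agree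
  -- on the component jk, each being τ times the curvature.
  have hricci : ∀ e c, inFrame E (cov g (fun y => cov g U y c) x e) j k -
      inFrame E (cov g (fun y => cov g U y e) x c) j k =
      2 * τ * inFrame E (Matrix.of fun a b => (riemann g x a b e c : ℂ)) j k := by
    intro e c
    set L : Tensor2 ℂ := Matrix.of fun a b => (riemann g x a b e c : ℂ) with hL'
    have h1 : toComplex (curvatureMatrix g x e c) = toComplex (g x)⁻¹ * L := by
      have : L = toComplex (g x * curvatureMatrix g x e c) := by
        ext a b
        rw [hL', Matrix.of_apply, riemann_eq]
        rfl
      rw [this, ← toComplex_mul, ← Matrix.mul_assoc,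
        Matrix.nonsing_inv_mul _ (hg.lorentz x hx).isUnit_det, Matrix.one_mul]
    have h2 : (toComplex (curvatureMatrix g x e c))ᵀ = -L * toComplex (g x)⁻¹ := by
      rw [h1, Matrix.transpose_mul, toComplex_transpose, (hg.lorentz x hx).inv_transpose]
      congr 1
      ext a b
      change ((riemann g x b a e c : ℝ) : ℂ) = -((riemann g x a b e c : ℝ) : ℂ)
      rw [hg.riemann_antisymm hx a b, Complex.ofReal_neg]
    rw [← Matrix.sub_apply, ← inFrame_sub, hg.ricci_identity hx hU.smooth, h2, h1,
      ← Matrix.mul_assoc, neg_add, neg_mul, neg_mul, neg_neg, ← sub_eq_add_neg, inFrame_sub,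
      h.tetrad.inFrame_mul, h.tetrad.inFrame_mul, h.unit, Matrix.sub_apply, hR, hL]
    ring
  have hsum : ∑ e, ∑ c, E e j * E c k * (inFrame E (cov g (fun y => cov g U y c) x e) j k -
      inFrame E (cov g (fun y => cov g U y e) x c) j k) = 0 := by
    -- The terms quadratic in first derivatives, contracted with the plane, contain the jet along
    -- e_j or e_k and vanish.
    have h1 : ∀ c, ∑ e, E e j * E c k *
        ((inFrame E (cov g U x e) * nullGram * inFrame E (A c x)) j k -
        (inFrame E (A c x) * nullGram * inFrame E (cov g U x e)) j k) = 0 := by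
      intro c
      simp only [mul_comm _ (E c k), @mul_assoc ℂ _, mul_sub, Finset.sum_sub_distrib]
      rw [← Finset.mul_sum, ← Finset.mul_sum, hX, hX', (hJL _).1, (hJR _).1]
      ring
    have h2 : ∀ e, ∑ c, E e j * E c k *
        ((inFrame E (cov g U x c) * nullGram * inFrame E (A e x)) j k -
        (inFrame E (A e x) * nullGram * inFrame E (cov g U x c)) j k) = 0 := by
      intro e
      simp only [@mul_assoc ℂ _, mul_sub, Finset.sum_sub_distrib]
      rw [← Finset.mul_sum, ← Finset.mul_sum, hX, hX', (hJL _).2, (hJR _).2]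
      ring
    calc _ = ∑ e, ∑ c, E e j * E c k * (inFrame E (C e c) j k - inFrame E (C c e) j k)
        - τ * (∑ c, ∑ e, E e j * E c k *
        ((inFrame E (cov g U x e) * nullGram * inFrame E (A c x)) j k -
        (inFrame E (A c x) * nullGram * inFrame E (cov g U x e)) j k)) +
        τ * (∑ e, ∑ c, E e j * E c k *
        ((inFrame E (cov g U x c) * nullGram * inFrame E (A e x)) j k -
        (inFrame E (A e x) * nullGram * inFrame E (cov g U x c)) j k)) := by
          rw [Finset.sum_comm (f := fun c e => E e j * E c k * (_ - _))]
          simp only [Finset.mul_sum, ← Finset.sum_sub_distrib, ← Finset.sum_add_distrib, hframe]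
          refine Finset.sum_congr rfl fun e _ => Finset.sum_congr rfl fun c _ => ?_
          ring
      _ = 0 := by simp only [h1, h2, hCanti]; simp
  have hτ0 : 2 * τ ≠ 0 := by
    intro h0
    rw [mul_eq_zero, or_iff_right two_ne_zero] at h0
    rw [h0] at hτ
    norm_num at hτ
  refine (mul_eq_zero.1 (?_ : 2 * τ * _ = 0)).resolve_left hτ0
  rw [← hsum, inFrame4_eq_right, inFrame_apply, Finset.mul_sum]
  refine Finset.sum_congr rfl fun e _ => ?_
  rw [Finset.mul_sum]
  refine Finset.sum_congr rfl fun c _ => ?_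
  rw [hricci, Matrix.of_apply]
  ring

end Umbilical

/-! ### Alignment with the principal structure of the Weyl tensor -/

section Aligned

variable {g : E4 → Tensor2 ℝ} {Ω : Set E4} {x : E4} {U : E4 → Tensor2 ℂ} {E : Tensor2 ℂ}
  {p q : Fin 4 → ℂ}

theorem inFrame4_mul_even (E G H : Tensor2 ℂ) (i j k l : Fin 4) :
    inFrame4 E (fun a b c d => G a c * H b d) i j k l = inFrame E G i k * inFrame E H j l := by
  simp only [inFrame4, inFrame_apply, Finset.sum_mul]
  simp only [Finset.mul_sum]
  refine Finset.sum_congr rfl fun a _ => ?_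
  rw [Finset.sum_comm]
  refine Finset.sum_congr rfl fun b _ => Finset.sum_congr rfl fun c _ =>
    Finset.sum_congr rfl fun d _ => ?_
  ring

theorem inFrame4_mul_odd (E G H : Tensor2 ℂ) (i j k l : Fin 4) :
    inFrame4 E (fun a b c d => G a d * H b c) i j k l = inFrame E G i l * inFrame E H j k := by
  simp only [inFrame4, inFrame_apply, Finset.sum_mul]
  simp only [Finset.mul_sum]
  refine Finset.sum_congr rfl fun a _ => ?_
  conv_rhs => rw [sum_comm_one_two]
  refine Finset.sum_congr rfl fun b _ => Finset.sum_congr rfl fun c _ =>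
    Finset.sum_congr rfl fun d _ => ?_
  ring

theorem IsNullTetrad.inFrame4_weyl (h : IsNullTetrad (g x) E) (i j k l : Fin 4) :
    inFrame4 E (fun a b c d => (weyl g x a b c d : ℂ)) i j k l =
      inFrame4 E (fun a b c d => (riemann g x a b c d : ℂ)) i j k l -
      (1 / 2) * (nullGram i k * inFrame E (toComplex (ricci g x)) j l
        - nullGram i l * inFrame E (toComplex (ricci g x)) j k
        - inFrame E (toComplex (ricci g x)) i l * nullGram j k
        + inFrame E (toComplex (ricci g x)) i k * nullGram j l) +
      (scalarCurv g x / 6 : ℂ) * (nullGram i k * nullGram j l - nullGram i l * nullGram j k) := by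
  have h1 : nullGram = inFrame E (toComplex (g x)) := h.gram.symm
  rw [h1]
  rw [← inFrame4_mul_even E (toComplex (g x)) (toComplex (ricci g x)),
    ← inFrame4_mul_odd E (toComplex (g x)) (toComplex (ricci g x)),
    ← inFrame4_mul_odd E (toComplex (ricci g x)) (toComplex (g x)),
    ← inFrame4_mul_even E (toComplex (ricci g x)) (toComplex (g x)),
    ← inFrame4_mul_even E (toComplex (g x)) (toComplex (g x)),
    ← inFrame4_mul_odd E (toComplex (g x)) (toComplex (g x))]
  simp only [inFrame4, Finset.mul_sum, ← Finset.sum_sub_distrib, ← Finset.sum_add_distrib]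
  refine Finset.sum_congr rfl fun a _ => Finset.sum_congr rfl fun b _ =>
    Finset.sum_congr rfl fun c _ => Finset.sum_congr rfl fun d _ => ?_
  simp only [weyl, toComplex, Matrix.map_apply]
  push_cast
  ring

/-- On a totally null plane the Ricci and scalar terms of the Weyl tensor drop out, and since its
bivector is self-dual the self-dual part has the same component. In Newman–Penrose terms, geodesic
shear-free k and l give Ψ₀ = Ψ₄ = 0. -/
theorem IsJetFrame.sdWeyl_eq_zero (h : IsJetFrame g U x E p q) (hg : IsMetricOn g Ω) (hx : x ∈ Ω)
    (hU : IsUnitFieldAt g U x) (hs : ∀ᶠ y in nhds x, ∀ c a b, Spacetime.sigma g U y c a b = 0) :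
    inFrame4 E (sdWeyl g x) 0 2 0 2 = 0 ∧ inFrame4 E (sdWeyl g x) 1 3 1 3 = 0 := by
  obtain ⟨h1, h2, h3, h4⟩ := h.sigma_eq_zero_iff.1 hs.self_of_nhds
  have hr := inv_sqrt_two_sq
  have e02 : inFrame4 E (fun a b c d => (riemann g x a b c d : ℂ)) 0 2 0 2 = 0 := by
    refine h.riemann_eq_zero hg hx hU hs hr ?_ ?_ ?_ ?_ ?_ ?_ ?_ ?_
    · intro M
      rw [mul_nullGram, frameUnit_eq]
      simp [mul_comm]
    · intro M
      rw [mul_nullGram, frameUnit_eq]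
      simp [Matrix.vecMul, dotProduct, Fin.sum_univ_four]
    · intro M
      simp only [mul_nullGram]
      simp [frameJet, h1, h2]
    · intro M
      simp only [mul_nullGram]
      simp [frameJet, Matrix.vecMul, dotProduct, Fin.sum_univ_four, h1, h2]
    all_goals simp [nullGram]
  have e13 : inFrame4 E (fun a b c d => (riemann g x a b c d : ℂ)) 1 3 1 3 = 0 := by
    refine h.riemann_eq_zero hg hx hU hs (τ := -(1 / Real.sqrt 2)) (by rw [neg_mul_neg, hr])
      ?_ ?_ ?_ ?_ ?_ ?_ ?_ ?_
    · intro M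
      rw [mul_nullGram, frameUnit_eq]
      simp [mul_comm]
    · intro M
      rw [mul_nullGram, frameUnit_eq]
      simp [Matrix.vecMul, dotProduct, Fin.sum_univ_four]
    · intro M
      simp only [mul_nullGram]
      simp [frameJet, h3, h4]
    · intro M
      simp only [mul_nullGram]
      simp [frameJet, Matrix.vecMul, dotProduct, Fin.sum_univ_four, h3, h4]
    all_goals simp [nullGram]
  have hW := (hg.isWeyl hx).symm.doubleForm
  have hsd : sdWeyl g x = sdPart (g x) (weyl g x) := rfl
  constructor
  · rw [hsd, h.tetrad.inFrame4_sdPart hW]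
    simp [frameHodge, h.tetrad.inFrame4_weyl, e02, nullGram]
  · rw [hsd, h.tetrad.inFrame4_sdPart hW]
    simp [frameHodge, h.tetrad.inFrame4_weyl, e13, nullGram]

/-- The structure of a conformal tensor is the principal structure of the Weyl tensor. -/
theorem IsUnitFieldAt.eq_or_eq_neg (hg : IsMetricOn g Ω) (hx : x ∈ Ω)
    (hU : IsUnitFieldAt g U x) (hs : ∀ᶠ y in nhds x, ∀ c a b, Spacetime.sigma g U y c a b = 0)
    {F : Tensor2 ℂ} (hF : IsUnitSD (g x) F)
    (hS : ∀ a b c d, tensorS g x a b c d = F a b * F c d) : F = U x ∨ F = -U x := by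
  obtain ⟨E, p, q, h⟩ := hg.exists_jetFrame hx hU
  obtain ⟨h02, h13⟩ := h.sdWeyl_eq_zero hg hx hU hs
  have hmetric : inFrame4 E (sdMetric (g x)) 0 2 0 2 = 0 ∧ inFrame4 E (sdMetric (g x)) 1 3 1 3 = 0 := by
    rw [h.tetrad.inFrame4_sdMetric, h.tetrad.inFrame4_sdMetric, permSymbol_eq, permSymbol_eq]
    simp [nullGram]
  have hten : ∀ i j, inFrame E F i j * inFrame E F i j =
      1 / (3 * rho g x) * (inFrame4 E (sdWeyl g x) i j i j -
        rho g x * inFrame4 E (sdMetric (g x)) i j i j) := by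
    intro i j
    have h1 : inFrame4 E (tensorS g x) i j i j = inFrame E F i j * inFrame E F i j := by
      simp only [inFrame4, inFrame_apply, hS, Finset.sum_mul, Finset.mul_sum]
      refine Finset.sum_congr rfl fun a _ => Finset.sum_congr rfl fun b _ =>
        Finset.sum_congr rfl fun c _ => Finset.sum_congr rfl fun d _ => ?_
      ring
    rw [← h1]
    simp only [inFrame4, Finset.mul_sum, ← Finset.sum_sub_distrib]
    refine Finset.sum_congr rfl fun a _ => Finset.sum_congr rfl fun b _ =>
        Finset.sum_congr rfl fun c _ => Finset.sum_congr rfl fun d _ => ?_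
    simp only [tensorS, Pi.smul_apply, Pi.sub_apply, smul_eq_mul]
    ring
  -- The square of this component of F is a component of `𝒮`, a combination of those of `𝒲` and `𝒢`,
  -- both of which vanish.
  have f02 : inFrame E F 0 2 = 0 := by
    have := hten 0 2
    rwa [h02, hmetric.1, mul_zero, sub_zero, mul_zero, mul_self_eq_zero] at this
  have f13 : inFrame E F 1 3 = 0 := by
    have := hten 1 3
    rwa [h13, hmetric.2, mul_zero, sub_zero, mul_zero, mul_self_eq_zero] at this
  have hsd := (h.tetrad.isSelfDual_iff F).1 hF.selfDual
  have hn := hF.norm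
  rw [h.tetrad.pairing_eq, hsd.framePairing, f02, f13] at hn
  have hr2 := inv_sqrt_two_sq
  -- Only F₀₁ is left, and the norm -1 gives F₀₁² = 1/2, which is the square of the corresponding
  -- component of `𝒰`.
  have hfac : (inFrame E F 0 1 - 1 / Real.sqrt 2) * (inFrame E F 0 1 + 1 / Real.sqrt 2) = 0 := by
    linear_combination (-1 / 2 : ℂ) * hn - hr2
  rcases mul_eq_zero.1 hfac with h0 | h0
  · left
    apply inFrame_injective h.tetrad.isUnit_det
    rw [h.unit, hsd.eq, frameUnit_eq, f02, f13, sub_eq_zero.1 h0]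
    ext i j
    fin_cases i <;> fin_cases j <;> simp
  · right
    apply inFrame_injective h.tetrad.isUnit_det
    rw [← neg_one_smul ℂ (U x), inFrame_smul, h.unit, hsd.eq, frameUnit_eq, f02, f13,
      eq_neg_of_add_eq_zero_left h0]
    ext i j
    fin_cases i <;> fin_cases j <;> simp

end Aligned

/-! ### Almost-product structures and unitary self-dual bivectors -/

/-- A phase u on a bivector is a duality rotation: it does not change its Hermitian square but
multiplies its norm by u². This freedom is used to make the norm equal to -1. -/
theorem exists_unit_phase {w : ℂ} (hw : normSq w = 1 / 4) : ∃ u : ℂ, u * u * w = 1 / 2 ∧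
    u * starRingEnd ℂ u = 1 := by
  have hw0 : w ≠ 0 := by
    rintro rfl
    norm_num at hw
  obtain ⟨u, hu⟩ := IsAlgClosed.exists_pow_nat_eq (1 / (2 * w)) (n := 2) (by norm_num)
  refine ⟨u, ?_, ?_⟩
  · rw [← pow_two, hu]
    field_simp
  · have h1 : normSq u ^ 2 = 1 := by
      rw [← map_pow, hu]
      simp [hw]
      norm_num
    have h2 : normSq u = 1 := by
      nlinarith [normSq_nonneg u]
    rw [mul_conj, h2]
    norm_num

/-- The Hermitian matrix with diagonal A, t, B and upper entries c, e, d has vanishing 2×2 minors by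
`h1` to `h4`, so up to a sign ε it is -2zz* with z = (a, f, -b). -/
theorem exists_frame_factor_aux {A t B : ℝ} {c d e : ℂ} (h1 : A * t = normSq c)
    (h2 : B * t = normSq d) (h3 : c * d = e * t) (h4 : A * B = normSq e)
    (h5 : normSq e + t ^ 2 - 2 * (c * starRingEnd ℂ d).re = 1) :
    ∃ (ε : ℝ) (f a b : ℂ), ε * ε = 1 ∧ (ε * A : ℂ) = -2 * (a * starRingEnd ℂ a) ∧
      (ε * t : ℂ) = -2 * (f * starRingEnd ℂ f) ∧ (ε * B : ℂ) = -2 * (b * starRingEnd ℂ b) ∧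
      ε * c = -2 * (a * starRingEnd ℂ f) ∧ ε * d = 2 * (f * starRingEnd ℂ b) ∧
      ε * e = 2 * (a * starRingEnd ℂ b) := by
  -- The vector z is proportional to the column of a nonzero diagonal entry, whose sign fixes ε. The
  -- entry t serves unless it is zero; then c = d = 0, `h5` gives |e| = 1, and A is a pivot because
  -- AB = 1.
  by_cases ht : t = 0
  · have hc : c = 0 := by rw [ht, mul_zero] at h1; exact normSq_eq_zero.1 h1.symm
    have hd : d = 0 := by rw [ht, mul_zero] at h2; exact normSq_eq_zero.1 h2.symm
    have he : normSq e = 1 := by simpa [ht, hc] using h5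
    have hA : A ≠ 0 := by
      rintro rfl
      rw [zero_mul, he] at h4
      norm_num at h4
    obtain ⟨ε, hε, s, hs, hsA⟩ : ∃ ε : ℝ, ε * ε = 1 ∧ ∃ s : ℝ, s ≠ 0 ∧ ε * A = -2 * (s * s) := by
      rcases lt_or_gt_of_ne hA with h | h
      · refine ⟨1, by norm_num, Real.sqrt (-A / 2), (Real.sqrt_pos.2 (by linarith)).ne', ?_⟩
        rw [Real.mul_self_sqrt (by linarith)]
        ring
      · refine ⟨-1, by norm_num, Real.sqrt (A / 2), (Real.sqrt_pos.2 (by linarith)).ne', ?_⟩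
        rw [Real.mul_self_sqrt (by linarith)]
        ring
    have hs' : (s : ℂ) ≠ 0 := by exact_mod_cast hs
    have he' : e * starRingEnd ℂ e = 1 := by rw [mul_conj, he]; norm_num
    have hAB : (A * B : ℂ) = 1 := by rw [he] at h4; exact_mod_cast h4
    have hsA' : (ε * A : ℂ) = -2 * (s * s) := by exact_mod_cast hsA
    have hε' : (ε * ε : ℂ) = 1 := by exact_mod_cast hε
    refine ⟨ε, 0, s, ε * starRingEnd ℂ e / (2 * s), hε, ?_, ?_, ?_, ?_, ?_, ?_⟩
    · rw [conj_ofReal]; exact hsA'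
    · simp [ht]
    · simp only [map_div₀, map_mul, conj_ofReal, conj_conj, map_ofNat]
      field_simp
      have : (ε * A : ℂ) * (ε * B) * 2 = 2 := by linear_combination 2 * A * B * hε' + 2 * hAB
      rw [hsA'] at this
      linear_combination -(1 / 2 : ℂ) * this + ε * ε * he' + hε'
    · simp [hc]
    · simp [hd]
    · simp only [map_div₀, map_mul, conj_ofReal, conj_conj, map_ofNat]
      field_simp
  · obtain ⟨ε, hε, s, hs, hst⟩ : ∃ ε : ℝ, ε * ε = 1 ∧ ∃ s : ℝ, s ≠ 0 ∧ ε * t = -2 * (s * s) := by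
      rcases lt_or_gt_of_ne ht with h | h
      · refine ⟨1, by norm_num, Real.sqrt (-t / 2), (Real.sqrt_pos.2 (by linarith)).ne', ?_⟩
        rw [Real.mul_self_sqrt (by linarith)]
        ring
      · refine ⟨-1, by norm_num, Real.sqrt (t / 2), (Real.sqrt_pos.2 (by linarith)).ne', ?_⟩
        rw [Real.mul_self_sqrt (by linarith)]
        ring
    have hs' : (s : ℂ) ≠ 0 := by exact_mod_cast hs
    have h1' : (A * t : ℂ) = c * starRingEnd ℂ c := by rw [mul_conj, ← h1]; push_cast; ring
    have h2' : (B * t : ℂ) = d * starRingEnd ℂ d := by rw [mul_conj, ← h2]; push_cast; ring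
    have hst' : (ε * t : ℂ) = -2 * (s * s) := by exact_mod_cast hst
    have hε' : (ε * ε : ℂ) = 1 := by exact_mod_cast hε
    refine ⟨ε, s, -ε * c / (2 * s), ε * starRingEnd ℂ d / (2 * s), hε, ?_, ?_, ?_, ?_, ?_, ?_⟩
    · simp only [map_div₀, map_mul, map_neg, conj_ofReal, map_ofNat]
      field_simp
      linear_combination (ε * A : ℂ) * hst' - ε * ε * h1'
    · rw [conj_ofReal]; exact hst'
    · simp only [map_div₀, map_mul, conj_ofReal, conj_conj, map_ofNat]
      field_simp
      linear_combination (ε * B : ℂ) * hst' - ε * ε * h2'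
    · simp only [conj_ofReal]
      field_simp
    · simp only [map_div₀, map_mul, conj_ofReal, conj_conj, map_ofNat]
      field_simp
    · simp only [map_div₀, map_mul, conj_ofReal, conj_conj, map_ofNat]
      field_simp
      linear_combination (ε * e : ℂ) * hst' + ε * ε * h3

/-- The rank-one factorization determines (f, a, b) up to a common phase. The hypothesis `h5` says
|f² + ab| = 1/2, and a suitable phase makes f² + ab equal to 1/2, that is, the norm equal to -1. -/
theorem exists_frame_factor {A t B : ℝ} {c d e : ℂ} (h1 : A * t = normSq c)
    (h2 : B * t = normSq d) (h3 : c * d = e * t) (h4 : A * B = normSq e)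
    (h5 : normSq e + t ^ 2 - 2 * (c * starRingEnd ℂ d).re = 1) :
    ∃ (ε : ℝ) (f a b : ℂ), ε * ε = 1 ∧ f * f + a * b = 1 / 2 ∧
      (ε * A : ℂ) = -2 * (a * starRingEnd ℂ a) ∧
      (ε * t : ℂ) = -2 * (f * starRingEnd ℂ f) ∧ (ε * B : ℂ) = -2 * (b * starRingEnd ℂ b) ∧
      ε * c = -2 * (a * starRingEnd ℂ f) ∧ ε * d = 2 * (f * starRingEnd ℂ b) ∧
      ε * e = 2 * (a * starRingEnd ℂ b) := by
  obtain ⟨ε, f, a, b, hε, hA, ht, hB, hc, hd, he⟩ := exists_frame_factor_aux h1 h2 h3 h4 h5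
  have hε' : (ε * ε : ℂ) = 1 := by exact_mod_cast hε
  have hw : normSq (f * f + a * b) = 1 / 4 := by
    have h5' : e * starRingEnd ℂ e + t ^ 2 - (c * starRingEnd ℂ d + starRingEnd ℂ c * d) = 1 := by
      have := congrArg (fun r : ℝ => (r : ℂ)) h5
      push_cast at this
      rw [mul_conj, ← this, show c * starRingEnd ℂ d + starRingEnd ℂ c * d =
        c * starRingEnd ℂ d + starRingEnd ℂ (c * starRingEnd ℂ d) by simp, add_conj]
      push_cast
      ring
    have hcc : ε * starRingEnd ℂ c = -2 * (starRingEnd ℂ a * f) := by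
      have := congrArg (starRingEnd ℂ) hc
      simpa [map_ofNat (starRingEnd ℂ) 2] using this
    have hdc : ε * starRingEnd ℂ d = 2 * (starRingEnd ℂ f * b) := by
      have := congrArg (starRingEnd ℂ) hd
      simpa [map_ofNat (starRingEnd ℂ) 2] using this
    have hec : ε * starRingEnd ℂ e = 2 * (starRingEnd ℂ a * b) := by
      have := congrArg (starRingEnd ℂ) he
      simpa [map_ofNat (starRingEnd ℂ) 2] using this
    apply Complex.ofReal_injective
    rw [← mul_conj]
    simp only [map_add, map_mul]
    push_cast
    have k1 : (ε * ε) * (e * starRingEnd ℂ e) = (2 * (a * starRingEnd ℂ b)) * (2 * (starRingEnd ℂ a * b)) := by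
      rw [← he, ← hec]; ring
    have k2 : (ε * ε) * (t ^ 2 : ℂ) = (-2 * (f * starRingEnd ℂ f)) * (-2 * (f * starRingEnd ℂ f)) := by
      rw [← ht]; ring
    have k3 : (ε * ε) * (c * starRingEnd ℂ d) = (-2 * (a * starRingEnd ℂ f)) * (2 * (starRingEnd ℂ f * b)) := by
      rw [← hc, ← hdc]; ring
    have k4 : (ε * ε) * (starRingEnd ℂ c * d) = (-2 * (starRingEnd ℂ a * f)) * (2 * (f * starRingEnd ℂ b)) := by
      rw [← hcc, ← hd]; ring
    rw [hε', one_mul] at k1 k2 k3 k4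
    linear_combination (1 / 4 : ℂ) * (h5' - k1 - k2 + k3 + k4)
  obtain ⟨u, hu, huu⟩ := exists_unit_phase hw
  refine ⟨ε, u * f, u * a, u * b, hε, ?_, ?_, ?_, ?_, ?_, ?_, ?_⟩
  · linear_combination hu
  all_goals simp only [map_mul]
  · linear_combination hA - 2 * (a * starRingEnd ℂ a) * -huu
  · linear_combination ht + 2 * (f * starRingEnd ℂ f) * huu
  · linear_combination hB + 2 * (b * starRingEnd ℂ b) * huu
  · linear_combination hc + 2 * (a * starRingEnd ℂ f) * huu
  · linear_combination hd - 2 * (f * starRingEnd ℂ b) * huu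
  · linear_combination he - 2 * (a * starRingEnd ℂ b) * huu

theorem frameHermitian_eq (f a b : ℂ) :
    !![0, f, a, 0; -f, 0, 0, b; -a, 0, 0, -f; 0, -b, f, 0] * nullGram *
        !![0, starRingEnd ℂ f, 0, starRingEnd ℂ a; -starRingEnd ℂ f, 0, starRingEnd ℂ b, 0;
          0, -starRingEnd ℂ b, 0, starRingEnd ℂ f; -starRingEnd ℂ a, 0, -starRingEnd ℂ f, 0] +
      !![0, starRingEnd ℂ f, 0, starRingEnd ℂ a; -starRingEnd ℂ f, 0, starRingEnd ℂ b, 0;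
          0, -starRingEnd ℂ b, 0, starRingEnd ℂ f; -starRingEnd ℂ a, 0, -starRingEnd ℂ f, 0] *
        nullGram * !![0, f, a, 0; -f, 0, 0, b; -a, 0, 0, -f; 0, -b, f, 0] =
    !![-2 * (a * starRingEnd ℂ a), -2 * (f * starRingEnd ℂ f), -2 * (a * starRingEnd ℂ f),
        -2 * (starRingEnd ℂ a * f);
      -2 * (f * starRingEnd ℂ f), -2 * (b * starRingEnd ℂ b), 2 * (f * starRingEnd ℂ b),
        2 * (starRingEnd ℂ f * b);
      -2 * (a * starRingEnd ℂ f), 2 * (f * starRingEnd ℂ b), 2 * (a * starRingEnd ℂ b),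
        -2 * (f * starRingEnd ℂ f);
      -2 * (starRingEnd ℂ a * f), 2 * (starRingEnd ℂ f * b), -2 * (f * starRingEnd ℂ f),
        2 * (starRingEnd ℂ a * b)] := by
  simp only [mul_nullGram]
  generalize starRingEnd ℂ f = f'
  generalize starRingEnd ℂ a = a'
  generalize starRingEnd ℂ b = b'
  simp
  and_intros <;> ring

theorem IsNullTetrad.trace_inv_mul {γ : Tensor2 ℝ} {E : Tensor2 ℂ} (h : IsNullTetrad γ E)
    (F : Tensor2 ℂ) : (toComplex γ⁻¹ * F).trace = (inFrame E F * nullGram).trace := by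
  rw [h.inv_eq, Matrix.mul_assoc, Matrix.trace_mul_comm, inFrame]
  simp only [Matrix.mul_assoc]

/-- An almost-product structure is the structure tensor of a unitary self-dual bivector, up to
the sign. -/
theorem IsLorentz.exists_unitSD {γ : Tensor2 ℝ} (hγ : IsLorentz γ) {S : Tensor2 ℝ} (hs : Sᵀ = S)
    (hq : S * γ⁻¹ * S = γ) (ht : (γ⁻¹ * S).trace = 0) :
    ∃ F, IsUnitSD γ F ∧ ∃ ε : ℝ, ε * ε = 1 ∧ toComplex S = (ε : ℂ) • hermitianSq γ F := by
  obtain ⟨E, hE⟩ := hγ.exists_nullTetrad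
  -- Symmetry and reality leave A, t, B real and c, d, e complex; the vanishing trace identifies the
  -- components 01 and 23.
  set T := inFrame E (toComplex S) with hT
  have hTs : ∀ i j, T j i = T i j := by
    have h1 : Tᵀ = T := by rw [hT, inFrame_transpose, toComplex_transpose, hs]
    exact fun i j => congrFun (congrFun h1 i) j
  have hTc : ∀ i j, T (tetradPerm i) (tetradPerm j) = starRingEnd ℂ (T i j) := by
    intro i j
    have h1 : (toComplex S).map (starRingEnd ℂ) = toComplex S := by ext; simp
    have h2 := hE.inFrame_conj (toComplex S) (tetradPerm i) (tetradPerm j)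
    rwa [h1, tetradPerm_tetradPerm, tetradPerm_tetradPerm] at h2
  have hTq : T * nullGram * T = nullGram := by
    rw [hT, ← hE.inFrame_mul, ← toComplex_mul, ← toComplex_mul, hq]
    exact hE.gram
  have hTt : T 0 1 = T 2 3 := by
    have h1 : (toComplex γ⁻¹ * toComplex S).trace = 0 := by
      rw [← toComplex_mul]
      have := congrArg (fun r : ℝ => (r : ℂ)) ht
      simpa [Matrix.trace] using this
    rw [hE.trace_inv_mul, ← hT, mul_nullGram] at h1
    simp [Matrix.trace, Fin.sum_univ_four, hTs 0 1, hTs 2 3] at h1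
    linear_combination (-1 / 2 : ℂ) * h1
  have e00 : ((T 0 0).re : ℂ) = T 0 0 := conj_eq_iff_re.1 (hTc 0 0).symm
  have e01 : ((T 0 1).re : ℂ) = T 0 1 := conj_eq_iff_re.1 (hTc 0 1).symm
  have e11 : ((T 1 1).re : ℂ) = T 1 1 := conj_eq_iff_re.1 (hTc 1 1).symm
  have e03 : T 0 3 = starRingEnd ℂ (T 0 2) := hTc 0 2
  have e13 : T 1 3 = starRingEnd ℂ (T 1 2) := hTc 1 2
  have e33 : T 3 3 = starRingEnd ℂ (T 2 2) := hTc 2 2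
  set A := (T 0 0).re
  set t := (T 0 1).re
  set B := (T 1 1).re
  have hTeq : T = !![(A : ℂ), (t : ℂ), T 0 2, starRingEnd ℂ (T 0 2);
      (t : ℂ), (B : ℂ), T 1 2, starRingEnd ℂ (T 1 2); T 0 2, T 1 2, T 2 2, (t : ℂ);
      starRingEnd ℂ (T 0 2), starRingEnd ℂ (T 1 2), (t : ℂ), starRingEnd ℂ (T 2 2)] := by
    ext i j
    fin_cases i <;> fin_cases j <;>
      simp [e00, e01, e11, e03, e13, e33, hTs 0 1, hTs 0 2, hTs 0 3, hTs 1 2, hTs 1 3, hTs 2 3, ← hTt]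
  generalize T 0 2 = c at *
  generalize T 1 2 = d at *
  generalize T 2 2 = e at *
  -- The entries 00, 11 and 22 of S² = g are three minor conditions; 01 and 23 together give the
  -- fourth, and 23 alone the normalization.
  have hq' := hTq
  rw [hTeq, mul_nullGram] at hq'
  have q := fun i j => congrFun (congrFun hq' i) j
  have q00 := q 0 0
  have q11 := q 1 1
  have q22 := q 2 2
  have q01 := q 0 1
  have q23 := q 2 3
  simp [nullGram] at q00 q11 q22 q01 q23
  have h5c : e * starRingEnd ℂ e + t ^ 2 - (c * starRingEnd ℂ d + starRingEnd ℂ c * d) = 1 := by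
    linear_combination q23
  obtain ⟨ε, f, a, b, hε, hfab, hA, ht', hB, hc, hd, he⟩ :=
    exists_frame_factor (A := A) (t := t) (B := B) (c := c) (d := d) (e := e)
    (by apply Complex.ofReal_injective
        rw [← mul_conj]
        push_cast
        linear_combination (-1 / 2 : ℂ) * q00)
    (by apply Complex.ofReal_injective
        rw [← mul_conj]
        push_cast
        linear_combination (-1 / 2 : ℂ) * q11)
    (by linear_combination (-1 / 2 : ℂ) * q22)
    (by apply Complex.ofReal_injective
        rw [← mul_conj]
        push_cast
        linear_combination -q01 - q23)
    (by apply Complex.ofReal_injective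
        have h6 : (2 * (c * starRingEnd ℂ d).re : ℂ) = c * starRingEnd ℂ d + starRingEnd ℂ c * d := by
          rw [show c * starRingEnd ℂ d + starRingEnd ℂ c * d =
            c * starRingEnd ℂ d + starRingEnd ℂ (c * starRingEnd ℂ d) by simp, add_conj]
          push_cast
          ring
        push_cast
        rw [← mul_conj, h6]
        exact h5c)
  have hε' : (ε * ε : ℂ) = 1 := by exact_mod_cast hε
  -- The self-dual bivector whose three free components 01, 02, 13 are f, a, b.
  set R : Tensor2 ℂ := !![0, f, a, 0; -f, 0, 0, b; -a, 0, 0, -f; 0, -b, f, 0] with hR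
  have hRF : inFrame E (E⁻¹ᵀ * R * E⁻¹) = R := inFrame_of_coframe hE.isUnit_det R
  have hsd : IsFrameSelfDual R := by
    refine ⟨?_, by simp [hR], by simp [hR], by simp [hR]⟩
    ext i j
    fin_cases i <;> fin_cases j <;> simp [hR]
  refine ⟨E⁻¹ᵀ * R * E⁻¹, ⟨?_, ?_⟩, ε, hε, ?_⟩
  · rw [hE.isSelfDual_iff, hRF]
    exact hsd
  · rw [hE.pairing_eq, hRF, hsd.framePairing]
    simp [hR]
    linear_combination (2 : ℂ) * hfab
  · apply inFrame_injective hE.isUnit_det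
    have hRc : inFrame E ((E⁻¹ᵀ * R * E⁻¹).map (starRingEnd ℂ)) =
        !![0, starRingEnd ℂ f, 0, starRingEnd ℂ a; -starRingEnd ℂ f, 0, starRingEnd ℂ b, 0;
          0, -starRingEnd ℂ b, 0, starRingEnd ℂ f; -starRingEnd ℂ a, 0, -starRingEnd ℂ f, 0] := by
      ext i j
      rw [hE.inFrame_conj, hRF]
      fin_cases i <;> fin_cases j <;> simp [hR, tetradPerm]
    rw [inFrame_smul, hermitianSq, inFrame_add, hE.inFrame_mul, hE.inFrame_mul, hRF, hRc,
      frameHermitian_eq, ← hA, ← ht', ← hB, ← hc, ← hd, ← he]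
    have hcc : -2 * (starRingEnd ℂ a * f) = ε * starRingEnd ℂ c := by
      have := congrArg (starRingEnd ℂ) hc
      simpa [map_ofNat (starRingEnd ℂ) 2] using this.symm
    have hdc : 2 * (starRingEnd ℂ f * b) = ε * starRingEnd ℂ d := by
      have := congrArg (starRingEnd ℂ) hd
      simpa [map_ofNat (starRingEnd ℂ) 2] using this.symm
    have hec : 2 * (starRingEnd ℂ a * b) = ε * starRingEnd ℂ e := by
      have := congrArg (starRingEnd ℂ) he
      simpa [map_ofNat (starRingEnd ℂ) 2] using this.symm
    rw [hcc, hdc, hec]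
    change T = _
    rw [hTeq]
    ext i j
    fin_cases i <;> fin_cases j <;> simp [← mul_assoc, hε']

/-! ### Tensors of type 2+2 -/

theorem toComplex_injective {A B : Tensor2 ℝ} (h : toComplex A = toComplex B) : A = B := by
  ext a b
  exact Complex.ofReal_injective (congrFun (congrFun h a) b)

/-- Both planes have dimension two, so a vanishing trace means β = -α and P = α(2v - g), where 2v -
g is a traceless square root of the metric. -/
theorem IsTwoPlusTwo.exists_unitSD {γ P : Tensor2 ℝ} (hγ : IsLorentz γ) (hP : IsTwoPlusTwo γ P)
    (ht : (γ⁻¹ * P).trace = 0) :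
    ∃ F, IsUnitSD γ F ∧ ∃ a : ℝ, a ≠ 0 ∧ toComplex P = (a : ℂ) • hermitianSq γ F := by
  obtain ⟨v, α, β, hαβ, hvs, hvv, hvt, hPv⟩ := hP
  have hu := hγ.isUnit_det
  have h4 : (γ⁻¹ * γ).trace = 4 := by
    rw [Matrix.nonsing_inv_mul _ hu, Matrix.trace_one]
    simp
  have hβ : β = -α := by
    rw [hPv, Matrix.mul_add, Matrix.mul_smul, Matrix.mul_smul, Matrix.mul_sub, Matrix.trace_add,
      Matrix.trace_smul, Matrix.trace_smul, Matrix.trace_sub, hvt, h4] at ht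
    simp only [smul_eq_mul] at ht
    linarith
  subst hβ
  have hα : α ≠ 0 := by
    rintro rfl
    simp at hαβ
  obtain ⟨F, hF, ε, hε, hS⟩ := hγ.exists_unitSD (S := (2 : ℝ) • v - γ)
    (by rw [Matrix.transpose_sub, Matrix.transpose_smul, hvs, hγ.transpose])
    (by
      simp only [Matrix.sub_mul, Matrix.mul_sub, Matrix.smul_mul, Matrix.mul_smul, hvv]
      rw [Matrix.mul_nonsing_inv _ hu, Matrix.one_mul, Matrix.mul_assoc, Matrix.nonsing_inv_mul _ hu,
        Matrix.mul_one, Matrix.one_mul]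
      module)
    (by
      rw [Matrix.mul_sub, Matrix.mul_smul, Matrix.trace_sub, Matrix.trace_smul, hvt, h4]
      norm_num)
  refine ⟨F, hF, α * ε, mul_ne_zero hα ?_, ?_⟩
  · rintro rfl
    norm_num at hε
  · have : P = α • ((2 : ℝ) • v - γ) := by
      rw [hPv]
      module
    rw [this, show toComplex (α • ((2 : ℝ) • v - γ)) = (α : ℂ) • toComplex ((2 : ℝ) • v - γ) by
      ext; simp, hS, smul_smul]
    push_cast
    rfl

theorem IsUnitSD.hermitianSq_sq {γ : Tensor2 ℝ} (hγ : IsLorentz γ) {F : Tensor2 ℂ}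
    (hF : IsUnitSD γ F) : hermitianSq γ F * toComplex γ⁻¹ * hermitianSq γ F = toComplex γ := by
  obtain ⟨E, hE, h0⟩ := hγ.exists_adapted hF.selfDual hF.norm
  apply inFrame_injective hE.isUnit_det
  rw [hE.inFrame_mul, hE.inFrame_hermitianSq h0, mul_nullGram, inFrame, hE.gram]
  simp [nullGram]

theorem IsUnitSD.hermitianSq_trace {γ : Tensor2 ℝ} (hγ : IsLorentz γ) {F : Tensor2 ℂ}
    (hF : IsUnitSD γ F) : (toComplex γ⁻¹ * hermitianSq γ F).trace = 0 := by
  obtain ⟨E, hE, h0⟩ := hγ.exists_adapted hF.selfDual hF.norm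
  rw [hE.trace_inv_mul, hE.inFrame_hermitianSq h0, mul_nullGram]
  simp [Matrix.trace, Fin.sum_univ_four]

theorem hermitianSq_transpose {γ : Tensor2 ℝ} (hγ : IsLorentz γ) {F : Tensor2 ℂ}
    (hF : Fᵀ = -F) : (hermitianSq γ F)ᵀ = hermitianSq γ F := by
  have hc : (F.map (starRingEnd ℂ))ᵀ = -F.map (starRingEnd ℂ) := by
    rw [← Matrix.transpose_map, hF]
    ext; simp
  rw [hermitianSq, Matrix.transpose_add, Matrix.transpose_mul, Matrix.transpose_mul,
    Matrix.transpose_mul, Matrix.transpose_mul, hF, hc, toComplex_transpose, hγ.inv_transpose]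
  simp only [neg_mul, mul_neg, neg_neg, Matrix.mul_assoc]
  rw [add_comm]

theorem hermitianSq_smul (γ : Tensor2 ℝ) (F : Tensor2 ℂ) (c : ℂ) :
    hermitianSq γ (c • F) = (c * starRingEnd ℂ c) • hermitianSq γ F := by
  have : (c • F).map (starRingEnd ℂ) = starRingEnd ℂ c • F.map (starRingEnd ℂ) := by
    ext; simp
  rw [hermitianSq, this, hermitianSq]
  simp only [Matrix.smul_mul, Matrix.mul_smul, smul_smul, smul_add]
  rw [mul_comm (starRingEnd ℂ c)]

/-- The projection of a self-dual bivector along a unitary one. -/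
theorem IsUnitSD.projection {γ : Tensor2 ℝ} (hγ : IsLorentz γ) {F X : Tensor2 ℂ}
    (hF : IsUnitSD γ F) (hX : IsSelfDual γ X) :
    (1 / 2 : ℂ) • (X + hermitianSq γ F * toComplex γ⁻¹ * X * toComplex γ⁻¹ * hermitianSq γ F) =
      (-pairing γ X F) • F := by
  obtain ⟨E, hE, h0⟩ := hγ.exists_adapted hF.selfDual hF.norm
  apply inFrame_injective hE.isUnit_det
  have hsd := (hE.isSelfDual_iff X).1 hX
  rw [inFrame_smul, inFrame_smul, inFrame_add, hE.inFrame_mul, hE.inFrame_mul,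
    hE.inFrame_hermitianSq h0, hE.pairing_eq, h0, hsd.eq, mul_nullGram, mul_nullGram, framePairing,
    nullGram_mul_mul, frameUnit_eq]
  have := inv_sqrt_two_sq
  generalize (1 / Real.sqrt 2 : ℂ) = r at this
  generalize inFrame E X 0 1 = a
  generalize inFrame E X 0 2 = b
  generalize inFrame E X 1 3 = c
  simp [Fin.sum_univ_four]
  and_intros <;>
    first
    | linear_combination (2 * a) * this
    | linear_combination -(2 * a) * this

/-- The self-dual part of a bivector. -/
def sdProjection (γ : Tensor2 ℝ) (F : Tensor2 ℂ) : Tensor2 ℂ := (1 / 2 : ℂ) • (F - I • hodge γ F)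

theorem IsLorentz.isSelfDual_sdProjection {γ : Tensor2 ℝ} (hγ : IsLorentz γ) {F : Tensor2 ℂ}
    (hF : Fᵀ = -F) : IsSelfDual γ (sdProjection γ F) := by
  obtain ⟨E, hE⟩ := hγ.exists_nullTetrad
  rw [hE.isSelfDual_iff, sdProjection, inFrame_smul, inFrame_sub, inFrame_smul, hE.inFrame_hodge F hF]
  have ha : ∀ i j, inFrame E F j i = -inFrame E F i j := by
    have : (inFrame E F)ᵀ = -inFrame E F := by
      rw [inFrame_transpose, hF]
      simp [inFrame]
    exact fun i j => congrFun (congrFun this i) j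
  have hd : ∀ i, inFrame E F i i = 0 := fun i => by
    have := ha i i
    rwa [eq_neg_iff_add_eq_zero, ← two_mul, mul_eq_zero, or_iff_right two_ne_zero] at this
  generalize inFrame E F = T at *
  refine ⟨?_, ?_, ?_, ?_⟩
  · ext i j
    fin_cases i <;> fin_cases j <;>
      simp [frameHodge, hd, ha 0 1, ha 0 2, ha 0 3, ha 1 2, ha 1 3, ha 2 3] <;> ring
  · simp [frameHodge, ← mul_assoc]
  · simp [frameHodge, ← mul_assoc]
  · simp [frameHodge, ← mul_assoc]
    try ring

theorem sdProjection_of_isSelfDual {γ : Tensor2 ℝ} {F : Tensor2 ℂ} (hF : IsSelfDual γ F) :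
    sdProjection γ F = F := by
  rw [sdProjection, hF.2, smul_smul, I_mul_I]
  module

/-- A smooth local branch of the square root. -/
theorem exists_smooth_sqrt {x : E4} {w : E4 → ℂ} (hw : ∀ᶠ y in nhds x, ContDiffAt ℝ ∞ w y)
    (h0 : w x ≠ 0) :
    ∃ s : E4 → ℂ, ∀ᶠ y in nhds x, ContDiffAt ℝ ∞ s y ∧ s y ^ 2 = w y ∧ s y ≠ 0 := by
  obtain ⟨c, hc⟩ := IsAlgClosed.exists_pow_nat_eq (w x) (n := 2) (by norm_num)
  have hc0 : c ≠ 0 := by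
    rintro rfl
    exact h0 (by rw [← hc]; simp)
  -- After division by w(x) the values are close to 1, away from the cut of the logarithm; the root
  -- is that of w(x) times the exponential of half the logarithm.
  have hslit : ∀ᶠ y in nhds x, w y / w x ∈ slitPlane := by
    have h1 : ContinuousAt (fun y => w y / w x) x :=
      hw.self_of_nhds.continuousAt.div_const _
    refine h1.eventually_mem (isOpen_slitPlane.mem_nhds ?_)
    rw [div_self h0]
    exact one_mem_slitPlane
  refine ⟨fun y => c * Complex.exp (Complex.log (w y / w x) / 2), ?_⟩
  filter_upwards [hw, hslit] with y hy hs
  have h2 : w y / w x ≠ 0 := slitPlane_ne_zero hs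
  refine ⟨?_, ?_, mul_ne_zero hc0 (Complex.exp_ne_zero _)⟩
  · refine contDiffAt_const.mul ?_
    have h3 : ContDiffAt ℝ ∞ (fun y => w y / w x) y := hy.div_const _
    have h4 : ContDiffAt ℝ ∞ Complex.log (w y / w x) :=
      (Complex.contDiffAt_log hs).restrict_scalars ℝ
    exact (((h4.comp y h3).div_const 2).cexp)
  · rw [mul_pow, hc, ← Complex.exp_nat_mul]
    push_cast
    rw [mul_div_cancel₀ _ (two_ne_zero), Complex.exp_log h2, mul_div_cancel₀ _ h0]

/-! ### Smooth unitary fields from smooth tensors of type 2+2 -/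

section UnitField

variable {g : E4 → Tensor2 ℝ} {Ω : Set E4} {x : E4} {U : E4 → Tensor2 ℂ}

theorem structureTensor_sq (hg : IsLorentz (g x)) (hU : IsUnitSD (g x) (U x)) :
    structureTensor g U x * (g x)⁻¹ * structureTensor g U x = g x := by
  apply toComplex_injective
  rw [toComplex_mul, toComplex_mul, toComplex_structureTensor hU.selfDual, hU.hermitianSq_sq hg]

theorem structureTensor_trace (hg : IsLorentz (g x)) (hU : IsUnitSD (g x) (U x)) :
    ((g x)⁻¹ * structureTensor g U x).trace = 0 := by
  apply Complex.ofReal_injective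
  have := hU.hermitianSq_trace hg
  rw [← toComplex_structureTensor hU.selfDual, ← toComplex_mul] at this
  simpa [Matrix.trace] using this

theorem structureTensor_transpose (hg : IsLorentz (g x)) (hU : IsUnitSD (g x) (U x)) :
    (structureTensor g U x)ᵀ = structureTensor g U x := by
  apply toComplex_injective
  rw [← toComplex_transpose, toComplex_structureTensor hU.selfDual,
    hermitianSq_transpose hg hU.selfDual.1]

theorem trace_inv_mul_self (hg : IsLorentz (g x)) : ((g x)⁻¹ * g x).trace = 4 := by
  rw [Matrix.nonsing_inv_mul _ hg.isUnit_det, Matrix.trace_one]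
  simp

theorem structureTensor_trace_sq (hg : IsLorentz (g x)) (hU : IsUnitSD (g x) (U x)) :
    ((g x)⁻¹ * structureTensor g U x * (g x)⁻¹ * structureTensor g U x).trace = 4 := by
  rw [Matrix.mul_assoc, Matrix.mul_assoc, ← Matrix.mul_assoc (structureTensor g U x),
    structureTensor_sq hg hU, trace_inv_mul_self hg]

/-- The factor of a multiple of the structure tensor. -/
def structureFactor (γ P S : Tensor2 ℝ) : ℝ := (1 / 4) * (γ⁻¹ * P * γ⁻¹ * S).trace

theorem structureFactor_smul (hg : IsLorentz (g x)) (hU : IsUnitSD (g x) (U x)) (a : ℝ) :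
    structureFactor (g x) (a • structureTensor g U x) (structureTensor g U x) = a := by
  rw [structureFactor, Matrix.mul_smul, Matrix.smul_mul, Matrix.smul_mul, Matrix.trace_smul,
    structureTensor_trace_sq hg hU, smul_eq_mul]
  ring

theorem SmoothAt.structureFactor (hg : IsMetricOn g Ω) (hx : x ∈ Ω) {P : E4 → Tensor2 ℝ}
    (hP : SmoothAt P x) (hU : IsUnitFieldAt g U x) :
    ContDiffAt ℝ ∞ (fun y => structureFactor (g y) (P y) (structureTensor g U y)) x := by
  have hi := hg.smoothAt_inv hx
  exact contDiffAt_const.mul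
    (((hi.mul hP).mul hi).mul (hU.smoothAt_structureTensor hg hx)).trace

theorem IsMetricOn.exists_selfDual_field (hg : IsMetricOn g Ω) {F : Tensor2 ℂ}
    (hF : IsSelfDual (g x) F) : ∃ X : E4 → Tensor2 ℂ, X x = F ∧
      ∀ y ∈ Ω, SmoothAt X y ∧ IsSelfDual (g y) (X y) := by
  refine ⟨fun y => sdProjection (g y) F, sdProjection_of_isSelfDual hF, fun y hy => ⟨?_, ?_⟩⟩
  · exact SmoothAt.smul contDiffAt_const ((smoothAt_const F).sub
      (SmoothAt.smul contDiffAt_const (hg.smoothAt_hodge hy (smoothAt_const F))))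
  · exact (hg.lorentz y hy).isSelfDual_sdProjection hF.1

/-- The projection of a self-dual bivector on the bivectors of the planes of `P`. -/
def planeProjection (γ P : Tensor2 ℝ) (X : Tensor2 ℂ) : Tensor2 ℂ :=
  (1 / 2 : ℂ) • (X + ((structureFactor γ P P)⁻¹ : ℝ) • (toComplex P * toComplex γ⁻¹ * X *
    toComplex γ⁻¹ * toComplex P))

theorem IsUnitSD.structureFactor_self {γ P : Tensor2 ℝ} (hγ : IsLorentz γ) {F : Tensor2 ℂ}
    (hF : IsUnitSD γ F) {a : ℝ} (h : toComplex P = (a : ℂ) • hermitianSq γ F) :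
    structureFactor γ P P = a ^ 2 := by
  have h1 : toComplex (γ⁻¹ * P * γ⁻¹ * P) = toComplex ((a ^ 2) • (1 : Tensor2 ℝ)) := by
    rw [toComplex_mul, toComplex_mul, toComplex_mul, h]
    simp only [Matrix.mul_smul, Matrix.smul_mul, smul_smul]
    rw [Matrix.mul_assoc, Matrix.mul_assoc, ← Matrix.mul_assoc (hermitianSq γ F),
      hF.hermitianSq_sq hγ, ← toComplex_mul, Matrix.nonsing_inv_mul _ hγ.isUnit_det]
    ext i j
    by_cases hij : i = j <;> simp [hij, pow_two]
  rw [structureFactor, toComplex_injective h1, Matrix.trace_smul, Matrix.trace_one]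
  simp
  ring

/-- The bivector F exists only pointwise and up to sign, but the projection along it is even in F
and can be written with P alone, normalized by its square. Hence it varies smoothly with P. -/
theorem IsUnitSD.planeProjection {γ P : Tensor2 ℝ} (hγ : IsLorentz γ) {F X : Tensor2 ℂ}
    (hF : IsUnitSD γ F) (hX : IsSelfDual γ X) {a : ℝ} (ha : a ≠ 0)
    (h : toComplex P = (a : ℂ) • hermitianSq γ F) :
    planeProjection γ P X = (-pairing γ X F) • F := by
  rw [← hF.projection hγ hX, Spacetime.planeProjection, hF.structureFactor_self hγ h, h]
  simp only [Matrix.mul_smul, Matrix.smul_mul, smul_smul]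
  congr 2
  rw [← Complex.coe_smul, smul_smul]
  push_cast
  rw [show ((a : ℂ) ^ 2)⁻¹ * ((a : ℂ) * a) = 1 from by
    have : (a : ℂ) ≠ 0 := by exact_mod_cast ha
    field_simp, one_smul]

theorem IsMetricOn.smoothAt_planeProjection (hg : IsMetricOn g Ω) (hx : x ∈ Ω)
    {P : E4 → Tensor2 ℝ} {X : E4 → Tensor2 ℂ} (hP : SmoothAt P x) (hX : SmoothAt X x)
    (h0 : Spacetime.structureFactor (g x) (P x) (P x) ≠ 0) :
    SmoothAt (fun y => Spacetime.planeProjection (g y) (P y) (X y)) x := by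
  have hi := hg.smoothAt_inv hx
  have hf : ContDiffAt ℝ ∞ (fun y => structureFactor (g y) (P y) (P y)) x :=
    contDiffAt_const.mul (((hi.mul hP).mul hi).mul hP).trace
  refine SmoothAt.smul contDiffAt_const (hX.add ?_)
  have h1 := (((hP.toComplex.mul hi.toComplex).mul hX).mul hi.toComplex).mul hP.toComplex
  exact fun a b => (hf.inv h0).smul (h1 a b)

/-- A smooth traceless tensor of type 2+2 is locally a multiple of the structure tensor of a smooth
field of unitary self-dual bivectors. -/
theorem IsMetricOn.exists_unitField (hg : IsMetricOn g Ω) (hx : x ∈ Ω) {P : E4 → Tensor2 ℝ}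
    (hP : ∀ᶠ y in nhds x, SmoothAt P y ∧ IsTwoPlusTwo (g y) (P y) ∧ ((g y)⁻¹ * P y).trace = 0) :
    ∃ (U : E4 → Tensor2 ℂ) (α : E4 → ℝ), IsUnitFieldAt g U x ∧ ∀ᶠ y in nhds x,
      ContDiffAt ℝ ∞ α y ∧ α y ≠ 0 ∧ P y = α y • structureTensor g U y := by
  have hΩ : ∀ᶠ y in nhds x, y ∈ Ω := hg.isOpen.mem_nhds hx
  obtain ⟨-, h22, ht⟩ := hP.self_of_nhds
  obtain ⟨F, hF, a, ha, hPF⟩ := h22.exists_unitSD (hg.lorentz x hx) ht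
  obtain ⟨X, hXx, hX⟩ := hg.exists_selfDual_field hF.selfDual
  have hsm : ∀ᶠ y in nhds x, SmoothAt (fun y => planeProjection (g y) (P y) (X y)) y := by
    filter_upwards [hP, hΩ] with y hy hyΩ
    obtain ⟨F, hF, a, ha, hPF⟩ := hy.2.1.exists_unitSD (hg.lorentz y hyΩ) hy.2.2
    refine hg.smoothAt_planeProjection hyΩ hy.1 (hX y hyΩ).1 ?_
    rw [hF.structureFactor_self (hg.lorentz y hyΩ) hPF]
    exact pow_ne_zero 2 ha
  set Z := fun y => planeProjection (g y) (P y) (X y) with hZ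
  have hw : ∀ᶠ y in nhds x, ContDiffAt ℝ ∞ (fun y => -pairing (g y) (Z y) (Z y)) y := by
    filter_upwards [hsm, hΩ] with y hy hyΩ using (hg.contDiffAt_pairing hyΩ hy hy).neg
  have hZx : Z x = F := by
    simp only [hZ]
    rw [hF.planeProjection (hg.lorentz x hx) (hXx ▸ hF.selfDual) ha hPF, hXx, hF.norm, neg_neg,
      one_smul]
  obtain ⟨s, hs⟩ := exists_smooth_sqrt hw (by simp [hZx, hF.norm])
  have hU : ∀ᶠ y in nhds x, y ∈ Ω ∧ SmoothAt P y ∧ SmoothAt (fun y => (s y)⁻¹ • Z y) y ∧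
      IsUnitSD (g y) ((s y)⁻¹ • Z y) ∧
      ∃ a : ℝ, a ≠ 0 ∧ toComplex (P y) = (a : ℂ) • hermitianSq (g y) ((s y)⁻¹ • Z y) := by
    filter_upwards [hP, hΩ, hsm, hs] with y hy hyΩ hZs ⟨hs1, hs2, hs3⟩
    have hγ := hg.lorentz y hyΩ
    obtain ⟨F, hF, a, ha, hPF⟩ := hy.2.1.exists_unitSD hγ hy.2.2
    have hZy : Z y = (-pairing (g y) (X y) F) • F :=
      hF.planeProjection hγ (hX y hyΩ).2 ha hPF
    rw [hZy, pairing_smul_left, pairing_smul_right, hF.norm] at hs2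
    -- The normalized projection is ±F for the pointwise bivector F. The sign may depend on y, but
    -- smoothness comes from the formula and the Hermitian square ignores the sign.
    have hc : ((s y)⁻¹ * -pairing (g y) (X y) F) ^ 2 = 1 := by
      have h3 := pow_ne_zero 2 hs3
      rw [mul_pow, inv_pow]
      rw [hs2] at h3 ⊢
      have h4 : pairing (g y) (X y) F ≠ 0 := by
        intro h
        simp [h] at h3
      field_simp
    have hU : (s y)⁻¹ • Z y = ((s y)⁻¹ * -pairing (g y) (X y) F) • F := by rw [hZy, smul_smul]
    refine ⟨hyΩ, hy.1, SmoothAt.smul (hs1.inv hs3) hZs, hU ▸ hF.smul_of_sq hc, a, ha, ?_⟩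
    rw [hU, hermitianSq_smul, hPF]
    rcases (sq_eq_sq_iff_eq_or_eq_neg.1 (hc.trans (one_pow 2).symm)) with h | h <;> simp [h]
  refine ⟨fun y => (s y)⁻¹ • Z y, fun y => structureFactor (g y) (P y)
    (structureTensor g (fun y => (s y)⁻¹ • Z y) y), ⟨hU.mono fun y h => h.2.2.1,
    hU.mono fun y h => h.2.2.2.1⟩, ?_⟩
  filter_upwards [eventually_eventually_nhds.2 hU] with y hy
  obtain ⟨hyΩ, hPy, hUs, hUy, a, ha, h⟩ := hy.self_of_nhds
  have h1 : P y = a • structureTensor g (fun y => (s y)⁻¹ • Z y) y := by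
    apply toComplex_injective
    rw [h, ← toComplex_structureTensor (U := fun y => (s y)⁻¹ • Z y) hUy.selfDual]
    ext i j
    simp
  have h2 : structureFactor (g y) (P y) (structureTensor g (fun y => (s y)⁻¹ • Z y) y) = a := by
    rw [h1]
    exact structureFactor_smul (hg.lorentz y hyΩ) hUy a
  refine ⟨SmoothAt.structureFactor hg hyΩ hPy ⟨hy.mono fun y h => h.2.2.1,
    hy.mono fun y h => h.2.2.2.1⟩, ?_, ?_⟩
  · rw [h2]
    exact ha
  · rw [h2]
    exact h1

end UnitField

/-! ### The canonical bivector field and its tensors -/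

section Seeds

variable {g : E4 → Tensor2 ℝ} {Ω O : Set E4} {x : E4} {U : E4 → Tensor2 ℂ}
  {X : E4 → Tensor2 ℂ} {s : E4 → ℂ}

theorem sq_starU_eq (hg : IsLorentz (g x)) (hU : IsUnitSD (g x) (U x)) :
    sq (g x) (starU g U x) = sq (g x) (realU U x) - g x := by
  rw [eq_sub_iff_add_eq, add_comm]
  exact (sub_eq_iff_eq_add.1 (sq_realU_sub_sq_starU hg hU)).symm

/-- Since S² = g and S is traceless, this exhibits U² as the projector on one of the two planes, the
time-like one. -/
theorem sq_realU_eq (hg : IsLorentz (g x)) (hU : IsUnitSD (g x) (U x)) :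
    sq (g x) (realU U x) = (1 / 2 : ℝ) • (g x + structureTensor g U x) := by
  rw [structureTensor, sq_starU_eq hg hU]
  module

theorem isTwoPlusTwo_realU (hg : IsLorentz (g x)) (hU : IsUnitSD (g x) (U x)) {α β : ℝ}
    (h : α ≠ β) :
    IsTwoPlusTwo (g x) (α • sq (g x) (realU U x) + β • (g x - sq (g x) (realU U x))) := by
  have h1 := sq_realU_eq hg hU
  refine ⟨sq (g x) (realU U x), α, β, h, ?_, ?_, ?_, rfl⟩
  · rw [h1, Matrix.IsSymm, Matrix.transpose_smul, Matrix.transpose_add, hg.transpose,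
      structureTensor_transpose hg hU]
  · rw [h1]
    simp only [Matrix.smul_mul, Matrix.mul_smul, Matrix.add_mul, Matrix.mul_add,
      structureTensor_sq hg hU, Matrix.mul_nonsing_inv _ hg.isUnit_det, Matrix.one_mul,
      Matrix.mul_assoc _ _ (g x), Matrix.nonsing_inv_mul _ hg.isUnit_det, Matrix.mul_one]
    module
  · rw [h1, Matrix.mul_smul, Matrix.mul_add, Matrix.trace_smul, Matrix.trace_add,
      trace_inv_mul_self hg, structureTensor_trace hg hU]
    norm_num

theorem isTwoPlusTwo_conformalTensor (hg : IsLorentz (g x)) (hU : IsUnitSD (g x) (U x))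
    {α : E4 → ℝ} {C : ℝ} (hα : α x ≠ 0) (hC : C ≠ 0) :
    IsTwoPlusTwo (g x) (conformalTensor g U α C x) := by
  have h0 : C * α x ≠ -(C * α x) := by
    intro h
    exact mul_ne_zero hC hα (by linarith)
  convert isTwoPlusTwo_realU hg hU h0 using 1
  rw [conformalTensor, sq_starU_eq hg hU]
  module

/-- The half difference of α and β multiplies the traceless part and the half sum the trace part.
These are the functions φ and ψ in which the Killing equation decouples. -/
theorem killingTensor_eq (hg : IsLorentz (g x)) (hU : IsUnitSD (g x) (U x)) {α β : E4 → ℝ}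
    (C D : ℝ) : killingTensor g U α β C D x = (C * ((α x - β x) / 2)) • structureTensor g U x +
      (C * ((α x + β x) / 2) + D) • g x := by
  rw [killingTensor, structureTensor, sq_starU_eq hg hU]
  module

theorem isTwoPlusTwo_killingTensor (hg : IsLorentz (g x)) (hU : IsUnitSD (g x) (U x))
    {α β : E4 → ℝ} {C D : ℝ} (h : α x ≠ β x) (hC : C ≠ 0) :
    IsTwoPlusTwo (g x) (killingTensor g U α β C D x) := by
  have h0 : C * α x + D ≠ C * β x + D := by
    intro h'
    exact h (mul_left_cancel₀ hC (by linarith))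
  convert isTwoPlusTwo_realU hg hU h0 using 1
  rw [killingTensor, sq_starU_eq hg hU]
  module

theorem IsSeed.canonicalSD_spec (hg : IsMetricOn g Ω) (ha : AlgebraicConditions g Ω) (hO : O ⊆ Ω)
    (hs : IsSeed g O X s) (hx : x ∈ O) : IsUnitSD (g x) (canonicalSD g X s x) ∧
      ∀ a b c d, tensorS g x a b c d = canonicalSD g X s x a b * canonicalSD g X s x c d :=
  Spacetime.canonicalSD_spec (hg.lorentz x (hO hx)) (hg.isWeyl (hO hx)) (ha x (hO hx)).1
    (ha x (hO hx)).2 (hs.root x hx) (hs.ne_zero x hx)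

theorem IsSeed.isUnitFieldAt (hg : IsMetricOn g Ω) (ha : AlgebraicConditions g Ω) (hO : O ⊆ Ω)
    (hs : IsSeed g O X s) (hx : x ∈ O) : IsUnitFieldAt g (canonicalSD g X s) x := by
  have hn : ∀ᶠ y in nhds x, y ∈ O := hs.isOpen.mem_nhds hx
  constructor
  · filter_upwards [hn] with y hy
    refine SmoothAt.smul ((hs.smooth_root.contDiffAt (hs.isOpen.mem_nhds hy)).inv
      (hs.ne_zero y hy)) (hg.smoothAt_act (hO hy) (hg.smooth4At_tensorS (hO hy)
      (ha y (hO hy)).1) (hs.smooth.smoothAt hs.isOpen hy))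
  · filter_upwards [hn] with y hy using (hs.canonicalSD_spec hg ha hO hy).1

/-- A suitable bivector at x is extended with constant components and then projected on the
self-dual ones. Without this existence the condition for every choice could hold vacuously. -/
theorem IsMetricOn.exists_seed (hg : IsMetricOn g Ω) (ha : AlgebraicConditions g Ω) (hx : x ∈ Ω) :
    ∃ O ⊆ Ω, x ∈ O ∧ ∃ X s, IsSeed g O X s := by
  have hΩ : ∀ᶠ y in nhds x, y ∈ Ω := hg.isOpen.mem_nhds hx
  obtain ⟨F, hF, hF0⟩ := exists_quad_ne_zero (hg.lorentz x hx) (hg.isWeyl hx) (ha x hx).1 (ha x hx).2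
  obtain ⟨X, hXx, hX⟩ := hg.exists_selfDual_field hF
  have hw : ∀ᶠ y in nhds x, ContDiffAt ℝ ∞ (fun y => quad (g y) (tensorS g y) (X y)) y := by
    filter_upwards [hΩ] with y hy using
      hg.contDiffAt_quad hy (hg.smooth4At_tensorS hy (ha y hy).1) (hX y hy).1
  obtain ⟨s, hs⟩ := exists_smooth_sqrt hw (by rw [hXx]; exact hF0)
  obtain ⟨O, hO, hOo, hxO⟩ := eventually_nhds_iff.1 (hs.and hΩ)
  refine ⟨O, fun y hy => (hO y hy).2, hxO, X, s, hOo, ?_, ?_, ?_, ?_, ?_⟩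
  · exact smoothOn_of_smoothAt fun y hy => (hX y (hO y hy).2).1
  · exact fun y hy => (hX y (hO y hy).2).2
  · exact fun y hy => (hO y hy).1.1.contDiffWithinAt
  · exact fun y hy => (hO y hy).1.2.1
  · exact fun y hy => (hO y hy).1.2.2

end Seeds

/-! ### Closed 1-forms -/

section Forms

variable {x : E4} {ξ ζ : E4 → Fin 4 → ℝ} {f h : E4 → ℝ}

/-- A 1-form is smooth at `x`. -/
def SmoothFormAt (ξ : E4 → Fin 4 → ℝ) (x : E4) : Prop :=
  ∀ i, ContDiffAt ℝ ∞ (fun y => ξ y i) x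

theorem fderiv_eq_sum_pd {V : Type} [NormedAddCommGroup V] [NormedSpace ℝ V] (f : E4 → V)
    (x u : E4) : fderiv ℝ f x u = ∑ j, u j • pd j f x := by
  have h : u = ∑ j, u j • EuclideanSpace.single j (1 : ℝ) := by
    ext k
    simp [Finset.sum_apply, Pi.single_apply]
  conv_lhs => rw [h]
  simp only [map_sum, map_smul]
  rfl

theorem eq_const_of_pd_eq_zero {N : Set E4} (hN : IsOpen N) (hc : IsPreconnected N)
    (hf : ∀ y ∈ N, DifferentiableAt ℝ f y) (h : ∀ y ∈ N, ∀ i, pd i f y = 0) :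
    ∃ C, ∀ y ∈ N, f y = C := by
  refine hN.exists_is_const_of_fderiv_eq_zero (𝕜 := ℝ) hc (fun y hy => (hf y hy).differentiableWithinAt) ?_
  intro y hy
  ext u
  simp [fderiv_eq_sum_pd, h y hy]

/-- The Poincaré lemma for 1-forms. -/
theorem exists_potential (h : ∀ᶠ y in nhds x, SmoothFormAt ξ y ∧ extDeriv1 ξ y = 0) :
    ∃ f : E4 → ℝ, ∀ᶠ y in nhds x, ContDiffAt ℝ ∞ f y ∧ ∀ i, pd i f y = ξ y i := by
  obtain ⟨r, hr, hb⟩ := Metric.eventually_nhds_iff_ball.1 h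
  let w : E4 → E4 →L[ℝ] ℝ := fun y => ∑ i, ξ y i • (EuclideanSpace.proj i : E4 →L[ℝ] ℝ)
  have hws : ∀ y ∈ Metric.ball x r, ContDiffAt ℝ ∞ w y := fun y hy =>
    ContDiffAt.sum fun i _ => ((hb y hy).1 i).smul contDiffAt_const
  have hwd : ∀ y ∈ Metric.ball x r, ∀ u v, fderiv ℝ w y u v =
      ∑ i, ∑ j, u j * v i * pd j (fun y => ξ y i) y := by
    intro y hy u v
    have hd : ∀ i, DifferentiableAt ℝ (fun y => ξ y i) y := fun i =>
      ((hb y hy).1 i).differentiableAt (by simp)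
    have h1 : HasFDerivAt w (∑ i, (fderiv ℝ (fun y => ξ y i) y).smulRight
        (EuclideanSpace.proj i : E4 →L[ℝ] ℝ)) y := by
      refine HasFDerivAt.fun_sum fun i _ => ?_
      exact (hd i).hasFDerivAt.smul_const (EuclideanSpace.proj i : E4 →L[ℝ] ℝ)
    rw [h1.fderiv]
    simp only [_root_.sum_apply, ContinuousLinearMap.smulRight_apply,
      _root_.smul_apply, fderiv_eq_sum_pd, smul_eq_mul, Finset.sum_mul]
    refine Finset.sum_congr rfl fun i _ => Finset.sum_congr rfl fun j _ => ?_
    rw [PiLp.proj_apply]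
    ring
  -- The form is regarded as a map w into the dual of ℝ⁴; closedness is the symmetry of its
  -- derivative.
  obtain ⟨f, hf⟩ := (convex_ball x r).exists_forall_hasFDerivAt_of_fderiv_symmetric
    Metric.isOpen_ball
    (fun y hy => ((hws y hy).differentiableAt (by simp) : DifferentiableAt ℝ w y).differentiableWithinAt) (by
      intro y hy u v
      rw [hwd y hy, hwd y hy, Finset.sum_comm]
      refine Finset.sum_congr rfl fun i _ => Finset.sum_congr rfl fun j _ => ?_
      have := congrFun (congrFun (hb y hy).2 i) j
      simp only [extDeriv1, Matrix.of_apply, Matrix.zero_apply] at this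
      linear_combination (u i * v j) * this)
  have hfs : ContDiffOn ℝ ∞ f (Metric.ball x r) := by
    rw [contDiffOn_infty_iff_fderiv_of_isOpen Metric.isOpen_ball]
    refine ⟨fun y hy => (hf y hy).differentiableAt.differentiableWithinAt, fun y hy => ?_⟩
    refine ((hws y hy).congr_of_eventuallyEq ?_).contDiffWithinAt
    filter_upwards [Metric.isOpen_ball.mem_nhds hy] with z hz using (hf z hz).fderiv
  refine ⟨f, ?_⟩
  filter_upwards [Metric.ball_mem_nhds x hr] with y hy
  refine ⟨hfs.contDiffAt (Metric.isOpen_ball.mem_nhds hy), fun i => ?_⟩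
  rw [pd, (hf y hy).fderiv]
  simp [w]

theorem extDeriv1_congr (h : ξ =ᶠ[nhds x] ζ) : extDeriv1 ξ x = extDeriv1 ζ x := by
  ext i j
  simp only [extDeriv1, Matrix.of_apply]
  rw [pd_congr (f := fun y => ξ y j) (h := fun y => ζ y j) (h.mono fun y hy => by simp only [hy]),
    pd_congr (f := fun y => ξ y i) (h := fun y => ζ y i) (h.mono fun y hy => by simp only [hy])]

theorem extDeriv1_pd (hf : ContDiffAt ℝ ∞ f x) : extDeriv1 (fun y i => pd i f y) x = 0 := by
  ext i j
  simp only [extDeriv1, Matrix.of_apply, Matrix.zero_apply]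
  rw [pd_comm hf, sub_self]

theorem extDeriv1_mul (hf : DifferentiableAt ℝ f x) (hξ : SmoothFormAt ξ x) (i j : Fin 4) :
    extDeriv1 (fun y i => f y * ξ y i) x i j =
      f x * extDeriv1 ξ x i j + (pd i f x * ξ x j - pd j f x * ξ x i) := by
  have h := fun i => (hξ i).differentiableAt (n := ∞) (by simp)
  simp only [extDeriv1, Matrix.of_apply]
  rw [pd_mul hf (h i), pd_mul hf (h j)]
  ring

theorem pd_log_abs (i : Fin 4) (hf : DifferentiableAt ℝ f x) (h0 : f x ≠ 0) :
    pd i (fun y => Real.log |f y|) x = pd i f x / f x := by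
  simp only [Real.log_abs, pd]
  rw [fderiv.log hf h0, _root_.smul_apply, smul_eq_mul]
  ring

theorem SmoothFormAt.add (hξ : SmoothFormAt ξ x) (hζ : SmoothFormAt ζ x) :
    SmoothFormAt (fun y => ξ y + ζ y) x := fun i => (hξ i).add (hζ i)

theorem SmoothFormAt.sub (hξ : SmoothFormAt ξ x) (hζ : SmoothFormAt ζ x) :
    SmoothFormAt (fun y => ξ y - ζ y) x := fun i => (hξ i).sub (hζ i)

theorem SmoothFormAt.extDeriv1_add (hξ : SmoothFormAt ξ x) (hζ : SmoothFormAt ζ x) :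
    extDeriv1 (fun y => ξ y + ζ y) x = extDeriv1 ξ x + extDeriv1 ζ x := by
  have h := fun i => (hξ i).differentiableAt (n := ∞) (by simp)
  have h' := fun i => (hζ i).differentiableAt (n := ∞) (by simp)
  ext i j
  simp only [extDeriv1, Matrix.of_apply, Pi.add_apply, Matrix.add_apply]
  rw [pd_add (h j) (h' j), pd_add (h i) (h' i)]
  ring

theorem SmoothFormAt.extDeriv1_sub (hξ : SmoothFormAt ξ x) (hζ : SmoothFormAt ζ x) :
    extDeriv1 (fun y => ξ y - ζ y) x = extDeriv1 ξ x - extDeriv1 ζ x := by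
  have h := fun i => (hξ i).differentiableAt (n := ∞) (by simp)
  have h' := fun i => (hζ i).differentiableAt (n := ∞) (by simp)
  ext i j
  simp only [extDeriv1, Matrix.of_apply, Pi.sub_apply, Matrix.sub_apply]
  rw [pd_sub (h j) (h' j), pd_sub (h i) (h' i)]
  ring

/-- A 1-form with an integrating factor which solves `dα = -α ξ` is closed. -/
theorem extDeriv1_eq_zero_of_factor (hf : ContDiffAt ℝ ∞ f x) (h0 : f x ≠ 0)
    (h : ∀ᶠ y in nhds x, (fun i => pd i f y) = (-f y) • ξ y) : extDeriv1 ξ x = 0 := by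
  have hne : ∀ᶠ y in nhds x, f y ≠ 0 := hf.continuousAt.eventually_ne h0
  have hd : ∀ᶠ y in nhds x, DifferentiableAt ℝ f y := by
    filter_upwards [(hf.of_le (m := 1) (by simp)).eventually (by simp)] with y hy using
      hy.differentiableAt (by simp)
  have h1 : ContDiffAt ℝ ∞ (fun y => -Real.log |f y|) x := by
    simp only [Real.log_abs]
    exact (hf.log h0).neg
  rw [← extDeriv1_pd h1]
  apply extDeriv1_congr
  filter_upwards [hne, hd, h] with y hy hdy hyf
  funext i
  rw [pd_neg, pd_log_abs i hdy hy, congrFun hyf i]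
  simp only [Pi.smul_apply, smul_eq_mul]
  field_simp

/-- The integrability of `dψ = φ (b - a)`, when `dφ = -φ (a + b)`. -/
theorem extDeriv1_factor_mul {a b : E4 → Fin 4 → ℝ} (ha : SmoothFormAt a x) (hb : SmoothFormAt b x)
    (hf : DifferentiableAt ℝ f x) (hd : (fun i => pd i f x) = (-f x) • (a x + b x))
    (hc : extDeriv1 (fun y => a y + b y) x = 0) :
    extDeriv1 (fun y i => f y * (b y - a y) i) x =
      (2 * f x) • (extDeriv1 b x + wedge1 (b x) (a x)) := by
  rw [ha.extDeriv1_add hb] at hc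
  ext i j
  rw [extDeriv1_mul hf (hb.sub ha), hb.extDeriv1_sub ha]
  have h1 := congrFun (congrFun hc i) j
  have h2 := congrFun hd i
  have h3 := congrFun hd j
  simp only [Matrix.add_apply, Matrix.zero_apply, Pi.smul_apply, Pi.add_apply, smul_eq_mul] at h1 h2 h3
  simp only [Matrix.sub_apply, Matrix.smul_apply, Matrix.add_apply, wedge1, Matrix.of_apply,
    Pi.sub_apply, h2, h3, smul_eq_mul]
  -- The term dφ ∧ (b - a) = -φ(a + b) ∧ (b - a) equals 2φ b ∧ a, and da = -db turns φ d(b - a) into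
  -- 2φ db.
  linear_combination (-f x) * h1

end Forms

/-! ### Conformal tensors in terms of the canonical bivector -/

section Factor

variable {g : E4 → Tensor2 ℝ} {Ω : Set E4} {x : E4} {U : E4 → Tensor2 ℂ}

theorem IsMetricOn.contDiffAt_covDeriv (hg : IsMetricOn g Ω) (hx : x ∈ Ω) {F : E4 → Tensor2 ℝ}
    (hF : SmoothAt F x) (c a b : Fin 4) : ContDiffAt ℝ ∞ (fun y => covDeriv g F y c a b) x := by
  have h := hg.smoothAt_connection hx c
  simp only [covDeriv]
  exact (contDiffAt_pd (hF a b)).sub (ContDiffAt.sum fun d _ =>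
    ((h d a).smul (hF d b)).add ((h d b).smul (hF a d)))

theorem IsMetricOn.smoothFormAt_interior_codiff (hg : IsMetricOn g Ω) (hx : x ∈ Ω)
    {F : E4 → Tensor2 ℝ} (hF : SmoothAt F x) :
    SmoothFormAt (fun y => interior (g y) (codiff g F y) (F y)) x := by
  have hi := hg.smoothAt_inv hx
  have h1 : SmoothFormAt (codiff g F) x := fun b =>
    (ContDiffAt.sum fun a _ => ContDiffAt.sum fun c _ =>
      (hi a c).smul (hg.contDiffAt_covDeriv hx hF c a b)).neg
  exact fun b => ContDiffAt.sum fun a _ => ContDiffAt.sum fun c _ =>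
    (hi a c).smul ((h1 c).mul (hF a b))

theorem IsUnitFieldAt.smoothFormAt_formA (hg : IsMetricOn g Ω) (hx : x ∈ Ω)
    (hU : IsUnitFieldAt g U x) : SmoothFormAt (formA g U) x := fun i =>
  (hg.smoothFormAt_interior_codiff hx (hU.smoothAt_starU hg hx) i).neg

theorem IsUnitFieldAt.smoothFormAt_formB (hg : IsMetricOn g Ω) (hx : x ∈ Ω)
    (hU : IsUnitFieldAt g U x) : SmoothFormAt (formB g U) x :=
  hg.smoothFormAt_interior_codiff hx hU.smoothAt_realU

theorem killingOp_congr {T S : E4 → Tensor2 ℝ} (h : T =ᶠ[nhds x] S) (a b c : Fin 4) :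
    killingOp g T x a b c = killingOp g S x a b c := by
  simp only [killingOp, covDeriv_congr h]

theorem IsMetricOn.covDeriv_add_smul (hg : IsMetricOn g Ω) (hx : x ∈ Ω) {T : E4 → Tensor2 ℝ}
    (hT : SmoothAt T x) {f : E4 → ℝ} (hf : ContDiffAt ℝ ∞ f x) (c a b : Fin 4) :
    covDeriv g (fun y => T y + f y • g y) x c a b = covDeriv g T x c a b + pd c f x * g x a b := by
  have hgx := hg.smoothAt hx
  have hfd : DifferentiableAt ℝ f x := hf.differentiableAt (by simp)
  apply Complex.ofReal_injective
  rw [ofReal_covDeriv (hT.add (SmoothAt.smul hf hgx))]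
  have h1 : (fun y => toComplex (T y + f y • g y)) =
      fun y => toComplex (T y) + (f y : ℂ) • toComplex (g y) := by
    funext y
    ext i j
    simp
  rw [h1, cov_add hT.toComplex (SmoothAt.smul (contDiffAt_ofReal hf) hgx.toComplex),
    cov_smul ((contDiffAt_ofReal hf).differentiableAt (by simp)) hgx.toComplex, hg.cov_metric hx,
    pd_ofReal hfd]
  push_cast
  rw [ofReal_covDeriv hT]
  simp

theorem IsMetricOn.killingOp_add_smul (hg : IsMetricOn g Ω) (hx : x ∈ Ω) {T : E4 → Tensor2 ℝ}
    (hT : SmoothAt T x) {f : E4 → ℝ} (hf : ContDiffAt ℝ ∞ f x) (a b c : Fin 4) :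
    killingOp g (fun y => T y + f y • g y) x a b c = killingOp g T x a b c +
      (g x a b * pd c f x + g x b c * pd a f x + g x c a * pd b f x) := by
  simp only [killingOp, hg.covDeriv_add_smul hx hT hf]
  ring

/-- `U` is a smooth field of unitary self-dual bivectors around `x`, and `𝒮 = U ⊗ U`. -/
structure IsCanonicalAt (g : E4 → Tensor2 ℝ) (U : E4 → Tensor2 ℂ) (x : E4) : Prop where
  field : IsUnitFieldAt g U x
  tensorS_eq : ∀ᶠ y in nhds x, ∀ a b c d, tensorS g y a b c d = U y a b * U y c d

/-- `P` is a conformal tensor of type 2+2 at `x`. -/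
structure IsConformalAt (g : E4 → Tensor2 ℝ) (P : E4 → Tensor2 ℝ) (x : E4) : Prop where
  smooth : SmoothAt P x
  twoPlusTwo : IsTwoPlusTwo (g x) (P x)
  traceless : ((g x)⁻¹ * P x).trace = 0
  conformal : ∃ t : Fin 4 → ℝ, ∀ a b c,
    killingOp g P x a b c = g x a b * t c + g x b c * t a + g x c a * t b

/-- `Σ = 0` is obtained in a neighbourhood and not only at x, because the alignment argument
differentiates it once more. -/
theorem IsMetricOn.exists_aligned_field (hg : IsMetricOn g Ω) (hx : x ∈ Ω) {P : E4 → Tensor2 ℝ}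
    (hP : ∀ᶠ y in nhds x, IsConformalAt g P y) :
    ∃ (U : E4 → Tensor2 ℂ) (α : E4 → ℝ), IsUnitFieldAt g U x ∧
      ∀ᶠ y in nhds x, α y ≠ 0 ∧ P y = α y • structureTensor g U y ∧
        ∀ c a b, sigma g U y c a b = 0 := by
  have hΩ : ∀ᶠ y in nhds x, y ∈ Ω := hg.isOpen.mem_nhds hx
  obtain ⟨U, α, hU, h⟩ := hg.exists_unitField hx
    (hP.mono fun y hy => ⟨hy.smooth, hy.twoPlusTwo, hy.traceless⟩)
  refine ⟨U, α, hU, ?_⟩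
  filter_upwards [eventually_eventually_nhds.2 h, hU.eventually, hΩ, hP] with y hy hUy hyΩ hPy
  obtain ⟨h1, h2, h3⟩ := hy.self_of_nhds
  obtain ⟨t, ht⟩ := hPy.conformal
  refine ⟨h2, h3, (hUy.conformal_forward hg hyΩ h1 h2 (t := t) fun a b c => ?_).1⟩
  rw [← ht]
  refine killingOp_congr ?_ a b c
  filter_upwards [hy] with z hz using hz.2.2.symm

theorem structureTensor_congr {V : E4 → Tensor2 ℂ} (hU : IsUnitSD (g x) (U x))
    (hV : IsUnitSD (g x) (V x)) (h : V x = U x ∨ V x = -U x) :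
    structureTensor g V x = structureTensor g U x := by
  apply toComplex_injective
  rw [toComplex_structureTensor hU.selfDual, toComplex_structureTensor hV.selfDual]
  rcases h with h | h
  · rw [h]
  · rw [h, ← neg_one_smul ℂ, hermitianSq_smul]
    simp

/-- The factor of a conformal tensor of type 2+2 with respect to the canonical bivector. -/
theorem IsCanonicalAt.eventually_factor (hg : IsMetricOn g Ω) (hx : x ∈ Ω)
    (hU : IsCanonicalAt g U x) {P : E4 → Tensor2 ℝ} (hP : ∀ᶠ y in nhds x, IsConformalAt g P y) :
    ∀ᶠ y in nhds x, structureFactor (g y) (P y) (structureTensor g U y) ≠ 0 ∧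
      P y = structureFactor (g y) (P y) (structureTensor g U y) • structureTensor g U y := by
  have hΩ : ∀ᶠ y in nhds x, y ∈ Ω := hg.isOpen.mem_nhds hx
  obtain ⟨V, α, hV, h⟩ := hg.exists_aligned_field hx hP
  filter_upwards [eventually_eventually_nhds.2 h, hV.eventually, hU.field.unit, hU.tensorS_eq, hΩ]
    with y hy hVy hUy hSy hyΩ
  obtain ⟨h1, h2, -⟩ := hy.self_of_nhds
  -- The field built from P and the canonical one agree up to a sign at each point, so their
  -- structure tensors are equal.
  have h3 := hVy.eq_or_eq_neg hg hyΩ (hy.mono fun z hz => hz.2.2) hUy hSy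
  have h4 := structureTensor_congr hVy.unit.self_of_nhds hUy h3
  rw [← h4] at h2
  have h5 : structureFactor (g y) (P y) (structureTensor g U y) = α y := by
    rw [h2, structureFactor_smul (hg.lorentz y hyΩ) hUy]
  rw [h5]
  exact ⟨h1, h2⟩

/-- The factor is the explicit contraction `structureFactor` of P with S, the same function around
every point. It is therefore defined on all of a connected set, where solutions are later compared.
-/
theorem IsCanonicalAt.conformal_factor (hg : IsMetricOn g Ω) (hx : x ∈ Ω)
    (hU : IsCanonicalAt g U x) {P : E4 → Tensor2 ℝ} (hP : ∀ᶠ y in nhds x, IsConformalAt g P y)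
    {α : E4 → ℝ} (hα : α = fun y => structureFactor (g y) (P y) (structureTensor g U y)) :
    ContDiffAt ℝ ∞ α x ∧ α x ≠ 0 ∧ P x = α x • structureTensor g U x ∧
      (∀ c a b, sigma g U x c a b = 0) ∧
      (fun i => pd i α x) = (-α x) • (formA g U x + formB g U x) ∧
      ∀ t : Fin 4 → ℝ, (∀ a b c, killingOp g P x a b c =
        g x a b * t c + g x b c * t a + g x c a * t b) →
        t = (-α x) • (formB g U x - formA g U x) := by
  have h := hU.eventually_factor hg hx hP
  have hs := SmoothAt.structureFactor hg hx hP.self_of_nhds.smooth hU.field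
  rw [← hα] at hs
  obtain ⟨h1, h2⟩ := h.self_of_nhds
  have hx1 : α x = structureFactor (g x) (P x) (structureTensor g U x) := by rw [hα]
  rw [← hx1] at h1 h2
  have h3 : ∀ a b c, killingOp g (fun y => α y • structureTensor g U y) x a b c =
      killingOp g P x a b c := by
    refine killingOp_congr ?_
    filter_upwards [h] with z hz
    rw [hα]
    exact hz.2.symm
  obtain ⟨t, ht⟩ := hP.self_of_nhds.conformal
  have h4 := hU.field.conformal_forward hg hx hs h1 (t := t) fun a b c => by rw [h3, ht]
  refine ⟨hs, h1, h2, h4.1, h4.2.1, fun t ht => ?_⟩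
  exact (hU.field.conformal_forward hg hx hs h1 (t := t) fun a b c => by rw [h3, ht]).2.2

theorem IsCanonicalAt.eventually (hU : IsCanonicalAt g U x) :
    ∀ᶠ y in nhds x, IsCanonicalAt g U y := by
  filter_upwards [hU.field.eventually, eventually_eventually_nhds.2 hU.tensorS_eq] with y h1 h2
    using ⟨h1, h2⟩

theorem IsCanonicalAt.conformalEqs (hg : IsMetricOn g Ω) (hx : x ∈ Ω)
    (hU : IsCanonicalAt g U x) {P : E4 → Tensor2 ℝ} (hP : ∀ᶠ y in nhds x, IsConformalAt g P y) :
    ConformalEqs g U x := by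
  have hΩ : ∀ᶠ y in nhds x, y ∈ Ω := hg.isOpen.mem_nhds hx
  have h := hU.conformal_factor hg hx hP rfl
  refine ⟨h.2.2.2.1, extDeriv1_eq_zero_of_factor h.1 h.2.1 ?_⟩
  filter_upwards [hU.eventually, hΩ, eventually_eventually_nhds.2 hP] with y h1 h2 h3
    using (h1.conformal_factor hg h2 h3 rfl).2.2.2.2.1

end Factor

/-! ### Killing tensors in terms of the canonical bivector -/

section Killing

variable {g : E4 → Tensor2 ℝ} {Ω : Set E4} {x : E4} {U : E4 → Tensor2 ℂ}

/-- `K` is a Killing tensor of type 2+2 at `x`. -/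
structure IsKillingAt (g : E4 → Tensor2 ℝ) (K : E4 → Tensor2 ℝ) (x : E4) : Prop where
  smooth : SmoothAt K x
  twoPlusTwo : IsTwoPlusTwo (g x) (K x)
  killing : ∀ a b c, killingOp g K x a b c = 0

/-- A quarter of the trace. -/
def meanTrace (γ K : Tensor2 ℝ) : ℝ := (1 / 4) * (γ⁻¹ * K).trace

/-- The traceless part. -/
def tracelessPart (γ K : Tensor2 ℝ) : Tensor2 ℝ := K + (-meanTrace γ K) • γ

theorem IsLorentz.trace_inv_mul_tracelessPart {γ K : Tensor2 ℝ} (hγ : IsLorentz γ) :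
    (γ⁻¹ * tracelessPart γ K).trace = 0 := by
  rw [tracelessPart, Matrix.mul_add, Matrix.mul_smul, Matrix.trace_add, Matrix.trace_smul,
    Matrix.nonsing_inv_mul _ hγ.isUnit_det, Matrix.trace_one, meanTrace]
  simp
  ring

theorem IsTwoPlusTwo.tracelessPart {γ K : Tensor2 ℝ} (h : IsTwoPlusTwo γ K) :
    IsTwoPlusTwo γ (tracelessPart γ K) := by
  obtain ⟨v, α, β, h0, h1, h2, h3, h4⟩ := h
  refine ⟨v, α - meanTrace γ K, β - meanTrace γ K, fun h => h0 (by linarith), h1, h2, h3, ?_⟩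
  rw [Spacetime.tracelessPart]
  generalize meanTrace γ K = m
  rw [h4]
  module

theorem IsMetricOn.contDiffAt_meanTrace (hg : IsMetricOn g Ω) (hx : x ∈ Ω) {K : E4 → Tensor2 ℝ}
    (hK : SmoothAt K x) : ContDiffAt ℝ ∞ (fun y => meanTrace (g y) (K y)) x :=
  contDiffAt_const.mul ((hg.smoothAt_inv hx).mul hK).trace

/-- Removing the trace ψg from a Killing tensor subtracts the cyclic sum of g ⊗ dψ. The traceless
part is thus conformal, with covector -dψ. -/
theorem IsKillingAt.killingOp_tracelessPart (hg : IsMetricOn g Ω) (hx : x ∈ Ω)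
    {K : E4 → Tensor2 ℝ} (hK : IsKillingAt g K x) {t : Fin 4 → ℝ}
    (ht : t = fun i => -pd i (fun y => meanTrace (g y) (K y)) x) (a b c : Fin 4) :
    killingOp g (fun y => tracelessPart (g y) (K y)) x a b c =
      g x a b * t c + g x b c * t a + g x c a * t b := by
  have h := hg.contDiffAt_meanTrace hx hK.smooth
  simp only [tracelessPart]
  rw [hg.killingOp_add_smul hx hK.smooth h.neg, hK.killing, ht]
  simp only [pd_neg]
  ring

theorem IsKillingAt.isConformalAt (hg : IsMetricOn g Ω) (hx : x ∈ Ω) {K : E4 → Tensor2 ℝ}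
    (hK : IsKillingAt g K x) : IsConformalAt g (fun y => tracelessPart (g y) (K y)) x where
  smooth := hK.smooth.add (SmoothAt.smul (hg.contDiffAt_meanTrace hx hK.smooth).neg (hg.smoothAt hx))
  twoPlusTwo := hK.twoPlusTwo.tracelessPart
  traceless := (hg.lorentz x hx).trace_inv_mul_tracelessPart
  conformal := ⟨_, hK.killingOp_tracelessPart hg hx rfl⟩

theorem IsMetricOn.eventually_isConformalAt (hg : IsMetricOn g Ω) (hx : x ∈ Ω)
    {K : E4 → Tensor2 ℝ} (hK : ∀ᶠ y in nhds x, IsKillingAt g K y) :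
    ∀ᶠ y in nhds x, IsConformalAt g (fun y => tracelessPart (g y) (K y)) y := by
  have hΩ : ∀ᶠ y in nhds x, y ∈ Ω := hg.isOpen.mem_nhds hx
  filter_upwards [hΩ, hK] with y hy h using h.isConformalAt hg hy

/-- The scalars of a Killing tensor of type 2+2 with respect to the canonical bivector. -/
theorem IsCanonicalAt.killing_factor (hg : IsMetricOn g Ω) (hx : x ∈ Ω)
    (hU : IsCanonicalAt g U x) {K : E4 → Tensor2 ℝ} (hK : ∀ᶠ y in nhds x, IsKillingAt g K y)
    {φ ψ : E4 → ℝ} (hφ : φ = fun y => structureFactor (g y) (tracelessPart (g y) (K y))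
      (structureTensor g U y)) (hψ : ψ = fun y => meanTrace (g y) (K y)) :
    ContDiffAt ℝ ∞ φ x ∧ ContDiffAt ℝ ∞ ψ x ∧ φ x ≠ 0 ∧
      K x = φ x • structureTensor g U x + ψ x • g x ∧
      (fun i => pd i φ x) = (-φ x) • (formA g U x + formB g U x) ∧
      (fun i => pd i ψ x) = φ x • (formB g U x - formA g U x) := by
  have h := hU.conformal_factor hg hx (hg.eventually_isConformalAt hx hK) hφ
  refine ⟨h.1, ?_, h.2.1, ?_, h.2.2.2.2.1, ?_⟩
  · rw [hψ]
    exact hg.contDiffAt_meanTrace hx hK.self_of_nhds.smooth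
  · rw [← h.2.2.1, hψ, tracelessPart]
    module
  -- The covector of the conformal equation is both -dψ and -φ(b - a).
  · have h1 := h.2.2.2.2.2 _ (hK.self_of_nhds.killingOp_tracelessPart hg hx rfl)
    rw [hψ]
    funext i
    have := congrFun h1 i
    simp only [Pi.smul_apply, smul_eq_mul] at this ⊢
    linarith

/-- Condition (2) is d(dψ) = 0 for dψ = φ(b - a), after division by 2φ ≠ 0. -/
theorem IsCanonicalAt.killingEqs (hg : IsMetricOn g Ω) (hx : x ∈ Ω)
    (hU : IsCanonicalAt g U x) {K : E4 → Tensor2 ℝ} (hK : ∀ᶠ y in nhds x, IsKillingAt g K y) :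
    KillingEqs g U x := by
  have hΩ : ∀ᶠ y in nhds x, y ∈ Ω := hg.isOpen.mem_nhds hx
  have hc := hU.conformalEqs hg hx (hg.eventually_isConformalAt hx hK)
  obtain ⟨h1, h2, h3, -, h5, h6⟩ := hU.killing_factor hg hx hK rfl rfl
  refine ⟨hc, ?_⟩
  have h7 := extDeriv1_factor_mul (hU.field.smoothFormAt_formA hg hx)
    (hU.field.smoothFormAt_formB hg hx) (h1.differentiableAt (by simp)) h5 hc.2
  have h8 := extDeriv1_pd h2
  rw [extDeriv1_congr (ζ := fun y i => structureFactor (g y) (tracelessPart (g y) (K y))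
      (structureTensor g U y) * (formB g U y - formA g U y) i), h7, smul_eq_zero] at h8
  · exact h8.resolve_left (mul_ne_zero two_ne_zero h3)
  · filter_upwards [hU.eventually, hΩ, eventually_eventually_nhds.2 hK] with y h1 h2 h3
    exact (h1.killing_factor hg h2 h3 rfl rfl).2.2.2.2.2

/-- The cyclic sum of g ⊗ dψ cancels the right-hand side of the conformal equation of φS. -/
theorem IsUnitFieldAt.killing_backward (hg : IsMetricOn g Ω) (hx : x ∈ Ω)
    (hU : IsUnitFieldAt g U x) {φ ψ : E4 → ℝ} (hφ : ContDiffAt ℝ ∞ φ x)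
    (hψ : ContDiffAt ℝ ∞ ψ x) (hs : ∀ c a b, sigma g U x c a b = 0)
    (h1 : (fun i => pd i φ x) = (-φ x) • (formA g U x + formB g U x))
    (h2 : (fun i => pd i ψ x) = φ x • (formB g U x - formA g U x)) (a b c : Fin 4) :
    killingOp g (fun y => φ y • structureTensor g U y + ψ y • g y) x a b c = 0 := by
  rw [hg.killingOp_add_smul hx (SmoothAt.smul hφ (hU.smoothAt_structureTensor hg hx)) hψ,
    hU.conformal_backward hg hx hφ hs h1]
  have h := fun i => congrFun h2 i
  simp only [Pi.smul_apply, smul_eq_mul] at h ⊢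
  rw [h, h, h]
  ring

end Killing

/-! ### Local solutions and constants of integration -/

section Integration

variable {g : E4 → Tensor2 ℝ} {Ω N : Set E4} {x : E4} {U : E4 → Tensor2 ℂ} {α β φ ψ : E4 → ℝ}

theorem factor_iff {a b : Fin 4 → ℝ} (hα : DifferentiableAt ℝ α x) (h0 : α x ≠ 0) :
    (∀ i, -pd i (fun y => Real.log |α y|) x = a i + b i) ↔
      (fun i => pd i α x) = (-α x) • (a + b) := by
  rw [funext_iff]
  refine forall_congr' fun i => ?_
  rw [pd_log_abs i hα h0, Pi.smul_apply, Pi.add_apply, smul_eq_mul]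
  constructor <;> intro h
  · rw [← h]
    field_simp
  · rw [h]
    field_simp

theorem exists_factor {ξ : E4 → Fin 4 → ℝ}
    (h : ∀ᶠ y in nhds x, SmoothFormAt ξ y ∧ extDeriv1 ξ y = 0) :
    ∃ α : E4 → ℝ, (∀ y, 0 < α y) ∧ ∀ᶠ y in nhds x, ContDiffAt ℝ ∞ α y ∧
      (fun i => pd i α y) = (-α y) • ξ y := by
  obtain ⟨f, hf⟩ := exists_potential h
  refine ⟨fun y => Real.exp (-f y), fun y => Real.exp_pos _, ?_⟩
  filter_upwards [hf] with y ⟨h1, h2⟩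
  refine ⟨h1.neg.exp, ?_⟩
  funext i
  rw [Pi.smul_apply, ← h2, pd, fderiv_exp (f := fun y => -f y) (h1.differentiableAt (by simp)).fun_neg]
  simp only [fderiv_fun_neg, _root_.smul_apply, _root_.neg_apply, smul_eq_mul, pd]
  ring

/-- Two solutions of `dα = -α ξ` are proportional. -/
theorem exists_factor_eq_mul {ξ : E4 → Fin 4 → ℝ} (hN : IsOpen N) (hc : IsPreconnected N)
    (hα : ∀ y ∈ N, DifferentiableAt ℝ α y ∧ α y ≠ 0 ∧ (fun i => pd i α y) = (-α y) • ξ y)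
    (hβ : ∀ y ∈ N, DifferentiableAt ℝ β y ∧ β y ≠ 0 ∧ (fun i => pd i β y) = (-β y) • ξ y) :
    ∃ C, C ≠ 0 ∧ ∀ y ∈ N, β y = C * α y := by
  have hdiv : ∀ y ∈ N, DifferentiableAt ℝ (fun z => β z / α z) y := fun y hy => by
    simp only [div_eq_mul_inv]
    exact (hβ y hy).1.mul ((hα y hy).1.inv (hα y hy).2.1)
  obtain ⟨C, hC⟩ := eq_const_of_pd_eq_zero (f := fun y => β y / α y) hN hc hdiv (by
    intro y hy i
    have h1 := congrFun (hα y hy).2.2 i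
    have h2 := congrFun (hβ y hy).2.2 i
    -- The quotient is not differentiated directly: the product rule is applied to α · (β/α) = β.
    have h3 := pd_mul (i := i) (hα y hy).1 (hdiv y hy)
    rw [pd_congr (h := β) (by
      filter_upwards [hN.mem_nhds hy] with z hz using mul_div_cancel₀ _ (hα z hz).2.1)] at h3
    simp only [Pi.smul_apply, smul_eq_mul] at h1 h2
    rw [h1, h2] at h3
    have h4 : α y * pd i (fun y => β y / α y) y = 0 := by
      have h5 : α y * (β y / α y) = β y := mul_div_cancel₀ _ (hα y hy).2.1
      linear_combination -h3 + ξ y i * h5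
    exact (mul_eq_zero.1 h4).resolve_left (hα y hy).2.1)
  rcases N.eq_empty_or_nonempty with rfl | ⟨y, hy⟩
  -- The empty set is preconnected; there any nonzero constant will do.
  · exact ⟨1, one_ne_zero, fun y hy => hy.elim⟩
  · refine ⟨C, ?_, fun z hz => ?_⟩
    · rw [← hC y hy]
      exact div_ne_zero (hβ y hy).2.1 (hα y hy).2.1
    · rw [← hC z hz, div_mul_cancel₀ _ (hα z hz).2.1]

theorem exists_eq_add_const {ξ : E4 → Fin 4 → ℝ} (hN : IsOpen N) (hc : IsPreconnected N)
    (hφ : ∀ y ∈ N, DifferentiableAt ℝ φ y ∧ (fun i => pd i φ y) = ξ y)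
    (hψ : ∀ y ∈ N, DifferentiableAt ℝ ψ y ∧ (fun i => pd i ψ y) = ξ y) :
    ∃ D, ∀ y ∈ N, ψ y = φ y + D := by
  obtain ⟨D, hD⟩ := eq_const_of_pd_eq_zero (f := fun y => ψ y - φ y) hN hc
    (fun y hy => (hψ y hy).1.sub (hφ y hy).1) (by
      intro y hy i
      rw [pd_sub (hψ y hy).1 (hφ y hy).1, congrFun (hφ y hy).2 i, congrFun (hψ y hy).2 i, sub_self])
  exact ⟨D, fun y hy => by rw [← hD y hy]; ring⟩

end Integration

/-! ### The components of the metric in a chart -/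

theorem isLorentz_gram {V : Type*} [AddCommGroup V] [Module ℝ V] (G : LinearMap.BilinForm ℝ V)
    (b : Module.Basis (Fin 4) ℝ V)
    (hb : ∀ i j : Fin 4, G (b i) (b j) = if i = j then (if i = 0 then -1 else 1) else 0)
    (D : E4 →ₗ[ℝ] V) (L : V →ₗ[ℝ] E4) (hL : ∀ u, L (D u) = u) :
    IsLorentz (Matrix.of fun i j =>
      G (D (EuclideanSpace.single i 1)) (D (EuclideanSpace.single j 1))) := by
  let s : Module.Basis (Fin 4) ℝ E4 := (EuclideanSpace.basisFun (Fin 4) ℝ).toBasis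
  have hs : ∀ i, s i = EuclideanSpace.single i (1 : ℝ) := fun i => by simp [s]
  have hD : L ∘ₗ D = LinearMap.id := LinearMap.ext hL
  -- The columns are the coordinate vectors in the orthonormal basis. The matrix is square, so a
  -- left inverse makes it invertible.
  refine ⟨LinearMap.toMatrix s b D, ?_, ?_⟩
  · refine Matrix.isUnit_det_of_left_inverse (B := LinearMap.toMatrix b s L) ?_
    rw [← LinearMap.toMatrix_comp, hD, LinearMap.toMatrix_id]
  · have hc : ∀ i, D (EuclideanSpace.single i 1) = ∑ k, LinearMap.toMatrix s b D k i • b k := by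
      intro i
      rw [← hs, ← b.sum_repr (D (s i))]
      refine Finset.sum_congr rfl fun k _ => ?_
      rw [LinearMap.toMatrix_apply]
    generalize LinearMap.toMatrix s b D = B at hc
    ext i j
    simp only [Matrix.of_apply, hc, Matrix.mul_apply, Matrix.transpose_apply,
      Matrix.diagonal_apply, Fin.sum_univ_four]
    simp [hb]

section Chart

variable {M : Type*} [TopologicalSpace M] [ChartedSpace E4 M]

/-- By the chain rule the differential of the chart is a left inverse of that of its inverse; hence
the coordinate vectors are independent. -/
theorem exists_leftInverse_mfderiv_symm {e : OpenPartialHomeomorph M E4}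
    (he : e ∈ IsManifold.maximalAtlas 𝓘(ℝ, E4) ∞ M) {y : E4} (hy : y ∈ e.target) :
    ∃ L : TangentSpace 𝓘(ℝ, E4) (e.symm y) →ₗ[ℝ] E4, ∀ u : E4,
      L (mfderiv 𝓘(ℝ, E4) 𝓘(ℝ, E4) e.symm y u) = u := by
  have hd : e.MDifferentiable 𝓘(ℝ, E4) 𝓘(ℝ, E4) :=
    ⟨(contMDiffOn_of_mem_maximalAtlas he).mdifferentiableOn (by simp),
      (contMDiffOn_symm_of_mem_maximalAtlas he).mdifferentiableOn (by simp)⟩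
  have h := hd.comp_symm_deriv hy
  exact ⟨(mfderiv 𝓘(ℝ, E4) 𝓘(ℝ, E4) e (e.symm y)).toLinearMap, fun u => DFunLike.congr_fun h u⟩

theorem LorentzMetric.isLorentz_components (metric : LorentzMetric M)
    {e : OpenPartialHomeomorph M E4} (he : e ∈ IsManifold.maximalAtlas 𝓘(ℝ, E4) ∞ M) {y : E4}
    (hy : y ∈ e.target) : IsLorentz (metric.components e y) := by
  obtain ⟨L, hL⟩ := exists_leftInverse_mfderiv_symm he hy
  obtain ⟨b, hb⟩ := metric.signature (e.symm y)
  exact isLorentz_gram (metric.val (e.symm y)) b hb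
    (mfderiv 𝓘(ℝ, E4) 𝓘(ℝ, E4) e.symm y).toLinearMap L hL

theorem LorentzMetric.isMetricOn_components (metric : LorentzMetric M)
    {e : OpenPartialHomeomorph M E4} (he : e ∈ IsManifold.maximalAtlas 𝓘(ℝ, E4) ∞ M)
    {Ω : Set E4} (hΩ : IsOpen Ω) (hΩe : Ω ⊆ e.target) : IsMetricOn (metric.components e) Ω where
  isOpen := hΩ
  lorentz _ hx := metric.isLorentz_components he (hΩe hx)
  smooth i j := (metric.smooth e he i j).mono hΩe

end Chart

/-! ### Equivalence with the conditions, and general form of the tensors -/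

section Algorithm

variable {g : E4 → Tensor2 ℝ} {Ω N O : Set E4} {x : E4} {U : E4 → Tensor2 ℂ}

theorem IsMetricOn.isTypeD_iff (hg : IsMetricOn g Ω) :
    (∀ x ∈ Ω, IsTypeD g x) ↔ AlgebraicConditions g Ω :=
  forall₂_congr fun x hx => Spacetime.isTypeD_iff (hg.lorentz x hx) (hg.isWeyl hx)

theorem IsSeed.isCanonicalAt (hg : IsMetricOn g Ω) (ha : AlgebraicConditions g Ω) (hO : O ⊆ Ω)
    {X : E4 → Tensor2 ℂ} {s : E4 → ℂ} (hs : IsSeed g O X s) (hx : x ∈ O) :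
    IsCanonicalAt g (canonicalSD g X s) x := by
  refine ⟨hs.isUnitFieldAt hg ha hO hx, ?_⟩
  filter_upwards [hs.isOpen.mem_nhds hx] with y hy using (hs.canonicalSD_spec hg ha hO hy).2

theorem IsConformalOn.isConformalAt {P : E4 → Tensor2 ℝ} (hN : IsOpen N)
    (hP : IsConformalOn g N P) (h : ∀ y ∈ N, IsTwoPlusTwo (g y) (P y)) (hx : x ∈ N) :
    IsConformalAt g P x :=
  ⟨hP.smooth.smoothAt hN hx, h x hx, hP.traceless x hx, hP.conformal x hx⟩

theorem IsConformalOn.eventually {P : E4 → Tensor2 ℝ} (hN : IsOpen N)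
    (hP : IsConformalOn g N P) (h : ∀ y ∈ N, IsTwoPlusTwo (g y) (P y)) (hx : x ∈ N) :
    ∀ᶠ y in nhds x, IsConformalAt g P y := by
  filter_upwards [hN.mem_nhds hx] with y hy using hP.isConformalAt hN h hy

theorem IsKillingOn.eventually {K : E4 → Tensor2 ℝ} (hN : IsOpen N)
    (hK : IsKillingOn g N K) (h : ∀ y ∈ N, IsTwoPlusTwo (g y) (K y)) (hx : x ∈ N) :
    ∀ᶠ y in nhds x, IsKillingAt g K y := by
  filter_upwards [hN.mem_nhds hx] with y hy using
    ⟨hK.smooth.smoothAt hN hy, h y hy, hK.killing y hy⟩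

theorem ForEverySeed.forSomeSeed (hg : IsMetricOn g Ω) (ha : AlgebraicConditions g Ω)
    {Q : (E4 → Tensor2 ℂ) → E4 → Prop} (h : ForEverySeed g Ω Q) : ForSomeSeed g Ω Q := by
  intro x hx
  obtain ⟨O, hO, hxO, X, s, hs⟩ := hg.exists_seed ha hx
  exact ⟨O, hO, hxO, X, s, hs, fun y hy => h O hO X s hs y hy⟩

theorem AdmitsConformal.forEverySeed (hg : IsMetricOn g Ω) (ha : AlgebraicConditions g Ω)
    (h : AdmitsConformal g Ω) : ForEverySeed g Ω (ConformalEqs g) := by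
  intro O hO X s hs x hx
  obtain ⟨N, hN, hNo, hxN, P, hP, h22⟩ := h x (hO hx)
  exact (hs.isCanonicalAt hg ha hO hx).conformalEqs hg (hO hx) (hP.eventually hNo h22 hxN)

theorem AdmitsKilling.forEverySeed (hg : IsMetricOn g Ω) (ha : AlgebraicConditions g Ω)
    (h : AdmitsKilling g Ω) : ForEverySeed g Ω (KillingEqs g) := by
  intro O hO X s hs x hx
  obtain ⟨N, hN, hNo, hxN, K, hK, h22⟩ := h x (hO hx)
  exact (hs.isCanonicalAt hg ha hO hx).killingEqs hg (hO hx) (hK.eventually hNo h22 hxN)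

/-! ### Conformal tensors from the canonical bivector -/

theorem exists_conformalFactor (hg : IsMetricOn g Ω) (hN : N ⊆ Ω) (hNo : IsOpen N)
    (hU : ∀ y ∈ N, IsUnitFieldAt g U y) (h : ∀ y ∈ N, ConformalEqs g U y) (hx : x ∈ N) :
    ∃ V ⊆ N, IsOpen V ∧ x ∈ V ∧ ∃ α, (∀ y, 0 < α y) ∧ IsConformalFactor g U V α := by
  have hn : ∀ᶠ y in nhds x, y ∈ N := hNo.mem_nhds hx
  obtain ⟨α, hα0, hα⟩ := exists_factor (x := x) (ξ := fun y => formA g U y + formB g U y) (by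
    filter_upwards [hn] with y hy
    exact ⟨((hU y hy).smoothFormAt_formA hg (hN hy)).add ((hU y hy).smoothFormAt_formB hg (hN hy)),
      (h y hy).2⟩)
  obtain ⟨V, hV, hVo, hxV⟩ := eventually_nhds_iff.1 (hα.and hn)
  refine ⟨V, fun y hy => (hV y hy).2, hVo, hxV, α, hα0, fun y hy => (hV y hy).1.1.contDiffWithinAt,
    fun y hy => ⟨(hα0 y).ne', ?_⟩⟩
  exact (factor_iff ((hV y hy).1.1.differentiableAt (by simp)) (hα0 y).ne').2 (hV y hy).1.2

theorem IsConformalFactor.contDiffAt {α : E4 → ℝ} (hα : IsConformalFactor g U N α) (hNo : IsOpen N)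
    (hx : x ∈ N) : ContDiffAt ℝ ∞ α x := hα.1.contDiffAt (hNo.mem_nhds hx)

theorem IsConformalFactor.deriv {α : E4 → ℝ} (hα : IsConformalFactor g U N α) (hNo : IsOpen N)
    (hx : x ∈ N) : (fun i => pd i α x) = (-α x) • (formA g U x + formB g U x) :=
  (factor_iff ((hα.contDiffAt hNo hx).differentiableAt (by simp)) (hα.2 x hx).1).1 (hα.2 x hx).2

theorem pd_const_mul {f : E4 → ℝ} (hf : DifferentiableAt ℝ f x) (C : ℝ) (i : Fin 4) :
    pd i (fun y => C * f y) x = C * pd i f x := by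
  rw [pd_mul (differentiableAt_const C) hf, pd_const]
  ring

theorem deriv_const_mul {f : E4 → ℝ} {ξ : Fin 4 → ℝ} (hf : DifferentiableAt ℝ f x)
    (h : (fun i => pd i f x) = (-f x) • ξ) (C : ℝ) :
    (fun i => pd i (fun y => C * f y) x) = (-(C * f x)) • ξ := by
  funext i
  rw [pd_const_mul hf, congrFun h i]
  simp only [Pi.smul_apply, smul_eq_mul]
  ring

theorem IsConformalFactor.isConformalOn (hg : IsMetricOn g Ω) (hN : N ⊆ Ω) (hNo : IsOpen N)
    (hU : ∀ y ∈ N, IsUnitFieldAt g U y) (hs : ∀ y ∈ N, ∀ c a b, sigma g U y c a b = 0)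
    {α : E4 → ℝ} (hα : IsConformalFactor g U N α) (C : ℝ) :
    IsConformalOn g N (conformalTensor g U α C) where
  smooth := smoothOn_of_smoothAt fun y hy => SmoothAt.smul
    (contDiffAt_const.mul (hα.contDiffAt hNo hy)) ((hU y hy).smoothAt_structureTensor hg (hN hy))
  symm y hy := by
    rw [Matrix.IsSymm, conformalTensor, Matrix.transpose_smul]
    exact congrArg _ (structureTensor_transpose (hg.lorentz y (hN hy)) (hU y hy).unit.self_of_nhds)
  traceless y hy := by
    rw [conformalTensor, Matrix.mul_smul, Matrix.trace_smul]
    refine smul_eq_zero_of_right _ ?_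
    exact structureTensor_trace (hg.lorentz y (hN hy)) (hU y hy).unit.self_of_nhds
  conformal y hy := by
    have h := hα.contDiffAt hNo hy
    exact ⟨_, (hU y hy).conformal_backward hg (hN hy) (contDiffAt_const.mul h) (hs y hy)
      (deriv_const_mul (h.differentiableAt (by simp)) (hα.deriv hNo hy) C)⟩

theorem IsConformalFactor.exists_eq (hg : IsMetricOn g Ω) (hN : N ⊆ Ω) (hNo : IsOpen N)
    (hU : ∀ y ∈ N, IsCanonicalAt g U y) {α : E4 → ℝ} (hα : IsConformalFactor g U N α)
    (hc : IsPreconnected N) {P : E4 → Tensor2 ℝ} (hP : IsConformalOn g N P)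
    (h : ∀ y ∈ N, IsTwoPlusTwo (g y) (P y)) :
    ∃ C : ℝ, C ≠ 0 ∧ ∀ x ∈ N, P x = conformalTensor g U α C x := by
  have h1 := fun y hy => (hU y hy).conformal_factor hg (hN hy) (hP.eventually hNo h hy) rfl
  obtain ⟨C, hC, hCα⟩ := exists_factor_eq_mul (α := α)
    (ξ := fun y => formA g U y + formB g U y) hNo hc
    (fun y hy => ⟨(hα.contDiffAt hNo hy).differentiableAt (by simp), (hα.2 y hy).1,
      hα.deriv hNo hy⟩)
    (fun y hy => ⟨(h1 y hy).1.differentiableAt (by simp), (h1 y hy).2.1, (h1 y hy).2.2.2.2.1⟩)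
  refine ⟨C, hC, fun y hy => ?_⟩
  rw [(h1 y hy).2.2.1]
  exact congrArg (· • structureTensor g U y) (hCα y hy)

/-! ### Killing tensors from the canonical bivector -/

theorem exists_killingPair (hg : IsMetricOn g Ω) (hN : N ⊆ Ω) (hNo : IsOpen N)
    (hU : ∀ y ∈ N, IsUnitFieldAt g U y) (h : ∀ y ∈ N, KillingEqs g U y) (hx : x ∈ N) :
    ∃ V ⊆ N, IsOpen V ∧ x ∈ V ∧ ∃ α β, IsKillingPair g U V α β := by
  obtain ⟨W, hW, hWo, hxW, φ, hφ0, hφ⟩ := exists_conformalFactor hg hN hNo hU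
    (fun y hy => (h y hy).1) hx
  have hn : ∀ᶠ y in nhds x, y ∈ W := hWo.mem_nhds hxW
  have hA := fun y hy => (hU y (hW hy)).smoothFormAt_formA hg (hN (hW hy))
  have hB := fun y hy => (hU y (hW hy)).smoothFormAt_formB hg (hN (hW hy))
  obtain ⟨ψ, hψ⟩ := exists_potential (x := x) (ξ := fun y i => φ y * (formB g U y - formA g U y) i) (by
    filter_upwards [hn] with y hy
    have hφs := hφ.contDiffAt hWo hy
    refine ⟨fun i => hφs.mul ((hB y hy).sub (hA y hy) i), ?_⟩
    rw [extDeriv1_factor_mul (hA y hy) (hB y hy) (hφs.differentiableAt (by simp))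
      (hφ.deriv hWo hy) (h y (hW hy)).1.2, (h y (hW hy)).2, smul_zero])
  obtain ⟨V, hV, hVo, hxV⟩ := eventually_nhds_iff.1 (hψ.and hn)
  -- Then α - β = 2φ and α + β = 2ψ; the factor 2 does not affect the logarithmic derivative, and φ
  -- > 0 ensures α ≠ β.
  refine ⟨V, fun y hy => hW (hV y hy).2, hVo, hxV, fun y => φ y + ψ y, fun y => ψ y - φ y, ?_⟩
  have hs : ∀ y ∈ V, ContDiffAt ℝ ∞ φ y := fun y hy => hφ.contDiffAt hWo (hV y hy).2
  have hd : ∀ y ∈ V, DifferentiableAt ℝ φ y := fun y hy => (hs y hy).differentiableAt (by simp)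
  refine ⟨fun y hy => ((hs y hy).add (hV y hy).1.1).contDiffWithinAt,
    fun y hy => ((hV y hy).1.1.sub (hs y hy)).contDiffWithinAt, fun y hy => ⟨?_, ?_, fun i => ?_⟩⟩
  · have := hφ0 y
    intro h
    linarith
  · have e : (fun y => Real.log |φ y + ψ y - (ψ y - φ y)|) = fun y => Real.log |2 * φ y| := by
      funext y
      ring_nf
    rw [e, factor_iff (α := fun y => 2 * φ y) ((differentiableAt_const _).mul (hd y hy))
      (mul_ne_zero two_ne_zero (hφ0 y).ne')]
    exact deriv_const_mul (hd y hy) (hφ.deriv hWo (hV y hy).2) 2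
  · have e : (fun y => φ y + ψ y + (ψ y - φ y)) = fun y => 2 * ψ y := by
      funext y
      ring
    rw [e, pd_const_mul ((hV y hy).1.1.differentiableAt (by simp)), (hV y hy).1.2, Pi.sub_apply]
    ring

variable {α β : E4 → ℝ}

theorem IsKillingPair.conformalFactor (h : IsKillingPair g U N α β) :
    IsConformalFactor g U N (fun y => α y - β y) :=
  ⟨h.1.sub h.2.1, fun x hx => ⟨sub_ne_zero.2 (h.2.2 x hx).1, (h.2.2 x hx).2.1⟩⟩

theorem IsKillingPair.deriv_add (h : IsKillingPair g U N α β) (hNo : IsOpen N) (hx : x ∈ N)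
    (C D : ℝ) : (fun i => pd i (fun y => C * ((α y + β y) / 2) + D) x) =
      (C * ((α x - β x) / 2)) • (formB g U x - formA g U x) := by
  have hs : DifferentiableAt ℝ (fun y => α y + β y) x :=
    ((h.1.add h.2.1).contDiffAt (hNo.mem_nhds hx)).differentiableAt (by simp)
  have e : (fun y => C * ((α y + β y) / 2) + D) = fun y => C / 2 * (α y + β y) + D := by
    funext y
    ring
  funext i
  rw [e, pd_add (f := fun y => C / 2 * (α y + β y)) ((differentiableAt_const _).mul hs) (differentiableAt_const _), pd_const,
    pd_const_mul hs, (h.2.2 x hx).2.2 i]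
  simp only [Pi.smul_apply, Pi.sub_apply, smul_eq_mul]
  ring

theorem IsKillingPair.isKillingOn (hg : IsMetricOn g Ω) (hN : N ⊆ Ω) (hNo : IsOpen N)
    (hU : ∀ y ∈ N, IsUnitFieldAt g U y) (hs : ∀ y ∈ N, ∀ c a b, sigma g U y c a b = 0)
    (h : IsKillingPair g U N α β) (C D : ℝ) : IsKillingOn g N (killingTensor g U α β C D) := by
  have hK : ∀ y ∈ N, killingTensor g U α β C D y = (C / 2 * (α y - β y)) • structureTensor g U y +
      (C * ((α y + β y) / 2) + D) • g y := fun y hy => by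
    rw [killingTensor_eq (hg.lorentz y (hN hy)) (hU y hy).unit.self_of_nhds]
    congr 2
    ring
  have hφ : ∀ y ∈ N, ContDiffAt ℝ ∞ (fun y => α y - β y) y := fun y hy =>
    h.conformalFactor.contDiffAt hNo hy
  have hψ : ∀ y ∈ N, ContDiffAt ℝ ∞ (fun y => C * ((α y + β y) / 2) + D) y := fun y hy =>
    (contDiffAt_const.mul (((h.1.add h.2.1).contDiffAt (hNo.mem_nhds hy)).div_const 2)).add
      contDiffAt_const
  have hev : ∀ y ∈ N, killingTensor g U α β C D =ᶠ[nhds y] fun y =>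
      (C / 2 * (α y - β y)) • structureTensor g U y + (C * ((α y + β y) / 2) + D) • g y := by
    intro y hy
    filter_upwards [hNo.mem_nhds hy] with z hz using hK z hz
  refine ⟨smoothOn_of_smoothAt fun y hy => ?_, fun y hy => ?_, fun y hy a b c => ?_⟩
  · refine SmoothAt.congr ?_ (hev y hy)
    exact (SmoothAt.smul (contDiffAt_const.mul (hφ y hy))
      ((hU y hy).smoothAt_structureTensor hg (hN hy))).add
      (SmoothAt.smul (hψ y hy) (hg.smoothAt (hN hy)))
  · rw [hK y hy, Matrix.IsSymm, Matrix.transpose_add, Matrix.transpose_smul,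
      Matrix.transpose_smul, (hg.lorentz y (hN hy)).transpose,
      structureTensor_transpose (hg.lorentz y (hN hy)) (hU y hy).unit.self_of_nhds]
  · rw [killingOp_congr (hev y hy)]
    refine (hU y hy).killing_backward hg (hN hy) (contDiffAt_const.mul (hφ y hy)) (hψ y hy)
      (hs y hy) (deriv_const_mul ((hφ y hy).differentiableAt (by simp))
        (h.conformalFactor.deriv hNo hy) _) ?_ a b c
    rw [h.deriv_add hNo hy]
    congr 1
    ring

theorem IsKillingPair.exists_eq (hg : IsMetricOn g Ω) (hN : N ⊆ Ω) (hNo : IsOpen N)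
    (hU : ∀ y ∈ N, IsCanonicalAt g U y) (h : IsKillingPair g U N α β)
    (hc : IsPreconnected N) {K : E4 → Tensor2 ℝ} (hK : IsKillingOn g N K)
    (h22 : ∀ y ∈ N, IsTwoPlusTwo (g y) (K y)) :
    ∃ C D : ℝ, C ≠ 0 ∧ ∀ x ∈ N, K x = killingTensor g U α β C D x := by
  have h1 := fun y hy => (hU y hy).killing_factor hg (hN hy) (hK.eventually hNo h22 hy) rfl rfl
  have hα := h.conformalFactor
  obtain ⟨C, hC, hCα⟩ := exists_factor_eq_mul (α := fun y => α y - β y)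
    (ξ := fun y => formA g U y + formB g U y) hNo hc
    (fun y hy => ⟨(hα.contDiffAt hNo hy).differentiableAt (by simp), (hα.2 y hy).1,
      hα.deriv hNo hy⟩)
    (fun y hy => ⟨(h1 y hy).1.differentiableAt (by simp), (h1 y hy).2.2.1, (h1 y hy).2.2.2.2.1⟩)
  -- Both functions have differential C(α - β)(b - a), because the factor of K is C(α - β). The
  -- summand 0 only fits the form of `IsKillingPair.deriv_add`.
  obtain ⟨D, hD⟩ := exists_eq_add_const (φ := fun y => 2 * C * ((α y + β y) / 2) + 0) hNo hc
    (fun y hy => ⟨((contDiffAt_const.mul (((h.1.add h.2.1).contDiffAt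
      (hNo.mem_nhds hy)).div_const 2)).add contDiffAt_const).differentiableAt
      (n := ∞) (by simp), h.deriv_add hNo hy (2 * C) 0⟩)
    (fun y hy => ⟨(h1 y hy).2.1.differentiableAt (by simp), (h1 y hy).2.2.2.2.2.trans (by
      rw [hCα y hy]
      congr 1
      ring)⟩)
  -- The traceless part of the general tensor carries (α - β)/2, so its constant is twice the ratio
  -- C found above.
  refine ⟨2 * C, D, mul_ne_zero two_ne_zero hC, fun y hy => ?_⟩
  rw [killingTensor_eq (hg.lorentz y (hN hy)) (hU y hy).field.unit.self_of_nhds]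
  refine (h1 y hy).2.2.2.1.trans ?_
  rw [hCα y hy, hD y hy]
  congr 2 <;> ring

theorem ForSomeSeed.admitsConformal (hg : IsMetricOn g Ω) (ha : AlgebraicConditions g Ω)
    (h : ForSomeSeed g Ω (ConformalEqs g)) : AdmitsConformal g Ω := by
  intro x hx
  obtain ⟨O, hO, hxO, X, s, hs, hE⟩ := h x hx
  have hU : ∀ y ∈ O, IsUnitFieldAt g (canonicalSD g X s) y := fun y hy =>
    hs.isUnitFieldAt hg ha hO hy
  obtain ⟨V, hV, hVo, hxV, α, -, hα⟩ := exists_conformalFactor hg hO hs.isOpen hU hE hxO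
  exact ⟨V, hV.trans hO, hVo, hxV, _, hα.isConformalOn hg (hV.trans hO) hVo
    (fun y hy => hU y (hV hy)) (fun y hy => (hE y (hV hy)).1) 1, fun y hy =>
      isTwoPlusTwo_conformalTensor (hg.lorentz y (hO (hV hy))) (hU y (hV hy)).unit.self_of_nhds
        (hα.2 y hy).1 one_ne_zero⟩

theorem ForSomeSeed.admitsKilling (hg : IsMetricOn g Ω) (ha : AlgebraicConditions g Ω)
    (h : ForSomeSeed g Ω (KillingEqs g)) : AdmitsKilling g Ω := by
  intro x hx
  obtain ⟨O, hO, hxO, X, s, hs, hE⟩ := h x hx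
  have hU : ∀ y ∈ O, IsUnitFieldAt g (canonicalSD g X s) y := fun y hy =>
    hs.isUnitFieldAt hg ha hO hy
  obtain ⟨V, hV, hVo, hxV, α, β, hα⟩ := exists_killingPair hg hO hs.isOpen hU hE hxO
  exact ⟨V, hV.trans hO, hVo, hxV, _, hα.isKillingOn hg (hV.trans hO) hVo
    (fun y hy => hU y (hV hy)) (fun y hy => (hE y (hV hy)).1.1) 1 0, fun y hy =>
      isTwoPlusTwo_killingTensor (hg.lorentz y (hO (hV hy))) (hU y (hV hy)).unit.self_of_nhds
        (hα.2.2 y hy).1 one_ne_zero⟩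

end Algorithm

end

end Spacetime

theorem theorem5 {M : Type*} [TopologicalSpace M] [ChartedSpace Spacetime.E4 M]
    [IsManifold 𝓘(ℝ, Spacetime.E4) ∞ M] (metric : Spacetime.LorentzMetric M)
    (e : OpenPartialHomeomorph M Spacetime.E4)
    (he : e ∈ IsManifold.maximalAtlas 𝓘(ℝ, Spacetime.E4) ∞ M)
    (g : Spacetime.E4 → Spacetime.Tensor2 ℝ) (hg : g = metric.components e)
    (Ω : Set Spacetime.E4) (hΩ : IsOpen Ω) (hΩe : Ω ⊆ e.target) :
    -- characterization of the type D metrics with a 2+2 conformal tensor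
    (((∀ x ∈ Ω, Spacetime.IsTypeD g x) ∧ Spacetime.AdmitsConformal g Ω) ↔
      (Spacetime.AlgebraicConditions g Ω ∧
        Spacetime.ForEverySeed g Ω (Spacetime.ConformalEqs g))) ∧
    (((∀ x ∈ Ω, Spacetime.IsTypeD g x) ∧ Spacetime.AdmitsConformal g Ω) ↔
      (Spacetime.AlgebraicConditions g Ω ∧
        Spacetime.ForSomeSeed g Ω (Spacetime.ConformalEqs g))) ∧
    -- algorithm for the conformal tensors
    (Spacetime.AlgebraicConditions g Ω →
      Spacetime.ForEverySeed g Ω (Spacetime.ConformalEqs g) →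
      ∀ O ⊆ Ω, ∀ X s, Spacetime.IsSeed g O X s →
        (∀ x ∈ O, ∃ N ⊆ O, IsOpen N ∧ x ∈ N ∧
          ∃ α, Spacetime.IsConformalFactor g (Spacetime.canonicalSD g X s) N α) ∧
        (∀ N ⊆ O, IsOpen N →
          ∀ α, Spacetime.IsConformalFactor g (Spacetime.canonicalSD g X s) N α →
            (∀ C : ℝ, Spacetime.IsConformalOn g N
              (Spacetime.conformalTensor g (Spacetime.canonicalSD g X s) α C)) ∧
            (∀ C : ℝ, C ≠ 0 → ∀ x ∈ N, Spacetime.IsTwoPlusTwo (g x)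
              (Spacetime.conformalTensor g (Spacetime.canonicalSD g X s) α C x)) ∧
            (IsPreconnected N → ∀ P, Spacetime.IsConformalOn g N P →
              (∀ x ∈ N, Spacetime.IsTwoPlusTwo (g x) (P x)) →
              ∃ C : ℝ, C ≠ 0 ∧ ∀ x ∈ N,
                P x = Spacetime.conformalTensor g (Spacetime.canonicalSD g X s) α C x))) ∧
    -- characterization of the type D metrics with a 2+2 Killing tensor
    (((∀ x ∈ Ω, Spacetime.IsTypeD g x) ∧ Spacetime.AdmitsKilling g Ω) ↔
      (Spacetime.AlgebraicConditions g Ω ∧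
        Spacetime.ForEverySeed g Ω (Spacetime.KillingEqs g))) ∧
    (((∀ x ∈ Ω, Spacetime.IsTypeD g x) ∧ Spacetime.AdmitsKilling g Ω) ↔
      (Spacetime.AlgebraicConditions g Ω ∧
        Spacetime.ForSomeSeed g Ω (Spacetime.KillingEqs g))) ∧
    -- algorithm for the Killing tensors
    (Spacetime.AlgebraicConditions g Ω →
      Spacetime.ForEverySeed g Ω (Spacetime.KillingEqs g) →
      ∀ O ⊆ Ω, ∀ X s, Spacetime.IsSeed g O X s →
        (∀ x ∈ O, ∃ N ⊆ O, IsOpen N ∧ x ∈ N ∧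
          ∃ α β, Spacetime.IsKillingPair g (Spacetime.canonicalSD g X s) N α β) ∧
        (∀ N ⊆ O, IsOpen N →
          ∀ α β, Spacetime.IsKillingPair g (Spacetime.canonicalSD g X s) N α β →
            (∀ C D : ℝ, Spacetime.IsKillingOn g N
              (Spacetime.killingTensor g (Spacetime.canonicalSD g X s) α β C D)) ∧
            (∀ C D : ℝ, C ≠ 0 → ∀ x ∈ N, Spacetime.IsTwoPlusTwo (g x)
              (Spacetime.killingTensor g (Spacetime.canonicalSD g X s) α β C D x)) ∧
            (IsPreconnected N → ∀ K, Spacetime.IsKillingOn g N K →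
              (∀ x ∈ N, Spacetime.IsTwoPlusTwo (g x) (K x)) →
              ∃ C D : ℝ, C ≠ 0 ∧ ∀ x ∈ N,
                K x = Spacetime.killingTensor g (Spacetime.canonicalSD g X s) α β C D x))) := by
  subst hg
  have hm := metric.isMetricOn_components he hΩ hΩe
  have hcf : ((∀ x ∈ Ω, Spacetime.IsTypeD (metric.components e) x) ∧
      Spacetime.AdmitsConformal (metric.components e) Ω) →
      (Spacetime.AlgebraicConditions (metric.components e) Ω ∧
        Spacetime.ForEverySeed (metric.components e) Ω
          (Spacetime.ConformalEqs (metric.components e))) := fun h =>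
    ⟨hm.isTypeD_iff.1 h.1, h.2.forEverySeed hm (hm.isTypeD_iff.1 h.1)⟩
  have hcs : (Spacetime.AlgebraicConditions (metric.components e) Ω ∧
        Spacetime.ForSomeSeed (metric.components e) Ω
          (Spacetime.ConformalEqs (metric.components e))) →
      ((∀ x ∈ Ω, Spacetime.IsTypeD (metric.components e) x) ∧
        Spacetime.AdmitsConformal (metric.components e) Ω) := fun h =>
    ⟨hm.isTypeD_iff.2 h.1, h.2.admitsConformal hm h.1⟩
  have hkf : ((∀ x ∈ Ω, Spacetime.IsTypeD (metric.components e) x) ∧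
      Spacetime.AdmitsKilling (metric.components e) Ω) →
      (Spacetime.AlgebraicConditions (metric.components e) Ω ∧
        Spacetime.ForEverySeed (metric.components e) Ω
          (Spacetime.KillingEqs (metric.components e))) := fun h =>
    ⟨hm.isTypeD_iff.1 h.1, h.2.forEverySeed hm (hm.isTypeD_iff.1 h.1)⟩
  have hks : (Spacetime.AlgebraicConditions (metric.components e) Ω ∧
        Spacetime.ForSomeSeed (metric.components e) Ω
          (Spacetime.KillingEqs (metric.components e))) →
      ((∀ x ∈ Ω, Spacetime.IsTypeD (metric.components e) x) ∧
        Spacetime.AdmitsKilling (metric.components e) Ω) := fun h =>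
    ⟨hm.isTypeD_iff.2 h.1, h.2.admitsKilling hm h.1⟩
  -- The three conditions form a cycle: a tensor gives the equations for every choice, these give
  -- them for some choice because choices exist, and one choice around each point produces a tensor.
  refine ⟨⟨hcf, fun h => hcs ⟨h.1, h.2.forSomeSeed hm h.1⟩⟩,
    ⟨fun h => ⟨(hcf h).1, (hcf h).2.forSomeSeed hm (hcf h).1⟩, hcs⟩, ?_,
    ⟨hkf, fun h => hks ⟨h.1, h.2.forSomeSeed hm h.1⟩⟩,
    ⟨fun h => ⟨(hkf h).1, (hkf h).2.forSomeSeed hm (hkf h).1⟩, hks⟩, ?_⟩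
  · intro ha hQ O hO X s hs
    have hU := fun y hy => hs.isCanonicalAt hm ha hO (x := y) hy
    have hE := fun y hy => hQ O hO X s hs y hy
    refine ⟨fun x hx => ?_, fun N hN hNo α hα => ⟨fun C => ?_, fun C hC x hx => ?_,
      fun hc P hP h22 => ?_⟩⟩
    · obtain ⟨V, hV, hVo, hxV, α, -, hα⟩ := Spacetime.exists_conformalFactor hm hO hs.isOpen
        (fun y hy => (hU y hy).field) hE hx
      exact ⟨V, hV, hVo, hxV, α, hα⟩
    · exact hα.isConformalOn hm (hN.trans hO) hNo (fun y hy => (hU y (hN hy)).field)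
        (fun y hy => (hE y (hN hy)).1) C
    · exact Spacetime.isTwoPlusTwo_conformalTensor (hm.lorentz x (hO (hN hx)))
        (hU x (hN hx)).field.unit.self_of_nhds (hα.2 x hx).1 hC
    · exact hα.exists_eq hm (hN.trans hO) hNo (fun y hy => hU y (hN hy)) hc hP h22
  · intro ha hQ O hO X s hs
    have hU := fun y hy => hs.isCanonicalAt hm ha hO (x := y) hy
    have hE := fun y hy => hQ O hO X s hs y hy
    refine ⟨fun x hx => ?_, fun N hN hNo α β hα => ⟨fun C D => ?_, fun C D hC x hx => ?_,
      fun hc K hK h22 => ?_⟩⟩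
    · exact Spacetime.exists_killingPair hm hO hs.isOpen (fun y hy => (hU y hy).field) hE hx
    · exact hα.isKillingOn hm (hN.trans hO) hNo (fun y hy => (hU y (hN hy)).field)
        (fun y hy => (hE y (hN hy)).1.1) C D
    · exact Spacetime.isTwoPlusTwo_killingTensor (hm.lorentz x (hO (hN hx)))
        (hU x (hN hx)).field.unit.self_of_nhds (hα.2.2 x hx).1 hC
    · exact hα.exists_eq hm (hN.trans hO) hNo (fun y hy => hU y (hN hy)) hc hK h22
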